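/- Let $(X^4,g)$ be either the unit sphere $S^4\subset\mathbb R^5$ with its round metric, oriented as the boundary of the ball, or $\mathbb{CP}^2$ with its complex orientation and the Fubini–Study metric for which the Hopf fibration $S^5\to\mathbb{CP}^2$ from the unit sphere is a Riemannian submersion. Put $\kappa=1$ if $X=S^4$ and $\kappa=2$ if $X=\mathbb{CP}^2$. Let $M^7=\Lambda^2_-(T^*X)$ be the total space of the bundle of anti-self-dual $2$-forms, $u\colon M\to X$ the projection, $\theta$ the tautological $2$-form on $M$, $\theta_\eta=u^*\eta$, and $r$ the radial coordinate of the fibres for the inner product for which $e^0\wedge e^1-e^2\wedge e^3$ has length one ($e^i$ oriented orthonormal). Using the horizontal distribution of the Levi-Civita connection, let $g_{\mathcal V}$ be the vertical metric given by this inner product, and let $\mathsf{vol}_{\mathcal V}$ be its vertical volume form, for the orientation of the fibres in which $e^0\wedge e^1-e^2\wedge e^3$, $e^0\wedge e^2-e^3\wedge e^1$, $e^0\wedge e^3-e^1\wedge e^2$ is an oriented basis. Let $b,c>0$ be constants, and put $$w=(c+2\kappa b^2r^2)^{1/4},\qquad v=b\,(c+2\kappa b^2r^2)^{-1/4},$$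 $$\varphi=v^3\,\mathsf{vol}_{\mathcal V}+w^2v\,d\theta,\qquad h=w^2\,u^*g+v^2\,g_{\mathcal V},\qquad \mathsf{vol}_M=v^3w^4\,\mathsf{vol}_{\mathcal V}\wedge u^*\mathsf{vol}_X .$$ Then: 1. (Bryant–Salamon structure) $h$ is a smooth Riemannian metric on $M$ with volume form $\mathsf{vol}_M$; $\varphi$ is a smooth $\mathrm G_2$-structure which induces the metric $h$ and this orientation (at each point there is an oriented $h$-orthonormal coframe in which $\varphi=e^{123}+e^1\wedge(e^{45}-e^{67})+e^2\wedge(e^{46}-e^{75})+e^3\wedge(e^{47}-e^{56})$); and it is torsion-free: $d\varphi=0$ and $d\star\varphi=0$. 2. $u\colon(M,h)\to(X,g)$ is a Smith submersion with respect to $\varphi$. That is, $\varphi$ is a calibration (it is at most $1$ on $h$-orthonormal triples), $u$ is smooth and surjective, and $$\varphi\wedge u^*\mathsf{vol}_X=\frac{1}{(\sqrt4)^4}\,|du|^4\,\mathsf{vol}_M,\qquad u^*g=\tfrac14|du|^2\,h^{(0,2)}$$ on all of $M$, where $h^{(0,2)}$ is the restriction of $h$ to $(\ker du)^\perp$. Moreover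 $u$ is a submersion at every point, and its dilation is $\lambda=|du|/\sqrt4=1/w$. 3. Hence $u$ is $4$-harmonic, that is $\operatorname{Div}(|du|^2\,du)=0$, and its fibres are associative: each fibre is calibrated by $\varphi$, where $\ker du$ is oriented so that $\mathsf{vol}_M=\mathsf{vol}_{\ker du}\wedge\mathsf{vol}_{(\ker du)^\perp}$, with $(\ker du)^\perp$ oriented by $u^*\mathsf{vol}_X$. -/

import Mathlib

open scoped Manifold ContDiff Topology Bundle

noncomputable section

namespace BryantSalamon

abbrev E4 : Type := EuclideanSpace ℝ (Fin 4)
abbrev E3 : Type := EuclideanSpace ℝ (Fin 3)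

section LinearAlgebra
variable {T : Type*} [AddCommGroup T] [Module ℝ T] [TopologicalSpace T]

/-- The vectors `e i` are orthonormal for `g`. -/
def IsOrthonormalFrame {n : ℕ} (g : T →L[ℝ] T →L[ℝ] ℝ) (e : Fin n → T) : Prop :=
  ∀ i j, g (e i) (e j) = if i = j then 1 else 0

/-- `g` is an inner product and `vol` is one of its two volume forms. It is used for
`n = dim T`. -/
structure IsOrientedInner {n : ℕ} (g : T →L[ℝ] T →L[ℝ] ℝ) (vol : T [⋀^Fin n]→L[ℝ] ℝ) : Prop where
  symm : ∀ v w, g v w = g w v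
  pos : ∀ v, v ≠ 0 → 0 < g v v
  unit : ∀ e : Fin n → T, IsOrthonormalFrame g e → vol e = 1 ∨ vol e = -1

/-- `η` is anti-self-dual: `⋆η = -η`, where the Hodge star maps `e⁰ ∧ e¹` to `e² ∧ e³` for every
oriented orthonormal frame. -/
def IsASD (g : T →L[ℝ] T →L[ℝ] ℝ) (vol : T [⋀^Fin 4]→L[ℝ] ℝ) (η : T [⋀^Fin 2]→L[ℝ] ℝ) : Prop :=
  ∀ e : Fin 4 → T, IsOrthonormalFrame g e → vol e = 1 → η ![e 0, e 1] = -η ![e 2, e 3]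

end LinearAlgebra

theorem exists_orthonormal_extending {T : Type*} [AddCommGroup T] [Module ℝ T]
    [FiniteDimensional ℝ T] (hT : Module.finrank ℝ T = 4) (B : T →ₗ[ℝ] T →ₗ[ℝ] ℝ)
    (hs : ∀ v w, B v w = B w v) (hp : ∀ v, v ≠ 0 → 0 < B v v) {v : T} (hv : v ≠ 0) :
    ∃ e : Fin 4 → T, (∀ i j, B (e i) (e j) = if i = j then 1 else 0) ∧
      v = Real.sqrt (B v v) • e 0 := by
  let core : InnerProductSpace.Core ℝ T :=
    { inner := fun v w => B v w
      conj_inner_symm := fun v w => by simp [hs v w]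
      re_inner_nonneg := fun v => by
        rcases eq_or_ne v 0 with rfl | h
        · simp
        · simpa using (hp v h).le
      add_left := fun u v w => by simp
      smul_left := fun u v r => by simp
      definite := fun v h => by
        by_contra hne
        exact (hp v hne).ne' h }
  let _ : NormedAddCommGroup T := core.toNormedAddCommGroup
  let _ : InnerProductSpace ℝ T := InnerProductSpace.ofCore core.toCore
  have hin : ∀ v w : T, inner ℝ v w = B v w := fun _ _ => rfl
  have hpos := hp v hv
  have hsq : Real.sqrt (B v v) * Real.sqrt (B v v) = B v v := Real.mul_self_sqrt hpos.le
  have hsp : 0 < Real.sqrt (B v v) := Real.sqrt_pos.mpr hpos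
  let w : Fin 4 → T := fun _ => (Real.sqrt (B v v))⁻¹ • v
  have hw : Orthonormal ℝ (({0} : Set (Fin 4)).domRestrict w) := by
    rw [orthonormal_iff_ite]
    rintro ⟨i, hi⟩ ⟨j, hj⟩
    obtain rfl : i = 0 := hi
    obtain rfl : j = 0 := hj
    simp only [Set.domRestrict, w, hin, if_true]
    simp only [map_smul, LinearMap.smul_apply, smul_eq_mul]
    field_simp
    nlinarith [hsq]
  obtain ⟨b, hb⟩ := hw.exists_orthonormalBasis_extension_of_card_eq (by simp [hT])
  refine ⟨b, fun i j => ?_, ?_⟩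
  · rw [← hin]; exact orthonormal_iff_ite.mp b.orthonormal i j
  · rw [hb 0 rfl]; simp [w, smul_smul, hsp.ne']

section E4
variable {g : E4 →L[ℝ] E4 →L[ℝ] ℝ} {vol : E4 [⋀^Fin 4]→L[ℝ] ℝ}

theorem vol_perm (vol : E4 [⋀^Fin 4]→L[ℝ] ℝ) (e : Fin 4 → E4) (σ : Equiv.Perm (Fin 4)) :
    vol (e ∘ σ) = ((Equiv.Perm.sign σ : ℤ) : ℝ) * vol e := by
  have := vol.toAlternatingMap.map_perm e σ
  rw [Units.smul_def, zsmul_eq_mul] at this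
  exact this

theorem exists_frame (hg : IsOrientedInner g vol) {v : E4} (hv : v ≠ 0) :
    ∃ e : Fin 4 → E4, IsOrthonormalFrame g e ∧ vol e = 1 ∧ v = Real.sqrt (g v v) • e 0 := by
  obtain ⟨e, he, hev⟩ := exists_orthonormal_extending (T := E4) (by simp)
    (ContinuousLinearMap.coeLM ℝ ∘ₗ (g : E4 →ₗ[ℝ] E4 →L[ℝ] ℝ)) hg.symm hg.pos hv
  have he' : IsOrthonormalFrame g e := he
  rcases hg.unit e he' with h | h
  · exact ⟨e, he', h, hev⟩
  · refine ⟨e ∘ Equiv.swap 2 3, fun i j => ?_, ?_, ?_⟩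
    · simp only [Function.comp, he' _ _, EmbeddingLike.apply_eq_iff_eq]
    · rw [vol_perm, h, Equiv.Perm.sign_swap (by decide)]; simp
    · simpa [Equiv.swap_apply_of_ne_of_ne] using hev

theorem frame_expand {e : Fin 4 → E4} (he : IsOrthonormalFrame g e)
    (v : E4) : v = ∑ i, g (e i) v • e i := by
  have hli : LinearIndependent ℝ e := by
    rw [Fintype.linearIndependent_iff]
    intro c hc i
    have h := congrArg (fun z => g (e i) z) hc
    simpa [map_sum, he i] using h
  have hsp : ⊤ ≤ Submodule.span ℝ (Set.range e) :=
    (hli.span_eq_top_of_card_eq_finrank (by simp)).ge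
  let b := Module.Basis.mk hli hsp
  have hb : ∀ i, b i = e i := fun i => by simp [b]
  have h1 : v = ∑ i, b.repr v i • e i := by
    conv_lhs => rw [← b.sum_repr v]
    simp [hb]
  have h2 : ∀ i, g (e i) v = b.repr v i := by
    intro i
    conv_lhs => rw [h1]
    simp [map_sum, he i]
  simp_rw [h2]
  exact h1

theorem two_form_eq_curry (η : E4 [⋀^Fin 2]→L[ℝ] ℝ) (v w : E4) :
    η ![v, w] = η.curryLeft v ![w] := rfl

theorem two_form_swap (η : E4 [⋀^Fin 2]→L[ℝ] ℝ) (v w : E4) : η ![v, w] = -η ![w, v] := by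
  have := η.toAlternatingMap.map_swap ![w, v] (i := 0) (j := 1) (by decide)
  have h2 : (![w, v] ∘ (Equiv.swap (0 : Fin 2) 1)) = ![v, w] := by
    ext i : 1; fin_cases i <;> simp
  rw [h2] at this
  exact this

theorem two_form_self (η : E4 [⋀^Fin 2]→L[ℝ] ℝ) (v : E4) : η ![v, v] = 0 :=
  η.map_eq_zero_of_eq ![v, v] (i := 0) (j := 1) rfl (by decide)

theorem vec2_eta {α : Type*} (f : Fin 2 → α) : f = ![f 0, f 1] := by
  ext i; fin_cases i <;> rfl

/-- A two-form as a bilinear map. -/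
def twoBilin (η : E4 [⋀^Fin 2]→L[ℝ] ℝ) : E4 →ₗ[ℝ] E4 →ₗ[ℝ] ℝ :=
  LinearMap.mk₂ ℝ (fun v w => η ![v, w])
    (fun v v' w => η.vecCons_add _ v v')
    (fun c v w => η.vecCons_smul _ c v)
    (fun v w w' => by
      rw [two_form_swap η v, two_form_swap η v w, two_form_swap η v w', η.vecCons_add]; ring)
    (fun c v w => by
      rw [two_form_swap η v, two_form_swap η v w, η.vecCons_smul]; simp)

theorem asd_unique (hg : IsOrientedInner g vol) {η : E4 [⋀^Fin 2]→L[ℝ] ℝ} (hη : IsASD g vol η)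
    {v : E4} (hv : v ≠ 0) (h : ∀ w, η ![v, w] = 0) : η = 0 := by
  obtain ⟨e, he, hve, hev⟩ := exists_frame hg hv
  have hsp : 0 < Real.sqrt (g v v) := Real.sqrt_pos.mpr (hg.pos v hv)
  have h0 : ∀ w, η ![e 0, w] = 0 := by
    intro w
    have := h w
    rw [hev, η.vecCons_smul] at this
    simpa [hsp.ne'] using this
  have key : ∀ σ : Equiv.Perm (Fin 4), Equiv.Perm.sign σ = 1 → σ 0 = 0 →
      η ![e (σ 2), e (σ 3)] = 0 := by
    intro σ hσ hσ0
    have := hη (e ∘ σ) (fun i j => by simp [he _ _]) (by rw [vol_perm, hσ, hve]; simp)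
    simp only [Function.comp, hσ0, h0] at this
    linarith
  have h23 : η ![e 2, e 3] = 0 := key 1 (by simp) rfl
  have h12 : η ![e 1, e 2] = 0 := by
    have := key (Equiv.swap 1 3 * Equiv.swap 2 3) (by decide) (by decide)
    have a2 : (Equiv.swap 1 3 * Equiv.swap 2 3 : Equiv.Perm (Fin 4)) 2 = 1 := by decide
    have a3 : (Equiv.swap 1 3 * Equiv.swap 2 3 : Equiv.Perm (Fin 4)) 3 = 2 := by decide
    rwa [a2, a3] at this
  have h31 : η ![e 3, e 1] = 0 := by
    have := key (Equiv.swap 1 2 * Equiv.swap 2 3) (by decide) (by decide)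
    have a2 : (Equiv.swap 1 2 * Equiv.swap 2 3 : Equiv.Perm (Fin 4)) 2 = 3 := by decide
    have a3 : (Equiv.swap 1 2 * Equiv.swap 2 3 : Equiv.Perm (Fin 4)) 3 = 1 := by decide
    rwa [a2, a3] at this
  have h21 : η ![e 2, e 1] = 0 := by rw [two_form_swap, h12, neg_zero]
  have h13 : η ![e 1, e 3] = 0 := by rw [two_form_swap, h31, neg_zero]
  have h32 : η ![e 3, e 2] = 0 := by rw [two_form_swap, h23, neg_zero]
  have h0' : ∀ w, η ![w, e 0] = 0 := fun w => by rw [two_form_swap, h0, neg_zero]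
  have hz : ∀ i j, η ![e i, e j] = 0 := by
    intro i j
    fin_cases i <;> fin_cases j <;>
      first | exact h0 _ | exact h0' _ | exact two_form_self η _ | assumption
  ext f
  rw [vec2_eta f]
  change twoBilin η (f 0) (f 1) = 0
  rw [frame_expand he (f 0), frame_expand he (f 1)]
  have hz' : ∀ i j, twoBilin η (e i) (e j) = 0 := hz
  simp [map_sum, LinearMap.sum_apply, hz']

/-- The anti-self-dual part of `n♭ ∧ s♭`, up to a factor `2`. -/
def asdOf (g : E4 →L[ℝ] E4 →L[ℝ] ℝ) (vol : E4 [⋀^Fin 4]→L[ℝ] ℝ) (n s : E4) :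
    E4 [⋀^Fin 2]→L[ℝ] ℝ :=
  ContinuousAlternatingMap.alternatizeUncurryFin
    ((g n).smulRight (ContinuousAlternatingMap.ofSubsingleton ℝ E4 ℝ (0 : Fin 1) (g s)))
    - (vol.curryLeft n).curryLeft s

theorem asdOf_apply (n s v w : E4) : asdOf g vol n s ![v, w] =
    g n v * g s w - g n w * g s v - vol ![n, s, v, w] := by
  simp [asdOf, ContinuousAlternatingMap.alternatizeUncurryFin_apply, Fin.sum_univ_two,
    ContinuousAlternatingMap.curryLeft_apply_apply, Fin.removeNth]
  ring

theorem vol_expand (vol : E4 [⋀^Fin 4]→L[ℝ] ℝ) (e : Fin 4 → E4) (a b : Fin 4 → ℝ) (v w : E4) :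
    vol ![∑ i, a i • e i, ∑ j, b j • e j, v, w] =
      ∑ i, ∑ j, a i * b j * vol ![e i, e j, v, w] := by
  have h : ∀ n s, vol ![n, s, v, w] = (vol.curryLeft n).curryLeft s ![v, w] := fun _ _ => rfl
  simp only [h]
  have h2 : ∀ (x : E4 [⋀^Fin 3]→L[ℝ] ℝ), x.curryLeft (∑ j, b j • e j) ![v, w]
      = ∑ j, b j * x.curryLeft (e j) ![v, w] := by
    intro x; rw [map_sum]; simp
  rw [h2, map_sum]
  simp only [map_smul]
  have h3 : ∀ j, (∑ i, a i • vol.curryLeft (e i)).curryLeft (e j) ![v, w]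
      = ∑ i, a i * (vol.curryLeft (e i)).curryLeft (e j) ![v, w] := by
    intro j; simp [ContinuousAlternatingMap.curryLeft_apply_apply]
  simp only [h3, Finset.mul_sum]
  rw [Finset.sum_comm]
  refine Finset.sum_congr rfl fun i _ => Finset.sum_congr rfl fun j _ => by ring

theorem asdOf_isASD (n s : E4) : IsASD g vol (asdOf g vol n s) := by
  intro e he hve
  obtain ⟨a, ha⟩ : ∃ a : Fin 4 → ℝ, n = ∑ i, a i • e i := ⟨_, frame_expand he n⟩
  obtain ⟨b, hb⟩ : ∃ b : Fin 4 → ℝ, s = ∑ i, b i • e i := ⟨_, frame_expand he s⟩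
  have gn : ∀ j, g n (e j) = a j := fun j => by
    rw [ha]; simp [map_sum, he _ _]
  have gs : ∀ j, g s (e j) = b j := fun j => by
    rw [hb]; simp [map_sum, he _ _]
  have hp : ∀ i j k l : Fin 4, ∀ σ : Equiv.Perm (Fin 4), σ 0 = i → σ 1 = j → σ 2 = k → σ 3 = l →
      vol ![e i, e j, e k, e l] = ((Equiv.Perm.sign σ : ℤ) : ℝ) := by
    rintro _ _ _ _ σ rfl rfl rfl rfl
    have := vol_perm vol e σ
    rw [hve, mul_one] at this
    rw [← this]; congr 1; ext m : 1; fin_cases m <;> rfl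
  have h2301 : vol ![e 2, e 3, e 0, e 1] = 1 := by
    rw [hp 2 3 0 1 (Equiv.swap 0 2 * Equiv.swap 1 3) (by decide) (by decide) (by decide)
      (by decide)]
    have : Equiv.Perm.sign (Equiv.swap (0 : Fin 4) 2 * Equiv.swap 1 3) = 1 := by decide
    simp [this]
  have h3201 : vol ![e 3, e 2, e 0, e 1] = -1 := by
    rw [hp 3 2 0 1 (Equiv.swap 0 2 * Equiv.swap 1 3 * Equiv.swap 0 1) (by decide) (by decide)
      (by decide) (by decide)]
    have : Equiv.Perm.sign (Equiv.swap (0 : Fin 4) 2 * Equiv.swap 1 3 * Equiv.swap 0 1) = -1 := by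
      decide
    simp [this]
  have h0123 : vol ![e 0, e 1, e 2, e 3] = 1 := by
    rw [hp 0 1 2 3 1 rfl rfl rfl rfl]; simp
  have h1023 : vol ![e 1, e 0, e 2, e 3] = -1 := by
    rw [hp 1 0 2 3 (Equiv.swap 0 1) (by decide) (by decide)
      (by decide) (by decide)]
    have : Equiv.Perm.sign (Equiv.swap (0 : Fin 4) 1) = -1 := by
      decide
    simp [this]
  have hz : ∀ (f : Fin 4 → E4) (i j : Fin 4), i ≠ j → f i = f j → vol f = 0 :=
    fun f i j hij h => vol.map_eq_zero_of_eq f h hij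
  have q1 : vol ![n, s, e 0, e 1] = a 2 * b 3 - a 3 * b 2 := by
    rw [ha, hb, vol_expand]
    simp only [Fin.sum_univ_four]
    rw [hz ![e 0, e 0, e 0, e 1] 0 1 (by decide) rfl, hz ![e 0, e 1, e 0, e 1] 0 2 (by decide) rfl,
      hz ![e 0, e 2, e 0, e 1] 0 2 (by decide) rfl, hz ![e 0, e 3, e 0, e 1] 0 2 (by decide) rfl,
      hz ![e 1, e 0, e 0, e 1] 0 3 (by decide) rfl, hz ![e 1, e 1, e 0, e 1] 0 3 (by decide) rfl,
      hz ![e 1, e 2, e 0, e 1] 0 3 (by decide) rfl, hz ![e 1, e 3, e 0, e 1] 0 3 (by decide) rfl,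
      hz ![e 2, e 0, e 0, e 1] 1 2 (by decide) rfl, hz ![e 2, e 1, e 0, e 1] 1 3 (by decide) rfl,
      hz ![e 2, e 2, e 0, e 1] 0 1 (by decide) rfl, hz ![e 3, e 3, e 0, e 1] 0 1 (by decide) rfl,
      hz ![e 3, e 0, e 0, e 1] 1 2 (by decide) rfl, hz ![e 3, e 1, e 0, e 1] 1 3 (by decide) rfl,
      h2301, h3201]
    ring
  have q2 : vol ![n, s, e 2, e 3] = a 0 * b 1 - a 1 * b 0 := by
    rw [ha, hb, vol_expand]
    simp only [Fin.sum_univ_four]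
    rw [hz ![e 0, e 0, e 2, e 3] 0 1 (by decide) rfl, hz ![e 1, e 1, e 2, e 3] 0 1 (by decide) rfl,
      hz ![e 0, e 2, e 2, e 3] 1 2 (by decide) rfl, hz ![e 0, e 3, e 2, e 3] 1 3 (by decide) rfl,
      hz ![e 1, e 2, e 2, e 3] 1 2 (by decide) rfl, hz ![e 1, e 3, e 2, e 3] 1 3 (by decide) rfl,
      hz ![e 2, e 0, e 2, e 3] 0 2 (by decide) rfl, hz ![e 2, e 1, e 2, e 3] 0 2 (by decide) rfl,
      hz ![e 2, e 2, e 2, e 3] 0 1 (by decide) rfl, hz ![e 2, e 3, e 2, e 3] 0 2 (by decide) rfl,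
      hz ![e 3, e 0, e 2, e 3] 0 3 (by decide) rfl, hz ![e 3, e 1, e 2, e 3] 0 3 (by decide) rfl,
      hz ![e 3, e 2, e 2, e 3] 0 3 (by decide) rfl, hz ![e 3, e 3, e 2, e 3] 0 1 (by decide) rfl,
      h0123, h1023]
    ring
  rw [asdOf_apply, asdOf_apply, gn, gn, gn, gn, gs, gs, gs, gs, q1, q2]
  ring
end E4

section General
variable {E H : Type*} [NormedAddCommGroup E] [NormedSpace ℝ E] [TopologicalSpace H]
  (I : ModelWithCorners ℝ E H) (M : Type*) [TopologicalSpace M] [ChartedSpace H M]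

/-- A (not necessarily continuous) field of bilinear forms on `M`. -/
abbrev BilinField : Type _ := ∀ x : M, TangentSpace I x →L[ℝ] TangentSpace I x →L[ℝ] ℝ

/-- A (not necessarily continuous) differential form of degree `k` on `M`. -/
abbrev DiffForm (k : ℕ) : Type _ := ∀ x : M, TangentSpace I x [⋀^Fin k]→L[ℝ] ℝ

variable {I M} in
theorem form_apply_contMDiffOn {k : ℕ} {α : M → E [⋀^Fin k]→L[ℝ] ℝ} {s : Set M}
    (hα : ContMDiffOn I 𝓘(ℝ, E [⋀^Fin k]→L[ℝ] ℝ) ∞ α s) {m : Fin k → M → E}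
    (hm : ∀ i, ContMDiffOn I 𝓘(ℝ, E) ∞ (m i) s) :
    ContMDiffOn I 𝓘(ℝ, ℝ) ∞ (fun x => α x (fun i => m i x)) s := by
  induction k with
  | zero =>
    have h := (contMDiffOn_const (I := I) (s := s) (n := ∞)
      (c := ContinuousAlternatingMap.apply ℝ E ℝ (fun i : Fin 0 => i.elim0))).clm_apply hα
    refine h.congr fun x _ => ?_
    rw [ContinuousAlternatingMap.apply_apply]
    congr 1; ext i : 1; exact i.elim0
  | succ k ih =>
    have hcl : ContDiff ℝ ∞ (fun a : E [⋀^Fin (k + 1)]→L[ℝ] ℝ => a.curryLeft) :=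
      IsBoundedLinearMap.contDiff
        { map_add := fun _ _ => rfl
          map_smul := fun _ _ => rfl
          bound := ⟨1, one_pos, fun a => by simp [ContinuousAlternatingMap.norm_curryLeft]⟩ }
    have h : ContMDiffOn I 𝓘(ℝ, E →L[ℝ] E [⋀^Fin k]→L[ℝ] ℝ) ∞ (fun x => (α x).curryLeft) s :=
      hcl.contMDiff.comp_contMDiffOn hα
    have h2 := ih (h.clm_apply (hm 0)) (m := fun i => m i.succ) (fun i => hm i.succ)
    refine h2.congr fun x _ => ?_
    change _ = α x (Matrix.vecCons (m 0 x) (fun i => m i.succ x))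
    congr 1; ext i : 1; refine Fin.cases ?_ (fun j => ?_) i <;> rfl

variable {M}
variable [IsManifold I 1 M]

/-- `coordFrame I x₀ x v` is the tangent vector at `x` whose components in the chart around `x₀`
are `v`. -/
def coordFrame (x₀ x : M) : E →L[ℝ] TangentSpace I x :=
  (trivializationAt E (TangentSpace I) x₀).symmL ℝ x

/-- The components of a tangent vector at `x` in the chart around `x₀`. -/
def coordFrameInv (x₀ x : M) : TangentSpace I x →L[ℝ] E :=
  (trivializationAt E (TangentSpace I) x₀).continuousLinearMapAt ℝ x

variable {I}

/-- The components at `x` of a field of bilinear forms in the chart around `x₀`. -/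
def frameBilin (g : BilinField I M) (x₀ x : M) : E →L[ℝ] E →L[ℝ] ℝ :=
  (ContinuousLinearMap.precomp ℝ (coordFrame I x₀ x)) ∘L (g x) ∘L (coordFrame I x₀ x)

/-- The components at `x` of a differential form in the chart around `x₀`. -/
def frameForm {k : ℕ} (α : DiffForm I M k) (x₀ x : M) : E [⋀^Fin k]→L[ℝ] ℝ :=
  (α x).compContinuousLinearMap (coordFrame I x₀ x)

theorem frameBilin_apply (g : BilinField I M) (x₀ x : M) (v w : E) :
    frameBilin g x₀ x v w = g x (coordFrame I x₀ x v) (coordFrame I x₀ x w) := rfl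

theorem frameForm_apply {k : ℕ} (α : DiffForm I M k) (x₀ x : M) (v : Fin k → E) :
    frameForm α x₀ x v = α x (fun i => coordFrame I x₀ x (v i)) := rfl

/-- The components of `g` in the chart around `x₀`, as a function of the coordinates. -/
def localBilin (g : BilinField I M) (x₀ : M) (y : E) : E →L[ℝ] E →L[ℝ] ℝ :=
  frameBilin g x₀ ((extChartAt I x₀).symm y)

/-- The components of `α` in the chart around `x₀`, as a function of the coordinates. -/
def localForm {k : ℕ} (α : DiffForm I M k) (x₀ : M) (y : E) : E [⋀^Fin k]→L[ℝ] ℝ :=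
  frameForm α x₀ ((extChartAt I x₀).symm y)

/-- The field of bilinear forms is smooth. -/
def IsSmoothBilin (g : BilinField I M) : Prop :=
  ∀ x₀ : M, ContDiffOn ℝ ∞ (localBilin g x₀) (extChartAt I x₀).target

/-- The differential form is smooth. -/
def IsSmoothForm {k : ℕ} (α : DiffForm I M k) : Prop :=
  ∀ x₀ : M, ContDiffOn ℝ ∞ (localForm α x₀) (extChartAt I x₀).target

/-- `g` is a Riemannian metric and `vol` is its volume form for an orientation of `M`, where `n`
is the dimension of `M`. -/
structure IsOrientedRiemannian {n : ℕ} (g : BilinField I M) (vol : DiffForm I M n) : Prop where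
  inner : ∀ x, IsOrientedInner (g x) (vol x)
  smooth_metric : IsSmoothBilin g
  smooth_vol : IsSmoothForm vol

variable (I M) in
/-- A Riemannian metric together with an orientation of `M`, given by its volume form. -/
structure OrientedMetric (n : ℕ) where
  metric : BilinField I M
  vol : DiffForm I M n
  isOriented : IsOrientedRiemannian metric vol

theorem coordFrame_inv_left {x₀ x : M} (hx : x ∈ (chartAt H x₀).source) (v : E) :
    coordFrameInv I x₀ x (coordFrame I x₀ x v) = v :=
  (trivializationAt E (TangentSpace I) x₀).continuousLinearMapAt_symmL (R := ℝ)
    (by simpa using hx) v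

theorem coordFrame_inv_right {x₀ x : M} (hx : x ∈ (chartAt H x₀).source) (v : TangentSpace I x) :
    coordFrame I x₀ x (coordFrameInv I x₀ x v) = v :=
  (trivializationAt E (TangentSpace I) x₀).symmL_continuousLinearMapAt (R := ℝ)
    (by simpa using hx) v

theorem frameBilin_contMDiffOn [IsManifold I ∞ M] {g : BilinField I M} (hg : IsSmoothBilin g)
    (x₀ : M) :
    ContMDiffOn I 𝓘(ℝ, E →L[ℝ] E →L[ℝ] ℝ) ∞ (frameBilin g x₀) (chartAt H x₀).source := by
  have h := ((hg x₀).contMDiffOn).comp (contMDiffOn_extChartAt (I := I) (n := ∞) (x := x₀))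
    (fun x hx => (extChartAt I x₀).map_source (by simpa using hx))
  refine h.congr fun x hx => ?_
  simp [localBilin, (chartAt H x₀).left_inv hx]

theorem frameForm_contMDiffOn [IsManifold I ∞ M] {k : ℕ} {α : DiffForm I M k}
    (hα : IsSmoothForm α) (x₀ : M) :
    ContMDiffOn I 𝓘(ℝ, E [⋀^Fin k]→L[ℝ] ℝ) ∞ (frameForm α x₀) (chartAt H x₀).source := by
  have h := ((hα x₀).contMDiffOn).comp (contMDiffOn_extChartAt (I := I) (n := ∞) (x := x₀))
    (fun x hx => (extChartAt I x₀).map_source (by simpa using hx))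
  refine h.congr fun x hx => ?_
  simp [localForm, (chartAt H x₀).left_inv hx]

theorem frame_isOrientedInner {n : ℕ} {g : BilinField I M} {vol : DiffForm I M n}
    (h : IsOrientedRiemannian g vol) {x₀ x : M} (hx : x ∈ (chartAt H x₀).source) :
    IsOrientedInner (frameBilin g x₀ x) (frameForm vol x₀ x) where
  symm v w := (h.inner x).symm _ _
  pos v hv := (h.inner x).pos _ fun h0 => hv <| by
    rw [← coordFrame_inv_left (I := I) hx v]; exact (congrArg _ h0).trans (map_zero _)
  unit e he := (h.inner x).unit (coordFrame I x₀ x ∘ e) he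

theorem coordFrame_change_contMDiffOn [IsManifold I ∞ M] (x₀ x₁ : M) :
    ContMDiffOn I 𝓘(ℝ, E →L[ℝ] E) ∞
      (fun x => (coordFrameInv I x₁ x) ∘L (coordFrame I x₀ x))
      ((chartAt H x₀).source ∩ (chartAt H x₁).source) := by
  have hM : IsManifold I (∞ + 1) M := ‹IsManifold I ∞ M›
  have := TangentBundle.contMDiffVectorBundle (I := I) (M := M) (n := ∞)
  have h := contMDiffOn_coordChangeL (n := ∞) (IB := I) (trivializationAt E (TangentSpace I : M → Type _) x₀)
    (trivializationAt E (TangentSpace I) x₁)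
  refine h.congr fun x hx => ?_
  ext v
  rw [ContinuousLinearEquiv.coe_coe, Bundle.Trivialization.coordChangeL_apply _ _ hx]
  simp only [coordFrame, coordFrameInv, ContinuousLinearMap.comp_apply]
  rw [Bundle.Trivialization.continuousLinearMapAt_apply, Bundle.Trivialization.coe_linearMapAt_of_mem _ hx.2]
  change (trivializationAt E (TangentSpace I) x₁ ⟨x, _⟩).2 = _
  rw [Bundle.Trivialization.symmL_apply (R := ℝ) _ hx.1]

end General

section ASDBundle
variable {X : Type*} [TopologicalSpace X] [ChartedSpace E4 X] [IsManifold (𝓡 4) ∞ X]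

/-- The subspace of anti-self-dual two-forms at `x`. -/
def asdSubmodule (R : OrientedMetric (𝓡 4) X 4) (x : X) :
    Submodule ℝ (TangentSpace (𝓡 4) x [⋀^Fin 2]→L[ℝ] ℝ) where
  carrier := {η | IsASD (R.metric x) (R.vol x) η}
  zero_mem' := fun e _ _ => by simp
  add_mem' := fun {a b} ha hb e he hv => by
    simp [ha e he hv, hb e he hv]; ring
  smul_mem' := fun c a ha e he hv => by
    simp [ha e he hv]

/-- The space of anti-self-dual two-forms at `x`. -/
def ASDForms (R : OrientedMetric (𝓡 4) X 4) (x : X) : Type := asdSubmodule R x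

variable (R : OrientedMetric (𝓡 4) X 4)

instance (x : X) : AddCommGroup (ASDForms R x) := inferInstanceAs (AddCommGroup (asdSubmodule R x))
instance (x : X) : Module ℝ (ASDForms R x) := inferInstanceAs (Module ℝ (asdSubmodule R x))
instance (x : X) : TopologicalSpace (ASDForms R x) :=
  inferInstanceAs (TopologicalSpace (asdSubmodule R x))
instance (x : X) : IsTopologicalAddGroup (ASDForms R x) :=
  inferInstanceAs (IsTopologicalAddGroup (asdSubmodule R x))
instance (x : X) : ContinuousSMul ℝ (ASDForms R x) :=
  inferInstanceAs (ContinuousSMul ℝ (asdSubmodule R x))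

/-- The underlying two-form of an element of the bundle of anti-self-dual forms. -/
def ASDForms.form {R : OrientedMetric (𝓡 4) X 4} {x : X} :
    ASDForms R x →L[ℝ] (TangentSpace (𝓡 4) x [⋀^Fin 2]→L[ℝ] ℝ) :=
  (asdSubmodule R x).subtypeL

variable {R} in
def ASDForms.mk {x : X} (η : TangentSpace (𝓡 4) x [⋀^Fin 2]→L[ℝ] ℝ)
    (h : IsASD (R.metric x) (R.vol x) η) : ASDForms R x := ⟨η, h⟩

variable {R} in
theorem ASDForms.isASD {x : X} (η : ASDForms R x) : IsASD (R.metric x) (R.vol x) η.form := η.2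

variable {R} in
theorem ASDForms.ext {x : X} {η ζ : ASDForms R x} (h : η.form = ζ.form) : η = ζ := Subtype.ext h

/-- The standard basis of `ℝ⁴`. -/
abbrev stdVec (i : Fin 4) : E4 := EuclideanSpace.single i 1

variable {R} in
/-- The fibre coordinates of an anti-self-dual form: its components `η(∂₀, ∂ⱼ)`, `j = 1, 2, 3`,
in the chart of `X` around `x₀`. -/
def asdCoords (x₀ : X) {x : X} (η : ASDForms R x) : E3 :=
  WithLp.toLp 2 fun j =>
    η.form ![coordFrame (𝓡 4) x₀ x (stdVec 0), coordFrame (𝓡 4) x₀ x (stdVec j.succ)]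

/-- The covector with components `(0, a)`. -/
def coordCovector (a : E3) : E4 →L[ℝ] ℝ := ∑ j : Fin 3, a j • EuclideanSpace.proj (j.succ : Fin 4)

/-- The vector which is `g`-dual to the covector with components `(0, a)`. -/
def sharp (g : E4 →L[ℝ] E4 →L[ℝ] ℝ) (a : E3) : E4 := g.inverse (coordCovector a)

/-- The anti-self-dual form `η` on `E4` with `η(∂₀, ∂ⱼ) = aⱼ`. -/
def localASD (g : E4 →L[ℝ] E4 →L[ℝ] ℝ) (vol : E4 [⋀^Fin 4]→L[ℝ] ℝ) (a : E3) :
    E4 [⋀^Fin 2]→L[ℝ] ℝ :=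
  (g (stdVec 0) (stdVec 0))⁻¹ • asdOf g vol (stdVec 0) (sharp g a)

theorem coordCovector_zero (a : E3) : coordCovector a (stdVec 0) = 0 := by
  simp [coordCovector, Fin.succ_ne_zero]

theorem coordCovector_succ (a : E3) (j : Fin 3) : coordCovector a (stdVec j.succ) = a j := by
  simp [coordCovector]

section
variable {g : E4 →L[ℝ] E4 →L[ℝ] ℝ} {vol : E4 [⋀^Fin 4]→L[ℝ] ℝ}

theorem inner_invertible (hg : IsOrientedInner g vol) : g.IsInvertible := by
  have hinj : Function.Injective (g : E4 →ₗ[ℝ] E4 →L[ℝ] ℝ) := by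
    rw [← LinearMap.ker_eq_bot, LinearMap.ker_eq_bot']
    intro v hv
    by_contra hne
    have h1 := hg.pos v hne
    have h2 : g v = 0 := hv
    rw [h2] at h1
    simp at h1
  have hdim : Module.finrank ℝ E4 = Module.finrank ℝ (E4 →L[ℝ] ℝ) := by
    rw [← LinearEquiv.finrank_eq (LinearMap.toContinuousLinearMap (𝕜 := ℝ) (E := E4) (F' := ℝ)),
      Module.finrank_linearMap]
    simp
  refine ⟨(LinearEquiv.ofInjectiveOfFinrankEq (g : E4 →ₗ[ℝ] E4 →L[ℝ] ℝ) hinj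
    hdim).toContinuousLinearEquiv, ?_⟩
  ext v : 1
  rfl

theorem sharp_spec (hg : IsOrientedInner g vol) (a : E3) : g (sharp g a) = coordCovector a := by
  obtain ⟨e, he⟩ := inner_invertible hg
  rw [sharp, ← he, ContinuousLinearMap.inverse_equiv]
  exact e.apply_symm_apply _

theorem stdVec_ne_zero (i : Fin 4) : stdVec i ≠ 0 := by simp [stdVec]

theorem localASD_isASD (a : E3) : IsASD g vol (localASD g vol a) := fun e he hv => by
  simp [localASD, asdOf_isASD _ _ e he hv]

theorem localASD_coord (hg : IsOrientedInner g vol) (a : E3) (j : Fin 3) :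
    localASD g vol a ![stdVec 0, stdVec j.succ] = a j := by
  have h0 := (hg.pos _ (stdVec_ne_zero 0)).ne'
  have hv : vol ![stdVec 0, sharp g a, stdVec 0, stdVec j.succ] = 0 :=
    vol.map_eq_zero_of_eq _ (i := 0) (j := 2) rfl (by decide)
  rw [localASD, ContinuousAlternatingMap.smul_apply, asdOf_apply, sharp_spec hg, hv,
    coordCovector_zero, coordCovector_succ]
  simp only [mul_zero, sub_zero, smul_eq_mul]
  field_simp

theorem asd_zero_of_coord (hg : IsOrientedInner g vol) {η : E4 [⋀^Fin 2]→L[ℝ] ℝ}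
    (hη : IsASD g vol η) (h : ∀ j : Fin 3, η ![stdVec 0, stdVec j.succ] = 0) : η = 0 := by
  refine asd_unique hg hη (stdVec_ne_zero 0) fun w => ?_
  have hw : w = ∑ i, w i • stdVec i := by
    ext k; simp [Pi.single_apply]
  change twoBilin η (stdVec 0) w = 0
  have h' : ∀ i, twoBilin η (stdVec 0) (stdVec i) = 0 := by
    intro i
    refine Fin.cases (two_form_self η _) (fun j => h j) i
  rw [hw]
  simp only [map_sum, map_smul, h', smul_zero, Finset.sum_const_zero]

end

theorem pullback_isASD {x₀ x : X} (hx : x ∈ (chartAt E4 x₀).source) {η : E4 [⋀^Fin 2]→L[ℝ] ℝ}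
    (hη : IsASD (frameBilin R.metric x₀ x) (frameForm R.vol x₀ x) η) :
    IsASD (R.metric x) (R.vol x) (η.compContinuousLinearMap (coordFrameInv (𝓡 4) x₀ x)) := by
  intro e he hv
  have h := hη (fun i => coordFrameInv (𝓡 4) x₀ x (e i)) (fun i j => by
      rw [frameBilin_apply, coordFrame_inv_right hx, coordFrame_inv_right hx]; exact he i j) (by
      rw [frameForm_apply]
      simp only [coordFrame_inv_right hx]
      exact hv)
  rw [ContinuousAlternatingMap.compContinuousLinearMap_apply,
    ContinuousAlternatingMap.compContinuousLinearMap_apply]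
  convert h using 2
  · ext i : 1; fin_cases i <;> rfl
  · congr 1; ext i : 1; fin_cases i <;> rfl

theorem frame_isASD (x₀ : X) {x : X} {η : TangentSpace (𝓡 4) x [⋀^Fin 2]→L[ℝ] ℝ}
    (hη : IsASD (R.metric x) (R.vol x) η) :
    IsASD (frameBilin R.metric x₀ x) (frameForm R.vol x₀ x) (η.compContinuousLinearMap (coordFrame (𝓡 4) x₀ x)) := by
  intro e he hv
  have h := hη (fun i => coordFrame (𝓡 4) x₀ x (e i)) he hv
  rw [ContinuousAlternatingMap.compContinuousLinearMap_apply,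
    ContinuousAlternatingMap.compContinuousLinearMap_apply]
  convert h using 2
  · ext i : 1; fin_cases i <;> rfl
  · congr 1; ext i : 1; fin_cases i <;> rfl

open Classical in
/-- The anti-self-dual form at `x` with prescribed fibre coordinates. -/
def asdOfCoords (x₀ x : X) (a : E3) : ASDForms R x :=
  if hx : x ∈ (chartAt E4 x₀).source then
    ASDForms.mk ((localASD (frameBilin R.metric x₀ x) (frameForm R.vol x₀ x)
      a).compContinuousLinearMap (coordFrameInv (𝓡 4) x₀ x)) (pullback_isASD R hx (localASD_isASD a))
  else 0

variable {R}

theorem asdOfCoords_form {x₀ x : X} (hx : x ∈ (chartAt E4 x₀).source) (a : E3) :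
    (asdOfCoords R x₀ x a).form = (localASD (frameBilin R.metric x₀ x) (frameForm R.vol x₀ x)
      a).compContinuousLinearMap (coordFrameInv (𝓡 4) x₀ x) := by
  rw [asdOfCoords, dif_pos hx]; rfl

theorem asdCoords_apply (x₀ : X) {x : X} (η : ASDForms R x) (j : Fin 3) : asdCoords x₀ η j =
    η.form ![coordFrame (𝓡 4) x₀ x (stdVec 0), coordFrame (𝓡 4) x₀ x (stdVec j.succ)] := rfl

theorem comp_vec2 {T T' : Type*} [AddCommGroup T] [Module ℝ T] [TopologicalSpace T]
    [AddCommGroup T'] [Module ℝ T'] [TopologicalSpace T'] (η : T' [⋀^Fin 2]→L[ℝ] ℝ)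
    (f : T →L[ℝ] T') (v w : T) : η.compContinuousLinearMap f ![v, w] = η ![f v, f w] := by
  rw [ContinuousAlternatingMap.compContinuousLinearMap_apply]
  congr 1; ext i : 1; fin_cases i <;> rfl

theorem asdCoords_ofCoords {x₀ x : X} (hx : x ∈ (chartAt E4 x₀).source) (a : E3) :
    asdCoords x₀ (asdOfCoords R x₀ x a) = a := by
  ext j
  rw [asdCoords_apply, asdOfCoords_form hx, comp_vec2, coordFrame_inv_left hx,
    coordFrame_inv_left hx]
  exact localASD_coord (frame_isOrientedInner R.isOriented hx) a j

theorem asdCoords_isLinear (x₀ x : X) : IsLinearMap ℝ (fun η : ASDForms R x => asdCoords x₀ η) where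
  map_add η ζ := by ext j; simp [asdCoords]
  map_smul c η := by ext j; simp [asdCoords]

theorem asdCoords_injective {x₀ x : X} (hx : x ∈ (chartAt E4 x₀).source) :
    Function.Injective (fun η : ASDForms R x => asdCoords x₀ η) := by
  have : Function.Injective ((asdCoords_isLinear (R := R) x₀ x).mk' _) := by
    rw [← LinearMap.ker_eq_bot, LinearMap.ker_eq_bot']
    intro η hη
    have h0 : ∀ j, asdCoords x₀ η j = 0 := fun j => by
      have : asdCoords x₀ η = 0 := hη
      rw [this]; rfl
    have h1 := asd_zero_of_coord (frame_isOrientedInner R.isOriented hx) (frame_isASD R x₀ η.isASD)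
      (fun j => by rw [comp_vec2]; exact h0 j)
    refine ASDForms.ext ?_
    ext f
    have h2 := congrArg (fun ξ => ξ ![coordFrameInv (𝓡 4) x₀ x (f 0), coordFrameInv (𝓡 4) x₀ x (f 1)]) h1
    simp only [comp_vec2, coordFrame_inv_right hx] at h2
    rw [vec2_eta f]
    simpa using h2
  exact this

theorem ofCoords_asdCoords {x₀ x : X} (hx : x ∈ (chartAt E4 x₀).source) (η : ASDForms R x) :
    asdOfCoords R x₀ x (asdCoords x₀ η) = η :=
  asdCoords_injective hx (asdCoords_ofCoords hx _)

end ASDBundle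

section ASDBundle
variable {X : Type*} [TopologicalSpace X] [ChartedSpace E4 X] [IsManifold (𝓡 4) ∞ X]
  (R : OrientedMetric (𝓡 4) X 4)

/-- The local trivialization of `Λ²₋(T*X)` given by a chart of `X`. -/
def asdPretrivialization (x₀ : X) :
    Bundle.Pretrivialization E3 (Bundle.TotalSpace.proj : Bundle.TotalSpace E3 (ASDForms R) → X) where
  toFun p := (p.1, asdCoords x₀ p.2)
  invFun q := ⟨q.1, asdOfCoords R x₀ q.1 q.2⟩
  source := Bundle.TotalSpace.proj ⁻¹' (chartAt E4 x₀).source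
  target := (chartAt E4 x₀).source ×ˢ Set.univ
  map_source' p hp := ⟨hp, trivial⟩
  map_target' q hq := hq.1
  left_inv' p hp := by
    obtain ⟨x, η⟩ := p
    exact congrArg (Bundle.TotalSpace.mk x) (ofCoords_asdCoords hp η)
  right_inv' q hq := Prod.ext rfl (asdCoords_ofCoords hq.1 q.2)
  open_target := (chartAt E4 x₀).open_source.prod isOpen_univ
  baseSet := (chartAt E4 x₀).source
  open_baseSet := (chartAt E4 x₀).open_source
  source_eq := rfl
  target_eq := rfl
  proj_toFun p hp := rfl

instance (x₀ : X) : (asdPretrivialization R x₀).IsLinear ℝ where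
  linear x _ := asdCoords_isLinear x₀ x

theorem asdPretrivialization_symm (x₀ : X) {x : X} (hx : x ∈ (chartAt E4 x₀).source) (a : E3) :
    (asdPretrivialization R x₀).symm x a = asdOfCoords R x₀ x a := by
  refine asdCoords_injective (x₀ := x₀) hx ?_
  have h := (asdPretrivialization R x₀).apply_mk_symm (b := x) hx a
  have h2 : asdCoords x₀ ((asdPretrivialization R x₀).symm x a) = a := congrArg Prod.snd h
  exact h2.trans (asdCoords_ofCoords hx a).symm

/-- The entries of the change of fibre coordinates. -/
def asdChangeEntry (x₀ x₁ : X) (j k : Fin 3) (x : X) : ℝ :=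
  localASD (frameBilin R.metric x₀ x) (frameForm R.vol x₀ x) (EuclideanSpace.single k 1)
    ![(coordFrameInv (𝓡 4) x₀ x ∘L coordFrame (𝓡 4) x₁ x) (stdVec 0),
      (coordFrameInv (𝓡 4) x₀ x ∘L coordFrame (𝓡 4) x₁ x) (stdVec j.succ)]

def elemMatrix (j k : Fin 3) : E3 →L[ℝ] E3 :=
  (EuclideanSpace.proj k : E3 →L[ℝ] ℝ).smulRight (EuclideanSpace.single j 1)

def asdChange (x₀ x₁ x : X) : E3 →L[ℝ] E3 :=
  ∑ j, ∑ k, asdChangeEntry R x₀ x₁ j k x • elemMatrix j k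

theorem localASD_linear (g : E4 →L[ℝ] E4 →L[ℝ] ℝ) (vol : E4 [⋀^Fin 4]→L[ℝ] ℝ) (a : E3) (v w : E4) :
    localASD g vol a ![v, w] = ∑ k, a k * localASD g vol (EuclideanSpace.single k 1) ![v, w] := by
  have hs : sharp g a = ∑ k, a k • sharp g (EuclideanSpace.single k 1) := by
    have hc : coordCovector a = ∑ k, a k • coordCovector (EuclideanSpace.single k 1) := by
      simp [coordCovector, Fin.sum_univ_three]
    simp only [sharp, ← map_smul, ← map_sum]
    rw [hc]
  have hvol : ∀ s, vol ![stdVec 0, s, v, w] = (vol.curryLeft (stdVec 0)).curryLeft s ![v, w] :=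
    fun _ => rfl
  simp only [localASD, ContinuousAlternatingMap.smul_apply, asdOf_apply, hvol]
  rw [hs]
  simp only [Fin.sum_univ_three, map_add, map_smul, add_apply,
    smul_apply, ContinuousAlternatingMap.add_apply, smul_eq_mul,
    ContinuousAlternatingMap.smul_apply]
  ring

theorem asdChange_apply {x₀ x₁ x : X} (hx : x ∈ (chartAt E4 x₀).source) (a : E3) :
    asdChange R x₀ x₁ x a = asdCoords x₁ (asdOfCoords R x₀ x a) := by
  ext j
  rw [asdCoords_apply, asdOfCoords_form hx, comp_vec2, localASD_linear]
  simp only [asdChange, elemMatrix, asdChangeEntry, sum_apply,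
    smul_apply, ContinuousLinearMap.smulRight_apply,
    ContinuousLinearMap.comp_apply]
  fin_cases j <;> simp [Fin.sum_univ_three] <;> ring

theorem asdChangeEntry_contMDiffOn (x₀ x₁ : X) (j k : Fin 3) :
    ContMDiffOn (𝓡 4) 𝓘(ℝ, ℝ) ∞ (asdChangeEntry R x₀ x₁ j k)
      ((chartAt E4 x₀).source ∩ (chartAt E4 x₁).source) := by
  set S := (chartAt E4 x₀).source ∩ (chartAt E4 x₁).source
  have hG : ContMDiffOn (𝓡 4) 𝓘(ℝ, E4 →L[ℝ] E4 →L[ℝ] ℝ) ∞ (frameBilin R.metric x₀) S :=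
    (frameBilin_contMDiffOn R.isOriented.smooth_metric x₀).mono Set.inter_subset_left
  have hV : ContMDiffOn (𝓡 4) 𝓘(ℝ, E4 [⋀^Fin 4]→L[ℝ] ℝ) ∞ (frameForm R.vol x₀) S :=
    (frameForm_contMDiffOn R.isOriented.smooth_vol x₀).mono Set.inter_subset_left
  have hτ : ContMDiffOn (𝓡 4) 𝓘(ℝ, E4 →L[ℝ] E4) ∞
      (fun x => coordFrameInv (𝓡 4) x₀ x ∘L coordFrame (𝓡 4) x₁ x) S :=
    (coordFrame_change_contMDiffOn x₁ x₀).mono (Set.inter_comm _ _).le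
  have hτv : ∀ v : E4, ContMDiffOn (𝓡 4) 𝓘(ℝ, E4) ∞
      (fun x => (coordFrameInv (𝓡 4) x₀ x ∘L coordFrame (𝓡 4) x₁ x) v) S :=
    fun v => hτ.clm_apply contMDiffOn_const
  have hinv : ContMDiffOn (𝓡 4) 𝓘(ℝ, (E4 →L[ℝ] ℝ) →L[ℝ] E4) ∞
      (fun x => (frameBilin R.metric x₀ x).inverse) S := by
    intro x hx
    have h1 : ContDiffAt ℝ ∞ ContinuousLinearMap.inverse (frameBilin R.metric x₀ x) :=
      (inner_invertible (frame_isOrientedInner R.isOriented hx.1)).contDiffAt_map_inverse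
    exact h1.contMDiffAt.comp_contMDiffWithinAt x (hG x hx)
  have hs : ContMDiffOn (𝓡 4) 𝓘(ℝ, E4) ∞
      (fun x => sharp (frameBilin R.metric x₀ x) (EuclideanSpace.single k 1)) S :=
    hinv.clm_apply contMDiffOn_const
  have hc : ∀ v : E4, ContMDiffOn (𝓡 4) 𝓘(ℝ, E4) ∞ (fun _ : X => v) S :=
    fun v => contMDiffOn_const
  have hgg : ∀ {p q : X → E4}, ContMDiffOn (𝓡 4) 𝓘(ℝ, E4) ∞ p S →
      ContMDiffOn (𝓡 4) 𝓘(ℝ, E4) ∞ q S →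
      ContMDiffOn (𝓡 4) 𝓘(ℝ, ℝ) ∞ (fun x => frameBilin R.metric x₀ x (p x) (q x)) S :=
    fun hp hq => (hG.clm_apply hp).clm_apply hq
  have h00 : ContMDiffOn (𝓡 4) 𝓘(ℝ, ℝ) ∞
      (fun x => (frameBilin R.metric x₀ x (stdVec 0) (stdVec 0))⁻¹) S := by
    intro x hx
    have hne := ((frame_isOrientedInner R.isOriented hx.1).pos _ (stdVec_ne_zero 0)).ne'
    have h1 : ContDiffAt ℝ ∞ (fun t : ℝ => t⁻¹) (frameBilin R.metric x₀ x (stdVec 0) (stdVec 0)) :=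
      contDiffAt_inv ℝ hne
    exact h1.contMDiffAt.comp_contMDiffWithinAt x (hgg (hc _) (hc _) x hx)
  have hvol : ContMDiffOn (𝓡 4) 𝓘(ℝ, ℝ) ∞
      (fun x => frameForm R.vol x₀ x (fun i =>
        (![fun _ => stdVec 0, fun x => sharp (frameBilin R.metric x₀ x) (EuclideanSpace.single k 1),
          fun x => (coordFrameInv (𝓡 4) x₀ x ∘L coordFrame (𝓡 4) x₁ x) (stdVec 0),
          fun x => (coordFrameInv (𝓡 4) x₀ x ∘L coordFrame (𝓡 4) x₁ x) (stdVec j.succ)] :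
          Fin 4 → X → E4) i x)) S := by
    refine form_apply_contMDiffOn hV fun i => ?_
    fin_cases i
    · exact hc _
    · exact hs
    · exact hτv _
    · exact hτv _
  have key := h00.mul (((hgg (hc (stdVec 0)) (hτv (stdVec 0))).mul (hgg hs (hτv (stdVec j.succ)))).sub
    ((hgg (hc (stdVec 0)) (hτv (stdVec j.succ))).mul (hgg hs (hτv (stdVec 0)))) |>.sub hvol)
  refine key.congr fun x _ => ?_
  rw [asdChangeEntry, localASD, ContinuousAlternatingMap.smul_apply, asdOf_apply, smul_eq_mul]
  simp only [Pi.mul_apply]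
  congr 3
  ext i : 1
  fin_cases i <;> rfl

theorem asdChange_contMDiffOn (x₀ x₁ : X) :
    ContMDiffOn (𝓡 4) 𝓘(ℝ, E3 →L[ℝ] E3) ∞ (asdChange R x₀ x₁)
      ((chartAt E4 x₀).source ∩ (chartAt E4 x₁).source) := by
  have h : ∀ j k, ContMDiffOn (𝓡 4) 𝓘(ℝ, E3 →L[ℝ] E3) ∞
      (fun x => asdChangeEntry R x₀ x₁ j k x • elemMatrix j k)
      ((chartAt E4 x₀).source ∩ (chartAt E4 x₁).source) :=
    fun j k => (asdChangeEntry_contMDiffOn R x₀ x₁ j k).smul contMDiffOn_const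
  have := (contMDiffOn_finsetSum (t := Finset.univ) fun j _ =>
    contMDiffOn_finsetSum (t := Finset.univ) fun k _ => h j k)
  refine this.congr fun x _ => by simp [asdChange]

/-- The fibre coordinates as an isomorphism. -/
def asdEquiv (x : X) : ASDForms R x ≃L[ℝ] E3 :=
  let e : ASDForms R x ≃ₗ[ℝ] E3 := LinearEquiv.ofBijective
    ((asdCoords_isLinear (R := R) x x).mk' _)
    ⟨asdCoords_injective (mem_chart_source E4 x),
      fun a => ⟨_, asdCoords_ofCoords (mem_chart_source E4 x) a⟩⟩
  have : FiniteDimensional ℝ (ASDForms R x) := e.symm.finiteDimensional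
  have : T2Space (ASDForms R x) := inferInstanceAs (T2Space (asdSubmodule R x))
  e.toContinuousLinearEquiv

theorem asdEquiv_apply (x : X) (η : ASDForms R x) : asdEquiv R x η = asdCoords x η := rfl

theorem asdCoords_isInducing (x : X) :
    Topology.IsInducing (fun η : ASDForms R x => asdCoords (R := R) x η) :=
  (asdEquiv R x).toHomeomorph.isInducing

/-- The vector bundle structure of `Λ²₋(T*X)`, whose trivializations are given by the charts
of `X`. -/
def asdPrebundle : VectorPrebundle ℝ E3 (ASDForms R) where
  pretrivializationAtlas := Set.range (asdPretrivialization R)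
  pretrivialization_linear' := by
    rintro _ ⟨x₀, rfl⟩; infer_instance
  pretrivializationAt := asdPretrivialization R
  mem_base_pretrivializationAt := fun x => mem_chart_source E4 x
  pretrivialization_mem_atlas := fun x => ⟨x, rfl⟩
  exists_coordChange := by
    rintro _ ⟨x₀, rfl⟩ _ ⟨x₁, rfl⟩
    refine ⟨asdChange R x₀ x₁, (asdChange_contMDiffOn R x₀ x₁).continuousOn, fun x hx a => ?_⟩
    rw [asdPretrivialization_symm R x₀ hx.1, asdChange_apply R hx.1]
    rfl
  totalSpaceMk_isInducing := fun x =>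
    Topology.isInducing_const_prod.mpr (asdCoords_isInducing R x)

instance : (asdPrebundle R).IsContMDiff (𝓡 4) ∞ where
  exists_contMDiffCoordChange := by
    rintro _ ⟨x₀, rfl⟩ _ ⟨x₁, rfl⟩
    refine ⟨asdChange R x₀ x₁, asdChange_contMDiffOn R x₀ x₁, fun x hx a => ?_⟩
    rw [asdPretrivialization_symm R x₀ hx.1, asdChange_apply R hx.1]
    rfl

instance : TopologicalSpace (Bundle.TotalSpace E3 (ASDForms R)) := (asdPrebundle R).totalSpaceTopology
instance : FiberBundle E3 (ASDForms R) := (asdPrebundle R).toFiberBundle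
instance : VectorBundle ℝ E3 (ASDForms R) := (asdPrebundle R).toVectorBundle
instance : ContMDiffVectorBundle ∞ E3 (ASDForms R) (𝓡 4) := (asdPrebundle R).contMDiffVectorBundle (𝓡 4)

/-- The total space of the bundle of anti-self-dual two-forms. -/
abbrev ASDBundle := Bundle.TotalSpace E3 (ASDForms R)

end ASDBundle

/-- The standard volume form of `ℝⁿ`. -/
def stdVol (n : ℕ) : EuclideanSpace ℝ (Fin n) [⋀^Fin n]→L[ℝ] ℝ where
  __ := (EuclideanSpace.basisFun (Fin n) ℝ).toBasis.det
  cont := by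
    have : Continuous fun v : Fin n → EuclideanSpace ℝ (Fin n) =>
        (Matrix.of fun i j => v j i).det :=
      Continuous.matrix_det (continuous_matrix fun i j => by
        simp only [Matrix.of_apply]; fun_prop)
    exact this

theorem stdVol_apply {n : ℕ} (v : Fin n → EuclideanSpace ℝ (Fin n)) :
    stdVol n v = (Matrix.of fun i j => v j i).det := rfl

theorem stdVol_orthonormal {n : ℕ} {v : Fin n → EuclideanSpace ℝ (Fin n)}
    (hv : Orthonormal ℝ v) : stdVol n v = 1 ∨ stdVol n v = -1 := by
  have hli := hv.linearIndependent
  have hsp : ⊤ ≤ Submodule.span ℝ (Set.range v) :=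
    (hli.span_eq_top_of_card_eq_finrank' (by simp)).ge
  let b := OrthonormalBasis.mk hv hsp
  have hb : (b : Fin n → EuclideanSpace ℝ (Fin n)) = v := by simp [b]
  have := (EuclideanSpace.basisFun (Fin n) ℝ).det_to_matrix_orthonormalBasis_real b
  rw [hb] at this
  exact this

theorem stdVol_contDiff {n : ℕ} {F : Type*} [NormedAddCommGroup F] [NormedSpace ℝ F] {s : Set F}
    {m : Fin n → F → EuclideanSpace ℝ (Fin n)} (hm : ∀ i, ContDiffOn ℝ ∞ (m i) s) :
    ContDiffOn ℝ ∞ (fun y => stdVol n (fun i => m i y)) s :=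
  (ContinuousMultilinearMap.contDiff (stdVol n).toContinuousMultilinearMap).comp_contDiffOn
    (contDiffOn_pi.mpr hm)

theorem form4_eq (α : E4 [⋀^Fin 4]→L[ℝ] ℝ) : α = α stdVec • stdVol 4 := by
  apply ContinuousAlternatingMap.toAlternatingMap_injective
  have := α.toAlternatingMap.eq_smul_basis_det (EuclideanSpace.basisFun (Fin 4) ℝ).toBasis
  rw [this]
  ext v
  simp [stdVol]
  left
  congr 1
  ext i : 1
  simp [stdVec]

/-- The pullback of the Euclidean inner product by a linear map. -/
def pullInner {T : Type*} [AddCommGroup T] [Module ℝ T] [TopologicalSpace T] {n : ℕ}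
    (A : T →L[ℝ] EuclideanSpace ℝ (Fin n)) : T →L[ℝ] T →L[ℝ] ℝ :=
  (ContinuousLinearMap.precomp ℝ A) ∘L (innerSL ℝ) ∘L A

theorem pullInner_apply {T : Type*} [AddCommGroup T] [Module ℝ T] [TopologicalSpace T] {n : ℕ}
    (A : T →L[ℝ] EuclideanSpace ℝ (Fin n)) (v w : T) : pullInner A v w = inner ℝ (A v) (A w) := rfl

theorem pullInner_contDiffOn {n : ℕ} {F : Type*} [NormedAddCommGroup F] [NormedSpace ℝ F]
    {s : Set F} {A : F → E4 →L[ℝ] EuclideanSpace ℝ (Fin n)} (hA : ContDiffOn ℝ ∞ A s) :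
    ContDiffOn ℝ ∞ (fun y => pullInner (A y)) s := by
  refine contDiffOn_clm_apply.mpr fun v => contDiffOn_clm_apply.mpr fun w => ?_
  exact (hA.clm_apply contDiffOn_const).inner ℝ (hA.clm_apply contDiffOn_const)

theorem localForm4_smooth {X : Type*} [TopologicalSpace X] [ChartedSpace E4 X]
    [IsManifold (𝓡 4) ∞ X] (α : DiffForm (𝓡 4) X 4)
    (h : ∀ x₀ : X, ContDiffOn ℝ ∞ (fun y => localForm α x₀ y stdVec) (extChartAt (𝓡 4) x₀).target) :
    IsSmoothForm α := fun x₀ =>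
  ((h x₀).smul contDiffOn_const).congr fun y _ => form4_eq (localForm α x₀ y)

abbrev E5 : Type := EuclideanSpace ℝ (Fin 5)

instance : Fact (Module.finrank ℝ E5 = 4 + 1) := ⟨by simp⟩

/-- The unit sphere in `ℝ⁵`. -/
abbrev S4 : Type := Metric.sphere (0 : E5) 1

instance : IsManifold (𝓡 4) ∞ S4 := IsManifold.of_le (n := ω) le_top
/-- The differential of the inclusion of the sphere in Euclidean space. -/
def sphereIncl (x : S4) : TangentSpace (𝓡 4) x →L[ℝ] E5 :=
  mfderiv (𝓡 4) 𝓘(ℝ, E5) ((↑) : S4 → E5) x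

/-- The round metric of the unit sphere. -/
def roundMetric : BilinField (𝓡 4) S4 := fun x => pullInner (sphereIncl x)

/-- The volume form of the unit sphere, oriented as the boundary of the ball. -/
def roundVol : DiffForm (𝓡 4) S4 4 := fun x =>
  ((stdVol 5).curryLeft (x : E5)).compContinuousLinearMap (sphereIncl x)

theorem roundVol_apply (x : S4) (v : Fin 4 → TangentSpace (𝓡 4) x) :
    roundVol x v = stdVol 5 (Fin.cons (x : E5) (fun i => sphereIncl x (v i))) := by
  rw [roundVol, ContinuousAlternatingMap.compContinuousLinearMap_apply,
    ContinuousAlternatingMap.curryLeft_apply_apply]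
  rfl

theorem sphereIncl_orthogonal (x : S4) (v : TangentSpace (𝓡 4) x) :
    inner ℝ (x : E5) (sphereIncl x v) = 0 := by
  have h := range_mvfderiv_subtypeVal (n := 4) x
  have h2 : sphereIncl x v ∈ (ℝ ∙ (x : E5))ᗮ := by
    rw [← h]; exact ⟨v, rfl⟩
  exact Submodule.mem_orthogonal_singleton_iff_inner_right.mp h2

theorem sphereIncl_frame (x₀ : S4) {y : E4} (hy : y ∈ (extChartAt (𝓡 4) x₀).target) :
    sphereIncl ((extChartAt (𝓡 4) x₀).symm y) ∘L coordFrame (𝓡 4) x₀ ((extChartAt (𝓡 4) x₀).symm y) =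
      fderiv ℝ (fun y => (((extChartAt (𝓡 4) x₀).symm y : S4) : E5)) y := by
  set x := (extChartAt (𝓡 4) x₀).symm y with hx
  have hxs : x ∈ (chartAt E4 x₀).source := by
    have := (extChartAt (𝓡 4) x₀).map_target hy
    rwa [extChartAt_source] at this
  have hy' : extChartAt (𝓡 4) x₀ x = y := (extChartAt (𝓡 4) x₀).right_inv hy
  have h1 : coordFrame (𝓡 4) x₀ x = mfderivWithin 𝓘(ℝ, E4) (𝓡 4) (extChartAt (𝓡 4) x₀).symm (Set.range (𝓡 4)) (extChartAt (𝓡 4) x₀ x) :=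
    TangentBundle.symmL_trivializationAt hxs
  rw [h1, hy']
  simp only [modelWithCornersSelf_coe, Set.range_id, mfderivWithin_univ]
  rw [← mfderiv_eq_fderiv]
  have hd1 : MDifferentiableAt (𝓡 4) 𝓘(ℝ, E5) ((↑) : S4 → E5) x :=
    (contMDiff_coe_sphere (m := ∞) x).mdifferentiableAt (by simp)
  have hd2 : MDifferentiableAt 𝓘(ℝ, E4) (𝓡 4) (extChartAt (𝓡 4) x₀).symm y :=
    ((contMDiffOn_extChartAt_symm (n := ∞) x₀).contMDiffAt
      ((isOpen_extChartAt_target x₀).mem_nhds hy)).mdifferentiableAt (by simp)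
  exact (mfderiv_comp y hd1 hd2).symm

theorem sphere_lift_smooth (x₀ : S4) : ContDiffOn ℝ ∞
    (fun y => (((extChartAt (𝓡 4) x₀).symm y : S4) : E5))
    (extChartAt (𝓡 4) x₀).target :=
  ((contMDiff_coe_sphere (m := ∞)).comp_contMDiffOn
    (contMDiffOn_extChartAt_symm (I := 𝓡 4) (n := ∞) x₀)).contDiffOn

theorem sphere_lift_fderiv_smooth (x₀ : S4) : ContDiffOn ℝ ∞
    (fderiv ℝ (fun y => (((extChartAt (𝓡 4) x₀).symm y : S4) : E5)))
    (extChartAt (𝓡 4) x₀).target :=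
  (sphere_lift_smooth x₀).fderiv_of_isOpen (isOpen_extChartAt_target x₀) (by simp)

theorem round_isOriented : IsOrientedRiemannian roundMetric roundVol where
  inner x :=
    { symm := fun v w => by
        simp only [roundMetric, pullInner_apply]; exact real_inner_comm _ _
      pos := fun v hv => by
        simp only [roundMetric, pullInner_apply]
        refine real_inner_self_pos.mpr fun h => hv ?_
        exact injective_mvfderiv_subtypeVal_sphere x (h.trans (map_zero _).symm)
      unit := fun e he => by
        rw [roundVol_apply]
        refine stdVol_orthonormal ?_
        rw [orthonormal_iff_ite]
        have ho := sphereIncl_orthogonal x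
        intro i j
        refine Fin.cases ?_ (fun i => ?_) i <;> refine Fin.cases ?_ (fun j => ?_) j
        · simp
        · simp [ho, (Fin.succ_ne_zero j).symm]
        · rw [real_inner_comm]; simp [ho]
        · simpa [roundMetric, pullInner_apply] using he i j }
  smooth_metric x₀ := by
    have h : ContDiffOn ℝ ∞ (fun y => pullInner (fderiv ℝ (fun y => (((extChartAt (𝓡 4) x₀).symm y : S4) : E5)) y))
        (extChartAt (𝓡 4) x₀).target := by
      exact pullInner_contDiffOn (sphere_lift_fderiv_smooth x₀)
    refine h.congr fun y hy => ?_
    rw [← sphereIncl_frame x₀ hy]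
    rfl
  smooth_vol := localForm4_smooth _ fun x₀ => by
    have h := stdVol_contDiff (n := 4 + 1) (s := (extChartAt (𝓡 4) x₀).target)
      (m := Fin.cons (fun y => (((extChartAt (𝓡 4) x₀).symm y : S4) : E5))
        (fun i y => fderiv ℝ (fun y => (((extChartAt (𝓡 4) x₀).symm y : S4) : E5)) y (stdVec i)))
      (fun i => by
        refine Fin.cases ?_ (fun i => ?_) i
        · exact sphere_lift_smooth x₀
        · exact (sphere_lift_fderiv_smooth x₀).clm_apply contDiffOn_const)
    refine h.congr fun y hy => ?_
    rw [localForm, frameForm_apply, roundVol_apply]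
    congr 1
    ext i : 1
    refine Fin.cases ?_ (fun i => ?_) i
    · rfl
    · simp only [Fin.cons_succ]
      rw [← sphereIncl_frame x₀ hy]
      rfl

section CP2Topology
abbrev C3 : Type := Fin 3 → ℂ

abbrev E6 : Type := EuclideanSpace ℝ (Fin 6)

/-- The complex projective plane, with the quotient topology. -/
def CP2 : Type := Projectivization ℂ C3

instance : TopologicalSpace CP2 :=
  inferInstanceAs (TopologicalSpace (Quotient (projectivizationSetoid ℂ C3)))

/-- The complex line spanned by `z`. -/
def CP2.mk (z : C3) (hz : z ≠ 0) : CP2 := Projectivization.mk ℂ z hz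

/-- Some vector that spans the given complex line. -/
def CP2.rep (L : CP2) : C3 := Projectivization.rep L

theorem CP2.rep_ne_zero (L : CP2) : L.rep ≠ 0 := Projectivization.rep_nonzero L

theorem CP2.mk_rep (L : CP2) : CP2.mk L.rep L.rep_ne_zero = L := Projectivization.mk_rep L

theorem CP2.mk_eq_mk_iff {z w : C3} (hz : z ≠ 0) (hw : w ≠ 0) :
    CP2.mk z hz = CP2.mk w hw ↔ ∃ c : ℂ, c ≠ 0 ∧ z = c • w := by
  refine (Projectivization.mk_eq_mk_iff' ℂ z w hz hw).trans ⟨?_, ?_⟩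
  · rintro ⟨c, hc⟩
    refine ⟨c, ?_, hc.symm⟩
    rintro rfl
    exact hz (by rw [← hc, zero_smul])
  · rintro ⟨c, -, hc⟩
    exact ⟨c, hc.symm⟩

theorem CP2.rep_mk {z : C3} (hz : z ≠ 0) : ∃ c : ℂ, c ≠ 0 ∧ (CP2.mk z hz).rep = c • z :=
  (CP2.mk_eq_mk_iff (CP2.rep_ne_zero _) hz).mp (CP2.mk_rep _)

theorem CP2.isQuotientMap :
    Topology.IsQuotientMap (fun z : {z : C3 // z ≠ 0} => CP2.mk z.1 z.2) :=
  isQuotientMap_quotient_mk'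

/-- The unitary group. -/
abbrev U3 : Type := Matrix.unitaryGroup (Fin 3) ℂ

/-- The action of a unitary matrix on `ℂ³`. -/
def U3.act (U : U3) : C3 →L[ℂ] C3 := LinearMap.toContinuousLinearMap (Matrix.toLin' U.1)

theorem U3.act_mul (U V : U3) (z : C3) : U3.act (U * V) z = U3.act U (U3.act V z) := by
  simp [U3.act]

theorem U3.act_one (z : C3) : U3.act 1 z = z := by
  simp [U3.act]

theorem U3.act_inv_act (U : U3) (z : C3) : U3.act U⁻¹ (U3.act U z) = z := by
  rw [← U3.act_mul, inv_mul_cancel, U3.act_one]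

theorem U3.act_act_inv (U : U3) (z : C3) : U3.act U (U3.act U⁻¹ z) = z := by
  rw [← U3.act_mul, mul_inv_cancel, U3.act_one]

theorem U3.act_ne_zero (U : U3) {z : C3} (hz : z ≠ 0) : U3.act U z ≠ 0 := fun h =>
  hz (by rw [← U3.act_inv_act U z, h, map_zero])

/-- The inhomogeneous coordinates `z₁ / z₀` and `z₂ / z₀`, as a point of `ℝ⁴`. -/
def affineCoords (z : C3) : E4 :=
  !₂[(z 1 / z 0).re, (z 1 / z 0).im, (z 2 / z 0).re, (z 2 / z 0).im]

/-- The linear map `(y₀, y₁, y₂, y₃) ↦ (0, y₀ + i y₁, y₂ + i y₃)`. -/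
def affineLin : E4 →L[ℝ] C3 := LinearMap.toContinuousLinearMap
  { toFun := fun y => ![0, y 0 + y 1 * Complex.I, y 2 + y 3 * Complex.I]
    map_add' := fun y y' => by
      ext i; fin_cases i <;> simp <;> ring
    map_smul' := fun c y => by
      ext i; fin_cases i <;> simp <;> ring }

theorem affineLin_apply (y : E4) :
    affineLin y = ![0, y 0 + y 1 * Complex.I, y 2 + y 3 * Complex.I] := rfl

/-- The point `(1, y₀ + i y₁, y₂ + i y₃)`. -/
def affinePoint (y : E4) : C3 := Pi.single 0 1 + affineLin y

theorem affinePoint_zero (y : E4) : affinePoint y 0 = 1 := by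
  simp [affinePoint, affineLin_apply]

theorem affineCoords_affinePoint (y : E4) : affineCoords (affinePoint y) = y := by
  ext i
  fin_cases i <;> simp [affineCoords, affinePoint, affineLin_apply]

theorem affinePoint_affineCoords {z : C3} (hz : z 0 ≠ 0) :
    affinePoint (affineCoords z) = (z 0)⁻¹ • z := by
  ext i
  fin_cases i
  · simp [affinePoint, affineLin_apply, hz]
  · simp [affinePoint, affineLin_apply, affineCoords, Complex.re_add_im]
    rw [div_eq_inv_mul]
  · simp [affinePoint, affineLin_apply, affineCoords, Complex.re_add_im]
    rw [div_eq_inv_mul]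

theorem affineCoords_smul {c : ℂ} (hc : c ≠ 0) (z : C3) :
    affineCoords (c • z) = affineCoords z := by
  simp [affineCoords, mul_div_mul_left _ _ hc]

theorem affineCoords_contDiffOn : ContDiffOn ℝ ∞ affineCoords {z | z 0 ≠ 0} := by
  have h : ∀ i : Fin 3, ContDiffOn ℝ ∞ (fun z : C3 => z i / z 0) {z | z 0 ≠ 0} := fun i => by
    have hp : ∀ i : Fin 3, ContDiffOn ℝ ∞ (fun z : C3 => z i) {z | z 0 ≠ 0} := fun i =>
      (contDiff_apply ℝ ℂ i).contDiffOn
    simp only [div_eq_mul_inv]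
    exact (hp i).mul ((hp 0).inv fun z hz => hz)
  have hre : ∀ i : Fin 3, ContDiffOn ℝ ∞ (fun z : C3 => (z i / z 0).re) {z | z 0 ≠ 0} := fun i =>
    Complex.reCLM.contDiff.comp_contDiffOn (h i)
  have him : ∀ i : Fin 3, ContDiffOn ℝ ∞ (fun z : C3 => (z i / z 0).im) {z | z 0 ≠ 0} := fun i =>
    Complex.imCLM.contDiff.comp_contDiffOn (h i)
  rw [contDiffOn_euclidean]
  intro i
  fin_cases i
  · exact hre 1
  · exact him 1
  · exact hre 2
  · exact him 2

theorem affinePoint_contDiff : ContDiff ℝ ∞ affinePoint := contDiff_const.add affineLin.contDiff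

/-- The point `U⁻¹ (1, y₀ + i y₁, y₂ + i y₃)`. -/
def affineLift (U : U3) (y : E4) : C3 := U3.act U⁻¹ (affinePoint y)

theorem affineLift_ne_zero (U : U3) (y : E4) : affineLift U y ≠ 0 :=
  U3.act_ne_zero _ fun h => by
    have := affinePoint_zero y
    rw [h] at this
    simp at this

theorem affineLift_contDiff (U : U3) : ContDiff ℝ ∞ (affineLift U) :=
  ((U3.act U⁻¹).restrictScalars ℝ).contDiff.comp affinePoint_contDiff

theorem act_rep_mk (U : U3) {z : C3} (hz : z ≠ 0) :
    affineCoords (U3.act U (CP2.mk z hz).rep) = affineCoords (U3.act U z) := by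
  obtain ⟨c, hc, h⟩ := CP2.rep_mk hz
  rw [h, map_smul, affineCoords_smul hc]

theorem act_rep_mk_zero (U : U3) {z : C3} (hz : z ≠ 0) :
    U3.act U (CP2.mk z hz).rep 0 ≠ 0 ↔ U3.act U z 0 ≠ 0 := by
  obtain ⟨c, hc, h⟩ := CP2.rep_mk hz
  rw [h, map_smul, Pi.smul_apply, smul_eq_mul, mul_ne_zero_iff]
  exact and_iff_right hc

/-- Inhomogeneous coordinates on the complex projective plane with respect to the homogeneous
coordinates `U z`, where `U` is a unitary matrix. -/
def cp2Chart (U : U3) : OpenPartialHomeomorph CP2 E4 where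
  toFun L := affineCoords (U3.act U L.rep)
  invFun y := CP2.mk (affineLift U y) (affineLift_ne_zero U y)
  source := {L | U3.act U L.rep 0 ≠ 0}
  target := Set.univ
  map_source' _ _ := trivial
  map_target' y _ := by
    change _ ≠ _
    rw [act_rep_mk_zero, affineLift, U3.act_act_inv, affinePoint_zero]
    exact one_ne_zero
  left_inv' L hL := by
    have hL' : U3.act U L.rep 0 ≠ 0 := hL
    conv_rhs => rw [← CP2.mk_rep L]
    rw [CP2.mk_eq_mk_iff]
    refine ⟨_, inv_ne_zero hL', ?_⟩
    rw [affineLift, affinePoint_affineCoords hL', map_smul, U3.act_inv_act]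
  right_inv' y _ := by
    rw [act_rep_mk, affineLift, U3.act_act_inv, affineCoords_affinePoint]
  open_source := by
    rw [← CP2.isQuotientMap.isOpen_preimage]
    have : ((fun z : {z : C3 // z ≠ 0} => CP2.mk z.1 z.2) ⁻¹' {L | U3.act U L.rep 0 ≠ 0}) =
        (fun z : {z : C3 // z ≠ 0} => U3.act U z.1 0) ⁻¹' {0}ᶜ := by
      ext z
      exact act_rep_mk_zero U z.2
    rw [this]
    exact isOpen_compl_singleton.preimage
      ((continuous_apply 0).comp ((U3.act U).continuous.comp continuous_subtype_val))
  open_target := isOpen_univ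
  continuousOn_toFun := by
    have hopen : IsOpen {L : CP2 | U3.act U L.rep 0 ≠ 0} := by
      rw [← CP2.isQuotientMap.isOpen_preimage]
      have : ((fun z : {z : C3 // z ≠ 0} => CP2.mk z.1 z.2) ⁻¹' {L | U3.act U L.rep 0 ≠ 0}) =
          (fun z : {z : C3 // z ≠ 0} => U3.act U z.1 0) ⁻¹' {0}ᶜ := by
        ext z
        exact act_rep_mk_zero U z.2
      rw [this]
      exact isOpen_compl_singleton.preimage
        ((continuous_apply 0).comp ((U3.act U).continuous.comp continuous_subtype_val))
    rw [CP2.isQuotientMap.continuousOn_isOpen_iff hopen]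
    have h : ContinuousOn (fun z : {z : C3 // z ≠ 0} => affineCoords (U3.act U z.1))
        {z | U3.act U z.1 0 ≠ 0} :=
      affineCoords_contDiffOn.continuousOn.comp
        ((U3.act U).continuous.comp continuous_subtype_val).continuousOn (fun z hz => hz)
    refine (h.mono fun z hz => ?_).congr fun z hz => ?_
    · exact (act_rep_mk_zero U z.2).mp hz
    · exact act_rep_mk U z.2
  continuousOn_invFun :=
    (CP2.isQuotientMap.continuous.comp
      (Continuous.subtype_mk (affineLift_contDiff U).continuous (affineLift_ne_zero U))).continuousOn

/-- Every point is the origin of one of the charts. -/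
theorem exists_centered (L : CP2) :
    ∃ U : U3, U3.act U L.rep 0 ≠ 0 ∧ affineCoords (U3.act U L.rep) = 0 := by
  let z : EuclideanSpace ℂ (Fin 3) := WithLp.toLp 2 L.rep
  have hz : z ≠ 0 := fun h => L.rep_ne_zero (congrArg WithLp.ofLp h)
  have hn : (‖z‖ : ℂ) ≠ 0 := by simpa using hz
  let w : Fin 3 → EuclideanSpace ℂ (Fin 3) := fun _ => (‖z‖ : ℂ)⁻¹ • z
  have hw : Orthonormal ℂ (({0} : Set (Fin 3)).domRestrict w) := by
    constructor
    · rintro ⟨i, hi⟩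
      have : ‖z‖ ≠ 0 := norm_ne_zero_iff.mpr hz
      simp [w, norm_smul, this]
    · rintro ⟨i, hi⟩ ⟨j, hj⟩ hij
      exact absurd (Subtype.ext (hi.trans hj.symm)) hij
  obtain ⟨b, hb⟩ := hw.exists_orthonormalBasis_extension_of_card_eq (by simp)
  let A : Matrix (Fin 3) (Fin 3) ℂ := Matrix.of fun i j => star (b i j)
  have hin : ∀ i k, inner ℂ (b i) (b k) = ∑ j, star (b i j) * b k j := fun i k => by
    simp [PiLp.inner_apply, mul_comm]
  have hA : A ∈ Matrix.unitaryGroup (Fin 3) ℂ := by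
    rw [Matrix.mem_unitaryGroup_iff]
    ext i k
    have h := orthonormal_iff_ite.mp b.orthonormal i k
    rw [hin] at h
    rw [Matrix.mul_apply, Matrix.one_apply, ← h]
    simp [A]
  have hzb : z = (‖z‖ : ℂ) • b 0 := by
    rw [hb 0 rfl]; simp [w, smul_smul, hn]
  have hact : ∀ i, U3.act ⟨A, hA⟩ L.rep i = if i = 0 then (‖z‖ : ℂ) else 0 := by
    intro i
    have h1 : U3.act ⟨A, hA⟩ L.rep i = inner ℂ (b i) z := by
      simp [U3.act, A, Matrix.mulVec, dotProduct, PiLp.inner_apply, z, mul_comm]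
    rw [h1]
    conv_lhs => rw [hzb]
    rw [inner_smul_right, orthonormal_iff_ite.mp b.orthonormal i 0]
    simp
  refine ⟨⟨A, hA⟩, ?_, ?_⟩
  · rw [hact]; simpa using hz
  · ext i
    fin_cases i <;> simp [affineCoords, hact]

/-- Unitary homogeneous coordinates whose affine chart has its origin at `L`. -/
def centeredFrame (L : CP2) : U3 := (exists_centered L).choose

theorem centeredFrame_spec (L : CP2) : U3.act (centeredFrame L) L.rep 0 ≠ 0 ∧
    affineCoords (U3.act (centeredFrame L) L.rep) = 0 := (exists_centered L).choose_spec

instance : ChartedSpace E4 CP2 where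
  atlas := Set.range cp2Chart
  chartAt L := cp2Chart (centeredFrame L)
  mem_chart_source L := (centeredFrame_spec L).1
  chart_mem_atlas _ := ⟨_, rfl⟩

theorem cp2_chartAt (L : CP2) : chartAt E4 L = cp2Chart (centeredFrame L) := rfl

theorem cp2_transition_source (U V : U3) {y : E4}
    (hy : y ∈ ((cp2Chart U).symm.trans (cp2Chart V)).source) :
    U3.act V (affineLift U y) 0 ≠ 0 := by
  have h := hy.2
  exact (act_rep_mk_zero V (affineLift_ne_zero U y)).mp h

theorem cp2_transition (U V : U3) (y : E4) :
    cp2Chart V ((cp2Chart U).symm y) = affineCoords (U3.act V (affineLift U y)) :=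
  act_rep_mk V (affineLift_ne_zero U y)

theorem cp2_transition_contDiffOn (U V : U3) :
    ContDiffOn ℝ ∞ (fun y => affineCoords (U3.act V (affineLift U y)))
      {y | U3.act V (affineLift U y) 0 ≠ 0} :=
  affineCoords_contDiffOn.comp
    (((U3.act V).restrictScalars ℝ).contDiff.comp (affineLift_contDiff U)).contDiffOn
    (fun y hy => hy)

instance : IsManifold (𝓡 4) ∞ CP2 := by
  refine isManifold_of_contDiffOn _ _ _ ?_
  rintro _ _ ⟨U, rfl⟩ ⟨V, rfl⟩
  refine ((cp2_transition_contDiffOn U V).mono ?_).congr ?_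
  · exact fun y hy => cp2_transition_source U V (y := y) (by simpa using hy)
  · exact fun _ _ => cp2_transition U V _

end CP2Topology

/-- The identification of `ℂ³` with `ℝ⁶`. -/
def realify : C3 →L[ℝ] E6 := LinearMap.toContinuousLinearMap
  { toFun := fun z => !₂[(z 0).re, (z 0).im, (z 1).re, (z 1).im, (z 2).re, (z 2).im]
    map_add' := fun z w => by ext i; fin_cases i <;> simp
    map_smul' := fun c z => by ext i; fin_cases i <;> simp }

theorem realify_apply (z : C3) :
    realify z = !₂[(z 0).re, (z 0).im, (z 1).re, (z 1).im, (z 2).re, (z 2).im] := rfl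

/-- The standard Hermitian product of `ℂ³`. -/
def herm (z w : C3) : ℂ := ∑ i, star (z i) * w i

theorem inner_realify (z w : C3) : inner ℝ (realify z) (realify w) = (herm z w).re := by
  simp [realify_apply, PiLp.inner_apply, herm, Fin.sum_univ_succ]
  ring

theorem realify_injective : Function.Injective realify := by
  intro z w h
  have h' : ∀ i : Fin 6, realify z i = realify w i := fun i => by rw [h]
  ext i
  fin_cases i
  · exact Complex.ext (h' 0) (h' 1)
  · exact Complex.ext (h' 2) (h' 3)
  · exact Complex.ext (h' 4) (h' 5)

theorem herm_add_right (z v w : C3) : herm z (v + w) = herm z v + herm z w := by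
  simp [herm, mul_add, Finset.sum_add_distrib]

theorem herm_smul_right (z : C3) (c : ℂ) (w : C3) : herm z (c • w) = c * herm z w := by
  simp only [herm, Pi.smul_apply, smul_eq_mul, Finset.mul_sum]
  exact Finset.sum_congr rfl fun i _ => by ring

theorem herm_smul_left (z : C3) (c : ℂ) (w : C3) : herm (c • z) w = star c * herm z w := by
  simp only [herm, Pi.smul_apply, smul_eq_mul, Finset.mul_sum, star_mul']
  exact Finset.sum_congr rfl fun i _ => by ring

theorem herm_conj (z w : C3) : star (herm z w) = herm w z := by
  simp only [herm, star_sum, star_mul', star_star]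
  exact Finset.sum_congr rfl fun i _ => by ring

theorem herm_self (z : C3) : herm z z = ((‖realify z‖ ^ 2 : ℝ) : ℂ) := by
  apply Complex.ext
  · rw [← real_inner_self_eq_norm_sq, inner_realify]; simp
  · have h := congrArg Complex.im (herm_conj z z)
    have h2 : -(herm z z).im = (herm z z).im := h
    rw [Complex.ofReal_im]; linarith

/-- The component of `a` that is orthogonal to the complex line through `z`. -/
def horizontal (z : C3) : C3 →ₗ[ℂ] C3 where
  toFun a := a - (herm z a / herm z z) • z
  map_add' a b := by rw [herm_add_right]; module
  map_smul' c a := by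
    rw [herm_smul_right, RingHom.id_apply, smul_sub, smul_smul, mul_div_assoc]

theorem horizontal_apply (z a : C3) : horizontal z a = a - (herm z a / herm z z) • z := rfl

/-- The differential at `z` of the projection from `ℂ³ \ {0}` to the complex projective plane, as
a map to the horizontal space of the Hopf fibration `S⁵ → ℂP²` at `z / ‖z‖`. -/
def hopfDiff (z : C3) : C3 →L[ℝ] E6 :=
  realify ∘L (‖realify z‖⁻¹ • LinearMap.toContinuousLinearMap ((horizontal z).restrictScalars ℝ))

theorem hopfDiff_apply (z a : C3) : hopfDiff z a = realify (‖realify z‖⁻¹ • horizontal z a) := rfl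

/-- The inner product on `ℝ⁴` for which the composition of `A` with the differential at `z` of
`ℂ³ \ {0} → ℂP²` preserves lengths: it is `Re (⟨z,z⟩⟨Av,Aw⟩ - ⟨Av,z⟩⟨z,Aw⟩) / ⟨z,z⟩²`. -/
def hopfInner (z : C3) (A : E4 →L[ℝ] C3) : E4 →L[ℝ] E4 →L[ℝ] ℝ := pullInner (hopfDiff z ∘L A)

/-- The volume form of `hopfInner z A`: with `ℂ³ = ℝ⁶`, the determinant of the unit vectors `z / ‖z‖`,
`i z / ‖z‖` and of four horizontal vectors. -/
def hopfVol (z : C3) (A : E4 →L[ℝ] C3) : E4 [⋀^Fin 4]→L[ℝ] ℝ :=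
  (((stdVol 6).curryLeft (realify (‖realify z‖⁻¹ • z))).curryLeft
    (realify (‖realify z‖⁻¹ • Complex.I • z))).compContinuousLinearMap (hopfDiff z ∘L A)

theorem hopfVol_apply (z : C3) (A : E4 →L[ℝ] C3) (v : Fin 4 → E4) :
    hopfVol z A v = stdVol 6 (Fin.cons (realify (‖realify z‖⁻¹ • z))
      (Fin.cons (realify (‖realify z‖⁻¹ • Complex.I • z)) fun i => hopfDiff z (A (v i)))) := by
  rw [hopfVol, ContinuousAlternatingMap.compContinuousLinearMap_apply,
    ContinuousAlternatingMap.curryLeft_apply_apply, ContinuousAlternatingMap.curryLeft_apply_apply]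
  rfl

theorem norm_realify_smul (c : ℂ) (z : C3) : ‖realify (c • z)‖ = ‖c‖ * ‖realify z‖ := by
  have h : ‖realify (c • z)‖ ^ 2 = (‖c‖ * ‖realify z‖) ^ 2 := by
    have h1 : ((‖realify (c • z)‖ ^ 2 : ℝ) : ℂ) = (((‖c‖ * ‖realify z‖) ^ 2 : ℝ) : ℂ) := by
      rw [← herm_self, herm_smul_left, herm_smul_right, herm_self, ← mul_assoc]
      have : star c * c = ((‖c‖ ^ 2 : ℝ) : ℂ) := by
        rw [mul_comm]; simpa using Complex.mul_conj' c
      rw [this]; push_cast; ring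
    exact_mod_cast h1
  exact (pow_left_inj₀ (norm_nonneg _) (by positivity) two_ne_zero).mp h

theorem herm_self_ne_zero {z : C3} (hz : z ≠ 0) : herm z z ≠ 0 := by
  rw [herm_self]
  have : realify z ≠ 0 := fun h => hz (realify_injective (h.trans (map_zero _).symm))
  simpa using this

theorem norm_realify_ne_zero {z : C3} (hz : z ≠ 0) : ‖realify z‖ ≠ 0 := fun h =>
  hz (realify_injective ((norm_eq_zero.mp h).trans (map_zero _).symm))

/-- Rotation of `ℝ⁶ = ℂ³` by a complex number. -/
def rot (c : ℂ) : E6 →ₗ[ℝ] E6 where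
  toFun x := realify (c • ![x 0 + x 1 * Complex.I, x 2 + x 3 * Complex.I, x 4 + x 5 * Complex.I])
  map_add' x y := by
    rw [← map_add, ← smul_add]; congr 2
    ext i; fin_cases i <;> simp <;> ring
  map_smul' r x := by
    rw [RingHom.id_apply, ← map_smul, smul_comm r c]; congr 2
    ext i; fin_cases i <;> simp <;> ring

theorem rot_realify (c : ℂ) (z : C3) : rot c (realify z) = realify (c • z) := by
  change realify _ = _
  congr 2
  ext i; fin_cases i <;> simp [realify_apply, Complex.re_add_im]

theorem realify_surjective : Function.Surjective realify := fun x => by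
  refine ⟨![x 0 + x 1 * Complex.I, x 2 + x 3 * Complex.I, x 4 + x 5 * Complex.I], ?_⟩
  ext i; fin_cases i <;> simp [realify_apply]

theorem rot_isometry {c : ℂ} (hc : ‖c‖ = 1) (x y : E6) :
    inner ℝ (rot c x) (rot c y) = inner ℝ x y := by
  obtain ⟨z, rfl⟩ := realify_surjective x
  obtain ⟨w, rfl⟩ := realify_surjective y
  rw [rot_realify, rot_realify, inner_realify, inner_realify, herm_smul_left, herm_smul_right,
    ← mul_assoc]
  have : star c * c = 1 := by
    rw [mul_comm]; have := Complex.mul_conj' c; rw [hc] at this; simpa using this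
  rw [this, one_mul]

theorem rot_mul (c d : ℂ) : rot (c * d) = rot c ∘ₗ rot d := by
  ext1 x
  obtain ⟨z, rfl⟩ := realify_surjective x
  rw [LinearMap.comp_apply, rot_realify, rot_realify, rot_realify, mul_smul]

theorem stdVol_comp {n : ℕ} (f : EuclideanSpace ℝ (Fin n) →ₗ[ℝ] EuclideanSpace ℝ (Fin n))
    (v : Fin n → EuclideanSpace ℝ (Fin n)) :
    stdVol n (fun i => f (v i)) = LinearMap.det f * stdVol n v :=
  (EuclideanSpace.basisFun (Fin n) ℝ).toBasis.det_comp f v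

theorem det_rot {c : ℂ} (hc : ‖c‖ = 1) : LinearMap.det (rot c) = 1 := by
  obtain ⟨d, hd⟩ := IsAlgClosed.exists_pow_nat_eq c (n := 2) two_pos
  have hd1 : ‖d‖ = 1 := by
    have : ‖d‖ ^ 2 = 1 := by rw [← norm_pow, hd, hc]
    nlinarith [norm_nonneg d]
  have h1 : stdVol 6 (EuclideanSpace.basisFun (Fin 6) ℝ) = 1 := by
    have := (EuclideanSpace.basisFun (Fin 6) ℝ).toBasis.det_self
    rw [OrthonormalBasis.coe_toBasis] at this
    exact this
  have h2 := stdVol_comp (rot d) (EuclideanSpace.basisFun (Fin 6) ℝ)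
  rw [h1, mul_one] at h2
  have h3 : stdVol 6 (fun i => rot d (EuclideanSpace.basisFun (Fin 6) ℝ i)) = 1 ∨
      stdVol 6 (fun i => rot d (EuclideanSpace.basisFun (Fin 6) ℝ i)) = -1 := by
    refine stdVol_orthonormal ?_
    rw [orthonormal_iff_ite]
    intro i j
    rw [rot_isometry hd1]
    exact orthonormal_iff_ite.mp (EuclideanSpace.basisFun (Fin 6) ℝ).orthonormal i j
  rw [← hd, pow_two, rot_mul, LinearMap.det_comp, ← h2]
  rcases h3 with h | h <;> rw [h] <;> norm_num

/-- Rescaling the representative of a point by `c`. -/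
theorem hopfDiff_smul {z : C3} (hz : z ≠ 0) {c : ℂ} (hc : c ≠ 0) (a : C3) (m : ℂ) :
    hopfDiff (c • z) (c • a + m • z) = rot (c / ‖c‖) (hopfDiff z a) := by
  have hh := herm_self_ne_zero hz
  have hc' : (starRingEnd ℂ) c ≠ 0 := by simpa using hc
  rw [hopfDiff_apply, hopfDiff_apply, rot_realify, norm_realify_smul]
  congr 1
  have h1 : horizontal (c • z) (c • a + m • z) = c • horizontal z a := by
    rw [horizontal_apply, horizontal_apply, herm_smul_left, herm_smul_left, herm_smul_right,
      herm_add_right, herm_smul_right, herm_smul_right, smul_sub, smul_smul, smul_smul]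
    have : star c * (c * herm z a + m * herm z z) / (star c * (c * herm z z)) * c =
        c * (herm z a / herm z z) + m := by
      have hs : star c ≠ 0 := hc'
      field_simp
    rw [this, add_smul]
    abel
  rw [h1]
  ext i
  simp only [Pi.smul_apply, Complex.real_smul, smul_eq_mul]
  push_cast
  rw [mul_inv]
  ring

/-- The derivative of `affineLift U`, which lifts the inverse of the chart `cp2Chart U` to `ℂ³`. -/
def affineLiftDeriv (U : U3) : E4 →L[ℝ] C3 := (U3.act U⁻¹).restrictScalars ℝ ∘L affineLin

theorem affineLift_hasFDerivAt (U : U3) (y : E4) :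
    HasFDerivAt (affineLift U) (affineLiftDeriv U) y := by
  have h : HasFDerivAt affinePoint affineLin y := affineLin.hasFDerivAt.const_add _
  exact ((U3.act U⁻¹).restrictScalars ℝ).hasFDerivAt.comp y h

/-- The Fubini–Study metric, for which the Hopf fibration from the unit sphere `S⁵` to `ℂP²` is a
Riemannian submersion. At `L` it is written in the preferred chart at `L`, whose inverse lifts to
`affineLift (centeredFrame L)`. -/
def fubiniStudyMetric : BilinField (𝓡 4) CP2 := fun L =>
  hopfInner (affineLift (centeredFrame L) (extChartAt (𝓡 4) L L))
    (affineLiftDeriv (centeredFrame L))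

/-- The volume form of the Fubini–Study metric, for the orientation given by the complex
structure. -/
def fubiniStudyVol : DiffForm (𝓡 4) CP2 4 := fun L =>
  hopfVol (affineLift (centeredFrame L) (extChartAt (𝓡 4) L L))
    (affineLiftDeriv (centeredFrame L))

theorem herm_horizontal {z : C3} (hz : z ≠ 0) (a : C3) : herm z (horizontal z a) = 0 := by
  have hh := herm_self_ne_zero hz
  rw [horizontal_apply, sub_eq_add_neg, ← neg_smul, herm_add_right, herm_smul_right]
  field_simp
  ring

theorem real_smul_eq (r : ℝ) (z : C3) : r • z = (r : ℂ) • z := by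
  ext i; simp

theorem hopf_isOrientedInner (U : U3) (y : E4) :
    IsOrientedInner (hopfInner (affineLift U y) (affineLiftDeriv U))
      (hopfVol (affineLift U y) (affineLiftDeriv U)) where
  symm v w := by
    simp only [hopfInner, pullInner_apply]; exact real_inner_comm _ _
  pos v hv := by
    simp only [hopfInner, pullInner_apply]
    refine real_inner_self_pos.mpr fun h => hv ?_
    rw [ContinuousLinearMap.comp_apply, hopfDiff_apply] at h
    have h1 := realify_injective (h.trans (map_zero _).symm)
    rw [smul_eq_zero_iff_right (inv_ne_zero (norm_realify_ne_zero (affineLift_ne_zero U y))),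
      horizontal_apply, sub_eq_zero] at h1
    set m := herm (affineLift U y) (affineLiftDeriv U v) / herm (affineLift U y) (affineLift U y)
    have h2 : affineLin v = m • affinePoint y := by
      have := congrArg (U3.act U) h1
      rw [map_smul] at this
      simpa only [affineLift, affineLiftDeriv, ContinuousLinearMap.comp_apply,
        ContinuousLinearMap.coe_restrictScalars', U3.act_act_inv] using this
    have h3 := congrFun h2 0
    rw [Pi.smul_apply, affinePoint_zero, affineLin_apply] at h3
    have h4 : m = 0 := by simpa using h3.symm
    rw [h4, zero_smul, affineLin_apply] at h2
    have e1 := congrFun h2 1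
    have e2 := congrFun h2 2
    ext i
    fin_cases i
    · simpa using congrArg Complex.re e1
    · simpa using congrArg Complex.im e1
    · simpa using congrArg Complex.re e2
    · simpa using congrArg Complex.im e2
  unit e he := by
    rw [hopfVol_apply]
    refine stdVol_orthonormal ?_
    set z := affineLift U y
    have hz : z ≠ 0 := affineLift_ne_zero U y
    have hn := norm_realify_ne_zero hz
    have hzz : inner ℝ (realify z) (realify z) = ‖realify z‖ ^ 2 := real_inner_self_eq_norm_sq _
    have hiz : inner ℝ (realify z) (realify (Complex.I • z)) = (0 : ℝ) := by
      rw [inner_realify, herm_smul_right, herm_self, Complex.I_mul_re, Complex.ofReal_im, neg_zero]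
    have hii : inner ℝ (realify (Complex.I • z)) (realify (Complex.I • z)) = ‖realify z‖ ^ 2 := by
      rw [real_inner_self_eq_norm_sq, norm_realify_smul]; simp
    have hza : ∀ a, inner ℝ (realify z) (realify (horizontal z a)) = (0 : ℝ) := fun a => by
      rw [inner_realify, herm_horizontal hz]; rfl
    have hia : ∀ a, inner ℝ (realify (Complex.I • z)) (realify (horizontal z a)) = (0 : ℝ) :=
      fun a => by
        rw [inner_realify, herm_smul_left, herm_horizontal hz, mul_zero]; rfl
    have hee : ∀ i j, inner ℝ (hopfDiff z (affineLiftDeriv U (e i)))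
      (hopfDiff z (affineLiftDeriv U (e j))) = if i = j then (1 : ℝ) else 0 := he
    rw [orthonormal_iff_ite]
    intro i j
    refine Fin.cases ?_ (fun i => Fin.cases ?_ (fun i => ?_) i) i <;>
      refine Fin.cases ?_ (fun j => Fin.cases ?_ (fun j => ?_) j) j
    · simp only [Fin.cons_zero, map_smul, inner_smul_left, inner_smul_right, hzz]
      simp; field_simp
    · simp only [Fin.cons_zero, Fin.cons_succ, map_smul, inner_smul_left, inner_smul_right, hiz]
      simp
    · simp only [Fin.cons_zero, Fin.cons_succ, map_smul, inner_smul_left, inner_smul_right,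
        hopfDiff_apply, hza]
      simp [(Fin.succ_ne_zero _).symm]
    · rw [real_inner_comm]
      simp only [Fin.cons_zero, Fin.cons_succ, map_smul, inner_smul_left, inner_smul_right, hiz]
      simp
    · simp only [Fin.cons_zero, Fin.cons_succ, map_smul, inner_smul_left, inner_smul_right, hii]
      simp; field_simp
    · simp only [Fin.cons_zero, Fin.cons_succ, map_smul, inner_smul_left, inner_smul_right,
        hopfDiff_apply, hia]
      rw [if_neg]
      · simp
      · exact fun h => Fin.succ_ne_zero _ (Fin.succ_injective _ h).symm
    · rw [real_inner_comm]
      simp only [Fin.cons_zero, Fin.cons_succ, map_smul, inner_smul_left, inner_smul_right,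
        hopfDiff_apply, hza]
      simp
    · rw [real_inner_comm]
      simp only [Fin.cons_zero, Fin.cons_succ, map_smul, inner_smul_left, inner_smul_right,
        hopfDiff_apply, hia]
      rw [if_neg]
      · simp
      · exact fun h => Fin.succ_ne_zero _ (Fin.succ_injective _ h)
    · simp only [Fin.cons_succ, hee]
      simp [Fin.ext_iff]

theorem norm_phase {c : ℂ} (hc : c ≠ 0) : ‖c / (‖c‖ : ℂ)‖ = 1 := by
  have : ‖c‖ ≠ 0 := norm_ne_zero_iff.mpr hc
  simp [this]

theorem hopfInner_change {z : C3} (hz : z ≠ 0) {c : ℂ} (hc : c ≠ 0) {A B : E4 →L[ℝ] C3}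
    {m : E4 → ℂ} (τ : E4 →L[ℝ] E4) (h : ∀ v, B (τ v) = c • A v + m v • z) (v w : E4) :
    hopfInner (c • z) B (τ v) (τ w) = hopfInner z A v w := by
  simp only [hopfInner, pullInner_apply, ContinuousLinearMap.comp_apply, h, hopfDiff_smul hz hc]
  exact rot_isometry (norm_phase hc) _ _

theorem hopfVol_change {z : C3} (hz : z ≠ 0) {c : ℂ} (hc : c ≠ 0) {A B : E4 →L[ℝ] C3}
    {m : E4 → ℂ} (τ : E4 →L[ℝ] E4) (h : ∀ v, B (τ v) = c • A v + m v • z) (v : Fin 4 → E4) :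
    hopfVol (c • z) B (fun i => τ (v i)) = hopfVol z A v := by
  have h1 : ∀ w : C3, realify (‖realify (c • z)‖⁻¹ • c • w) =
      rot (c / ‖c‖) (realify (‖realify z‖⁻¹ • w)) := fun w => by
    rw [rot_realify, norm_realify_smul]
    congr 1
    ext i
    simp only [Pi.smul_apply, Complex.real_smul, smul_eq_mul]
    push_cast
    rw [mul_inv]
    ring
  have h2 := stdVol_comp (rot (c / ‖c‖)) (Fin.cons (realify (‖realify z‖⁻¹ • z))
    (Fin.cons (realify (‖realify z‖⁻¹ • Complex.I • z)) fun i => hopfDiff z (A (v i))) :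
    Fin 6 → E6)
  rw [det_rot (norm_phase hc), one_mul] at h2
  rw [hopfVol_apply, hopfVol_apply, ← h2]
  congr 1
  ext i : 1
  refine Fin.cases ?_ (fun i => Fin.cases ?_ (fun i => ?_) i) i
  · simp only [Fin.cons_zero]; exact h1 z
  · simp only [Fin.cons_zero, Fin.cons_succ]; rw [← h1, smul_comm Complex.I c]
  · simp only [Fin.cons_succ]; rw [h, hopfDiff_smul hz hc]

theorem fs_change (L₀ : CP2) {y : E4} (hy : y ∈ (extChartAt (𝓡 4) L₀).target) :
    ∃ c : ℂ, c ≠ 0 ∧ ∃ m : E4 → ℂ,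
      affineLift (centeredFrame ((extChartAt (𝓡 4) L₀).symm y))
        (extChartAt (𝓡 4) ((extChartAt (𝓡 4) L₀).symm y) ((extChartAt (𝓡 4) L₀).symm y)) =
        c • affineLift (centeredFrame L₀) y ∧
      ∀ v, affineLiftDeriv (centeredFrame ((extChartAt (𝓡 4) L₀).symm y))
        (coordFrame (𝓡 4) L₀ ((extChartAt (𝓡 4) L₀).symm y) v) =
        c • affineLiftDeriv (centeredFrame L₀) v + m v • affineLift (centeredFrame L₀) y := by
  set L := (extChartAt (𝓡 4) L₀).symm y with hL
  set U := centeredFrame L₀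
  set V := centeredFrame L
  have hLs : L ∈ (chartAt E4 L₀).source := by
    have := (extChartAt (𝓡 4) L₀).map_target hy
    rwa [extChartAt_source] at this
  have hy' : extChartAt (𝓡 4) L₀ L = y := (extChartAt (𝓡 4) L₀).right_inv hy
  have hτ : coordFrame (𝓡 4) L₀ L =
      fderivWithin ℝ (extChartAt (𝓡 4) L ∘ (extChartAt (𝓡 4) L₀).symm) (Set.range (𝓡 4))
        (extChartAt (𝓡 4) L₀ L) :=
    TangentBundle.symmL_trivializationAt_eq_core hLs
  rw [hy'] at hτ
  simp only [modelWithCornersSelf_coe, Set.range_id, fderivWithin_univ] at hτ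
  have hcomp : (extChartAt (𝓡 4) L ∘ (extChartAt (𝓡 4) L₀).symm) =
      fun y => affineCoords (U3.act V (affineLift U y)) := by
    ext1 y'
    exact cp2_transition U V y'
  rw [hcomp] at hτ
  have hne : U3.act V (affineLift U y) 0 ≠ 0 :=
    (act_rep_mk_zero V (affineLift_ne_zero U y)).mp (centeredFrame_spec L).1
  have hS : IsOpen {y' : E4 | U3.act V (affineLift U y') 0 ≠ 0} :=
    isOpen_compl_singleton.preimage ((continuous_apply 0).comp
      ((U3.act V).continuous.comp (affineLift_contDiff U).continuous))
  have hd : HasFDerivAt (fun y => affineCoords (U3.act V (affineLift U y))) (coordFrame (𝓡 4) L₀ L)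
      y := by
    rw [hτ]
    exact (((cp2_transition_contDiffOn U V).contDiffAt (hS.mem_nhds hne)).differentiableAt
      (by simp)).hasFDerivAt
  have hf : ContDiff ℝ ∞ fun y' => U3.act V (affineLift U y') 0 :=
    (contDiff_apply ℝ ℂ (0 : Fin 3)).comp
      (((U3.act V).restrictScalars ℝ).contDiff.comp (affineLift_contDiff U))
  have hfi : HasFDerivAt (fun y' => (U3.act V (affineLift U y') 0)⁻¹)
      (fderiv ℝ (fun y' => (U3.act V (affineLift U y') 0)⁻¹) y) y :=
    ((hf.contDiffAt.inv hne).differentiableAt (by simp)).hasFDerivAt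
  have hkey : ∀ y', U3.act V (affineLift U y') 0 ≠ 0 →
      affineLift V (affineCoords (U3.act V (affineLift U y'))) =
        (U3.act V (affineLift U y') 0)⁻¹ • affineLift U y' := fun y' hy' => by
    conv_lhs => rw [affineLift]
    rw [affinePoint_affineCoords hy', map_smul, U3.act_inv_act]
  refine ⟨(U3.act V (affineLift U y) 0)⁻¹, inv_ne_zero hne,
    fderiv ℝ (fun y' => (U3.act V (affineLift U y') 0)⁻¹) y, ?_, fun v => ?_⟩
  · rw [← hkey y hne]
    congr 1
    exact cp2_transition U V y
  · have h1 := (affineLift_hasFDerivAt V _).comp y hd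
    have h2 := hfi.smul (affineLift_hasFDerivAt U y)
    have h3 := h2.congr_of_eventuallyEq (f₁ := fun y' => affineLift V
      (affineCoords (U3.act V (affineLift U y'))))
      (Filter.eventually_of_mem (hS.mem_nhds hne) hkey)
    have h4 := h1.unique h3
    have h5 := congrArg (fun T : E4 →L[ℝ] C3 => T v) h4
    exact h5

theorem hopf_norm_contDiff (U : U3) :
    ContDiff ℝ ∞ (fun y => ‖realify (affineLift U y)‖⁻¹) :=
  ((realify.contDiff.comp (affineLift_contDiff U)).norm ℝ fun y h =>
    norm_realify_ne_zero (affineLift_ne_zero U y) (norm_eq_zero.mpr h)).inv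
    fun y => norm_realify_ne_zero (affineLift_ne_zero U y)

theorem hopfDiff_lift_contDiff (U : U3) :
    ContDiff ℝ ∞ (fun y => hopfDiff (affineLift U y) ∘L affineLiftDeriv U) := by
  refine contDiff_clm_apply_iff.mpr fun v => ?_
  have hz := affineLift_contDiff U
  have hzi : ∀ i, ContDiff ℝ ∞ fun y => affineLift U y i := fun i => contDiff_pi.mp hz i
  have hh : ∀ f : E4 → C3, ContDiff ℝ ∞ f → ContDiff ℝ ∞ fun y => herm (affineLift U y) (f y) :=
    fun f hf => ContDiff.sum fun i _ =>
      ((Complex.conjCLE : ℂ →L[ℝ] ℂ).contDiff.comp (hzi i)).mul (contDiff_pi.mp hf i)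
  have hn := hopf_norm_contDiff U
  simp only [ContinuousLinearMap.comp_apply, hopfDiff_apply, horizontal_apply, div_eq_mul_inv]
  refine realify.contDiff.comp (hn.smul (contDiff_const.sub ?_))
  exact ((hh _ contDiff_const).mul ((hh _ hz).inv fun y => herm_self_ne_zero
    (affineLift_ne_zero U y))).smul hz

theorem localBilin_fs (L₀ : CP2) {y : E4} (hy : y ∈ (extChartAt (𝓡 4) L₀).target) :
    localBilin fubiniStudyMetric L₀ y =
      hopfInner (affineLift (centeredFrame L₀) y) (affineLiftDeriv (centeredFrame L₀)) := by
  obtain ⟨c, hc, m, h1, h2⟩ := fs_change L₀ hy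
  ext v w
  rw [localBilin, frameBilin_apply, fubiniStudyMetric, h1]
  exact hopfInner_change (affineLift_ne_zero _ _) hc _ h2 v w

theorem localForm_fs (L₀ : CP2) {y : E4} (hy : y ∈ (extChartAt (𝓡 4) L₀).target) :
    localForm fubiniStudyVol L₀ y =
      hopfVol (affineLift (centeredFrame L₀) y) (affineLiftDeriv (centeredFrame L₀)) := by
  obtain ⟨c, hc, m, h1, h2⟩ := fs_change L₀ hy
  ext v
  rw [localForm, frameForm_apply, fubiniStudyVol, h1]
  exact hopfVol_change (affineLift_ne_zero _ _) hc _ h2 v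

theorem fubiniStudy_isOriented : IsOrientedRiemannian fubiniStudyMetric fubiniStudyVol where
  inner L := hopf_isOrientedInner _ _
  smooth_metric L₀ := by
    refine ContDiffOn.congr ?_ fun y hy => localBilin_fs L₀ hy
    exact pullInner_contDiffOn (hopfDiff_lift_contDiff _).contDiffOn
  smooth_vol := localForm4_smooth _ fun L₀ => by
    set U := centeredFrame L₀
    have h := stdVol_contDiff (n := 6) (s := (extChartAt (𝓡 4) L₀).target)
      (m := Fin.cons (fun y => realify (‖realify (affineLift U y)‖⁻¹ • affineLift U y))
        (Fin.cons
          (fun y => realify (‖realify (affineLift U y)‖⁻¹ • Complex.I • affineLift U y))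
          (fun i y => hopfDiff (affineLift U y) (affineLiftDeriv U (stdVec i)))))
      (fun i => by
        refine Fin.cases ?_ (fun i => Fin.cases ?_ (fun i => ?_) i) i
        · exact (realify.contDiff.comp ((hopf_norm_contDiff U).smul
            (affineLift_contDiff U))).contDiffOn
        · exact (realify.contDiff.comp ((hopf_norm_contDiff U).smul
            ((affineLift_contDiff U).const_smul Complex.I))).contDiffOn
        · exact ((hopfDiff_lift_contDiff U).clm_apply contDiff_const).contDiffOn)
    refine h.congr fun y hy => ?_
    rw [localForm_fs L₀ hy, hopfVol_apply]
    congr 1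
    ext i : 1
    refine Fin.cases ?_ (fun i => Fin.cases ?_ (fun i => ?_) i) i <;> rfl

section Algebra
variable {T : Type*} [AddCommGroup T] [Module ℝ T] [TopologicalSpace T]

theorem wedge_continuous {k l : ℕ} (α : T [⋀^Fin k]→L[ℝ] ℝ) (β : T [⋀^Fin l]→L[ℝ] ℝ) :
    Continuous fun v : Fin (k + l) → T => LinearMap.mul' ℝ ℝ
      (AlternatingMap.domCoprod α.toAlternatingMap β.toAlternatingMap (v ∘ finSumFinEquiv)) := by
  simp only [AlternatingMap.domCoprod_apply, sum_apply, map_sum]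
  refine continuous_finsetSum _ fun σ _ => ?_
  induction σ using Quotient.inductionOn' with
  | h σ =>
    have h : ∀ v : Fin (k + l) → T, LinearMap.mul' ℝ ℝ
        (AlternatingMap.domCoprod.summand α.toAlternatingMap β.toAlternatingMap
          (Quotient.mk'' σ) (v ∘ finSumFinEquiv)) = (Equiv.Perm.sign σ : ℤ) •
        (α (fun i => v (finSumFinEquiv (σ (Sum.inl i)))) *
          β (fun i => v (finSumFinEquiv (σ (Sum.inr i))))) := fun v => by
      rw [AlternatingMap.domCoprod.summand_mk'', smul_apply, Units.smul_def, map_zsmul]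
      rfl
    refine Continuous.congr ?_ fun v => (h v).symm
    simp only [zsmul_eq_mul]
    refine continuous_const.mul ?_
    refine Continuous.mul (α.cont.comp ?_) (β.cont.comp ?_) <;>
      exact continuous_pi fun i => continuous_apply _

/-- The exterior product of two alternating forms. -/
def wedge {k l : ℕ} (α : T [⋀^Fin k]→L[ℝ] ℝ) (β : T [⋀^Fin l]→L[ℝ] ℝ) :
    T [⋀^Fin (k + l)]→L[ℝ] ℝ where
  __ := ((LinearMap.mul' ℝ ℝ).compAlternatingMap (AlternatingMap.domCoprod α.toAlternatingMap
    β.toAlternatingMap)).domDomCongr finSumFinEquiv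
  cont := wedge_continuous α β

/-- The trace of a bilinear map with respect to an inner product `h`, that is `∑ B(eᵢ, eᵢ)` for
an `h`-orthonormal basis `e`. It is written in an arbitrary basis `b` as `∑ hⁱʲ B(bᵢ, bⱼ)`. -/
def metricTrace {F : Type*} [AddCommGroup F] [Module ℝ F]
    [FiniteDimensional ℝ T] (h : T → T → ℝ) (B : T → T → F) : F :=
  let b := Module.finBasis ℝ T
  ∑ i, ∑ j, (Matrix.of fun i j => h (b i) (b j))⁻¹ i j • B (b i) (b j)

end Algebra
section Manifolds
variable {E H E' H' : Type*} [NormedAddCommGroup E] [NormedSpace ℝ E] [TopologicalSpace H]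
  [NormedAddCommGroup E'] [NormedSpace ℝ E'] [TopologicalSpace H']
  {I : ModelWithCorners ℝ E H} {M : Type*} [TopologicalSpace M] [ChartedSpace H M]
  {J : ModelWithCorners ℝ E' H'} {L : Type*} [TopologicalSpace L] [ChartedSpace H' L]

instance [FiniteDimensional ℝ E] (x : M) : FiniteDimensional ℝ (TangentSpace I x) :=
  inferInstanceAs (FiniteDimensional ℝ E)

instance (x : M) : T2Space (TangentSpace I x) := inferInstanceAs (T2Space E)

/-- The pullback `u^* β`. -/
def pullbackForm {k : ℕ} (u : M → L) (β : DiffForm J L k) : DiffForm I M k := fun x =>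
  (β (u x)).compContinuousLinearMap (mfderiv I J u x)

/-- The square `|du|² = tr_h (u^* g)` of the norm of the differential. -/
def diffNormSq (h : BilinField I M) (g : BilinField J L) [FiniteDimensional ℝ E] (u : M → L)
    (x : M) : ℝ :=
  metricTrace (fun v w => h x v w) fun v w => g (u x) (mfderiv I J u x v) (mfderiv I J u x w)

/-- A differential form is a calibration if it has comass at most one. -/
def IsCalibration {k : ℕ} (h : BilinField I M) (α : DiffForm I M k) : Prop :=
  ∀ (x : M) (e : Fin k → TangentSpace I x), IsOrthonormalFrame (h x) e → α x e ≤ 1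

variable (J) in
/-- `v` is `h`-orthogonal to the kernel of `du`. -/
def IsHorizontal (h : BilinField I M) (u : M → L) {x : M} (v : TangentSpace I x) : Prop :=
  ∀ w : TangentSpace I x, mfderiv I J u x w = 0 → h x v w = 0

variable [IsManifold I 1 M] [IsManifold J 1 L]

/-- The exterior derivative, computed at each point in the preferred chart at this point. -/
def extD {k : ℕ} (α : DiffForm I M k) : DiffForm I M (k + 1) := fun x =>
  (extDeriv (localForm α x) (extChartAt I x x)).compContinuousLinearMap (coordFrameInv I x x)

/-- `u : (M, h) → (L, g)` is a Smith submersion with respect to the calibration `α`, where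
`dim L = k` and `dim M = l + k`. -/
structure IsSmithSubmersion {k l : ℕ} [FiniteDimensional ℝ E] (h : BilinField I M)
    (volM : DiffForm I M (l + k)) (g : BilinField J L) (volL : DiffForm J L k)
    (α : DiffForm I M l) (u : M → L) : Prop where
  smooth_form : IsSmoothForm α
  calibration : IsCalibration h α
  smooth : ContMDiff I J ∞ u
  surjective : Function.Surjective u
  wedge_eq : ∀ x, wedge (α x) (pullbackForm (I := I) u volL x) =
    (1 / Real.sqrt k ^ k * Real.sqrt (diffNormSq h g u x) ^ k) • volM x
  conformal : ∀ (x : M) (v w : TangentSpace I x),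
    IsHorizontal J h u v → IsHorizontal J h u w →
    g (u x) (mfderiv I J u x v) (mfderiv I J u x w) = 1 / k * diffNormSq h g u x * h x v w

/-- The submanifolds `u⁻¹(y)` of `M` are calibrated by `α`, where `u` is a submersion: `α` takes
the value one on the oriented orthonormal frames `(e₁, …, e_l)` of the tangent spaces `ker du`.
The fibres are oriented by `vol_M = vol_{ker du} ∧ vol_{(ker du)^⊥}`, where `(ker du)^⊥` is oriented
by `u^* vol_L`. -/
def FibresCalibrated {k l : ℕ} (h : BilinField I M) (volM : DiffForm I M (l + k))
    (volL : DiffForm J L k) (α : DiffForm I M l) (u : M → L) : Prop :=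
  ∀ (x : M) (e : Fin (l + k) → TangentSpace I x), IsOrthonormalFrame (h x) e →
    (∀ i : Fin l, mfderiv I J u x (e (Fin.castAdd k i)) = 0) →
    0 < pullbackForm (I := I) u volL x (fun j => e (Fin.natAdd l j)) → volM x e = 1 →
    α x (fun i => e (Fin.castAdd k i)) = 1

/-- The Christoffel symbol `Γ(v, w)` of the metric `g` at `x`, in the preferred chart at `x`. -/
def christoffel (g : BilinField I M) (x : M) (v w : E) : E :=
  let D := fderiv ℝ (localBilin g x) (extChartAt I x x)
  (localBilin g x (extChartAt I x x)).inverse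
    ((1 / 2 : ℝ) • (D v w + D w v - (D.flip v).flip w))

theorem christoffel_isLinear (g : BilinField I M) (x : M) (w : E) :
    IsLinearMap ℝ (fun v => christoffel g x v w) where
  map_add v v' := by
    rw [christoffel, christoffel, christoffel, ← map_add]
    generalize fderiv ℝ (localBilin g x) (extChartAt I x x) = D
    refine congrArg _ (ContinuousLinearMap.ext fun z => ?_)
    change (1 / 2 : ℝ) * (D (v + v') w z + D w (v + v') z - D z (v + v') w) =
      (1 / 2 : ℝ) * (D v w z + D w v z - D z v w) +
        (1 / 2 : ℝ) * (D v' w z + D w v' z - D z v' w)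
    rw [D.map_add, (D w).map_add, (D z).map_add, add_apply, add_apply, add_apply, add_apply]
    ring
  map_smul c v := by
    rw [christoffel, christoffel, ← map_smul]
    generalize fderiv ℝ (localBilin g x) (extChartAt I x x) = D
    refine congrArg _ (ContinuousLinearMap.ext fun z => ?_)
    change (1 / 2 : ℝ) * (D (c • v) w z + D w (c • v) z - D z (c • v) w) =
      c * ((1 / 2 : ℝ) * (D v w z + D w v z - D z v w))
    rw [D.map_smul, (D w).map_smul, (D z).map_smul, smul_apply, smul_apply, smul_apply, smul_apply]
    simp only [smul_eq_mul]
    ring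

/-- The `p`-tension field `τ_p(u) = Div(|du|^{p-2} du)` at `x`, in the preferred charts at `x`
and `u x`: with `F = |du|^{p-2} du`, it is the trace of
`(∇F)(v, w) = ∂_v F(w) - F(Γ^h(v, w)) + Γ^g(du(v), F(w))`. -/
def pTension [FiniteDimensional ℝ E] (p : ℝ) (h : BilinField I M) (g : BilinField J L) (u : M → L)
    (x : M) : E' :=
  let y := extChartAt I x x
  let uloc : E → E' := writtenInExtChartAt I J x u
  let F : E → E →L[ℝ] E' := fun z =>
    Real.sqrt (diffNormSq h g u ((extChartAt I x).symm z)) ^ (p - 2) • fderiv ℝ uloc z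
  metricTrace (fun v w => localBilin h x y v w) fun v w =>
    fderiv ℝ F y v w - F y (christoffel h x v w) + christoffel g (u x) (fderiv ℝ uloc y v) (F y w)

/-- `u` is `p`-harmonic: its `p`-tension vanishes. -/
def IsPHarmonic [FiniteDimensional ℝ E] (p : ℝ) (h : BilinField I M) (g : BilinField J L)
    (u : M → L) : Prop :=
  ∀ x, pTension p h g u x = 0

end Manifolds

section Structure
variable {X : Type*} [TopologicalSpace X] [ChartedSpace E4 X] [IsManifold (𝓡 4) ∞ X]
  (R : OrientedMetric (𝓡 4) X 4)

/-- The model with corners of the total space of `Λ²₋(T*X)`. -/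
abbrev I7 : ModelWithCorners ℝ (E4 × E3) (ModelProd E4 E3) := (𝓡 4).prod 𝓘(ℝ, E3)

/-- The projection `Λ²₋(T*X) → X`. -/
def proj : ASDBundle R → X := Bundle.TotalSpace.proj

/-- The tautological two-form `θ` on `Λ²₋(T*X)`, given by `θ_η = π^* η`. -/
def tautForm : DiffForm I7 (ASDBundle R) 2 := fun p =>
  p.2.form.compContinuousLinearMap (mfderiv I7 (𝓡 4) (proj R) p)

/-- The coordinate vectors `∂₀, …, ∂₃` at `x` in the preferred chart at `x`. -/
def coordVec (x : X) (i : Fin 4) : TangentSpace (𝓡 4) x := coordFrame (𝓡 4) x x (stdVec i)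

/-- The derivative in the direction `v` of the fibre coordinates `η(∂₀, ∂ⱼ)` along parallel
transport of `η` for the Levi-Civita connection, in the preferred chart at `x`. -/
def parallelRate {x : X} (η : ASDForms R x) (v : E4) : E3 :=
  let c (i : Fin 4) : TangentSpace (𝓡 4) x :=
    coordFrame (𝓡 4) x x (christoffel R.metric x v (stdVec i))
  WithLp.toLp 2 fun j =>
    η.form ![c 0, coordVec x j.succ] + η.form ![coordVec x 0, c j.succ]

theorem parallelRate_isLinear {x : X} (η : ASDForms R x) : IsLinearMap ℝ (parallelRate R η) := by
  have hs : ∀ u v : TangentSpace (𝓡 4) x, η.form ![u, v] = -η.form ![v, u] :=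
    two_form_swap (η.form : E4 [⋀^Fin 2]→L[ℝ] ℝ)
  have ha : ∀ u u' v : TangentSpace (𝓡 4) x,
      η.form ![u + u', v] = η.form ![u, v] + η.form ![u', v] :=
    fun u u' v => η.form.vecCons_add ![v] u u'
  have hm : ∀ (r : ℝ) (u v : TangentSpace (𝓡 4) x), η.form ![r • u, v] = r * η.form ![u, v] :=
    fun r u v => η.form.vecCons_smul ![v] r u
  have hc := fun w => christoffel_isLinear R.metric x w
  constructor
  · intro v v'
    ext j
    simp only [parallelRate, (hc _).map_add, map_add, PiLp.add_apply]
    rw [ha, hs _ (_ + _), ha, hs _ (coordVec x 0), hs _ (coordVec x 0)]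
    ring
  · intro r v
    ext j
    simp only [parallelRate, (hc _).map_smul, map_smul, PiLp.smul_apply, smul_eq_mul]
    rw [hm, hs _ (_ • _), hm, hs _ (coordVec x 0)]
    ring

/-- The vertical component of a tangent vector of `Λ²₋(T*X)`, with respect to the horizontal
distribution of the Levi-Civita connection. -/
def vertPart (p : ASDBundle R) : TangentSpace I7 p →L[ℝ] ASDForms R p.1 :=
  let comps : TangentSpace I7 p →L[ℝ] E4 × E3 := coordFrameInv I7 p p
  (asdEquiv R p.1).symm.toContinuousLinearMap ∘L (ContinuousLinearMap.snd ℝ E4 E3 ∘L comps -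
    LinearMap.toContinuousLinearMap ((parallelRate_isLinear R p.2).mk' _) ∘L
      ContinuousLinearMap.fst ℝ E4 E3 ∘L comps)

/-- The inverse matrix of the metric in the preferred chart at `x`. -/
def invMetric (x : X) : Matrix (Fin 4) (Fin 4) ℝ :=
  (Matrix.of fun i j => R.metric x (coordVec x i) (coordVec x j))⁻¹

/-- The inner product `¼ ∑ gⁱᵏ gʲˡ ηᵢⱼ ζₖₗ` of two-forms at `x`, which is half of the usual one:
the form `e⁰ ∧ e¹ - e² ∧ e³` has length one if the `eⁱ` are orthonormal. -/
def asdInner {x : X} (η ζ : ASDForms R x) : ℝ :=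
  1 / 4 * ∑ i, ∑ j, ∑ k, ∑ l, invMetric R x i k * invMetric R x j l *
    η.form ![coordVec x i, coordVec x j] * ζ.form ![coordVec x k, coordVec x l]

theorem asdInner_add_left {x : X} (η η' ζ : ASDForms R x) :
    asdInner R (η + η') ζ = asdInner R η ζ + asdInner R η' ζ := by
  simp only [asdInner, map_add, ContinuousAlternatingMap.add_apply, mul_add, add_mul,
    Finset.sum_add_distrib]

theorem asdInner_smul_left {x : X} (c : ℝ) (η ζ : ASDForms R x) :
    asdInner R (c • η) ζ = c * asdInner R η ζ := by
  simp only [asdInner, map_smul, ContinuousAlternatingMap.smul_apply, smul_eq_mul, Finset.mul_sum]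
  refine Finset.sum_congr rfl fun i _ => Finset.sum_congr rfl fun j _ =>
    Finset.sum_congr rfl fun k _ => Finset.sum_congr rfl fun l _ => by ring

theorem asdInner_add_right {x : X} (η ζ ζ' : ASDForms R x) :
    asdInner R η (ζ + ζ') = asdInner R η ζ + asdInner R η ζ' := by
  simp only [asdInner, map_add, ContinuousAlternatingMap.add_apply, mul_add,
    Finset.sum_add_distrib]

theorem asdInner_smul_right {x : X} (c : ℝ) (η ζ : ASDForms R x) :
    asdInner R η (c • ζ) = c * asdInner R η ζ := by
  simp only [asdInner, map_smul, ContinuousAlternatingMap.smul_apply, smul_eq_mul, Finset.mul_sum]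
  refine Finset.sum_congr rfl fun i _ => Finset.sum_congr rfl fun j _ =>
    Finset.sum_congr rfl fun k _ => Finset.sum_congr rfl fun l _ => by ring

/-- A bilinear form on a finite-dimensional space as a continuous bilinear form. -/
def mkBilin {E H : Type*} [NormedAddCommGroup E] [NormedSpace ℝ E] [FiniteDimensional ℝ E]
    [TopologicalSpace H] {I : ModelWithCorners ℝ E H} {M : Type*} [TopologicalSpace M]
    [ChartedSpace H M] {x : M}
    (B : TangentSpace I x →ₗ[ℝ] TangentSpace I x →ₗ[ℝ] ℝ) :
    TangentSpace I x →L[ℝ] TangentSpace I x →L[ℝ] ℝ :=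
  LinearMap.toContinuousLinearMap (LinearMap.toContinuousLinearMap.toLinearMap ∘ₗ B)

/-- The vertical metric `g_V`. -/
def vertMetric : BilinField I7 (ASDBundle R) := fun p =>
  mkBilin (LinearMap.mk₂ ℝ (fun ξ ζ => asdInner R (vertPart R p ξ) (vertPart R p ζ))
    (fun _ _ _ => by rw [map_add, asdInner_add_left])
    (fun _ _ _ => by rw [map_smul, asdInner_smul_left]; rfl)
    (fun _ _ _ => by rw [map_add, asdInner_add_right])
    (fun _ _ _ => by rw [map_smul, asdInner_smul_right]; rfl))

/-- The vertical volume form `vol_V`: the volume form of `g_V` on the fibres, for the orientation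
in which `e⁰ ∧ e¹ - e² ∧ e³`, `e⁰ ∧ e² - e³ ∧ e¹`, `e⁰ ∧ e³ - e¹ ∧ e²` is an oriented basis, for
oriented orthonormal `eⁱ`. -/
def vertVol : DiffForm I7 (ASDBundle R) 3 := fun p =>
  (R.metric p.1 (coordVec p.1 0) (coordVec p.1 0) * R.vol p.1 (coordVec p.1))⁻¹ •
    (stdVol 3).compContinuousLinearMap ((asdEquiv R p.1).toContinuousLinearMap ∘L vertPart R p)

/-- The square of the radial coordinate of the fibres. -/
def radiusSq (p : ASDBundle R) : ℝ := asdInner R p.2 p.2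

variable (κ b c : ℝ)

/-- The function `w = (c + 2κb²r²)^{1/4}`. -/
def coefW (p : ASDBundle R) : ℝ := (c + 2 * κ * b ^ 2 * radiusSq R p) ^ (1 / 4 : ℝ)

/-- The function `v = b (c + 2κb²r²)^{-1/4}`. -/
def coefV (p : ASDBundle R) : ℝ := b * (c + 2 * κ * b ^ 2 * radiusSq R p) ^ (-(1 / 4) : ℝ)

/-- The three-form `φ = v³ vol_V + w² v dθ`. -/
def bsForm : DiffForm I7 (ASDBundle R) 3 := fun p =>
  coefV R κ b c p ^ 3 • vertVol R p + (coefW R κ b c p ^ 2 * coefV R κ b c p) • extD (tautForm R) p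

/-- The metric `h = w² π^* g + v² g_V`. -/
def bsMetric : BilinField I7 (ASDBundle R) := fun p =>
  coefW R κ b c p ^ 2 • ((ContinuousLinearMap.precomp ℝ (mfderiv I7 (𝓡 4) (proj R) p)) ∘L
    (R.metric p.1) ∘L (mfderiv I7 (𝓡 4) (proj R) p)) + coefV R κ b c p ^ 2 • vertMetric R p

/-- The volume form `v³ w⁴ vol_V ∧ π^* vol_X`. -/
def bsVol : DiffForm I7 (ASDBundle R) (3 + 4) := fun p =>
  (coefV R κ b c p ^ 3 * coefW R κ b c p ^ 4) •
    wedge (vertVol R p) (pullbackForm (I := I7) (proj R) R.vol p)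

end Structure

/-- `η₁₂₃ + η₁ ∧ (η₄₅ - η₆₇) + η₂ ∧ (η₄₆ - η₇₅) + η₃ ∧ (η₄₇ - η₅₆)` on basis vectors, where
the indices are shifted by one. -/
def g2Coeff (a : Fin 3 → Fin 7) : ℝ :=
  let ε (i j k : Fin 7) : ℝ :=
    (Matrix.of fun r s : Fin 3 => if a s = ![i, j, k] r then (1 : ℝ) else 0).det
  ε 0 1 2 + (ε 0 3 4 - ε 0 5 6) + (ε 1 3 5 - ε 1 6 4) + (ε 2 3 6 - ε 2 4 5)

section G2
variable {M : Type*} [TopologicalSpace M] [ChartedSpace (ModelProd E4 E3) M]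
  [IsManifold I7 1 M]

/-- `φ` is a `G₂`-structure inducing the metric `h` and the orientation `vol`: it has the standard
form in some oriented orthonormal frame at each point. -/
def IsG2Structure (φ : DiffForm I7 M 3) (h : BilinField I7 M) (vol : DiffForm I7 M (3 + 4)) : Prop :=
  IsSmoothForm φ ∧ ∀ x, ∃ e : Fin 7 → TangentSpace I7 x, IsOrthonormalFrame (h x) e ∧
    vol x e = 1 ∧ ∀ a : Fin 3 → Fin 7, φ x (e ∘ a) = g2Coeff a

/-- `ψ = ⋆φ` for a three-form `φ`. -/
def IsHodgeDual (h : BilinField I7 M) (vol : DiffForm I7 M (3 + 4)) (φ : DiffForm I7 M 3)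
    (ψ : DiffForm I7 M 4) : Prop :=
  ∀ (x : M) (e : Fin 7 → TangentSpace I7 x), IsOrthonormalFrame (h x) e → vol x e = 1 →
    ψ x ![e 3, e 4, e 5, e 6] = φ x ![e 0, e 1, e 2]

/-- `φ` is closed and coclosed. -/
def IsTorsionFree (h : BilinField I7 M) (vol : DiffForm I7 M (3 + 4)) (φ : DiffForm I7 M 3) : Prop :=
  (∀ x, extD φ x = 0) ∧
    ∃ ψ : DiffForm I7 M 4, IsSmoothForm ψ ∧ IsHodgeDual h vol φ ψ ∧ ∀ x, extD ψ x = 0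

end G2

/-- The unit sphere `S⁴` with its round metric and its standard orientation. -/
def roundS4 : OrientedMetric (𝓡 4) S4 4 := ⟨roundMetric, roundVol, round_isOriented⟩

/-- The complex projective plane with the Fubini–Study metric and its complex orientation. -/
def fubiniStudyCP2 : OrientedMetric (𝓡 4) CP2 4 :=
  ⟨fubiniStudyMetric, fubiniStudyVol, fubiniStudy_isOriented⟩

end BryantSalamon

end

open scoped Manifold ContDiff Topology Bundle

set_option maxSynthPendingDepth 3

noncomputable section

/-! Everything about the base is reduced to one property, `NormalCharts R κ`. It says that in the
preferred chart at each point the metric is Euclidean at the centre, that its first derivative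
vanishes there, and that its second derivative rotates the coordinates `a` of an anti-self-dual form
by `κ a × ω(u', u)`, where `ω` is the triple of basic anti-self-dual forms. This is the shape of the
curvature of `Λ²₋` for an Einstein metric with vanishing anti-self-dual Weyl tensor. Both spaces
have it because the metric is given by one and the same formula in all preferred charts:
stereographic projection from the antipode for the sphere, affine coordinates in a unitary frame for
the projective plane.

Over the centre of such a chart the Levi-Civita horizontal space is the factor `E4` of `E4 × E3`,
and all tensors in question are constant-coefficient expressions on `ℝ⁴ ⊕ ℝ³`. A rescaling (`iso`)
turns `h` into the Euclidean metric of `ℝ⁷` and `φ` into `stdPhi`. The pointwise assertions are then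
linear algebra. The comass bound is Cauchy–Schwarz for the seven-dimensional cross product; the
identity `|du|² = 4 / w²`, the wedge identity and conformality are read off an adapted frame; a
fibre is calibrated because `φ` and `v³ vol_V` agree on vertical triples.

For assertions about derivatives, tensors that are defined pointwise, each in its own chart, must be
written in one chart near a point. `bundle_transition` does this: the fibre component of a vector in
the chart centred at `q` represents its vertical component `τ`, because the second derivative of the
change to normal coordinates is the Christoffel symbol. The relation `Represents` then carries inner
products and determinants over to the fixed chart.

At the centre the metric, the volume form and everything built from them are stationary. Only two
quantities vary to first order: `F = c + 2κb²r²`, with derivative `4κb²⟨a, ·⟩`, and `τ`, with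
derivative `-Q`, where the skew part of `Q` is the curvature. In `φ` the coefficients are `v³ =
b³F^{-3/4}` and `w²v = bF^{1/4}`. The form `d(v³) ∧ vol_V` vanishes because the fibres have
dimension three, the curvature term of `d vol_V` cancels `d(w²v) ∧ dθ`, and the curvature terms of
`d(dθ)` cancel by skewness of the triple product. In `⋆φ` the coefficients are `w⁴ = F` and `w²v² =
b²`, and `dF ∧ vol_X` cancels the curvature terms.

For harmonicity, `|du|² du` is `4F^{-1/2}` times the projection to `E4`. Its covariant derivative is
traced over a frame of purely horizontal and purely vertical vectors, and each summand vanishes: `F`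
is horizontally constant, vertical vectors are killed by the projection, and the Christoffel symbol
`Γ(e, e)` has no horizontal component. -/

namespace BryantSalamon

/-! ### Forms of top degree, wedge products and traces -/

section Multilinear
variable {T : Type*} [AddCommGroup T] [Module ℝ T] [TopologicalSpace T]

/-- Forms of top degree are determined by their value on a basis. -/
theorem topForm_ext {n : ℕ} (b : Module.Basis (Fin n) ℝ T) {α β : T [⋀^Fin n]→L[ℝ] ℝ}
    (h : α b = β b) : α = β := by
  apply ContinuousAlternatingMap.toAlternatingMap_injective
  rw [α.toAlternatingMap.eq_smul_basis_det b, β.toAlternatingMap.eq_smul_basis_det b]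
  exact congrArg (· • b.det) h

/-- If `β` is killed by the first `k` vectors, only one shuffle contributes to the value of
`α ∧ β`. -/
theorem wedge_apply_of_right_zero {k l : ℕ} (α : T [⋀^Fin k]→L[ℝ] ℝ) (β : T [⋀^Fin l]→L[ℝ] ℝ)
    (v : Fin (k + l) → T)
    (h : ∀ (i : Fin k) (f : Fin l → T) (j : Fin l), f j = v (Fin.castAdd l i) → β f = 0) :
    wedge α β v = α (fun i => v (Fin.castAdd l i)) * β (fun j => v (Fin.natAdd k j)) := by
  change LinearMap.mul' ℝ ℝ
    (AlternatingMap.domCoprod α.toAlternatingMap β.toAlternatingMap (v ∘ finSumFinEquiv)) = _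
  simp only [AlternatingMap.domCoprod_apply, sum_apply, map_sum]
  have hs : ∀ σ : Equiv.Perm (Fin k ⊕ Fin l), LinearMap.mul' ℝ ℝ
        (AlternatingMap.domCoprod.summand α.toAlternatingMap β.toAlternatingMap
          (Quotient.mk'' σ) (v ∘ finSumFinEquiv)) = (Equiv.Perm.sign σ : ℤ) •
        (α (fun i => v (finSumFinEquiv (σ (Sum.inl i)))) *
          β (fun i => v (finSumFinEquiv (σ (Sum.inr i))))) := fun σ => by
    rw [AlternatingMap.domCoprod.summand_mk'', smul_apply, Units.smul_def, map_zsmul]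
    rfl
  refine (Finset.sum_eq_single (Quotient.mk'' (1 : Equiv.Perm (Fin k ⊕ Fin l)) :
    Equiv.Perm.ModSumCongr (Fin k) (Fin l)) ?_ ?_).trans ?_
  · intro q _ hq
    induction q using Quotient.inductionOn' with
    | h σ =>
      rw [hs]
      -- Either the permutation preserves both blocks, and then it lies in the trivial coset, or it
      -- feeds one of the first `k` vectors to `β`.
      by_cases hm : Set.MapsTo σ (Set.range Sum.inr) (Set.range Sum.inr)
      · exfalso
        apply hq
        have h1 := (Equiv.Perm.perm_mapsTo_inl_iff_mapsTo_inr σ).mpr hm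
        have h2 := Equiv.Perm.mem_sumCongrHom_range_of_perm_mapsTo_inl h1
        refine Quotient.sound' ?_
        rw [QuotientGroup.leftRel_apply, mul_one]
        exact inv_mem h2
      · rw [Set.MapsTo] at hm
        push Not at hm
        obtain ⟨_, ⟨j, rfl⟩, hj⟩ := hm
        have : ∃ i, σ (Sum.inr j) = Sum.inl i := by
          rcases hσ : σ (Sum.inr j) with i | i
          · exact ⟨i, rfl⟩
          · exact absurd ⟨i, hσ.symm⟩ hj
        obtain ⟨i, hi⟩ := this
        rw [h i _ j (by simp [hi]), mul_zero, smul_zero]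
  · intro h; exact absurd (Finset.mem_univ _) h
  · rw [hs]; simp

omit [TopologicalSpace T] in
/-- The trace of a bilinear map is the sum over an orthonormal basis. -/
theorem metricTrace_eq_sum {F ι : Type*} [AddCommGroup F] [Module ℝ F] [FiniteDimensional ℝ T]
    [Fintype ι] [DecidableEq ι] (h : T → T → ℝ) (B : T → T → F) (h' : T →ₗ[ℝ] T →ₗ[ℝ] ℝ)
    (B' : T →ₗ[ℝ] T →ₗ[ℝ] F) (hh : ∀ v w, h v w = h' v w) (hB : ∀ v w, B v w = B' v w)
    (e : Module.Basis ι ℝ T) (he : ∀ i j, h (e i) (e j) = if i = j then 1 else 0) :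
    metricTrace h B = ∑ i, B (e i) (e i) := by
  set b := Module.finBasis ℝ T with hb
  let C : Matrix (Fin (Module.finrank ℝ T)) ι ℝ := Matrix.of fun i k => e.repr (b i) k
  let D : Matrix ι (Fin (Module.finrank ℝ T)) ℝ := Matrix.of fun i k => b.repr (e i) k
  have hCD : C * D = 1 := by
    ext i j
    have : b.repr (b i) j = ∑ k, e.repr (b i) k * b.repr (e k) j := by
      conv_lhs => rw [← Module.Basis.coord_apply, ← e.sum_repr (b i), map_sum]
      simp only [map_smul, smul_eq_mul, Module.Basis.coord_apply]
    rw [Matrix.mul_apply, Matrix.one_apply]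
    simp only [C, D, Matrix.of_apply]
    rw [← this, b.repr_self, Finsupp.single_apply]
  have hDC : D * C = 1 := by
    ext i j
    have : e.repr (e i) j = ∑ k, b.repr (e i) k * e.repr (b k) j := by
      conv_lhs => rw [← Module.Basis.coord_apply, ← b.sum_repr (e i), map_sum]
      simp only [map_smul, smul_eq_mul, Module.Basis.coord_apply]
    rw [Matrix.mul_apply, Matrix.one_apply]
    simp only [C, D, Matrix.of_apply]
    rw [← this, e.repr_self, Finsupp.single_apply]
  have hG : (Matrix.of fun i j => h (b i) (b j)) = C * C.transpose := by
    ext i j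
    rw [Matrix.of_apply, hh, Matrix.mul_apply]
    conv_lhs => rw [← e.sum_repr (b i), ← e.sum_repr (b j)]
    simp only [map_sum, map_smul, LinearMap.sum_apply, LinearMap.smul_apply, ← hh, he, C]
    simp [mul_comm]
  -- The Gram matrix is `C Cᵀ` and `D` inverts `C`, so the inverse Gram matrix is `Dᵀ D`; its
  -- entries are exactly the coefficients that expand the `B(eₖ, eₖ)` in the basis `b`.
  have hinv : (Matrix.of fun i j => h (b i) (b j))⁻¹ = D.transpose * D := by
    refine Matrix.inv_eq_left_inv ?_
    rw [hG]
    calc D.transpose * D * (C * C.transpose) = D.transpose * (D * C) * C.transpose := by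
          simp only [Matrix.mul_assoc]
      _ = (C * D).transpose := by rw [hDC, Matrix.mul_one, Matrix.transpose_mul]
      _ = 1 := by rw [hCD, Matrix.transpose_one]
  have hBb : ∀ k, B (e k) (e k) = ∑ i, ∑ j, (D k i * D k j) • B (b i) (b j) := fun k => by
    rw [hB]
    conv_lhs => rw [← b.sum_repr (e k)]
    simp only [map_sum, map_smul, LinearMap.sum_apply, LinearMap.smul_apply, Finset.smul_sum, hB]
    rw [Finset.sum_comm]
    refine Finset.sum_congr rfl fun i _ => Finset.sum_congr rfl fun j _ => ?_
    rw [smul_smul, mul_comm]; rfl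
  simp only [metricTrace]
  rw [← hb, hinv]
  simp only [hBb]
  rw [Finset.sum_comm]
  simp only [Matrix.mul_apply, Finset.sum_smul, Matrix.transpose_apply]
  rw [Finset.sum_comm]
  calc _ = ∑ i, ∑ k, ∑ j, (D k i * D k j) • B (b i) (b j) :=
        Finset.sum_congr rfl fun i _ => Finset.sum_comm
    _ = _ := Finset.sum_comm

end Multilinear

/-! ### Testing smoothness on fixed vectors -/

section FormSmooth
variable {E F : Type*} [NormedAddCommGroup E] [NormedSpace ℝ E] [FiniteDimensional ℝ E]
  [NormedAddCommGroup F] [NormedSpace ℝ F]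

/-- The values of a form on all tuples of basis vectors. -/
def formValues (E : Type*) [NormedAddCommGroup E] [NormedSpace ℝ E] [FiniteDimensional ℝ E]
    (k : ℕ) :
    (E [⋀^Fin k]→L[ℝ] ℝ) →ₗ[ℝ] ((Fin k → Fin (Module.finrank ℝ E)) → ℝ) where
  toFun α f := α fun i => Module.finBasis ℝ E (f i)
  map_add' _ _ := rfl
  map_smul' _ _ := rfl

theorem formValues_injective (k : ℕ) : Function.Injective (formValues E k) := by
  intro α β h
  apply ContinuousAlternatingMap.toAlternatingMap_injective
  exact Module.Basis.ext_alternating (Module.finBasis ℝ E) fun v _ => congrFun h v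

instance finiteDimensional_form (k : ℕ) : FiniteDimensional ℝ (E [⋀^Fin k]→L[ℝ] ℝ) :=
  FiniteDimensional.of_injective _ (formValues_injective (E := E) k)

omit [FiniteDimensional ℝ E] in
-- An injective linear map into a finite power of `ℝ` has a linear left inverse, which is continuous
-- because it starts from a finite-dimensional space.
theorem contDiffAt_of_coordinates {ι : Type*} [Fintype ι] {n : WithTop ℕ∞} (ev : E →ₗ[ℝ] ι → ℝ)
    (hev : Function.Injective ev) {α : F → E} {z : F}
    (h : ∀ i, ContDiffAt ℝ n (fun y => ev (α y) i) z) : ContDiffAt ℝ n α z := by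
  obtain ⟨L, hL⟩ := LinearMap.exists_leftInverse_of_injective ev (LinearMap.ker_eq_bot.mpr hev)
  have h2 := (LinearMap.toContinuousLinearMap L).contDiff.contDiffAt.comp z (contDiffAt_pi.mpr h)
  refine h2.congr_of_eventuallyEq (Filter.Eventually.of_forall fun y => ?_)
  exact (LinearMap.congr_fun hL (α y)).symm

theorem form_contDiffAt {k : ℕ} {n : WithTop ℕ∞} {α : F → E [⋀^Fin k]→L[ℝ] ℝ} {z : F}
    (h : ∀ v : Fin k → E, ContDiffAt ℝ n (fun y => α y v) z) : ContDiffAt ℝ n α z :=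
  contDiffAt_of_coordinates (formValues E k) (formValues_injective k) fun _ => h _

/-- A basis of the source identifies the space of maps with a finite power of `G`; no finiteness of
`G` is involved. -/
theorem clm_contDiffAt {G : Type*} [NormedAddCommGroup G] [NormedSpace ℝ G] {n : WithTop ℕ∞}
    {α : F → E →L[ℝ] G} {z : F} (h : ∀ v : E, ContDiffAt ℝ n (fun y => α y v) z) :
    ContDiffAt ℝ n α z := by
  let d := Module.finrank ℝ E
  have hd : d = Module.finrank ℝ (Fin d → ℝ) := (Module.finrank_fin_fun ℝ).symm
  let e₁ := ContinuousLinearEquiv.ofFinrankEq hd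
  let e₂ := (e₁.arrowCongr (1 : G ≃L[ℝ] G)).trans (ContinuousLinearEquiv.piRing (Fin d))
  rw [← Function.id_comp α, ← e₂.symm_comp_self]
  exact e₂.symm.contDiff.contDiffAt.comp z (contDiffAt_pi.mpr fun i => h _)

theorem bilin_contDiffAt {n : WithTop ℕ∞} {α : F → E →L[ℝ] E →L[ℝ] ℝ} {z : F}
    (h : ∀ v w : E, ContDiffAt ℝ n (fun y => α y v w) z) : ContDiffAt ℝ n α z :=
  clm_contDiffAt fun v => clm_contDiffAt fun w => h v w

omit [FiniteDimensional ℝ E] in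
theorem form_apply_contDiffAt {k : ℕ} {n : WithTop ℕ∞} {α : F → E [⋀^Fin k]→L[ℝ] ℝ} {z : F}
    (hα : ContDiffAt ℝ n α z) (v : Fin k → E) : ContDiffAt ℝ n (fun y => α y v) z :=
  (ContinuousAlternatingMap.apply ℝ E ℝ v).contDiff.contDiffAt.comp z hα

end FormSmooth

/-! ### The model three-form and four-form on `ℝ⁷` -/

section Seven

/-- The values of the forms `dx^{ijk}`. -/
def minor3 (v : Fin 3 → Fin 7 → ℝ) (i j k : Fin 7) : ℝ :=
  (Matrix.of fun r s : Fin 3 => v s (![i, j, k] r)).det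

/-- The values of the forms `dx^{ijkl}`. -/
def minor4 (v : Fin 4 → Fin 7 → ℝ) (i j k l : Fin 7) : ℝ :=
  (Matrix.of fun r s : Fin 4 => v s (![i, j, k, l] r)).det

/-- The standard three-form of `ℝ⁷`. -/
def stdPhi (v : Fin 3 → Fin 7 → ℝ) : ℝ :=
  minor3 v 0 1 2 + (minor3 v 0 3 4 - minor3 v 0 5 6) + (minor3 v 1 3 5 - minor3 v 1 6 4) +
    (minor3 v 2 3 6 - minor3 v 2 4 5)

/-- The Hodge dual of the standard three-form of `ℝ⁷`. -/
def stdPsi (v : Fin 4 → Fin 7 → ℝ) : ℝ :=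
  minor4 v 3 4 5 6 + (minor4 v 1 2 5 6 - minor4 v 1 2 3 4) + (minor4 v 0 2 4 6 + minor4 v 0 2 3 5) +
    (minor4 v 0 1 4 5 - minor4 v 0 1 3 6)

theorem stdPhi_single (a : Fin 3 → Fin 7) :
    stdPhi (fun s => Pi.single (a s) 1) = g2Coeff a := by
  simp only [stdPhi, g2Coeff, minor3, Pi.single_apply, eq_comm]

theorem minor3_eq (x y z : Fin 7 → ℝ) (i j k : Fin 7) : minor3 ![x, y, z] i j k =
    x i * y j * z k - x i * z j * y k - y i * x j * z k + y i * z j * x k + z i * x j * y k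
      - z i * y j * x k := by
  simp [minor3, Matrix.det_fin_three]

/-- The standard three-form has comass at most one. -/
theorem stdPhi_le_one (v : Fin 3 → Fin 7 → ℝ)
    (hv : ∀ i j, ∑ k, v i k * v j k = if i = j then 1 else 0) : stdPhi v ≤ 1 := by
  obtain ⟨x, y, z, rfl⟩ : ∃ x y z, v = ![x, y, z] :=
    ⟨v 0, v 1, v 2, by ext i : 1; fin_cases i <;> rfl⟩
  have hxx := hv 0 0
  have hyy := hv 1 1
  have hzz := hv 2 2
  have hxy := hv 0 1
  simp [Fin.sum_univ_succ] at hxx hyy hzz hxy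
  -- The vector `c` is the seven-dimensional cross product `x × y`: the three-form is `⟨x × y, z⟩`,
  -- and `|x × y|²` is the Gram determinant of `x` and `y`. Cauchy–Schwarz then gives the bound.
  obtain ⟨c, hc, hcc⟩ : ∃ c : Fin 7 → ℝ, stdPhi ![x, y, z] = ∑ k, c k * z k ∧
      ∑ k, c k * c k = (∑ k, x k * x k) * (∑ k, y k * y k) - (∑ k, x k * y k) ^ 2 := by
    refine ⟨![x 1 * y 2 - x 2 * y 1 + x 3 * y 4 - x 4 * y 3 - (x 5 * y 6 - x 6 * y 5),
      x 2 * y 0 - x 0 * y 2 + x 3 * y 5 - x 5 * y 3 - (x 6 * y 4 - x 4 * y 6),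
      x 0 * y 1 - x 1 * y 0 + x 3 * y 6 - x 6 * y 3 - (x 4 * y 5 - x 5 * y 4),
      x 4 * y 0 - x 0 * y 4 + x 5 * y 1 - x 1 * y 5 + x 6 * y 2 - x 2 * y 6,
      x 0 * y 3 - x 3 * y 0 - (x 1 * y 6 - x 6 * y 1) - (x 5 * y 2 - x 2 * y 5),
      x 1 * y 3 - x 3 * y 1 - (x 6 * y 0 - x 0 * y 6) - (x 2 * y 4 - x 4 * y 2),
      x 2 * y 3 - x 3 * y 2 - (x 0 * y 5 - x 5 * y 0) - (x 4 * y 1 - x 1 * y 4)], ?_, ?_⟩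
    · simp only [stdPhi, minor3_eq]
      simp [Fin.sum_univ_succ]
      ring
    · simp [Fin.sum_univ_succ]
      ring
  have hcs := Finset.sum_mul_sq_le_sq_mul_sq Finset.univ c z
  rw [hc]
  have h1 : ∑ k, c k ^ 2 = 1 := by
    have : ∑ k, c k ^ 2 = ∑ k, c k * c k := Finset.sum_congr rfl fun _ _ => by ring
    rw [this, hcc]
    simp [Fin.sum_univ_succ, hxx, hyy, hxy]
  have h2 : ∑ k, z k ^ 2 = 1 := by
    have : ∑ k, z k ^ 2 = ∑ k, z k * z k := Finset.sum_congr rfl fun _ _ => by ring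
    rw [this]
    simp [Fin.sum_univ_succ, hzz]
  rw [h1, h2] at hcs
  nlinarith

/-- Complementary minors of a matrix in `SO(7)` agree. -/
theorem complementary_minor (e : Fin 7 → Fin 7 → ℝ)
    (he : ∀ i j, ∑ k, e i k * e j k = if i = j then 1 else 0)
    (hdet : (Matrix.of e).det = 1) (σ : Equiv.Perm (Fin 7)) (hσ : Equiv.Perm.sign σ = 1) :
    (Matrix.of fun r s : Fin 3 => e (Fin.castAdd 4 s) (σ (Fin.castAdd 4 r))).det =
      (Matrix.of fun r s : Fin 4 => e (Fin.natAdd 3 s) (σ (Fin.natAdd 3 r))).det := by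
  let A : Matrix (Fin 3 ⊕ Fin 4) (Fin 3 ⊕ Fin 4) ℝ :=
    Matrix.of fun i j => e (finSumFinEquiv i) (σ (finSumFinEquiv j))
  have hAA : A * A.transpose = 1 := by
    ext i j
    rw [Matrix.mul_apply, Matrix.one_apply]
    simp only [A, Matrix.transpose_apply, Matrix.of_apply]
    rw [Equiv.sum_comp (finSumFinEquiv (m := 3) (n := 4)) (fun k => e _ (σ k) * e _ (σ k)),
      Equiv.sum_comp σ (fun k => e (finSumFinEquiv i) k * e (finSumFinEquiv j) k), he]
    simp
  have hA : A.det = 1 := by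
    have h1 : A = (Matrix.of fun i j => e i (σ j)).submatrix (finSumFinEquiv (m := 3) (n := 4))
      (finSumFinEquiv (m := 3) (n := 4)) := rfl
    rw [h1, Matrix.det_submatrix_equiv_self]
    have h2 := Matrix.det_permute' σ (Matrix.of e)
    rw [hdet, hσ] at h2
    simpa [Matrix.submatrix] using h2
  -- `X` is chosen so that its second block column is the transpose of the lower block row of `A`.
  -- Orthogonality of the rows makes `A X` block triangular, and comparing determinants equates the
  -- two complementary minors.
  let X : Matrix (Fin 3 ⊕ Fin 4) (Fin 3 ⊕ Fin 4) ℝ :=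
    Matrix.fromBlocks 1 (A.toBlocks₂₁).transpose 0 (A.toBlocks₂₂).transpose
  have hX : A * X = Matrix.fromBlocks A.toBlocks₁₁ 0 A.toBlocks₂₁ 1 := by
    have hb := hAA
    rw [← Matrix.fromBlocks_toBlocks A, Matrix.fromBlocks_transpose, Matrix.fromBlocks_multiply,
      ← Matrix.fromBlocks_one, Matrix.fromBlocks_inj] at hb
    conv_lhs => rw [← Matrix.fromBlocks_toBlocks A]
    rw [Matrix.fromBlocks_multiply, hb.2.1, hb.2.2.2]
    simp
  have hd := congrArg Matrix.det hX
  rw [Matrix.det_mul, hA, one_mul, Matrix.det_fromBlocks_zero₁₂, Matrix.det_fromBlocks_zero₂₁,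
    Matrix.det_one, Matrix.det_one, one_mul, mul_one, Matrix.det_transpose] at hd
  rw [← Matrix.det_transpose, ← Matrix.det_transpose (M := Matrix.of fun r s : Fin 4 => _)]
  exact hd.symm

/-- The list `a` names three indices followed by the complementary four. It must form an even
permutation, which is what removes the sign. -/
theorem minor4_eq_minor3 (e : Fin 7 → Fin 7 → ℝ)
    (he : ∀ i j, ∑ k, e i k * e j k = if i = j then 1 else 0)
    (hdet : (Matrix.of e).det = 1) (a : Fin 7 → Fin 7) (ha : Function.Injective a)
    (hσ : Equiv.Perm.sign (Equiv.ofBijective a (Finite.injective_iff_bijective.mp ha)) = 1) :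
    minor4 ![e 3, e 4, e 5, e 6] (a 3) (a 4) (a 5) (a 6) =
      minor3 ![e 0, e 1, e 2] (a 0) (a 1) (a 2) := by
  have h := complementary_minor e he hdet _ hσ
  rw [minor3, minor4]
  refine Eq.trans ?_ (h.symm.trans ?_) <;> congr 1 <;> ext r s <;> fin_cases r <;> fin_cases s <;>
    rfl

theorem minor4_swap (v : Fin 4 → Fin 7 → ℝ) (i j k l : Fin 7) :
    minor4 v i j k l = -minor4 v i j l k := by
  have h := Matrix.det_permute (Equiv.swap (2 : Fin 4) 3)
    (Matrix.of fun r s : Fin 4 => v s (![i, j, l, k] r))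
  rw [Equiv.Perm.sign_swap (by decide)] at h
  simp only [Units.val_neg, Units.val_one, Int.cast_neg, Int.cast_one, neg_one_mul] at h
  rw [minor4, minor4, ← h]
  congr 1
  ext r s
  fin_cases r <;> rfl

/-- The four-form `stdPsi` is the Hodge dual of `stdPhi`. -/
theorem stdPsi_eq_stdPhi (e : Fin 7 → Fin 7 → ℝ)
    (he : ∀ i j, ∑ k, e i k * e j k = if i = j then 1 else 0) (hdet : (Matrix.of e).det = 1) :
    stdPsi ![e 3, e 4, e 5, e 6] = stdPhi ![e 0, e 1, e 2] := by
  have h := minor4_eq_minor3 e he hdet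
  have h1 := h ![0, 1, 2, 3, 4, 5, 6] (by decide) (by decide)
  have h2 := h ![0, 3, 4, 1, 2, 5, 6] (by decide) (by decide)
  have h3 := h ![0, 5, 6, 1, 2, 3, 4] (by decide) (by decide)
  have h4 := h ![1, 3, 5, 0, 2, 4, 6] (by decide) (by decide)
  have h5 := h ![1, 6, 4, 0, 2, 5, 3] (by decide) (by decide)
  have h6 := h ![2, 3, 6, 0, 1, 4, 5] (by decide) (by decide)
  have h7 := h ![2, 4, 5, 0, 1, 3, 6] (by decide) (by decide)
  simp only [stdPsi, stdPhi]
  -- The index order 1, 6, 4 is completed to an even permutation by 0, 2, 5, 3, whereas `stdPsi`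
  -- uses the increasing order. This accounts for the plus sign of that term in `stdPsi`.
  have h5' := minor4_swap ![e 3, e 4, e 5, e 6] 0 2 3 5
  have e1 : minor4 ![e 3, e 4, e 5, e 6] 3 4 5 6 = minor3 ![e 0, e 1, e 2] 0 1 2 := h1
  have e2 : minor4 ![e 3, e 4, e 5, e 6] 1 2 5 6 = minor3 ![e 0, e 1, e 2] 0 3 4 := h2
  have e3 : minor4 ![e 3, e 4, e 5, e 6] 1 2 3 4 = minor3 ![e 0, e 1, e 2] 0 5 6 := h3
  have e4 : minor4 ![e 3, e 4, e 5, e 6] 0 2 4 6 = minor3 ![e 0, e 1, e 2] 1 3 5 := h4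
  have e5 : minor4 ![e 3, e 4, e 5, e 6] 0 2 5 3 = minor3 ![e 0, e 1, e 2] 1 6 4 := h5
  have e6 : minor4 ![e 3, e 4, e 5, e 6] 0 1 4 5 = minor3 ![e 0, e 1, e 2] 2 3 6 := h6
  have e7 : minor4 ![e 3, e 4, e 5, e 6] 0 1 3 6 = minor3 ![e 0, e 1, e 2] 2 4 5 := h7
  rw [h5', e1, e2, e3, e4, e5, e6, e7]
  ring

end Seven

/-! ### Coordinate frames and changes of chart -/

section Frames
variable {E H : Type*} [NormedAddCommGroup E] [NormedSpace ℝ E] [TopologicalSpace H]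
  {I : ModelWithCorners ℝ E H} {M : Type*} [TopologicalSpace M] [ChartedSpace H M]
  [IsManifold I 1 M]

/-- The tangent coordinate change from a chart to itself is the identity. Hence vectors at the
centre of a preferred chart may be treated as elements of the model space. -/
theorem coordFrame_self (x : M) (v : E) : coordFrame I x x v = v := by
  rw [coordFrame, TangentBundle.symmL_trivializationAt_eq_core (mem_chart_source H x)]
  exact (tangentBundleCore I M).coordChange_self _ _ (mem_achart_source H x) v

theorem coordFrameInv_self (x : M) (v : E) : coordFrameInv I x x v = v := by
  rw [coordFrameInv, TangentBundle.continuousLinearMapAt_trivializationAt_eq_core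
    (mem_chart_source H x)]
  exact (tangentBundleCore I M).coordChange_self _ _ (mem_achart_source H x) v

theorem coordFrame_eq_fderiv (hI : Set.range I = Set.univ) {x₀ x : M}
    (hx : x ∈ (chartAt H x₀).source) :
    coordFrame I x₀ x =
      fderiv ℝ (extChartAt I x ∘ (extChartAt I x₀).symm) (extChartAt I x₀ x) := by
  have h : coordFrame I x₀ x = fderivWithin ℝ (extChartAt I x ∘ (extChartAt I x₀).symm)
      (Set.range I) (extChartAt I x₀ x) := TangentBundle.symmL_trivializationAt_eq_core hx
  rw [h, hI, fderivWithin_univ]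

theorem coordFrameInv_comp_coordFrame_eq_fderiv (hI : Set.range I = Set.univ) {x₀ x₁ x : M}
    (hx : x ∈ (chartAt H x₀).source) (hx₁ : x ∈ (chartAt H x₁).source) :
    coordFrameInv I x₁ x ∘L coordFrame I x₀ x =
      fderiv ℝ (extChartAt I x₁ ∘ (extChartAt I x₀).symm) (extChartAt I x₀ x) := by
  have h1 : coordFrameInv I x₁ x = (tangentBundleCore I M).coordChange (achart H x) (achart H x₁) x :=
    TangentBundle.continuousLinearMapAt_trivializationAt_eq_core hx₁
  have h2 : coordFrame I x₀ x = (tangentBundleCore I M).coordChange (achart H x₀) (achart H x) x :=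
    TangentBundle.symmL_trivializationAt_eq_core hx
  have h3 : (tangentBundleCore I M).coordChange (achart H x₀) (achart H x₁) x =
      fderivWithin ℝ (extChartAt I x₁ ∘ (extChartAt I x₀).symm) (Set.range I)
        (extChartAt I x₀ x) := rfl
  rw [hI, fderivWithin_univ] at h3
  rw [← h3, h1, h2]
  ext v
  exact (tangentBundleCore I M).coordChange_comp (achart H x₀) (achart H x) (achart H x₁) x
    ⟨⟨hx, mem_chart_source H x⟩, hx₁⟩ v

end Frames

/-! ### Charts of the total space -/

section Bundle
variable {X : Type*} [TopologicalSpace X] [ChartedSpace E4 X] [IsManifold (𝓡 4) ∞ X]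
  {R : OrientedMetric (𝓡 4) X 4}

theorem bundle_extChartAt (p₀ p : ASDBundle R) :
    extChartAt I7 p₀ p = (extChartAt (𝓡 4) p₀.1 p.1, asdCoords p₀.1 p.2) := by
  rw [FiberBundle.extChartAt]
  rfl

theorem bundle_extChartAt_target (p₀ : ASDBundle R) :
    (extChartAt I7 p₀).target = (extChartAt (𝓡 4) p₀.1).target ×ˢ Set.univ := by
  rw [FiberBundle.extChartAt_target]
  congr 1
  refine Set.inter_eq_left.mpr fun y hy => ?_
  have := (extChartAt (𝓡 4) p₀.1).map_target hy
  rwa [extChartAt_source] at this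

omit [IsManifold (𝓡 4) ∞ X] in
theorem base_mem_source {x₀ : X} {y : E4} (hy : y ∈ (extChartAt (𝓡 4) x₀).target) :
    (extChartAt (𝓡 4) x₀).symm y ∈ (chartAt E4 x₀).source := by
  have := (extChartAt (𝓡 4) x₀).map_target hy
  rwa [extChartAt_source] at this

theorem bundle_extChartAt_source (p₀ p : ASDBundle R) :
    p ∈ (chartAt (ModelProd E4 E3) p₀).source ↔ p.1 ∈ (chartAt E4 p₀.1).source := by
  rw [FiberBundle.chartedSpace_chartAt]
  simp only [mfld_simps]
  constructor
  · exact fun h => h.2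
  · exact fun h => ⟨h, h⟩

theorem bundle_extChartAt_symm (p₀ : ASDBundle R) {y : E4}
    (hy : y ∈ (extChartAt (𝓡 4) p₀.1).target) (a : E3) :
    (extChartAt I7 p₀).symm (y, a) =
      ⟨(extChartAt (𝓡 4) p₀.1).symm y, asdOfCoords R p₀.1 ((extChartAt (𝓡 4) p₀.1).symm y) a⟩ := by
  have hs := base_mem_source hy
  have h1 : (y, a) = extChartAt I7 p₀ (⟨(extChartAt (𝓡 4) p₀.1).symm y,
      asdOfCoords R p₀.1 ((extChartAt (𝓡 4) p₀.1).symm y) a⟩ : ASDBundle R) := by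
    rw [bundle_extChartAt, (extChartAt (𝓡 4) p₀.1).right_inv hy, asdCoords_ofCoords hs]
  rw [h1]
  refine (extChartAt I7 p₀).left_inv ?_
  rw [extChartAt_source, bundle_extChartAt_source]
  exact hs

theorem range_I7 : Set.range I7 = Set.univ := ModelWithCorners.range_eq_univ I7
theorem range_I4 : Set.range (𝓡 4) = Set.univ := ModelWithCorners.range_eq_univ _

end Bundle

/-! ### Anti-self-dual forms and volume forms on `ℝ⁴` -/

section FlatModel

/-- The form `∑ aⱼ (e⁰ ∧ eʲ - σ eᵏ ∧ eˡ)` on `ℝ⁴`. -/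
def flatASD (σ : ℝ) (a : E3) (v w : E4) : ℝ :=
  a 0 * ((v 0 * w 1 - v 1 * w 0) - σ * (v 2 * w 3 - v 3 * w 2)) +
  a 1 * ((v 0 * w 2 - v 2 * w 0) - σ * (v 3 * w 1 - v 1 * w 3)) +
  a 2 * ((v 0 * w 3 - v 3 * w 0) - σ * (v 1 * w 2 - v 2 * w 1))

theorem stdVol_three (x y z : E3) : stdVol 3 ![x, y, z] =
    x 0 * (y 1 * z 2 - y 2 * z 1) - x 1 * (y 0 * z 2 - y 2 * z 0) +
      x 2 * (y 0 * z 1 - y 1 * z 0) := by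
  rw [stdVol_apply, Matrix.det_fin_three]
  simp
  ring

theorem stdVol_four (x y z w : E4) : stdVol 4 ![x, y, z, w] =
    x 0 * (y 1 * (z 2 * w 3 - z 3 * w 2) - y 2 * (z 1 * w 3 - z 3 * w 1) +
      y 3 * (z 1 * w 2 - z 2 * w 1)) -
    x 1 * (y 0 * (z 2 * w 3 - z 3 * w 2) - y 2 * (z 0 * w 3 - z 3 * w 0) +
      y 3 * (z 0 * w 2 - z 2 * w 0)) +
    x 2 * (y 0 * (z 1 * w 3 - z 3 * w 1) - y 1 * (z 0 * w 3 - z 3 * w 0) +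
      y 3 * (z 0 * w 1 - z 1 * w 0)) -
    x 3 * (y 0 * (z 1 * w 2 - z 2 * w 1) - y 1 * (z 0 * w 2 - z 2 * w 0) +
      y 2 * (z 0 * w 1 - z 1 * w 0)) := by
  rw [stdVol_apply, Matrix.det_succ_row_zero]
  simp [Fin.sum_univ_succ, Matrix.det_fin_three, Fin.succAbove]
  ring

theorem e4_inner (v w : E4) : inner ℝ v w = v 0 * w 0 + v 1 * w 1 + v 2 * w 2 + v 3 * w 3 := by
  simp [PiLp.inner_apply, Fin.sum_univ_succ]
  ring

theorem e3_inner (v w : E3) : inner ℝ v w = v 0 * w 0 + v 1 * w 1 + v 2 * w 2 := by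
  simp [PiLp.inner_apply, Fin.sum_univ_succ]
  ring

/-- In orthonormal coordinates the dual of the covector `(0, a)` is the vector `(0, a)`, so the form
is `e⁰ ∧ a` minus its Hodge dual; the sign of the orientation enters through the latter. -/
theorem localASD_flat {g : E4 →L[ℝ] E4 →L[ℝ] ℝ} {vol : E4 [⋀^Fin 4]→L[ℝ] ℝ}
    (hgv : IsOrientedInner g vol) (hg : ∀ v w, g v w = inner ℝ v w) (a : E3) (v w : E4) :
    localASD g vol a ![v, w] = flatASD (vol stdVec) a v w := by
  have hs : sharp g a = !₂[0, a 0, a 1, a 2] := by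
    refine ext_inner_right ℝ fun w => ?_
    rw [← hg, sharp_spec hgv, e4_inner]
    simp [coordCovector, Fin.sum_univ_three]
  have hvol : vol ![stdVec 0, sharp g a, v, w] =
      vol stdVec * stdVol 4 ![stdVec 0, sharp g a, v, w] := by
    conv_lhs => rw [form4_eq vol]
    rfl
  rw [localASD, ContinuousAlternatingMap.smul_apply, asdOf_apply, hg, hg, hvol, stdVol_four, hg,
    sharp_spec hgv, hg, hs]
  simp [coordCovector, Fin.sum_univ_three, e4_inner, flatASD]
  ring

/-- The square of a volume form is the Gram determinant. -/
theorem vol_sq_eq_det {g : E4 →L[ℝ] E4 →L[ℝ] ℝ} {vol : E4 [⋀^Fin 4]→L[ℝ] ℝ}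
    (hg : IsOrientedInner g vol) :
    vol stdVec ^ 2 = (Matrix.of fun i j => g (stdVec i) (stdVec j)).det := by
  obtain ⟨e, he, hv, -⟩ := exists_frame hg (stdVec_ne_zero 0)
  have hli : LinearIndependent ℝ e := by
    rw [Fintype.linearIndependent_iff]
    intro c hc i
    have h := congrArg (fun z => g (e i) z) hc
    simpa [map_sum, he i] using h
  let b := Module.Basis.mk hli (hli.span_eq_top_of_card_eq_finrank (by simp)).ge
  have hb : (b : Fin 4 → E4) = e := by simp [b]
  let C : Matrix (Fin 4) (Fin 4) ℝ := Matrix.of fun i j => g (e i) (stdVec j)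
  have h1 : vol stdVec = C.det := by
    have h := vol.toAlternatingMap.eq_smul_basis_det b
    have h2 : vol stdVec = vol b * b.det stdVec := congrArg (fun A => A stdVec) h
    rw [h2, hb, hv, one_mul, Module.Basis.det_apply]
    congr 1
    ext i j
    rw [Module.Basis.toMatrix_apply]
    conv_rhs => rw [show C i j = g (e i) (stdVec j) from rfl, ← b.sum_repr (stdVec j)]
    simp [map_sum, hb, he i]
  have h2 : (Matrix.of fun i j => g (stdVec i) (stdVec j)) = C.transpose * C := by
    ext i j
    rw [Matrix.mul_apply, Matrix.of_apply]
    conv_lhs => rw [frame_expand he (stdVec i)]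
    simp [C]
  rw [h2, Matrix.det_mul, Matrix.det_transpose, h1, sq]

theorem vol_stdVec_ne_zero {g : E4 →L[ℝ] E4 →L[ℝ] ℝ} {vol : E4 [⋀^Fin 4]→L[ℝ] ℝ}
    (hg : IsOrientedInner g vol) : vol stdVec ≠ 0 := by
  obtain ⟨e, he, hv, -⟩ := exists_frame hg (stdVec_ne_zero 0)
  intro h
  rw [form4_eq vol, h, zero_smul] at hv
  simp at hv

end FlatModel

/-! ### Smooth dependence of anti-self-dual forms on metric and volume -/

section Smoothness
variable {F : Type*} [NormedAddCommGroup F] [NormedSpace ℝ F] {n : WithTop ℕ∞}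

theorem form4_apply_contDiffAt {vol : F → E4 [⋀^Fin 4]→L[ℝ] ℝ} {m : Fin 4 → F → E4} {z : F}
    (hvol : ContDiffAt ℝ n vol z) (hm : ∀ i, ContDiffAt ℝ n (m i) z) :
    ContDiffAt ℝ n (fun y => vol y (fun i => m i y)) z := by
  have h1 : ContDiffAt ℝ n (fun y => vol y stdVec) z := form_apply_contDiffAt hvol _
  have h2 : ContDiffAt ℝ n (fun y => stdVol 4 (fun i => m i y)) z :=
    (ContinuousMultilinearMap.contDiff
      (stdVol 4).toContinuousMultilinearMap).contDiffAt.comp z (contDiffAt_pi.mpr hm)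
  refine (h1.mul h2).congr_of_eventuallyEq (Filter.Eventually.of_forall fun y => ?_)
  dsimp only
  conv_lhs => rw [form4_eq (vol y)]
  rfl

variable {g : F → E4 →L[ℝ] E4 →L[ℝ] ℝ} {vol : F → E4 [⋀^Fin 4]→L[ℝ] ℝ} {a : F → E3}
  {v w : F → E4} {z : F}

theorem inverse_contDiffAt (hg : ContDiffAt ℝ n g z) (hinv : (g z).IsInvertible) :
    ContDiffAt ℝ n (fun y => (g y).inverse) z :=
  ContDiffAt.comp z (g := ContinuousLinearMap.inverse) hinv.contDiffAt_map_inverse hg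

theorem coordCovector_contDiff : ContDiff ℝ n coordCovector := by
  unfold coordCovector
  exact ContDiff.sum fun i _ =>
    (EuclideanSpace.proj i : E3 →L[ℝ] ℝ).contDiff.smul contDiff_const

theorem localASD_apply_contDiffAt (hg : ContDiffAt ℝ n g z) (hvol : ContDiffAt ℝ n vol z)
    (ha : ContDiffAt ℝ n a z) (hv : ContDiffAt ℝ n v z) (hw : ContDiffAt ℝ n w z)
    (hinv : (g z).IsInvertible) (h0 : g z (stdVec 0) (stdVec 0) ≠ 0) :
    ContDiffAt ℝ n (fun y => localASD (g y) (vol y) (a y) ![v y, w y]) z := by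
  have hs : ContDiffAt ℝ n (fun y => sharp (g y) (a y)) z :=
    (inverse_contDiffAt hg hinv).clm_apply (coordCovector_contDiff.contDiffAt.comp z ha)
  have hgg : ∀ {p q : F → E4}, ContDiffAt ℝ n p z → ContDiffAt ℝ n q z →
      ContDiffAt ℝ n (fun y => g y (p y) (q y)) z := fun hp hq => (hg.clm_apply hp).clm_apply hq
  have hc : ContDiffAt ℝ n (fun _ : F => stdVec 0) z := contDiffAt_const
  have h4 : ContDiffAt ℝ n (fun y => vol y ![stdVec 0, sharp (g y) (a y), v y, w y]) z := by
    have := form4_apply_contDiffAt hvol (m := ![fun _ => stdVec 0, fun y => sharp (g y) (a y), v, w])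
      (fun i => by
        fin_cases i
        · exact hc
        · exact hs
        · exact hv
        · exact hw)
    refine this.congr_of_eventuallyEq (Filter.Eventually.of_forall fun y => ?_)
    dsimp only
    congr 1
    ext i : 1
    fin_cases i <;> rfl
  refine (((hgg hc hc).inv h0).mul ((((hgg hc hv).mul (hgg hs hw)).sub
    ((hgg hc hw).mul (hgg hs hv))).sub h4)).congr_of_eventuallyEq
    (Filter.Eventually.of_forall fun y => ?_)
  simp only [localASD, ContinuousAlternatingMap.smul_apply, asdOf_apply, smul_eq_mul]
  rfl

theorem localASD_contDiffAt (hg : ContDiffAt ℝ n g z) (hvol : ContDiffAt ℝ n vol z)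
    (ha : ContDiffAt ℝ n a z) (hinv : (g z).IsInvertible)
    (h0 : g z (stdVec 0) (stdVec 0) ≠ 0) :
    ContDiffAt ℝ n (fun y => localASD (g y) (vol y) (a y)) z := by
  refine form_contDiffAt fun m => ?_
  rw [vec2_eta m]
  exact localASD_apply_contDiffAt hg hvol ha contDiffAt_const contDiffAt_const hinv h0

end Smoothness

/-! ### Normal charts and the tensors of the base in a chart -/

/-- A two-form as a continuous bilinear form, depending continuously on the form. -/
def toBil : (E4 [⋀^Fin 2]→L[ℝ] ℝ) →L[ℝ] (E4 →L[ℝ] E4 →L[ℝ] ℝ) :=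
  LinearMap.toContinuousLinearMap
    { toFun := fun η => LinearMap.toContinuousLinearMap
        (LinearMap.toContinuousLinearMap.toLinearMap ∘ₗ twoBilin η)
      map_add' := fun _ _ => rfl
      map_smul' := fun _ _ => rfl }

theorem toBil_apply (η : E4 [⋀^Fin 2]→L[ℝ] ℝ) (v w : E4) : toBil η v w = η ![v, w] := rfl

/-- The Levi-Civita connection of a metric with value `g` and derivative `D` at a point. -/
def leviCivita (g : E4 →L[ℝ] E4 →L[ℝ] ℝ) (D : E4 →L[ℝ] E4 →L[ℝ] E4 →L[ℝ] ℝ) (v w : E4) : E4 :=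
  g.inverse ((1 / 2 : ℝ) • (D v w + D w v - (D.flip v).flip w))

/-- The rate of change of fibre coordinates along parallel transport. -/
def transportRate (N : E4 [⋀^Fin 2]→L[ℝ] ℝ) (Γ : E4 → E4) : E3 :=
  WithLp.toLp 2 fun j => N ![Γ (stdVec 0), stdVec j.succ] + N ![stdVec 0, Γ (stdVec j.succ)]

section Local
variable {X : Type*} [TopologicalSpace X] [ChartedSpace E4 X] [IsManifold (𝓡 4) ∞ X]
  (R : OrientedMetric (𝓡 4) X 4)

/-- Half the vector dual to the Koszul expression for the second derivative `D` of a metric. -/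
def koszulVec (D : E4 → E4 → E4 → ℝ) (u v : E4) : E4 :=
  WithLp.toLp 2 fun k => 1 / 2 * (D u v (stdVec k) + D v u (stdVec k) - D (stdVec k) u v)

/-- The rotation of anti-self-dual forms produced by the second derivative `D` of the metric. -/
def curvRate (σ : ℝ) (D : E4 → E4 → E4 → ℝ) (a : E3) (u : E4) (j : Fin 3) : ℝ :=
  flatASD σ a (koszulVec D u (stdVec 0)) (stdVec j.succ) +
    flatASD σ a (stdVec 0) (koszulVec D u (stdVec j.succ))

/-- The cross product of `ℝ³`. -/
def cross (a b : E3) : E3 :=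
  !₂[a 1 * b 2 - a 2 * b 1, a 2 * b 0 - a 0 * b 2, a 0 * b 1 - a 1 * b 0]

/-- The values of the three forms `e⁰ ∧ eʲ - σ eᵏ ∧ eˡ`. -/
def flatTriple (σ : ℝ) (v w : E4) : E3 :=
  WithLp.toLp 2 fun j => flatASD σ (EuclideanSpace.single j 1) v w

/-- The sign of the orientation of the coordinates at `x`. -/
def volSign (x : X) : ℝ := R.vol x stdVec

/-- The preferred charts are normal to first order at their centres, and the curvature of the
bundle of anti-self-dual forms is `κ` times that of the standard model. -/
structure NormalCharts (κ : ℝ) : Prop where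
  metric_center : ∀ (x : X) (v w : E4), R.metric x v w = inner ℝ v w
  fderiv_metric : ∀ x : X, fderiv ℝ (localBilin R.metric x) (extChartAt (𝓡 4) x x) = 0
  curvature : ∀ x : X, ∃ D : E4 → E4 → E4 → E4 → ℝ,
    (∀ u' u v w : E4, HasDerivAt (fun t : ℝ =>
      fderiv ℝ (localBilin R.metric x) (extChartAt (𝓡 4) x x + t • u') u v w) (D u' u v w) 0) ∧
    ∀ (a : E3) (u' u : E4) (j : Fin 3),
      curvRate (volSign R x) (D u') a u j - curvRate (volSign R x) (D u) a u' j =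
        volSign R x * κ * cross a (flatTriple (volSign R x) u' u) j

/-- The anti-self-dual form with given fibre coordinates, in a chart. -/
def locASD (x₀ : X) (a : E3) (y : E4) : E4 [⋀^Fin 2]→L[ℝ] ℝ :=
  localASD (localBilin R.metric x₀ y) (localForm R.vol x₀ y) a

/-- The Levi-Civita connection in a chart. -/
def locGamma (x₀ : X) (y u v : E4) : E4 :=
  leviCivita (localBilin R.metric x₀ y) (fderiv ℝ (localBilin R.metric x₀) y) u v

/-- The rate of change of fibre coordinates along parallel transport, in a chart. -/
def locRate (x₀ : X) (a : E3) (y u : E4) : E3 :=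
  transportRate (locASD R x₀ a y) (locGamma R x₀ y u)

variable {R}

theorem loc_isOriented {x₀ : X} {y : E4} (hy : y ∈ (extChartAt (𝓡 4) x₀).target) :
    IsOrientedInner (localBilin R.metric x₀ y) (localForm R.vol x₀ y) :=
  frame_isOrientedInner R.isOriented (base_mem_source hy)

theorem localBilin_contDiffAt {x₀ : X} {y : E4} (hy : y ∈ (extChartAt (𝓡 4) x₀).target) :
    ContDiffAt ℝ ∞ (localBilin R.metric x₀) y :=
  (R.isOriented.smooth_metric x₀).contDiffAt ((isOpen_extChartAt_target x₀).mem_nhds hy)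

theorem localForm_contDiffAt {x₀ : X} {y : E4} (hy : y ∈ (extChartAt (𝓡 4) x₀).target) :
    ContDiffAt ℝ ∞ (localForm R.vol x₀) y :=
  (R.isOriented.smooth_vol x₀).contDiffAt ((isOpen_extChartAt_target x₀).mem_nhds hy)

theorem locASD_contDiffAt {x₀ : X} {y : E4} (hy : y ∈ (extChartAt (𝓡 4) x₀).target) (a : E3) :
    ContDiffAt ℝ ∞ (locASD R x₀ a) y :=
  localASD_contDiffAt (localBilin_contDiffAt hy) (localForm_contDiffAt hy) contDiffAt_const
    (inner_invertible (loc_isOriented hy)) ((loc_isOriented hy).pos _ (stdVec_ne_zero 0)).ne'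

/-- An anti-self-dual form is rebuilt from its three coordinates, so its chart components are those
of `localASD`. This links the fibres of the bundle with the local computations. -/
theorem form_coordFrame {x₀ x : X} (hx : x ∈ (chartAt E4 x₀).source) (η : ASDForms R x) (v w : E4) :
    η.form ![coordFrame (𝓡 4) x₀ x v, coordFrame (𝓡 4) x₀ x w] =
      localASD (frameBilin R.metric x₀ x) (frameForm R.vol x₀ x) (asdCoords x₀ η) ![v, w] := by
  conv_lhs => rw [← ofCoords_asdCoords hx η, asdOfCoords_form hx, comp_vec2,
    coordFrame_inv_left hx, coordFrame_inv_left hx]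

theorem localBilin_center (x : X) (v w : E4) :
    localBilin R.metric x (extChartAt (𝓡 4) x x) v w = R.metric x v w := by
  rw [localBilin, extChartAt_to_inv, frameBilin_apply, coordFrame_self, coordFrame_self]

theorem localForm_center (x : X) (v : Fin 4 → E4) :
    localForm R.vol x (extChartAt (𝓡 4) x x) v = R.vol x v := by
  rw [localForm, extChartAt_to_inv, frameForm_apply]
  simp only [coordFrame_self]

/-- Linearity separates the fibre variable from the base variable, so that derivatives along the
total space follow from the product rule. -/
theorem locASD_sum (x₀ : X) (a : E3) (y : E4) :
    locASD R x₀ a y = ∑ k, a k • locASD R x₀ (EuclideanSpace.single k 1) y := by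
  ext m
  rw [vec2_eta m, locASD, localASD_linear]
  simp [Fin.sum_univ_three, locASD]

namespace NormalCharts
variable {κ : ℝ} (hR : NormalCharts R κ)
include hR

theorem hasFDerivAt_metric (x : X) :
    HasFDerivAt (localBilin R.metric x) (0 : E4 →L[ℝ] E4 →L[ℝ] E4 →L[ℝ] ℝ)
      (extChartAt (𝓡 4) x x) := by
  have h := ((localBilin_contDiffAt (R := R) (mem_extChartAt_target x)).differentiableAt
    (by simp)).hasFDerivAt
  rwa [hR.fderiv_metric] at h

/-- The square of the density is the Gram determinant of the metric, which is stationary at the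
centre. The density is nonzero there, so it is stationary as well. -/
theorem hasFDerivAt_vol (x : X) :
    HasFDerivAt (localForm R.vol x) (0 : E4 →L[ℝ] E4 [⋀^Fin 4]→L[ℝ] ℝ)
      (extChartAt (𝓡 4) x x) := by
  set c := extChartAt (𝓡 4) x x
  have hc : c ∈ (extChartAt (𝓡 4) x).target := mem_extChartAt_target x
  have hd := ((localForm_contDiffAt (R := R) hc).differentiableAt (by simp)).hasFDerivAt
  have hρ : HasFDerivAt (fun y => localForm R.vol x y stdVec)
      ((ContinuousAlternatingMap.apply ℝ E4 ℝ stdVec) ∘L fderiv ℝ (localForm R.vol x) c) c :=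
    (ContinuousAlternatingMap.apply ℝ E4 ℝ stdVec).hasFDerivAt.comp c hd
  set ρ' := (ContinuousAlternatingMap.apply ℝ E4 ℝ stdVec) ∘L fderiv ℝ (localForm R.vol x) c
  have hdet : ContDiff ℝ ∞ (fun g : E4 →L[ℝ] E4 →L[ℝ] ℝ =>
      (Matrix.of fun i j => g (stdVec i) (stdVec j)).det) := by
    simp only [Matrix.det_apply]
    refine ContDiff.sum fun σ _ => ContDiff.const_smul _ (contDiff_prod fun i _ => ?_)
    exact (contDiff_id.clm_apply contDiff_const).clm_apply contDiff_const
  have h1 : HasFDerivAt (fun y => (Matrix.of fun i j =>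
      localBilin R.metric x y (stdVec i) (stdVec j)).det) (0 : E4 →L[ℝ] ℝ) c := by
    have := ((hdet.differentiable (by simp)) (localBilin R.metric x c)).hasFDerivAt.comp c
      (hR.hasFDerivAt_metric x)
    rw [ContinuousLinearMap.comp_zero] at this
    exact this
  have h2 : HasFDerivAt (fun y => localForm R.vol x y stdVec ^ 2) (0 : E4 →L[ℝ] ℝ) c := by
    refine h1.congr_of_eventuallyEq ?_
    filter_upwards [(isOpen_extChartAt_target x).mem_nhds hc] with y hy
    exact vol_sq_eq_det (loc_isOriented hy)
  have h3 := h2.unique (hρ.pow 2)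
  have hne := vol_stdVec_ne_zero (loc_isOriented (R := R) hc)
  have h4 : ρ' = 0 := by
    ext u
    have := congrArg (fun A : E4 →L[ℝ] ℝ => A u) h3
    simpa [hne] using this
  have h5 : HasFDerivAt (fun y => localForm R.vol x y stdVec • stdVol 4)
      (ρ'.smulRight (stdVol 4)) c := hρ.smul_const _
  rw [h4] at h5
  have h6 := h5.congr_of_eventuallyEq (f₁ := localForm R.vol x)
    (Filter.Eventually.of_forall fun y => form4_eq _)
  simpa using h6

/-- Whatever depends differentiably on the metric and the volume form alone is constant to first
order at the centre. -/
theorem hasFDerivAt_comp {G : Type*} [NormedAddCommGroup G] [NormedSpace ℝ G] (x : X)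
    {f : (E4 →L[ℝ] E4 →L[ℝ] ℝ) × (E4 [⋀^Fin 4]→L[ℝ] ℝ) → G}
    (hf : DifferentiableAt ℝ f (localBilin R.metric x (extChartAt (𝓡 4) x x),
      localForm R.vol x (extChartAt (𝓡 4) x x))) :
    HasFDerivAt (fun y => f (localBilin R.metric x y, localForm R.vol x y)) (0 : E4 →L[ℝ] G)
      (extChartAt (𝓡 4) x x) := by
  have h := hf.hasFDerivAt.comp (extChartAt (𝓡 4) x x)
    ((hR.hasFDerivAt_metric x).prodMk (hR.hasFDerivAt_vol x))
  have h0 : (0 : E4 →L[ℝ] E4 →L[ℝ] E4 →L[ℝ] ℝ).prod (0 : E4 →L[ℝ] E4 [⋀^Fin 4]→L[ℝ] ℝ) = 0 := rfl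
  rw [h0, ContinuousLinearMap.comp_zero] at h
  exact h

theorem hasFDerivAt_locASD (x : X) (a : E3) :
    HasFDerivAt (locASD R x a) (0 : E4 →L[ℝ] E4 [⋀^Fin 2]→L[ℝ] ℝ) (extChartAt (𝓡 4) x x) := by
  have ho := loc_isOriented (R := R) (mem_extChartAt_target x)
  exact hR.hasFDerivAt_comp x (f := fun p => localASD p.1 p.2 a)
    ((localASD_contDiffAt (n := 1) contDiffAt_fst contDiffAt_snd contDiffAt_const
      (inner_invertible ho) (ho.pos _ (stdVec_ne_zero 0)).ne').differentiableAt (by simp))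

theorem locASD_center (x : X) (a : E3) (v w : E4) :
    locASD R x a (extChartAt (𝓡 4) x x) ![v, w] = flatASD (volSign R x) a v w := by
  have ho := loc_isOriented (R := R) (mem_extChartAt_target x)
  rw [locASD, localASD_flat ho fun v w => (localBilin_center x v w).trans (hR.metric_center x v w),
    localForm_center]
  rfl

theorem orientation_sq (x : X) : volSign R x = 1 ∨ volSign R x = -1 :=
  (R.isOriented.inner x).unit stdVec fun i j => by
    rw [hR.metric_center]
    simp [stdVec, PiLp.inner_apply, eq_comm]

theorem locGamma_center (x : X) (u v : E4) : locGamma R x (extChartAt (𝓡 4) x x) u v = 0 := by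
  rw [locGamma, leviCivita, hR.fderiv_metric]
  have : (1 / 2 : ℝ) • ((0 : E4 →L[ℝ] E4 →L[ℝ] E4 →L[ℝ] ℝ) u v +
    (0 : E4 →L[ℝ] E4 →L[ℝ] E4 →L[ℝ] ℝ) v u -
    ((0 : E4 →L[ℝ] E4 →L[ℝ] E4 →L[ℝ] ℝ).flip u).flip v) = 0 := by
    ext w; simp
  rw [this, map_zero]

end NormalCharts

end Local

/-! ### Passing to the normal chart at a nearby point -/

section Transition
variable {X : Type*} [TopologicalSpace X] [ChartedSpace E4 X] [IsManifold (𝓡 4) ∞ X]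
  {R : OrientedMetric (𝓡 4) X 4}

/-- The change of coordinates from the chart at `x₀` to the chart at `x`. -/
def transition (x₀ x : X) : E4 → E4 := extChartAt (𝓡 4) x ∘ (extChartAt (𝓡 4) x₀).symm

omit [IsManifold (𝓡 4) ∞ X] in
theorem chart_mem_target {x₀ x : X} (hx : x ∈ (chartAt E4 x₀).source) :
    extChartAt (𝓡 4) x₀ x ∈ (extChartAt (𝓡 4) x₀).target :=
  (extChartAt (𝓡 4) x₀).map_source (by rwa [extChartAt_source])

omit [IsManifold (𝓡 4) ∞ X] in
theorem chart_left_inv {x₀ x : X} (hx : x ∈ (chartAt E4 x₀).source) :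
    (extChartAt (𝓡 4) x₀).symm (extChartAt (𝓡 4) x₀ x) = x :=
  (extChartAt (𝓡 4) x₀).left_inv (by rwa [extChartAt_source])

omit [IsManifold (𝓡 4) ∞ X] in
theorem transition_apply_self {x₀ x : X} (hx : x ∈ (chartAt E4 x₀).source) :
    transition x₀ x (extChartAt (𝓡 4) x₀ x) = extChartAt (𝓡 4) x x := by
  rw [transition, Function.comp_apply, chart_left_inv hx]

theorem transition_contDiffAt {x₀ x : X} (hx : x ∈ (chartAt E4 x₀).source) :
    ContDiffAt ℝ ∞ (transition x₀ x) (extChartAt (𝓡 4) x₀ x) := by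
  have h := contDiffWithinAt_ext_coord_change (I := 𝓡 4) (n := ∞) x x₀
    (y := extChartAt (𝓡 4) x₀ x) (by
      rw [PartialEquiv.trans_source, PartialEquiv.symm_source]
      refine ⟨chart_mem_target hx, ?_⟩
      rw [Set.mem_preimage, chart_left_inv hx]
      exact mem_extChartAt_source x)
  rwa [range_I4, contDiffWithinAt_univ] at h

omit [IsManifold (𝓡 4) ∞ X] in
theorem eventually_mem_sources {x₀ x : X} (hx : x ∈ (chartAt E4 x₀).source) :
    ∀ᶠ y in 𝓝 (extChartAt (𝓡 4) x₀ x), y ∈ (extChartAt (𝓡 4) x₀).target ∧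
      (extChartAt (𝓡 4) x₀).symm y ∈ (chartAt E4 x).source := by
  have ht := chart_mem_target hx
  refine Filter.Eventually.and ((isOpen_extChartAt_target x₀).mem_nhds ht) ?_
  refine (continuousAt_extChartAt_symm'' ht).eventually_mem ?_
  rw [chart_left_inv hx]
  exact chart_source_mem_nhds E4 x

theorem coordFrame_eq_transition {x₀ x : X} {y : E4} (hy : y ∈ (extChartAt (𝓡 4) x₀).target)
    (hy' : (extChartAt (𝓡 4) x₀).symm y ∈ (chartAt E4 x).source) (v : E4) :
    coordFrame (𝓡 4) x₀ ((extChartAt (𝓡 4) x₀).symm y) v =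
      coordFrame (𝓡 4) x ((extChartAt (𝓡 4) x₀).symm y) (fderiv ℝ (transition x₀ x) y v) := by
  have h := coordFrameInv_comp_coordFrame_eq_fderiv range_I4 (base_mem_source hy) hy'
  rw [(extChartAt (𝓡 4) x₀).right_inv hy] at h
  rw [← coordFrame_inv_right hy' (coordFrame (𝓡 4) x₀ _ v), transition, ← h]
  rfl

theorem coordFrame_eq_fderiv_transition {x₀ x : X} (hx : x ∈ (chartAt E4 x₀).source) (v : E4) :
    coordFrame (𝓡 4) x₀ x v = fderiv ℝ (transition x₀ x) (extChartAt (𝓡 4) x₀ x) v := by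
  rw [coordFrame_eq_fderiv range_I4 hx]; rfl

theorem localBilin_transition {x₀ x : X} {y : E4} (hy : y ∈ (extChartAt (𝓡 4) x₀).target)
    (hy' : (extChartAt (𝓡 4) x₀).symm y ∈ (chartAt E4 x).source) (v w : E4) :
    localBilin R.metric x₀ y v w = localBilin R.metric x (transition x₀ x y)
      (fderiv ℝ (transition x₀ x) y v) (fderiv ℝ (transition x₀ x) y w) := by
  have h : (extChartAt (𝓡 4) x).symm (transition x₀ x y) = (extChartAt (𝓡 4) x₀).symm y :=
    chart_left_inv hy'
  rw [localBilin, localBilin, h, frameBilin_apply, frameBilin_apply,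
    coordFrame_eq_transition hy hy', coordFrame_eq_transition hy hy']

theorem locASD_transition {x₀ x : X} {y : E4} (hy : y ∈ (extChartAt (𝓡 4) x₀).target)
    (hy' : (extChartAt (𝓡 4) x₀).symm y ∈ (chartAt E4 x).source) (a : E3) (v w : E4) :
    locASD R x₀ a y ![v, w] =
      locASD R x (asdCoords x (asdOfCoords R x₀ ((extChartAt (𝓡 4) x₀).symm y) a))
        (transition x₀ x y)
        ![fderiv ℝ (transition x₀ x) y v, fderiv ℝ (transition x₀ x) y w] := by
  have h : (extChartAt (𝓡 4) x).symm (transition x₀ x y) = (extChartAt (𝓡 4) x₀).symm y :=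
    chart_left_inv hy'
  have h1 := form_coordFrame (base_mem_source hy)
    (asdOfCoords R x₀ ((extChartAt (𝓡 4) x₀).symm y) a) v w
  rw [asdCoords_ofCoords (base_mem_source hy)] at h1
  rw [locASD, locASD, localBilin, localForm, localBilin, localForm, h, ← h1,
    ← form_coordFrame hy', coordFrame_eq_transition hy hy', coordFrame_eq_transition hy hy']

theorem coordFrame_surjective {x₀ x : X} (hx : x ∈ (chartAt E4 x₀).source)
    (v : TangentSpace (𝓡 4) x) : ∃ w : E4, coordFrame (𝓡 4) x₀ x w = v :=
  ⟨_, coordFrame_inv_right hx v⟩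

/-- The derivative of a sum of products of functions with bilinear forms. -/
theorem hasFDerivAt_sum_bil {F : Type*} [NormedAddCommGroup F] [NormedSpace ℝ F]
    {B : Fin 3 → F → E4 →L[ℝ] E4 →L[ℝ] ℝ} {α : F → E3} {p q : F → E4}
    {B' : Fin 3 → F →L[ℝ] E4 →L[ℝ] E4 →L[ℝ] ℝ} {α' : F →L[ℝ] E3} {p' q' : F →L[ℝ] E4} {z : F}
    (hB : ∀ k, HasFDerivAt (B k) (B' k) z) (hα : HasFDerivAt α α' z) (hp : HasFDerivAt p p' z)
    (hq : HasFDerivAt q q' z) :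
    ∃ A : F →L[ℝ] ℝ, HasFDerivAt (fun y => ∑ k, α y k * B k y (p y) (q y)) A z ∧
      ∀ ξ, A ξ = ∑ k, α' ξ k * B k z (p z) (q z) + ∑ k, α z k * B' k ξ (p z) (q z) +
        ∑ k, α z k * B k z (p' ξ) (q z) + ∑ k, α z k * B k z (p z) (q' ξ) := by
  have hk : ∀ k, HasFDerivAt (fun y => α y k)
      ((EuclideanSpace.proj k : E3 →L[ℝ] ℝ) ∘L α') z := fun k =>
    (EuclideanSpace.proj k : E3 →L[ℝ] ℝ).hasFDerivAt.comp z hα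
  refine ⟨_, HasFDerivAt.fun_sum fun k _ => (hk k).mul (((hB k).clm_apply hp).clm_apply hq),
    fun ξ => ?_⟩
  simp [Fin.sum_univ_three]
  ring

namespace NormalCharts
variable {κ : ℝ} (hR : NormalCharts R κ)
include hR

/-- The Christoffel symbols are the second derivatives of the transition to normal
coordinates. -/
theorem transition_second_deriv {x₀ x : X} (hx : x ∈ (chartAt E4 x₀).source) (u v : E4) :
    fderiv ℝ (fderiv ℝ (transition x₀ x)) (extChartAt (𝓡 4) x₀ x) u v =
      fderiv ℝ (transition x₀ x) (extChartAt (𝓡 4) x₀ x)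
        (locGamma R x₀ (extChartAt (𝓡 4) x₀ x) u v) := by
  set y := extChartAt (𝓡 4) x₀ x with hy
  set φ := transition x₀ x
  have hφ : ContDiffAt ℝ ∞ φ y := transition_contDiffAt hx
  have hD1 : HasFDerivAt φ (fderiv ℝ φ y) y := (hφ.differentiableAt (by simp)).hasFDerivAt
  have hD2 : HasFDerivAt (fderiv ℝ φ) (fderiv ℝ (fderiv ℝ φ) y) y :=
    ((hφ.fderiv_right (m := 1) (by norm_cast)).differentiableAt (by simp)).hasFDerivAt
  have hsymm : ∀ u v, fderiv ℝ (fderiv ℝ φ) y u v = fderiv ℝ (fderiv ℝ φ) y v u :=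
    fun u v => hφ.isSymmSndFDerivAt (by simp only [minSmoothness_of_isRCLikeNormedField]; exact WithTop.coe_le_coe.mpr le_top) u v
  have hc : φ y = extChartAt (𝓡 4) x x := transition_apply_self hx
  have hG : HasFDerivAt (fun y' => localBilin R.metric x (φ y'))
      (0 : E4 →L[ℝ] E4 →L[ℝ] E4 →L[ℝ] ℝ) y := by
    have h := hR.hasFDerivAt_metric x
    rw [← hc] at h
    have := h.comp y hD1
    rwa [ContinuousLinearMap.zero_comp] at this
  have hG1 : ∀ v w : E4, localBilin R.metric x (φ y) v w = inner ℝ v w := fun v w => by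
    rw [hc, localBilin_center]; exact hR.metric_center x v w
  -- Derivative of `g(v, w) = ⟨φ'v, φ'w⟩`, which is correct to first order at `y`: the metric in the
  -- chart at `x` is Euclidean and stationary at its centre.
  have hd : ∀ u v w : E4, fderiv ℝ (localBilin R.metric x₀) y u v w =
      inner ℝ (fderiv ℝ (fderiv ℝ φ) y u v) (fderiv ℝ φ y w) +
        inner ℝ (fderiv ℝ φ y v) (fderiv ℝ (fderiv ℝ φ) y u w) := by
    intro u v w
    have h1 : HasFDerivAt (fun y' => localBilin R.metric x₀ y' v w)
        (((ContinuousLinearMap.apply ℝ ℝ w) ∘L (ContinuousLinearMap.apply ℝ (E4 →L[ℝ] ℝ) v)) ∘L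
          fderiv ℝ (localBilin R.metric x₀) y) y :=
      ((ContinuousLinearMap.apply ℝ ℝ w) ∘L
        (ContinuousLinearMap.apply ℝ (E4 →L[ℝ] ℝ) v)).hasFDerivAt.comp y
        ((localBilin_contDiffAt (chart_mem_target hx)).differentiableAt (by simp)).hasFDerivAt
    have h2 := (hG.clm_apply (hD2.clm_apply (hasFDerivAt_const v y))).clm_apply
      (hD2.clm_apply (hasFDerivAt_const w y))
    have h3 := h1.unique (h2.congr_of_eventuallyEq (by
      filter_upwards [eventually_mem_sources hx] with y' hy'
      exact localBilin_transition hy'.1 hy'.2 v w))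
    have h4 := congrArg (fun A : E4 →L[ℝ] ℝ => A u) h3
    simp [hG1] at h4
    rw [h4]
    ring
  have ho := loc_isOriented (R := R) (chart_mem_target hx)
  rw [← hy] at ho
  obtain ⟨e, he⟩ := inner_invertible ho
  -- In the Koszul combination the symmetry of the second derivative of `φ` cancels every term
  -- except `⟨φ''(u, v), φ'w⟩`.
  have hK : ∀ w, localBilin R.metric x₀ y (locGamma R x₀ y u v) w =
      inner ℝ (fderiv ℝ (fderiv ℝ φ) y u v) (fderiv ℝ φ y w) := by
    intro w
    have h1 : localBilin R.metric x₀ y (locGamma R x₀ y u v) =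
        (1 / 2 : ℝ) • (fderiv ℝ (localBilin R.metric x₀) y u v +
          fderiv ℝ (localBilin R.metric x₀) y v u -
          ((fderiv ℝ (localBilin R.metric x₀) y).flip u).flip v) := by
      rw [locGamma, leviCivita, ← he, ContinuousLinearMap.inverse_equiv]
      exact e.apply_symm_apply _
    rw [h1]
    simp only [smul_apply, add_apply, sub_apply, ContinuousLinearMap.flip_apply, hd, smul_eq_mul]
    rw [hsymm v u, hsymm w u, hsymm w v,
      real_inner_comm (fderiv ℝ φ y v) (fderiv ℝ (fderiv ℝ φ) y u w)]
    ring
  have hsurj : ∀ w : E4, ∃ w', fderiv ℝ φ y w' = w := fun w => by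
    obtain ⟨w', hw'⟩ := coordFrame_surjective hx w
    exact ⟨w', by rw [← coordFrame_eq_fderiv_transition hx]; exact hw'⟩
  refine ext_inner_right ℝ fun w => ?_
  obtain ⟨w, rfl⟩ := hsurj w
  rw [← hK w, localBilin_transition (chart_mem_target hx)
    (by rw [chart_left_inv hx]; exact mem_chart_source E4 x)]
  exact hG1 _ _

theorem form_center {x : X} (η : ASDForms R x) (v w : E4) :
    η.form ![v, w] = flatASD (volSign R x) (asdCoords x η) v w := by
  have h := form_coordFrame (mem_chart_source E4 x) η v w
  have h1 := hR.locASD_center x (asdCoords x η) v w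
  rw [locASD, localBilin, localForm, extChartAt_to_inv] at h1
  rw [← h1, ← h, coordFrame_self, coordFrame_self]

/-- In the chart centred at `q` parallel transport is stationary, so the fibre component of a vector
there is its vertical component. In the chart at `p₀` the vertical component is `s` minus the rate
of change under parallel transport, and the two sets of coordinates describe the same two-form at
`q`. -/
theorem bundle_transition {p₀ q : ASDBundle R} (hq : q.1 ∈ (chartAt E4 p₀.1).source) (u : E4)
    (s : E3) :
    (coordFrame I7 p₀ q (u, s) : E4 × E3).1 = coordFrame (𝓡 4) p₀.1 q.1 u ∧
    ∀ v w : E4, flatASD (volSign R q.1) (coordFrame I7 p₀ q (u, s) : E4 × E3).2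
      (coordFrame (𝓡 4) p₀.1 q.1 v) (coordFrame (𝓡 4) p₀.1 q.1 w) =
      locASD R p₀.1 (s - locRate R p₀.1 (asdCoords p₀.1 q.2) (extChartAt (𝓡 4) p₀.1 q.1) u)
        (extChartAt (𝓡 4) p₀.1 q.1) ![v, w] := by
  set y := extChartAt (𝓡 4) p₀.1 q.1 with hy
  set a := asdCoords p₀.1 q.2 with ha
  set φ := transition p₀.1 q.1 with hφdef
  have hφ : ContDiffAt ℝ ∞ φ y := transition_contDiffAt hq
  have hD1 : HasFDerivAt φ (fderiv ℝ φ y) y := (hφ.differentiableAt (by simp)).hasFDerivAt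
  have hD2 : HasFDerivAt (fderiv ℝ φ) (fderiv ℝ (fderiv ℝ φ) y) y :=
    ((hφ.fderiv_right (m := 1) (by norm_cast)).differentiableAt (by simp)).hasFDerivAt
  have hc : φ y = extChartAt (𝓡 4) q.1 q.1 := transition_apply_self hq
  let Φ : E4 × E3 → E4 × E3 := extChartAt I7 q ∘ (extChartAt I7 p₀).symm
  have hz : extChartAt I7 p₀ q = (y, a) := bundle_extChartAt p₀ q
  have hqs : q ∈ (chartAt (ModelProd E4 E3) p₀).source := (bundle_extChartAt_source p₀ q).mpr hq
  have hΦ : ContDiffAt ℝ ∞ Φ (y, a) := by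
    have h := contDiffWithinAt_ext_coord_change (I := I7) (n := ∞) q p₀
      (y := extChartAt I7 p₀ q) (by
        rw [PartialEquiv.trans_source, PartialEquiv.symm_source]
        refine ⟨(extChartAt I7 p₀).map_source (by rwa [extChartAt_source]), ?_⟩
        rw [Set.mem_preimage, (extChartAt I7 p₀).left_inv (by rwa [extChartAt_source])]
        exact mem_extChartAt_source q)
    rwa [range_I7, contDiffWithinAt_univ, hz] at h
  have hΦ' : HasFDerivAt Φ (fderiv ℝ Φ (y, a)) (y, a) := (hΦ.differentiableAt (by simp)).hasFDerivAt
  have hT : coordFrame I7 p₀ q = fderiv ℝ Φ (y, a) := by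
    rw [coordFrame_eq_fderiv range_I7 hqs, hz]
  have hΦeq : ∀ y' ∈ (extChartAt (𝓡 4) p₀.1).target, ∀ a', Φ (y', a') = (φ y',
      asdCoords q.1 (asdOfCoords R p₀.1 ((extChartAt (𝓡 4) p₀.1).symm y') a')) := fun y' hy' a' => by
    simp only [Φ, Function.comp_apply]
    rw [bundle_extChartAt_symm p₀ hy', bundle_extChartAt]
    rfl
  have hev : ∀ᶠ z : E4 × E3 in 𝓝 (y, a), z.1 ∈ (extChartAt (𝓡 4) p₀.1).target ∧
      (extChartAt (𝓡 4) p₀.1).symm z.1 ∈ (chartAt E4 q.1).source :=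
    (continuous_fst.tendsto (y, a)).eventually (eventually_mem_sources hq)
  have hfst : HasFDerivAt (fun z : E4 × E3 => z.1) (ContinuousLinearMap.fst ℝ E4 E3) (y, a) :=
    hasFDerivAt_fst
  have hsnd : HasFDerivAt (fun z : E4 × E3 => z.2) (ContinuousLinearMap.snd ℝ E4 E3) (y, a) :=
    hasFDerivAt_snd
  have h1 : (fderiv ℝ Φ (y, a) (u, s)).1 = coordFrame (𝓡 4) p₀.1 q.1 u := by
    have e1 : HasFDerivAt (fun z => (Φ z).1)
        (ContinuousLinearMap.fst ℝ E4 E3 ∘L fderiv ℝ Φ (y, a)) (y, a) :=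
      (ContinuousLinearMap.fst ℝ E4 E3).hasFDerivAt.comp (y, a) hΦ'
    have e2 : HasFDerivAt (fun z : E4 × E3 => φ z.1)
        (fderiv ℝ φ y ∘L ContinuousLinearMap.fst ℝ E4 E3) (y, a) :=
      HasFDerivAt.comp (y, a) (f := fun z : E4 × E3 => z.1) hD1 hfst
    have e3 := e1.unique (e2.congr_of_eventuallyEq (by
      filter_upwards [hev] with z hz
      rw [hΦeq z.1 hz.1 z.2]))
    rw [coordFrame_eq_fderiv_transition hq]
    exact congrArg (fun A : E4 × E3 →L[ℝ] E4 => A (u, s)) e3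
  rw [hT]
  refine ⟨h1, fun v w => ?_⟩
  set S := (fderiv ℝ Φ (y, a) (u, s)).2
  refine (congrArg₂ (flatASD (volSign R q.1) S) (coordFrame_eq_fderiv_transition hq v)
    (coordFrame_eq_fderiv_transition hq w)).trans ?_
  -- The derivative in the direction `(u, s)` of the identity `hident`, which writes one form in
  -- both charts. The coefficient forms of the normal chart are stationary, and `φ''(u, ·) = φ'Γ(u,
  -- ·)` produces the two Christoffel terms.
  have hkey : ∀ v w : E4, flatASD (volSign R q.1) S (fderiv ℝ φ y v) (fderiv ℝ φ y w) =
      locASD R p₀.1 s y ![v, w] + fderiv ℝ (locASD R p₀.1 a) y u ![v, w] -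
        locASD R p₀.1 a y ![locGamma R p₀.1 y u v, w] -
        locASD R p₀.1 a y ![v, locGamma R p₀.1 y u w] := by
    intro v w
    have hident : ∀ v w : E4, ∀ z : E4 × E3, z.1 ∈ (extChartAt (𝓡 4) p₀.1).target ∧
        (extChartAt (𝓡 4) p₀.1).symm z.1 ∈ (chartAt E4 q.1).source →
        ∑ k, z.2 k * toBil (locASD R p₀.1 (EuclideanSpace.single k 1) z.1) v w =
        ∑ k, (Φ z).2 k * toBil (locASD R q.1 (EuclideanSpace.single k 1) (φ z.1))
          (fderiv ℝ φ z.1 v) (fderiv ℝ φ z.1 w) := by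
      intro v w z hz
      have h := locASD_transition (R := R) hz.1 hz.2 z.2 v w
      have h2 : (Φ z).2 = asdCoords q.1 (asdOfCoords R p₀.1 ((extChartAt (𝓡 4) p₀.1).symm z.1) z.2) :=
        congrArg Prod.snd (hΦeq z.1 hz.1 z.2)
      rw [locASD_sum, locASD_sum q.1, ← h2] at h
      simpa [toBil_apply] using h
    have hya := hev.self_of_nhds
    have hN0 : ∀ k : Fin 3, HasFDerivAt (fun z : E4 × E3 =>
        toBil (locASD R p₀.1 (EuclideanSpace.single k 1) z.1))
        (toBil ∘L fderiv ℝ (locASD R p₀.1 (EuclideanSpace.single k 1)) y ∘L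
          ContinuousLinearMap.fst ℝ E4 E3) (y, a) := fun k => by
      have h := ((locASD_contDiffAt (R := R) (chart_mem_target hq)
        (EuclideanSpace.single k 1)).differentiableAt (by simp)).hasFDerivAt
      exact toBil.hasFDerivAt.comp (y, a) (HasFDerivAt.comp (y, a) (f := fun z : E4 × E3 => z.1)
        h hfst)
    have hN1 : ∀ k : Fin 3, HasFDerivAt (fun z : E4 × E3 =>
        toBil (locASD R q.1 (EuclideanSpace.single k 1) (φ z.1)))
        (0 : E4 × E3 →L[ℝ] E4 →L[ℝ] E4 →L[ℝ] ℝ) (y, a) := fun k => by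
      have h := hR.hasFDerivAt_locASD q.1 (EuclideanSpace.single k 1)
      rw [← hc] at h
      have h2 := toBil.hasFDerivAt.comp (y, a) (HasFDerivAt.comp (y, a)
        (f := fun z : E4 × E3 => φ z.1) h
        (HasFDerivAt.comp (y, a) (f := fun z : E4 × E3 => z.1) hD1 hfst))
      rwa [ContinuousLinearMap.zero_comp, ContinuousLinearMap.comp_zero] at h2
    have hsn : HasFDerivAt (fun z => (Φ z).2)
        (ContinuousLinearMap.snd ℝ E4 E3 ∘L fderiv ℝ Φ (y, a)) (y, a) :=
      (ContinuousLinearMap.snd ℝ E4 E3).hasFDerivAt.comp (y, a) hΦ'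
    have hdv : ∀ v : E4, HasFDerivAt (fun z : E4 × E3 => fderiv ℝ φ z.1 v)
        ((ContinuousLinearMap.apply ℝ E4 v) ∘L fderiv ℝ (fderiv ℝ φ) y ∘L
          ContinuousLinearMap.fst ℝ E4 E3) (y, a) := fun v =>
      (ContinuousLinearMap.apply ℝ E4 v).hasFDerivAt.comp (y, a)
        (HasFDerivAt.comp (y, a) (f := fun z : E4 × E3 => z.1) hD2 hfst)
    obtain ⟨A, hA, hA'⟩ := hasFDerivAt_sum_bil hN0 hsnd (hasFDerivAt_const v (y, a))
      (hasFDerivAt_const w (y, a))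
    obtain ⟨A₁, hA₁, hA₁'⟩ := hasFDerivAt_sum_bil hN1 hsn (hdv v) (hdv w)
    have hAA := hA.unique (hA₁.congr_of_eventuallyEq (by
      filter_upwards [hev] with z hz
      exact hident v w z hz))
    have h2 := hA' (u, s)
    rw [hAA, hA₁'] at h2
    have hG : ∀ v, fderiv ℝ (fderiv ℝ φ) y u v = fderiv ℝ φ y (locGamma R p₀.1 y u v) :=
      fun v => hR.transition_second_deriv hq u v
    have hs : (ContinuousLinearMap.snd ℝ E4 E3 ∘L fderiv ℝ Φ (y, a)) (u, s) = S := rfl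
    have hfd : ∑ k, a k * toBil (fderiv ℝ (locASD R p₀.1 (EuclideanSpace.single k 1)) y u) v w =
        fderiv ℝ (locASD R p₀.1 a) y u ![v, w] := by
      have h : HasFDerivAt (locASD R p₀.1 a)
          (∑ k, a k • fderiv ℝ (locASD R p₀.1 (EuclideanSpace.single k 1)) y) y := by
        refine (HasFDerivAt.fun_sum fun k _ => (((locASD_contDiffAt (R := R) (chart_mem_target hq)
          (EuclideanSpace.single k 1)).differentiableAt (by simp)).hasFDerivAt).const_smul
          (a k)).congr_of_eventuallyEq (Filter.Eventually.of_forall fun y' => ?_)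
        exact locASD_sum p₀.1 a y'
      rw [h.fderiv]
      simp [Fin.sum_univ_three, toBil_apply]
    have hflat : ∑ k, S k * toBil (locASD R q.1 (EuclideanSpace.single k 1) (φ y))
        (fderiv ℝ φ y v) (fderiv ℝ φ y w) =
        flatASD (volSign R q.1) S (fderiv ℝ φ y v) (fderiv ℝ φ y w) := by
      rw [← hR.locASD_center, ← hc, locASD_sum]
      simp [toBil_apply]
    have hs0 : ∑ k, s k * toBil (locASD R p₀.1 (EuclideanSpace.single k 1) y) v w =
        locASD R p₀.1 s y ![v, w] := by
      rw [locASD_sum p₀.1 s]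
      simp [toBil_apply]
    have ha0 : ∀ v w, ∑ k, (Φ (y, a)).2 k * toBil (locASD R q.1 (EuclideanSpace.single k 1) (φ y))
        (fderiv ℝ φ y v) (fderiv ℝ φ y w) = locASD R p₀.1 a y ![v, w] := by
      intro v w
      rw [← hident v w (y, a) hya, locASD_sum p₀.1 a]
      simp [toBil_apply]
    simp only [hs, ContinuousLinearMap.comp_apply, ContinuousLinearMap.apply_apply,
      ContinuousLinearMap.coe_fst', ContinuousLinearMap.coe_snd', hG, ha0, hflat, hs0,
      hfd, zero_apply, map_zero, mul_zero, Finset.sum_const_zero, add_zero] at h2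
    linarith [h2]
  have ho := loc_isOriented (R := R) (chart_mem_target hq)
  rw [← hy] at ho
  -- `S` lists the coordinates of a genuine anti-self-dual form at `q`. Both sides are therefore
  -- determined by their values on the pairs `(∂₀, ∂ⱼ)`.
  have hSt : ∀ v w : E4, flatASD (volSign R q.1) S (fderiv ℝ φ y v) (fderiv ℝ φ y w) =
      locASD R p₀.1 (asdCoords p₀.1 ((asdEquiv R q.1).symm S)) y ![v, w] := by
    intro v w
    have e1 := form_coordFrame hq ((asdEquiv R q.1).symm S) v w
    have e2 := hR.form_center ((asdEquiv R q.1).symm S) (coordFrame (𝓡 4) p₀.1 q.1 v)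
      (coordFrame (𝓡 4) p₀.1 q.1 w)
    have e3 : asdCoords q.1 ((asdEquiv R q.1).symm S) = S := (asdEquiv R q.1).apply_symm_apply S
    rw [e3] at e2
    have e4 : coordFrame (𝓡 4) p₀.1 q.1 v = fderiv ℝ φ y v := coordFrame_eq_fderiv_transition hq v
    have e5 : coordFrame (𝓡 4) p₀.1 q.1 w = fderiv ℝ φ y w := coordFrame_eq_fderiv_transition hq w
    refine (congrArg₂ (flatASD (volSign R q.1) S) e4 e5).symm.trans (e2.symm.trans ?_)
    rw [e1, locASD, localBilin, localForm, chart_left_inv hq]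
  have hcoord : ∀ b j, locASD R p₀.1 b y ![stdVec 0, stdVec j.succ] = b j :=
    fun b j => localASD_coord ho b j
  refine (hSt v w).trans ?_
  congr 2
  ext j
  rw [← hcoord (asdCoords p₀.1 ((asdEquiv R q.1).symm S)) j, ← hSt, hkey, hcoord]
  -- With `a` held fixed, the value on `(∂₀, ∂ⱼ)` is the constant `aⱼ` throughout the chart.
  have hconst : fderiv ℝ (locASD R p₀.1 a) y u ![stdVec 0, stdVec j.succ] = 0 := by
    have h := ((locASD_contDiffAt (R := R) (chart_mem_target hq)
      a).differentiableAt (by simp)).hasFDerivAt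
    have h2 := (ContinuousAlternatingMap.apply ℝ E4 ℝ ![stdVec 0, stdVec j.succ]).hasFDerivAt.comp
      _ h
    have h3 := h2.unique ((hasFDerivAt_const (a j) y).congr_of_eventuallyEq (by
      filter_upwards [(isOpen_extChartAt_target p₀.1).mem_nhds (chart_mem_target hq)] with y' hy'
      exact localASD_coord (loc_isOriented hy') a j))
    exact congrArg (fun A : E4 →L[ℝ] ℝ => A u) h3
  rw [hconst]
  simp only [locRate, transportRate, PiLp.sub_apply]
  ring

end NormalCharts
end Transition

/-! ### The structure at the centre of a normal chart -/

section Pointwise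
variable {X : Type*} [TopologicalSpace X] [ChartedSpace E4 X] [IsManifold (𝓡 4) ∞ X]
  {R : OrientedMetric (𝓡 4) X 4}

theorem proj_contMDiff : ContMDiff I7 (𝓡 4) ∞ (proj R) :=
  Bundle.contMDiff_proj (IB := 𝓡 4) (n := ∞) (F := E3) (ASDForms R)

theorem proj_surjective : Function.Surjective (proj R) := fun x => ⟨⟨x, 0⟩, rfl⟩

theorem writtenInExtChartAt_proj (p : ASDBundle R) {z : E4 × E3}
    (hz : z ∈ (extChartAt I7 p).target) :
    writtenInExtChartAt I7 (𝓡 4) p (proj R) z = z.1 := by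
  rw [bundle_extChartAt_target] at hz
  obtain ⟨y, a⟩ := z
  simp only [writtenInExtChartAt, Function.comp_apply, bundle_extChartAt_symm p hz.1, proj]
  exact (extChartAt (𝓡 4) p.1).right_inv hz.1

theorem mfderiv_proj (p : ASDBundle R) (ξ : E4 × E3) :
    mfderiv I7 (𝓡 4) (proj R) p ξ = ξ.1 := by
  have hd : MDifferentiableAt I7 (𝓡 4) (proj R) p := (proj_contMDiff p).mdifferentiableAt (by simp)
  rw [hd.mfderiv, range_I7, fderivWithin_univ]
  have h : HasFDerivAt (writtenInExtChartAt I7 (𝓡 4) p (proj R)) (ContinuousLinearMap.fst ℝ E4 E3)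
      (extChartAt I7 p p) := by
    refine (hasFDerivAt_fst (𝕜 := ℝ) (E := E4) (F := E3)).congr_of_eventuallyEq ?_
    filter_upwards [(isOpen_extChartAt_target p).mem_nhds (mem_extChartAt_target p)] with z hz
    exact writtenInExtChartAt_proj p hz
  rw [h.fderiv]
  rfl

theorem coordVec_eq (x : X) (i : Fin 4) : coordVec x i = stdVec i := coordFrame_self x _

theorem pullbackVol_eq (q : ASDBundle R) (ξ : Fin 4 → E4 × E3) :
    pullbackForm (I := I7) (proj R) R.vol q ξ = volSign R q.1 * stdVol 4 fun i => (ξ i).1 := by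
  have h : pullbackForm (I := I7) (proj R) R.vol q ξ =
      (R.vol q.1 : E4 [⋀^Fin 4]→L[ℝ] ℝ) fun i => (ξ i).1 :=
    congrArg (R.vol q.1) (funext fun i => mfderiv_proj q (ξ i))
  rw [h, form4_eq (R.vol q.1)]
  rfl

/-- The projection discards fibre components. In a bundle chart the tautological form is therefore
linear in the fibre coordinate and involves only the base components of its arguments. -/
theorem localForm_taut_apply {p₀ : ASDBundle R} {κ : ℝ} (hR : NormalCharts R κ) {y : E4}
    (hy : y ∈ (extChartAt (𝓡 4) p₀.1).target) (a : E3) (ξ ζ : E4 × E3) :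
    localForm (tautForm R) p₀ (y, a) ![ξ, ζ] = locASD R p₀.1 a y ![ξ.1, ζ.1] := by
  have hs := base_mem_source hy
  rw [localForm, frameForm_apply, bundle_extChartAt_symm p₀ hy]
  set q : ASDBundle R := ⟨(extChartAt (𝓡 4) p₀.1).symm y,
    asdOfCoords R p₀.1 ((extChartAt (𝓡 4) p₀.1).symm y) a⟩
  have h := form_coordFrame hs q.2 ξ.1 ζ.1
  rw [asdCoords_ofCoords hs] at h
  rw [locASD, localBilin, localForm, ← h]
  have e : ∀ ξ : E4 × E3, mfderiv I7 (𝓡 4) (proj R) q (coordFrame I7 p₀ q ξ) =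
      coordFrame (𝓡 4) p₀.1 q.1 ξ.1 := fun ξ =>
    (mfderiv_proj q _).trans (hR.bundle_transition (q := q) hs ξ.1 ξ.2).1
  refine congrArg q.2.form (funext fun i => ?_)
  fin_cases i
  · exact e ξ
  · exact e ζ

namespace NormalCharts
variable {κ : ℝ} (hR : NormalCharts R κ)
include hR

theorem volSign_mul_self (x : X) : volSign R x * volSign R x = 1 := by
  rcases hR.orientation_sq x with h | h <;> rw [h] <;> norm_num

theorem volSign_inv (x : X) : (volSign R x)⁻¹ = volSign R x := by
  rcases hR.orientation_sq x with h | h <;> rw [h] <;> norm_num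

theorem parallelRate_center {x : X} (η : ASDForms R x) (v : E4) : parallelRate R η v = 0 := by
  have hc : ∀ w : E4, christoffel R.metric x v w = 0 := fun w => hR.locGamma_center x v w
  have h0 : ∀ w : E4, η.form ![(0 : E4), w] = 0 := fun w =>
    η.form.map_coord_zero (m := ![(0 : E4), w]) 0 rfl
  have h1 : ∀ w : E4, η.form ![w, (0 : E4)] = 0 := fun w =>
    η.form.map_coord_zero (m := ![w, (0 : E4)]) 1 rfl
  ext j
  simp only [parallelRate, hc, map_zero]
  exact (congrArg₂ (· + ·) (h0 _) (h1 _)).trans (add_zero 0)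

/-- The Christoffel symbols vanish at the centre, so the horizontal space there is `E4 × 0`. -/
theorem vertPart_coords (q : ASDBundle R) (ξ : E4 × E3) :
    asdEquiv R q.1 (vertPart R q ξ) = ξ.2 := by
  have h : vertPart R q ξ = (asdEquiv R q.1).symm
      ((coordFrameInv I7 q q ξ : E4 × E3).2 -
        parallelRate R q.2 (coordFrameInv I7 q q ξ : E4 × E3).1) := rfl
  rw [h, ContinuousLinearEquiv.apply_symm_apply, hR.parallelRate_center, sub_zero]
  exact congrArg Prod.snd (coordFrameInv_self (I := I7) q ξ)

theorem asdInner_eq {x : X} (η ζ : ASDForms R x) :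
    asdInner R η ζ = inner ℝ (asdEquiv R x η) (asdEquiv R x ζ) := by
  have hm : invMetric R x = 1 := by
    rw [invMetric]
    have : (Matrix.of fun i j => R.metric x (coordVec x i) (coordVec x j)) =
        (1 : Matrix (Fin 4) (Fin 4) ℝ) := by
      ext i j
      rw [Matrix.of_apply, coordVec_eq, coordVec_eq, hR.metric_center, Matrix.one_apply]
      simp [stdVec, PiLp.inner_apply, eq_comm]
    rw [this, inv_one]
  have hf : ∀ (η : ASDForms R x) i j, η.form ![coordVec x i, coordVec x j] =
      flatASD (volSign R x) (asdCoords x η) (stdVec i) (stdVec j) := fun η i j => by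
    rw [coordVec_eq, coordVec_eq]; exact hR.form_center η _ _
  have hσ := hR.volSign_mul_self x
  rw [asdInner, asdEquiv_apply, asdEquiv_apply, e3_inner]
  simp only [hf, hm, Matrix.one_apply, ite_mul, mul_ite, mul_one, mul_zero, one_mul, zero_mul,
    Finset.sum_ite_eq, Finset.mem_univ, if_true]
  simp [Fin.sum_univ_four, flatASD]
  -- Half of the nonzero components carry the orientation sign, which enters squared; the two sides
  -- differ by one half of the inner product times `σ² - 1`.
  linear_combination (-(1 / 2 : ℝ) + 1) * (asdCoords x η 0 * asdCoords x ζ 0 +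
    asdCoords x η 1 * asdCoords x ζ 1 + asdCoords x η 2 * asdCoords x ζ 2) * hσ

theorem vertMetric_eq (q : ASDBundle R) (ξ ζ : E4 × E3) :
    vertMetric R q ξ ζ = inner ℝ ξ.2 ζ.2 := by
  have h : vertMetric R q ξ ζ = asdInner R (vertPart R q ξ) (vertPart R q ζ) := rfl
  rw [h, hR.asdInner_eq, hR.vertPart_coords, hR.vertPart_coords]

/-- The normalising factor reduces at the centre to the sign of the coordinates, which is its own
inverse. -/
theorem vertVol_eq (q : ASDBundle R) (ξ : Fin 3 → E4 × E3) :
    vertVol R q ξ = volSign R q.1 * stdVol 3 fun i => (ξ i).2 := by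
  have h : vertVol R q ξ = (R.metric q.1 (coordVec q.1 0) (coordVec q.1 0) *
      R.vol q.1 (coordVec q.1))⁻¹ * stdVol 3 fun i => asdEquiv R q.1 (vertPart R q (ξ i)) := rfl
  have hv : R.vol q.1 (coordVec q.1) = volSign R q.1 := congrArg _ (funext fun i => coordVec_eq _ i)
  rw [h, hv, coordVec_eq, hR.metric_center]
  simp only [hR.vertPart_coords]
  rw [show inner ℝ (stdVec 0) (stdVec 0) = (1 : ℝ) by simp [stdVec], one_mul, hR.volSign_inv]

theorem radiusSq_eq (q : ASDBundle R) :
    radiusSq R q = inner ℝ (asdCoords q.1 q.2) (asdCoords q.1 q.2) := hR.asdInner_eq _ _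

theorem localForm_taut_contDiffAt {p₀ : ASDBundle R} {y : E4}
    (hy : y ∈ (extChartAt (𝓡 4) p₀.1).target) (a : E3) :
    ContDiffAt ℝ ∞ (localForm (tautForm R) p₀) (y, a) := by
  refine form_contDiffAt fun m => ?_
  rw [vec2_eta m]
  have ho := loc_isOriented (R := R) hy
  have hg : ContDiffAt ℝ ∞ (fun z : E4 × E3 => localBilin R.metric p₀.1 z.1) (y, a) :=
    ContDiffAt.comp (y, a) (g := localBilin R.metric p₀.1) (f := fun z : E4 × E3 => z.1)
      (localBilin_contDiffAt hy) contDiffAt_fst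
  have hv : ContDiffAt ℝ ∞ (fun z : E4 × E3 => localForm R.vol p₀.1 z.1) (y, a) :=
    ContDiffAt.comp (y, a) (g := localForm R.vol p₀.1) (f := fun z : E4 × E3 => z.1)
      (localForm_contDiffAt hy) contDiffAt_fst
  have hi : (localBilin R.metric p₀.1 ((y, a) : E4 × E3).1).IsInvertible := inner_invertible ho
  have h0 : localBilin R.metric p₀.1 ((y, a) : E4 × E3).1 (stdVec 0) (stdVec 0) ≠ 0 :=
    (ho.pos _ (stdVec_ne_zero 0)).ne'
  have hs : ContDiffAt ℝ ∞ (fun z : E4 × E3 => z.2) (y, a) := contDiffAt_snd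
  have h := localASD_apply_contDiffAt hg hv hs (contDiffAt_const (c := (m 0).1))
    (contDiffAt_const (c := (m 1).1)) hi h0
  refine h.congr_of_eventuallyEq ?_
  filter_upwards [(continuous_fst.tendsto (y, a)).eventually
    ((isOpen_extChartAt_target p₀.1).mem_nhds hy)] with z hz
  exact localForm_taut_apply hR hz z.2 _ _

/-- The exterior derivative of the tautological form. -/
theorem extD_taut (q : ASDBundle R) (ξ₀ ξ₁ ξ₂ : E4 × E3) :
    extD (tautForm R) q ![ξ₀, ξ₁, ξ₂] = flatASD (volSign R q.1) ξ₀.2 ξ₁.1 ξ₂.1 -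
      flatASD (volSign R q.1) ξ₁.2 ξ₀.1 ξ₂.1 + flatASD (volSign R q.1) ξ₂.2 ξ₀.1 ξ₁.1 := by
  set c := extChartAt (𝓡 4) q.1 q.1
  have hc : c ∈ (extChartAt (𝓡 4) q.1).target := mem_extChartAt_target q.1
  have hz : extChartAt I7 q q = (c, asdCoords q.1 q.2) := bundle_extChartAt q q
  have hD := hR.localForm_taut_contDiffAt (p₀ := q) hc (asdCoords q.1 q.2)
  have hE : extD (tautForm R) q ![ξ₀, ξ₁, ξ₂] =
      extDeriv (localForm (tautForm R) q) (c, asdCoords q.1 q.2) ![ξ₀, ξ₁, ξ₂] := by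
    rw [← hz]
    refine congrArg (extDeriv (localForm (tautForm R) q) (extChartAt I7 q q)) (funext fun i => ?_)
    exact coordFrameInv_self (I := I7) q _
  -- The coefficient forms are stationary at the centre, so differentiation acts on the fibre
  -- coordinate only: there `dθ` is `∑ daₖ ∧ ωₖ`.
  have hd : ∀ η ξ ζ : E4 × E3,
      fderiv ℝ (fun z => localForm (tautForm R) q z ![ξ, ζ]) (c, asdCoords q.1 q.2) η =
        flatASD (volSign R q.1) η.2 ξ.1 ζ.1 := by
    intro η ξ ζ
    have hN : ∀ k : Fin 3, HasFDerivAt (fun z : E4 × E3 =>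
        toBil (locASD R q.1 (EuclideanSpace.single k 1) z.1))
        (0 : E4 × E3 →L[ℝ] E4 →L[ℝ] E4 →L[ℝ] ℝ) (c, asdCoords q.1 q.2) := fun k => by
      have h := toBil.hasFDerivAt.comp (c, asdCoords q.1 q.2)
        (HasFDerivAt.comp (c, asdCoords q.1 q.2) (f := fun z : E4 × E3 => z.1)
          (hR.hasFDerivAt_locASD q.1 (EuclideanSpace.single k 1)) hasFDerivAt_fst)
      rwa [ContinuousLinearMap.zero_comp, ContinuousLinearMap.comp_zero] at h
    obtain ⟨A, hA, hA'⟩ := hasFDerivAt_sum_bil hN hasFDerivAt_snd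
      (hasFDerivAt_const ξ.1 (c, asdCoords q.1 q.2)) (hasFDerivAt_const ζ.1 (c, asdCoords q.1 q.2))
    have h2 : HasFDerivAt (fun z => localForm (tautForm R) q z ![ξ, ζ]) A
        (c, asdCoords q.1 q.2) := by
      refine hA.congr_of_eventuallyEq ?_
      filter_upwards [(continuous_fst.tendsto (c, asdCoords q.1 q.2)).eventually
        ((isOpen_extChartAt_target q.1).mem_nhds hc)] with z hz
      have h3 := localForm_taut_apply hR hz z.2 ξ ζ
      rw [locASD_sum] at h3
      rw [show z = (z.1, z.2) from rfl, h3]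
      simp [toBil_apply]
    rw [h2.fderiv, hA', ← hR.locASD_center, locASD_sum q.1 η.2]
    simp only [zero_apply, map_zero, mul_zero, Finset.sum_const_zero, add_zero]
    simp [toBil_apply, c]
  rw [hE, extDeriv_apply (hD.differentiableAt (by simp)), Fin.sum_univ_three]
  have r0 : (0 : Fin 3).removeNth ![ξ₀, ξ₁, ξ₂] = ![ξ₁, ξ₂] := by
    ext i : 1; fin_cases i <;> rfl
  have r1 : (1 : Fin 3).removeNth ![ξ₀, ξ₁, ξ₂] = ![ξ₀, ξ₂] := by
    ext i : 1; fin_cases i <;> rfl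
  have r2 : (2 : Fin 3).removeNth ![ξ₀, ξ₁, ξ₂] = ![ξ₀, ξ₁] := by
    ext i : 1; fin_cases i <;> rfl
  rw [r0, r1, r2, hd, hd, hd]
  simp
  ring

end NormalCharts
end Pointwise

/-! ### Coordinates that identify the tangent spaces with `ℝ⁷` -/

section ModelSpace
variable {T : Type*} [AddCommGroup T] [Module ℝ T] [TopologicalSpace T]

theorem topForm_eq_det {n : ℕ} (L : T ≃ₗ[ℝ] (Fin n → ℝ)) (vol : T [⋀^Fin n]→L[ℝ] ℝ)
    (h : vol (fun i => L.symm (Pi.single i 1)) = 1) (v : Fin n → T) :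
    vol v = (Matrix.of fun i => L (v i)).det := by
  let b := Module.Basis.ofEquivFun L
  have hb : (b : Fin n → T) = fun i => L.symm (Pi.single i 1) := by
    ext i; simp [b]
  have h1 : vol v = vol b * b.det v :=
    congrArg (fun A => A v) (vol.toAlternatingMap.eq_smul_basis_det b)
  rw [h1, hb, h, one_mul, Module.Basis.det_apply, ← Matrix.det_transpose]
  congr 1

theorem frame_of_iso {n : ℕ} (L : T ≃ₗ[ℝ] (Fin n → ℝ)) (g : T →L[ℝ] T →L[ℝ] ℝ)
    (hg : ∀ v w, g v w = ∑ k, L v k * L w k) :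
    IsOrthonormalFrame g (fun i => L.symm (Pi.single i 1)) := fun i j => by
  rw [hg]
  simp [Pi.single_apply, eq_comm]

theorem det_sq_of_frame {n : ℕ} (L : T ≃ₗ[ℝ] (Fin n → ℝ)) (g : T →L[ℝ] T →L[ℝ] ℝ)
    (hg : ∀ v w, g v w = ∑ k, L v k * L w k) {e : Fin n → T} (he : IsOrthonormalFrame g e) :
    (Matrix.of fun i => L (e i)).det * (Matrix.of fun i => L (e i)).det = 1 := by
  have h : (Matrix.of fun i => L (e i)) * (Matrix.of fun i => L (e i)).transpose = 1 := by
    ext i j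
    rw [Matrix.mul_apply, Matrix.one_apply, ← he i j, hg]
    rfl
  have h2 := congrArg Matrix.det h
  rwa [Matrix.det_mul, Matrix.det_transpose, Matrix.det_one] at h2

theorem isOrientedInner_of_iso {n : ℕ} (L : T ≃ₗ[ℝ] (Fin n → ℝ)) (g : T →L[ℝ] T →L[ℝ] ℝ)
    (vol : T [⋀^Fin n]→L[ℝ] ℝ) (hg : ∀ v w, g v w = ∑ k, L v k * L w k)
    (h : vol (fun i => L.symm (Pi.single i 1)) = 1) : IsOrientedInner g vol where
  symm v w := by rw [hg, hg]; exact Finset.sum_congr rfl fun k _ => mul_comm _ _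
  pos v hv := by
    rw [hg]
    have h1 : L v ≠ 0 := fun h0 => hv (by simpa using h0)
    obtain ⟨k, hk⟩ := Function.ne_iff.mp h1
    exact Finset.sum_pos' (fun k _ => mul_self_nonneg _) ⟨k, Finset.mem_univ k, mul_self_pos.mpr hk⟩
  unit e he := by
    rw [topForm_eq_det L vol h e]
    exact mul_self_eq_one_iff.mp (det_sq_of_frame L g hg he)

end ModelSpace

/-- The coordinates in which the Bryant-Salamon forms are the standard ones. -/
def modelIso {σ w v : ℝ} (hσ : σ * σ = 1) (hw : w ≠ 0) (hv : v ≠ 0) :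
    (E4 × E3) ≃ₗ[ℝ] (Fin 7 → ℝ) where
  -- The sign `σ` on the first base coordinate makes the basis positively oriented. The fibre
  -- coordinates are values on `(∂₀, ∂ⱼ)` and so change sign with it; the factors `w` and `v` make
  -- the metric Euclidean.
  toFun ξ := ![v * σ * ξ.2 0, v * σ * ξ.2 1, v * σ * ξ.2 2, w * σ * ξ.1 0, w * ξ.1 1, w * ξ.1 2,
    w * ξ.1 3]
  map_add' ξ ζ := by ext i; fin_cases i <;> simp <;> ring
  map_smul' r ξ := by ext i; fin_cases i <;> simp <;> ring
  invFun x := (!₂[w⁻¹ * σ * x 3, w⁻¹ * x 4, w⁻¹ * x 5, w⁻¹ * x 6],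
    !₂[v⁻¹ * σ * x 0, v⁻¹ * σ * x 1, v⁻¹ * σ * x 2])
  left_inv ξ := by
    have h1 : ∀ r : ℝ, v⁻¹ * σ * (v * σ * r) = r := fun r => by
      field_simp; linear_combination r * hσ
    have h2 : ∀ r : ℝ, w⁻¹ * σ * (w * σ * r) = r := fun r => by
      field_simp; linear_combination r * hσ
    refine Prod.ext ?_ ?_
    · ext i; fin_cases i <;> simp [h2, hw]
    · ext i; fin_cases i <;> simp [h1]
  right_inv x := by
    have h1 : ∀ r : ℝ, v * σ * (v⁻¹ * σ * r) = r := fun r => by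
      field_simp; linear_combination r * hσ
    have h2 : ∀ r : ℝ, w * σ * (w⁻¹ * σ * r) = r := fun r => by
      field_simp; linear_combination r * hσ
    ext i; fin_cases i <;> simp [h1, h2, hw]

section ModelIso
variable {σ w v : ℝ} (hσ : σ * σ = 1) (hw : w ≠ 0) (hv : v ≠ 0)

theorem modelIso_apply (ξ : E4 × E3) : modelIso hσ hw hv ξ =
    ![v * σ * ξ.2 0, v * σ * ξ.2 1, v * σ * ξ.2 2, w * σ * ξ.1 0, w * ξ.1 1, w * ξ.1 2,
      w * ξ.1 3] := rfl

theorem modelIso_symm_apply (x : Fin 7 → ℝ) : (modelIso hσ hw hv).symm x =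
    (!₂[w⁻¹ * σ * x 3, w⁻¹ * x 4, w⁻¹ * x 5, w⁻¹ * x 6],
      !₂[v⁻¹ * σ * x 0, v⁻¹ * σ * x 1, v⁻¹ * σ * x 2]) := rfl

theorem modelIso_inner (ξ ζ : E4 × E3) :
    ∑ k, modelIso hσ hw hv ξ k * modelIso hσ hw hv ζ k =
      w ^ 2 * inner ℝ ξ.1 ζ.1 + v ^ 2 * inner ℝ ξ.2 ζ.2 := by
  rw [e4_inner, e3_inner, modelIso_apply, modelIso_apply]
  simp [Fin.sum_univ_succ]
  linear_combination (v ^ 2 * (ξ.2 0 * ζ.2 0 + ξ.2 1 * ζ.2 1 + ξ.2 2 * ζ.2 2) +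
    w ^ 2 * ξ.1 0 * ζ.1 0) * hσ

/-- The model form splits into parts of vertical degree three and one. The first gives the fibre
volume; the second pairs a fibre component with the anti-self-dual triple on the base, which is the
shape of `dθ`. -/
theorem stdPhi_modelIso (ξ₀ ξ₁ ξ₂ : E4 × E3) :
    stdPhi ![modelIso hσ hw hv ξ₀, modelIso hσ hw hv ξ₁, modelIso hσ hw hv ξ₂] =
      v ^ 3 * (σ * stdVol 3 ![ξ₀.2, ξ₁.2, ξ₂.2]) + w ^ 2 * v * (flatASD σ ξ₀.2 ξ₁.1 ξ₂.1 -
        flatASD σ ξ₁.2 ξ₀.1 ξ₂.1 + flatASD σ ξ₂.2 ξ₀.1 ξ₁.1) := by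
  simp only [stdPhi, minor3_eq, stdVol_three, flatASD, modelIso_apply]
  rcases mul_self_eq_one_iff.mp hσ with rfl | rfl
  · simp; ring
  · simp; ring

/-- The parts have vertical degree zero and two. The six determinants are the choices of the two
arguments whose fibre components are used, with the signs of the shuffles. -/
theorem stdPsi_modelIso (ξ₀ ξ₁ ξ₂ ξ₃ : E4 × E3) :
    stdPsi ![modelIso hσ hw hv ξ₀, modelIso hσ hw hv ξ₁, modelIso hσ hw hv ξ₂,
      modelIso hσ hw hv ξ₃] =
      w ^ 4 * (σ * stdVol 4 ![ξ₀.1, ξ₁.1, ξ₂.1, ξ₃.1]) - w ^ 2 * v ^ 2 * σ *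
        (stdVol 3 ![ξ₀.2, ξ₁.2, flatTriple σ ξ₂.1 ξ₃.1] -
          stdVol 3 ![ξ₀.2, ξ₂.2, flatTriple σ ξ₁.1 ξ₃.1] +
          stdVol 3 ![ξ₀.2, ξ₃.2, flatTriple σ ξ₁.1 ξ₂.1] +
          stdVol 3 ![ξ₁.2, ξ₂.2, flatTriple σ ξ₀.1 ξ₃.1] -
          stdVol 3 ![ξ₁.2, ξ₃.2, flatTriple σ ξ₀.1 ξ₂.1] +
          stdVol 3 ![ξ₂.2, ξ₃.2, flatTriple σ ξ₀.1 ξ₁.1]) := by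
  have hm : ∀ (x y z t : Fin 7 → ℝ) (i j k l : Fin 7), minor4 ![x, y, z, t] i j k l =
      stdVol 4 ![!₂[x i, x j, x k, x l], !₂[y i, y j, y k, y l], !₂[z i, z j, z k, z l],
        !₂[t i, t j, t k, t l]] := by
    intro x y z t i j k l
    rw [minor4, stdVol_apply]
    congr 1
    ext r s
    fin_cases r <;> fin_cases s <;> rfl
  simp only [stdPsi, hm, stdVol_three, stdVol_four, flatTriple, flatASD, modelIso_apply]
  rcases mul_self_eq_one_iff.mp hσ with rfl | rfl
  · simp; ring
  · simp; ring

end ModelIso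

/-! ### Metric, three-form and projection at a point -/

section Forms
variable {X : Type*} [TopologicalSpace X] [ChartedSpace E4 X] [IsManifold (𝓡 4) ∞ X]
  {R : OrientedMetric (𝓡 4) X 4} {κ b c : ℝ}

/-- The function `c + 2κb²r²`. -/
def coefBase (R : OrientedMetric (𝓡 4) X 4) (κ b c : ℝ) (q : ASDBundle R) : ℝ :=
  c + 2 * κ * b ^ 2 * radiusSq R q

namespace NormalCharts
variable (hR : NormalCharts R κ) (hκ : 0 ≤ κ) (hb : 0 < b) (hc : 0 < c)

include hR hκ hc in
theorem coefBase_pos (q : ASDBundle R) : 0 < coefBase R κ b c q := by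
  rw [coefBase, hR.radiusSq_eq]
  have := real_inner_self_nonneg (x := asdCoords q.1 q.2)
  positivity

include hR hκ hb hc in
theorem coefW_pos (q : ASDBundle R) : 0 < coefW R κ b c q :=
  Real.rpow_pos_of_pos (hR.coefBase_pos hκ hc q) _

include hR hκ hb hc in
theorem coefV_pos (q : ASDBundle R) : 0 < coefV R κ b c q :=
  mul_pos hb (Real.rpow_pos_of_pos (hR.coefBase_pos hκ hc q) _)

/-- The coordinates on the tangent space at `q` in which the structure is the standard one. -/
def iso (q : ASDBundle R) : TangentSpace I7 q ≃ₗ[ℝ] (Fin 7 → ℝ) :=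
  modelIso (hR.volSign_mul_self q.1) (hR.coefW_pos hκ hb hc q).ne' (hR.coefV_pos hκ hb hc q).ne'

include hR in
theorem bsMetric_eq (q : ASDBundle R) (ξ ζ : E4 × E3) : bsMetric R κ b c q ξ ζ =
    coefW R κ b c q ^ 2 * inner ℝ ξ.1 ζ.1 + coefV R κ b c q ^ 2 * inner ℝ ξ.2 ζ.2 := by
  have h : bsMetric R κ b c q ξ ζ = coefW R κ b c q ^ 2 * R.metric q.1
      (mfderiv I7 (𝓡 4) (proj R) q ξ) (mfderiv I7 (𝓡 4) (proj R) q ζ) +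
      coefV R κ b c q ^ 2 * vertMetric R q ξ ζ := rfl
  rw [h, hR.vertMetric_eq, mfderiv_proj, mfderiv_proj]
  congr 2
  exact hR.metric_center _ _ _

theorem bsMetric_iso (q : ASDBundle R) (ξ ζ : TangentSpace I7 q) : bsMetric R κ b c q ξ ζ =
    ∑ k, hR.iso hκ hb hc q ξ k * hR.iso hκ hb hc q ζ k := by
  refine (hR.bsMetric_eq q ξ ζ).trans ?_
  exact (modelIso_inner (hR.volSign_mul_self q.1) (hR.coefW_pos hκ hb hc q).ne'
    (hR.coefV_pos hκ hb hc q).ne' ξ ζ).symm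

include hR in
theorem bsForm_eq (q : ASDBundle R) (ξ₀ ξ₁ ξ₂ : E4 × E3) : bsForm R κ b c q ![ξ₀, ξ₁, ξ₂] =
    coefV R κ b c q ^ 3 * (volSign R q.1 * stdVol 3 ![ξ₀.2, ξ₁.2, ξ₂.2]) +
      coefW R κ b c q ^ 2 * coefV R κ b c q * (flatASD (volSign R q.1) ξ₀.2 ξ₁.1 ξ₂.1 -
        flatASD (volSign R q.1) ξ₁.2 ξ₀.1 ξ₂.1 + flatASD (volSign R q.1) ξ₂.2 ξ₀.1 ξ₁.1) := by
  have h : bsForm R κ b c q ![ξ₀, ξ₁, ξ₂] = coefV R κ b c q ^ 3 * vertVol R q ![ξ₀, ξ₁, ξ₂] +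
      (coefW R κ b c q ^ 2 * coefV R κ b c q) * extD (tautForm R) q ![ξ₀, ξ₁, ξ₂] := rfl
  have hv : vertVol R q ![ξ₀, ξ₁, ξ₂] = volSign R q.1 * stdVol 3 ![ξ₀.2, ξ₁.2, ξ₂.2] :=
    (hR.vertVol_eq q ![ξ₀, ξ₁, ξ₂]).trans (congrArg (fun f => volSign R q.1 * stdVol 3 f)
      (funext fun i => by fin_cases i <;> rfl))
  exact h.trans (congrArg₂ (· + ·) (congrArg _ hv) (congrArg _ (hR.extD_taut q ξ₀ ξ₁ ξ₂)))

theorem bsForm_iso (q : ASDBundle R) (ξ : Fin 3 → TangentSpace I7 q) :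
    bsForm R κ b c q ξ = stdPhi fun i => hR.iso hκ hb hc q (ξ i) := by
  have e : ξ = ![ξ 0, ξ 1, ξ 2] := by ext i : 1; fin_cases i <;> rfl
  have e2 : (fun i => hR.iso hκ hb hc q (ξ i)) =
      ![hR.iso hκ hb hc q (ξ 0), hR.iso hκ hb hc q (ξ 1), hR.iso hκ hb hc q (ξ 2)] := by
    ext i : 1; fin_cases i <;> rfl
  rw [e2]
  refine (congrArg (bsForm R κ b c q) e).trans ((hR.bsForm_eq q (ξ 0) (ξ 1) (ξ 2)).trans ?_)
  rw [← stdPhi_modelIso (hR.volSign_mul_self q.1) (hR.coefW_pos hκ hb hc q).ne'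
    (hR.coefV_pos hκ hb hc q).ne' (ξ 0) (ξ 1) (ξ 2)]
  rfl

/-- A frame in which the structure is the standard one. -/
def frame (q : ASDBundle R) (i : Fin 7) : E4 × E3 := (hR.iso hκ hb hc q).symm (Pi.single i 1)

theorem frame_fst_eq_zero (q : ASDBundle R) (i : Fin 3) :
    (hR.frame hκ hb hc q (Fin.castAdd 4 i)).1 = 0 := by
  have h : hR.frame hκ hb hc q (Fin.castAdd 4 i) = _ := modelIso_symm_apply
    (hR.volSign_mul_self q.1) (hR.coefW_pos hκ hb hc q).ne' (hR.coefV_pos hκ hb hc q).ne' _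
  rw [h]
  ext j
  fin_cases i <;> fin_cases j <;> simp

/-- The pulled-back volume form kills vertical vectors, so only the identity shuffle survives when
the first three arguments are vertical. -/
theorem wedge_pullbackVol (q : ASDBundle R) (α : TangentSpace I7 q [⋀^Fin 3]→L[ℝ] ℝ)
    (e : Fin (3 + 4) → TangentSpace I7 q) (he : ∀ i : Fin 3, (e (Fin.castAdd 4 i) : E4 × E3).1 = 0) :
    wedge α (pullbackForm (I := I7) (proj R) R.vol q) e = α (fun i => e (Fin.castAdd 4 i)) *
      pullbackForm (I := I7) (proj R) R.vol q (fun j => e (Fin.natAdd 3 j)) := by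
  refine wedge_apply_of_right_zero _ _ _ fun i f j hf => ?_
  rw [pullbackForm, ContinuousAlternatingMap.compContinuousLinearMap_apply]
  refine ContinuousAlternatingMap.map_coord_zero _ j ?_
  simp only [Function.comp_apply, hf]
  exact (mfderiv_proj q _).trans (he i)

theorem pullbackVol_frame (q : ASDBundle R) : pullbackForm (I := I7) (proj R) R.vol q
    (fun j => hR.frame hκ hb hc q (Fin.natAdd 3 j)) = (coefW R κ b c q ^ 4)⁻¹ := by
  have h : ∀ i, hR.frame hκ hb hc q i = _ := fun i => modelIso_symm_apply
    (hR.volSign_mul_self q.1) (hR.coefW_pos hκ hb hc q).ne' (hR.coefV_pos hκ hb hc q).ne' _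
  refine (pullbackVol_eq q _).trans ?_
  have e : (fun i => (hR.frame hκ hb hc q (Fin.natAdd 3 i)).1) =
      ![(hR.frame hκ hb hc q 3).1, (hR.frame hκ hb hc q 4).1, (hR.frame hκ hb hc q 5).1,
        (hR.frame hκ hb hc q 6).1] := by
    ext i : 1; fin_cases i <;> rfl
  rw [e, stdVol_four]
  simp only [h]
  simp
  have hσ := hR.volSign_mul_self q.1
  linear_combination ((coefW R κ b c q) ^ 4)⁻¹ * hσ

theorem vertVol_frame (q : ASDBundle R) : vertVol R q
    (fun j => hR.frame hκ hb hc q (Fin.castAdd 4 j)) = (coefV R κ b c q ^ 3)⁻¹ := by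
  have h : ∀ i, hR.frame hκ hb hc q i = _ := fun i => modelIso_symm_apply
    (hR.volSign_mul_self q.1) (hR.coefW_pos hκ hb hc q).ne' (hR.coefV_pos hκ hb hc q).ne' _
  refine (hR.vertVol_eq q _).trans ?_
  have e : (fun i => (hR.frame hκ hb hc q (Fin.castAdd 4 i)).2) =
      ![(hR.frame hκ hb hc q 0).2, (hR.frame hκ hb hc q 1).2, (hR.frame hκ hb hc q 2).2] := by
    ext i : 1; fin_cases i <;> rfl
  rw [e, stdVol_three]
  simp only [h]
  simp
  have hσ := hR.volSign_mul_self q.1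
  linear_combination ((coefV R κ b c q) ^ 3)⁻¹ * (volSign R q.1 * volSign R q.1 + 1) * hσ

theorem bsVol_apply (q : ASDBundle R) (e : Fin (3 + 4) → TangentSpace I7 q) :
    bsVol R κ b c q e = (coefV R κ b c q ^ 3 * coefW R κ b c q ^ 4) *
      wedge (vertVol R q) (pullbackForm (I := I7) (proj R) R.vol q) e := by
  rw [bsVol, ContinuousAlternatingMap.smul_apply, smul_eq_mul]

theorem bsVol_frame (q : ASDBundle R) : bsVol R κ b c q (hR.frame hκ hb hc q) = 1 := by
  have h1 := (hR.coefW_pos hκ hb hc q).ne'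
  have h2 := (hR.coefV_pos hκ hb hc q).ne'
  have h3 : wedge (vertVol R q) (pullbackForm (I := I7) (proj R) R.vol q) (hR.frame hκ hb hc q) =
      (coefV R κ b c q ^ 3)⁻¹ * (coefW R κ b c q ^ 4)⁻¹ :=
    (wedge_pullbackVol q _ _ (hR.frame_fst_eq_zero hκ hb hc q)).trans
      (congrArg₂ (· * ·) (hR.vertVol_frame hκ hb hc q) (hR.pullbackVol_frame hκ hb hc q))
  refine (bsVol_apply q _).trans ?_
  rw [h3]
  field_simp

theorem frame_orthonormal (q : ASDBundle R) :
    IsOrthonormalFrame (T := TangentSpace I7 q) (bsMetric R κ b c q) (hR.frame hκ hb hc q) :=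
  frame_of_iso (hR.iso hκ hb hc q) (bsMetric R κ b c q) (hR.bsMetric_iso hκ hb hc q)

theorem bsVol_iso_symm (q : ASDBundle R) : bsVol R κ b c q
    (fun i : Fin 7 => (hR.iso hκ hb hc q).symm (Pi.single i 1)) = 1 := by
  have h : (fun i : Fin 7 => (hR.iso hκ hb hc q).symm (Pi.single i 1)) = hR.frame hκ hb hc q := rfl
  rw [h]
  exact hR.bsVol_frame hκ hb hc q

include hR hκ hb hc in
theorem bs_isOrientedInner (q : ASDBundle R) :
    IsOrientedInner (bsMetric R κ b c q) (bsVol R κ b c q) := by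
  have h := hR.bsVol_iso_symm hκ hb hc q
  have h1 := hR.bsMetric_iso hκ hb hc q
  generalize bsVol R κ b c q = vol at *
  generalize bsMetric R κ b c q = g at *
  generalize hR.iso hκ hb hc q = L at *
  exact isOrientedInner_of_iso L g vol h1 h

theorem bsVol_iso (q : ASDBundle R) (e : Fin 7 → TangentSpace I7 q) :
    bsVol R κ b c q e = (Matrix.of fun i => hR.iso hκ hb hc q (e i)).det := by
  have h := hR.bsVol_iso_symm hκ hb hc q
  generalize bsVol R κ b c q = vol at *
  generalize hR.iso hκ hb hc q = L at *
  exact topForm_eq_det L vol h e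

theorem bsForm_frame (q : ASDBundle R) (a : Fin 3 → Fin 7) :
    bsForm R κ b c q (hR.frame hκ hb hc q ∘ a) = g2Coeff a := by
  rw [← stdPhi_single]
  refine (hR.bsForm_iso hκ hb hc q _).trans (congrArg stdPhi (funext fun i => ?_))
  exact (hR.iso hκ hb hc q).apply_symm_apply _

include hR hκ hb hc in
theorem bs_isCalibration : IsCalibration (bsMetric R κ b c) (bsForm R κ b c) := by
  intro q e he
  rw [hR.bsForm_iso hκ hb hc]
  refine stdPhi_le_one _ fun i j => ?_
  rw [← hR.bsMetric_iso hκ hb hc]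
  exact he i j

/-- The coordinates `iso` carry oriented orthonormal frames to matrices of determinant one with
orthonormal rows, for which the duality of the model forms is known. -/
theorem stdPsi_dual (q : ASDBundle R) (e : Fin 7 → TangentSpace I7 q)
    (he : IsOrthonormalFrame (bsMetric R κ b c q) e) (hv : bsVol R κ b c q e = 1) :
    stdPsi (fun i => hR.iso hκ hb hc q (![e 3, e 4, e 5, e 6] i)) =
      bsForm R κ b c q ![e 0, e 1, e 2] := by
  rw [hR.bsForm_iso hκ hb hc]
  have h := stdPsi_eq_stdPhi (fun i => hR.iso hκ hb hc q (e i)) (fun i j => by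
    rw [← hR.bsMetric_iso hκ hb hc]; exact he i j) (by rw [← hR.bsVol_iso hκ hb hc]; exact hv)
  convert h using 2
  · ext i : 1; fin_cases i <;> rfl
  · ext i : 1; fin_cases i <;> rfl

include hR hκ hb hc in
-- Of the adapted frame, three vectors are killed by the projection and the other four have images
-- of length `1 / w`.
theorem diffNormSq_eq (q : ASDBundle R) :
    diffNormSq (bsMetric R κ b c) R.metric (proj R) q = 4 / coefW R κ b c q ^ 2 := by
  let e : Module.Basis (Fin 7) ℝ (TangentSpace I7 q) :=
    Module.Basis.ofEquivFun (hR.iso hκ hb hc q)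
  have he : ∀ i, e i = hR.frame hκ hb hc q i := fun i => by simp [e, frame]
  have h := metricTrace_eq_sum (fun v w => bsMetric R κ b c q v w)
    (fun v w => R.metric q.1 (mfderiv I7 (𝓡 4) (proj R) q v) (mfderiv I7 (𝓡 4) (proj R) q w))
    (ContinuousLinearMap.coeLM ℝ ∘ₗ (bsMetric R κ b c q).toLinearMap)
    (ContinuousLinearMap.coeLM ℝ ∘ₗ ((ContinuousLinearMap.precomp ℝ (mfderiv I7 (𝓡 4) (proj R) q)) ∘L
      (R.metric q.1) ∘L (mfderiv I7 (𝓡 4) (proj R) q)).toLinearMap) (fun _ _ => rfl) (fun _ _ => rfl)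
    e (fun i j => by rw [he, he]; exact hR.frame_orthonormal hκ hb hc q i j)
  refine h.trans ?_
  have h2 : ∀ i, R.metric q.1 (mfderiv I7 (𝓡 4) (proj R) q (e i))
      (mfderiv I7 (𝓡 4) (proj R) q (e i)) =
      inner ℝ (hR.frame hκ hb hc q i).1 (hR.frame hκ hb hc q i).1 := fun i => by
    rw [he]
    exact (congrArg₂ (fun v w : E4 => R.metric q.1 v w) (mfderiv_proj q _) (mfderiv_proj q _)).trans
      (hR.metric_center _ _ _)
  simp only [h2]
  have h3 : ∀ i, hR.frame hκ hb hc q i = _ := fun i => modelIso_symm_apply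
    (hR.volSign_mul_self q.1) (hR.coefW_pos hκ hb hc q).ne' (hR.coefV_pos hκ hb hc q).ne' _
  simp only [h3, e4_inner]
  simp [Pi.single_apply, Fin.sum_univ_succ]
  have hσ := hR.volSign_mul_self q.1
  linear_combination ((coefW R κ b c q) ^ 2)⁻¹ * hσ

include hR hκ hb hc in
theorem sqrt_diffNormSq (q : ASDBundle R) :
    Real.sqrt (diffNormSq (bsMetric R κ b c) R.metric (proj R) q) = 2 / coefW R κ b c q := by
  have h := hR.coefW_pos hκ hb hc q
  rw [hR.diffNormSq_eq hκ hb hc, show 4 / coefW R κ b c q ^ 2 = (2 / coefW R κ b c q) ^ 2 by ring]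
  exact Real.sqrt_sq (by positivity)

theorem sqrt_four : Real.sqrt 4 = 2 := by
  rw [show (4 : ℝ) = 2 ^ 2 by norm_num]; exact Real.sqrt_sq (by norm_num)

include hR hκ hb hc in
theorem dilation (q : ASDBundle R) :
    Real.sqrt (diffNormSq (bsMetric R κ b c) R.metric (proj R) q) / Real.sqrt 4 =
      1 / coefW R κ b c q := by
  rw [hR.sqrt_diffNormSq hκ hb hc, sqrt_four]; ring

theorem mfderiv_proj_surjective (q : ASDBundle R) :
    Function.Surjective (mfderiv I7 (𝓡 4) (proj R) q) := fun v =>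
  ⟨((v, 0) : E4 × E3), mfderiv_proj q _⟩

include hR hκ hb hc in
-- Two top-degree forms need only be compared on one basis. On the adapted frame `φ` is one on the
-- vertical vectors, and both sides equal `w⁻⁴`.
theorem bs_wedge_eq (q : ASDBundle R) :
    wedge (bsForm R κ b c q) (pullbackForm (I := I7) (proj R) R.vol q) =
      (1 / Real.sqrt (4 : ℕ) ^ 4 *
        Real.sqrt (diffNormSq (bsMetric R κ b c) R.metric (proj R) q) ^ 4) • bsVol R κ b c q := by
  let e : Module.Basis (Fin (3 + 4)) ℝ (TangentSpace I7 q) :=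
    Module.Basis.ofEquivFun (hR.iso hκ hb hc q)
  have he : (e : Fin (3 + 4) → TangentSpace I7 q) = hR.frame hκ hb hc q := by
    ext i : 1; simp [e, frame]
  refine topForm_ext e ?_
  rw [he]
  refine (wedge_pullbackVol q _ _ (hR.frame_fst_eq_zero hκ hb hc q)).trans ?_
  have h1 : bsForm R κ b c q (fun i => hR.frame hκ hb hc q (Fin.castAdd 4 i)) = 1 := by
    have h2 : (fun i => hR.frame hκ hb hc q (Fin.castAdd 4 i)) =
        hR.frame hκ hb hc q ∘ ![0, 1, 2] := by ext i : 1; fin_cases i <;> rfl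
    refine (congrArg (bsForm R κ b c q) h2).trans ((hR.bsForm_frame hκ hb hc q _).trans ?_)
    simp [g2Coeff, Matrix.det_fin_three]
  have h := (hR.coefW_pos hκ hb hc q).ne'
  rw [hR.sqrt_diffNormSq hκ hb hc]
  refine (congrArg₂ (· * ·) h1 (hR.pullbackVol_frame hκ hb hc q)).trans ?_
  refine Eq.trans ?_ (congrArg (fun r => (1 / Real.sqrt (4 : ℕ) ^ 4 * (2 / coefW R κ b c q) ^ 4) * r)
    (hR.bsVol_frame hκ hb hc q)).symm
  rw [show ((4 : ℕ) : ℝ) = 4 by norm_num, sqrt_four]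
  field_simp

include hR hκ hb hc in
-- The metric is block diagonal in `E4 × E3`. Testing orthogonality against the vertical vector with
-- the same fibre component shows that this component is zero; on what remains `h` is `w² g`, while
-- `|du|² / 4` is `w⁻²`.
theorem bs_conformal (q : ASDBundle R) (v w : TangentSpace I7 q)
    (hv : IsHorizontal (𝓡 4) (bsMetric R κ b c) (proj R) v) :
    R.metric q.1 (mfderiv I7 (𝓡 4) (proj R) q v) (mfderiv I7 (𝓡 4) (proj R) q w) =
      1 / (4 : ℕ) * diffNormSq (bsMetric R κ b c) R.metric (proj R) q * bsMetric R κ b c q v w := by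
  have hW := (hR.coefW_pos hκ hb hc q).ne'
  have hV := hR.coefV_pos hκ hb hc q
  have h1 : (v : E4 × E3).2 = 0 := by
    have h2 := hv (((0, (v : E4 × E3).2) : E4 × E3)) (mfderiv_proj q _)
    have h3 := (hR.bsMetric_eq q v (0, (v : E4 × E3).2)).symm.trans h2
    simpa [hV.ne'] using h3
  have h4 := hR.bsMetric_eq (b := b) (c := c) q v w
  rw [h1, inner_zero_left] at h4
  rw [hR.diffNormSq_eq hκ hb hc, h4]
  refine (congrArg₂ (fun v w : E4 => R.metric q.1 v w) (mfderiv_proj q _) (mfderiv_proj q _)).trans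
      ((hR.metric_center _ _ _).trans ?_)
  push_cast
  field_simp
  ring

include hR hκ hb hc in
-- On vertical triples `φ` equals `v³ σ D`, with `D` the determinant of the fibre components, and so
-- does `v³ vol_V`. Orthonormality makes this number `±1`. The volume of the full frame is this
-- number times a positive factor, so the orientation condition selects `+1`.
theorem bs_fibresCalibrated : FibresCalibrated (J := 𝓡 4) (k := 4) (l := 3) (bsMetric R κ b c)
    (bsVol R κ b c) R.vol (bsForm R κ b c) (proj R) := by
  intro q e he hk hpos hvol
  have hV := hR.coefV_pos hκ hb hc q
  have hW := hR.coefW_pos hκ hb hc q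
  have hσ := hR.volSign_mul_self q.1
  have hz : ∀ i : Fin 3, (e (Fin.castAdd 4 i) : E4 × E3).1 = 0 := fun i =>
    (mfderiv_proj q _).symm.trans (hk i)
  have h1 : bsVol R κ b c q e = (coefV R κ b c q ^ 3 * coefW R κ b c q ^ 4) *
      (vertVol R q (fun i => e (Fin.castAdd 4 i)) *
        pullbackForm (I := I7) (proj R) R.vol q (fun j => e (Fin.natAdd 3 j))) :=
    (bsVol_apply q e).trans (congrArg _ (wedge_pullbackVol q _ _ hz))
  rw [hvol] at h1
  have h2 : (vertVol R q fun i => e (Fin.castAdd 4 i)) =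
      volSign R q.1 * stdVol 3 fun i => (e (Fin.castAdd 4 i) : E4 × E3).2 :=
    hR.vertVol_eq q _
  set D := stdVol 3 fun i => (e (Fin.castAdd 4 i) : E4 × E3).2
  -- The Gram matrix of a vertical orthonormal triple is `v²` times the matrix of fibre components
  -- times its transpose; its determinant gives the relation.
  have h3 : D * D * coefV R κ b c q ^ 6 = 1 := by
    have hdet : D = (Matrix.of fun i j : Fin 3 =>
        (e (Fin.castAdd 4 i) : E4 × E3).2 j).det := by
      rw [← Matrix.det_transpose]
      exact stdVol_apply _
    have hm : (coefV R κ b c q ^ 2) • ((Matrix.of fun i j : Fin 3 =>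
        (e (Fin.castAdd 4 i) : E4 × E3).2 j) * (Matrix.of fun i j : Fin 3 =>
        (e (Fin.castAdd 4 i) : E4 × E3).2 j).transpose) = 1 := by
      ext i j
      have h4 := he (Fin.castAdd 4 i) (Fin.castAdd 4 j)
      have h5 := (hR.bsMetric_eq q (e (Fin.castAdd 4 i)) (e (Fin.castAdd 4 j))).symm.trans h4
      rw [hz, inner_zero_left, mul_zero, zero_add, PiLp.inner_apply] at h5
      rw [Matrix.smul_apply, Matrix.mul_apply, Matrix.one_apply]
      have h7 : (Fin.castAdd 4 i = Fin.castAdd 4 j) = (i = j) := by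
        rw [Fin.castAdd_inj]
      simp only [h7] at h5
      simpa [mul_comm] using h5
    have h6 := congrArg Matrix.det hm
    rw [Matrix.det_smul, Matrix.det_mul, Matrix.det_transpose, ← hdet, Matrix.det_one] at h6
    simp at h6
    linear_combination h6
  have h4 : bsForm R κ b c q (fun i => e (Fin.castAdd 4 i)) =
      coefV R κ b c q ^ 3 * (volSign R q.1 * D) := by
    have e3 : (fun i => e (Fin.castAdd 4 i)) = ![e (Fin.castAdd 4 0), e (Fin.castAdd 4 1),
      e (Fin.castAdd 4 2)] := by ext i : 1; fin_cases i <;> rfl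
    refine (congrArg (bsForm R κ b c q) e3).trans ((hR.bsForm_eq q _ _ _).trans ?_)
    have e4 : D = stdVol 3 ![(e (Fin.castAdd 4 0) : E4 × E3).2, (e (Fin.castAdd 4 1) : E4 × E3).2,
        (e (Fin.castAdd 4 2) : E4 × E3).2] :=
      congrArg (stdVol 3) (funext fun i => by fin_cases i <;> rfl)
    rw [hz, hz, hz, e4]
    simp [flatASD]
  rw [h2] at h1
  set P := pullbackForm (I := I7) (proj R) R.vol q (fun j => e (Fin.natAdd 3 j))
  have h5 : 0 < coefV R κ b c q ^ 3 * (volSign R q.1 * D) := by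
    refine pos_of_mul_pos_left (b := coefW R κ b c q ^ 4 * P) ?_ (by positivity)
    have : coefV R κ b c q ^ 3 * (volSign R q.1 * D) * (coefW R κ b c q ^ 4 * P) = 1 := by
      rw [h1]; ring
    rw [this]; exact one_pos
  rw [h4]
  have h6 : (coefV R κ b c q ^ 3 * (volSign R q.1 * D)) *
      (coefV R κ b c q ^ 3 * (volSign R q.1 * D)) = 1 := by
    linear_combination h3 + (D * D * coefV R κ b c q ^ 6) * hσ
  rcases mul_self_eq_one_iff.mp h6 with h | h
  · exact h
  · linarith

end NormalCharts
end Forms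

/-! ### Identities for flat anti-self-dual forms -/

section Algebra

/-- The value of `η ∧ ζ` on four vectors, for bilinear forms. -/
def wedgePair (η ζ : E4 → E4 → ℝ) (u : Fin 4 → E4) : ℝ :=
  η (u 0) (u 1) * ζ (u 2) (u 3) + η (u 2) (u 3) * ζ (u 0) (u 1) -
    η (u 0) (u 2) * ζ (u 1) (u 3) - η (u 1) (u 3) * ζ (u 0) (u 2) +
    η (u 0) (u 3) * ζ (u 1) (u 2) + η (u 1) (u 2) * ζ (u 0) (u 3)

/-- Since `⋆b = -b`, the wedge product of `a` and `b` is minus their usual inner product times the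
volume form, and the usual inner product is twice the one in these coordinates. The wedge product
thus recovers the fibre metric in any chart without inverting the base metric. -/
theorem wedgePair_flatASD {σ : ℝ} (hσ : σ * σ = 1) (a b : E3) (u : Fin 4 → E4) :
    wedgePair (flatASD σ a) (flatASD σ b) u = -2 * σ * inner ℝ a b * stdVol 4 u := by
  obtain ⟨x, y, z, w, rfl⟩ : ∃ x y z w, u = ![x, y, z, w] :=
    ⟨u 0, u 1, u 2, u 3, by ext i : 1; fin_cases i <;> rfl⟩
  rw [stdVol_four, e3_inner]
  simp only [wedgePair, flatASD, Matrix.cons_val]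
  rcases mul_self_eq_one_iff.mp hσ with rfl | rfl
  · ring
  · ring

theorem flatASD_flatTriple {σ : ℝ} (hσ : σ * σ = 1) (n s v w : E4) :
    flatASD σ (flatTriple σ n s) v w = inner ℝ n v * inner ℝ s w - inner ℝ n w * inner ℝ s v -
      σ * stdVol 4 ![n, s, v, w] := by
  rw [stdVol_four]
  simp only [e4_inner, flatTriple, flatASD]
  rcases mul_self_eq_one_iff.mp hσ with rfl | rfl
  · simp; ring
  · simp; ring

/-- For fixed `n`, the map `x ↦ flatTriple σ n x` is a similarity with factor `|n|` on the
orthogonal complement of `n` and kills `n`. With `n = ∂₀` it compares the fibre coordinates of a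
chart with orthonormal ones. -/
theorem flatTriple_det {σ : ℝ} (hσ : σ * σ = 1) (n x y z : E4) :
    stdVol 3 ![flatTriple σ n x, flatTriple σ n y, flatTriple σ n z] =
      inner ℝ n n * stdVol 4 ![n, x, y, z] := by
  rw [stdVol_four, stdVol_three]
  simp only [e4_inner, flatTriple, flatASD]
  rcases mul_self_eq_one_iff.mp hσ with rfl | rfl
  · simp; ring
  · simp; ring

theorem flatASD_eq_inner (σ : ℝ) (a : E3) (v w : E4) :
    flatASD σ a v w = inner ℝ a (flatTriple σ v w) := by
  rw [e3_inner]
  simp [flatASD, flatTriple]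

/-- The matrix of inner products is the product of the matrices of the two triples, so this is
multiplicativity of the determinant. -/
theorem stdVol_three_inner (a b c x y z : E3) :
    stdVol 3 ![WithLp.toLp 2 ![inner ℝ a x, inner ℝ a y, inner ℝ a z],
      WithLp.toLp 2 ![inner ℝ b x, inner ℝ b y, inner ℝ b z],
      WithLp.toLp 2 ![inner ℝ c x, inner ℝ c y, inner ℝ c z]] =
      stdVol 3 ![a, b, c] * stdVol 3 ![x, y, z] := by
  simp only [stdVol_three, e3_inner]
  simp
  ring

end Algebra

/-! ### Tensors of the bundle written in one fixed chart -/

section Local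
variable {X : Type*} [TopologicalSpace X] [ChartedSpace E4 X] [IsManifold (𝓡 4) ∞ X]
  (R : OrientedMetric (𝓡 4) X 4)

/-- The density of the vertical volume form in a chart. -/
def locScale (x₀ : X) (y : E4) : ℝ :=
  (localBilin R.metric x₀ y (stdVec 0) (stdVec 0) * localForm R.vol x₀ y stdVec)⁻¹

/-- The inner product of anti-self-dual forms in a chart. -/
def locInner (x₀ : X) (a b : E3) (y : E4) : ℝ :=
  -wedgePair (fun v w => locASD R x₀ a y ![v, w]) (fun v w => locASD R x₀ b y ![v, w]) stdVec *
    (2 * localForm R.vol x₀ y stdVec)⁻¹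

/-- The coordinates of the anti-self-dual part of `n♭ ∧ s♭` in a chart. -/
def locStar (x₀ : X) (n s : E4) (y : E4) : E3 :=
  WithLp.toLp 2 fun j => localBilin R.metric x₀ y n (stdVec 0) *
      localBilin R.metric x₀ y s (stdVec j.succ) -
    localBilin R.metric x₀ y n (stdVec j.succ) * localBilin R.metric x₀ y s (stdVec 0) -
    localForm R.vol x₀ y ![n, s, stdVec 0, stdVec j.succ]

variable {R}

/-- Both forms are anti-self-dual, and `locStar` lists the values of the right-hand one on `(∂₀,
∂ⱼ)`. -/
theorem locASD_locStar {x₀ : X} {y : E4} (hy : y ∈ (extChartAt (𝓡 4) x₀).target) (n s v w : E4) :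
    locASD R x₀ (locStar R x₀ n s y) y ![v, w] =
      asdOf (localBilin R.metric x₀ y) (localForm R.vol x₀ y) n s ![v, w] := by
  have ho := loc_isOriented (R := R) hy
  have h : locASD R x₀ (locStar R x₀ n s y) y -
      asdOf (localBilin R.metric x₀ y) (localForm R.vol x₀ y) n s = 0 := by
    refine asd_zero_of_coord ho (fun e he hv => ?_) fun j => ?_
    · have h1 := localASD_isASD (locStar R x₀ n s y) e he hv
      have h2 := asdOf_isASD n s e he hv
      rw [ContinuousAlternatingMap.sub_apply, ContinuousAlternatingMap.sub_apply, locASD, h1, h2]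
      ring
    · rw [ContinuousAlternatingMap.sub_apply, asdOf_apply]
      exact sub_eq_zero.mpr (localASD_coord ho (locStar R x₀ n s y) j)
  exact congrArg (fun η => η ![v, w]) (sub_eq_zero.mp h)

/-- The components `τ` in a chart represent the flat coordinates `S` with respect to `A`. -/
def Represents (R : OrientedMetric (𝓡 4) X 4) (x₀ : X) (y : E4) (σ : ℝ) (A : E4 → E4) (S τ : E3) :
    Prop :=
  ∀ v w, flatASD σ S (A v) (A w) = locASD R x₀ τ y ![v, w]

section Representation
variable {x₀ : X} {y : E4} {σ : ℝ} {A : E4 → E4}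
  (hy : y ∈ (extChartAt (𝓡 4) x₀).target) (hσ : σ * σ = 1)
  (hG : ∀ v w, localBilin R.metric x₀ y v w = inner ℝ (A v) (A w))
  (hV : ∀ v : Fin 4 → E4, localForm R.vol x₀ y v = σ * stdVol 4 fun i => A (v i))
include hy hσ hV

/-- A represented form has the same wedge products in flat and in chart coordinates; by
`wedgePair_flatASD` these determine the inner product, and `locInner` is defined by the resulting
quotient. -/
theorem Represents.inner_eq {S S' τ τ' : E3} (h : Represents R x₀ y σ A S τ)
    (h' : Represents R x₀ y σ A S' τ') : inner ℝ S S' = locInner R x₀ τ τ' y := by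
  have h1 := wedgePair_flatASD hσ S S' fun i => A (stdVec i)
  have h2 : wedgePair (flatASD σ S) (flatASD σ S') (fun i => A (stdVec i)) =
      wedgePair (fun v w => locASD R x₀ τ y ![v, w]) (fun v w => locASD R x₀ τ' y ![v, w])
        stdVec := by
    simp only [wedgePair, h _ _, h' _ _]
  have hne := vol_stdVec_ne_zero (loc_isOriented (R := R) hy)
  rw [locInner, ← h2, h1, eq_mul_inv_iff_mul_eq₀ (by positivity), hV]
  ring

include hG

/-- The chart coordinates of a form are the inner products of `S` with `flatTriple σ (A ∂₀) (A ∂ⱼ)`.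
The two determinants therefore differ by the determinant of these three vectors, which
`flatTriple_det` evaluates as the inverse of `locScale` up to the sign `σ`. -/
theorem Represents.stdVol_eq {S₀ S₁ S₂ τ₀ τ₁ τ₂ : E3} (h₀ : Represents R x₀ y σ A S₀ τ₀)
    (h₁ : Represents R x₀ y σ A S₁ τ₁) (h₂ : Represents R x₀ y σ A S₂ τ₂) :
    σ * stdVol 3 ![S₀, S₁, S₂] = locScale R x₀ y * stdVol 3 ![τ₀, τ₁, τ₂] := by
  have ho := loc_isOriented (R := R) hy
  have h : ∀ {S τ : E3}, Represents R x₀ y σ A S τ → τ = WithLp.toLp 2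
      ![inner ℝ S (flatTriple σ (A (stdVec 0)) (A (stdVec 1))),
        inner ℝ S (flatTriple σ (A (stdVec 0)) (A (stdVec 2))),
        inner ℝ S (flatTriple σ (A (stdVec 0)) (A (stdVec 3)))] := by
    intro S τ hS
    ext j
    rw [← flatASD_eq_inner, ← flatASD_eq_inner, ← flatASD_eq_inner, hS, hS, hS]
    have := localASD_coord ho τ j
    fin_cases j
    · exact this.symm
    · exact this.symm
    · exact this.symm
  have hv : localForm R.vol x₀ y stdVec =
      σ * stdVol 4 ![A (stdVec 0), A (stdVec 1), A (stdVec 2), A (stdVec 3)] := by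
    rw [hV]
    congr 2
    ext i : 1; fin_cases i <;> rfl
  have h0 := (ho.pos _ (stdVec_ne_zero 0)).ne'
  have hne := vol_stdVec_ne_zero ho
  rw [h h₀, h h₁, h h₂, stdVol_three_inner, flatTriple_det hσ, locScale]
  rw [hG] at h0 ⊢
  rw [hv] at hne ⊢
  have := right_ne_zero_of_mul hne
  have := left_ne_zero_of_mul hne
  field_simp
  linear_combination stdVol 3 ![S₀, S₁, S₂] * hσ

theorem represents_flatTriple (n s : E4) :
    Represents R x₀ y σ A (flatTriple σ (A n) (A s)) (locStar R x₀ n s y) := by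
  intro v w
  have e : (fun i => A (![n, s, v, w] i)) = ![A n, A s, A v, A w] := by
    ext i : 1; fin_cases i <;> rfl
  rw [locASD_locStar hy, asdOf_apply, flatASD_flatTriple hσ, hG, hG, hG, hG, hV, e]

end Representation

/-- The matrix of the coordinate frame in the chart at `x₀` with respect to the chart at `x`. -/
def baseFrame (x₀ x : X) (v : E4) : E4 := coordFrame (𝓡 4) x₀ x v

theorem localForm_eq_transition {x₀ x : X} (hx : x ∈ (chartAt E4 x₀).source) (v : Fin 4 → E4) :
    localForm R.vol x₀ (extChartAt (𝓡 4) x₀ x) v =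
      volSign R x * stdVol 4 fun i => baseFrame x₀ x (v i) := by
  rw [localForm, chart_left_inv hx, frameForm_apply]
  exact congrArg (fun η : E4 [⋀^Fin 4]→L[ℝ] ℝ => η fun i => coordFrame (𝓡 4) x₀ x (v i))
    (form4_eq (R.vol x))

/-- The vertical component of a tangent vector with components `ξ` in a chart. -/
def locTau (R : OrientedMetric (𝓡 4) X 4) (x₀ : X) (z ξ : E4 × E3) : E3 :=
  ξ.2 - locRate R x₀ z.2 z.1 ξ.1

/-- The matrix of the coordinate frame of the bundle. -/
def bundleFrame (p₀ q : ASDBundle R) (ξ : E4 × E3) : E4 × E3 := coordFrame I7 p₀ q ξ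

/-- The function `c + 2κb²r²` in a chart. -/
def locBase (R : OrientedMetric (𝓡 4) X 4) (κ b c : ℝ) (x₀ : X) (z : E4 × E3) : ℝ :=
  c + 2 * κ * b ^ 2 * locInner R x₀ z.2 z.2 z.1

/-- The point with given coordinates in a chart. -/
def bundlePoint (p₀ : ASDBundle R) (z : E4 × E3) : ASDBundle R :=
  ⟨(extChartAt (𝓡 4) p₀.1).symm z.1, asdOfCoords R p₀.1 ((extChartAt (𝓡 4) p₀.1).symm z.1) z.2⟩

theorem localForm_bundle {k : ℕ} (α : DiffForm I7 (ASDBundle R) k) (p₀ : ASDBundle R) {z : E4 × E3}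
    (hz : z.1 ∈ (extChartAt (𝓡 4) p₀.1).target) (ξ : Fin k → E4 × E3) :
    localForm α p₀ z ξ = α (bundlePoint p₀ z) fun i => bundleFrame p₀ (bundlePoint p₀ z) (ξ i) := by
  rw [localForm, frameForm_apply, show z = (z.1, z.2) from rfl, bundle_extChartAt_symm p₀ hz]
  rfl

theorem localBilin_bundle (g : BilinField I7 (ASDBundle R)) (p₀ : ASDBundle R) {z : E4 × E3}
    (hz : z.1 ∈ (extChartAt (𝓡 4) p₀.1).target) (ξ ζ : E4 × E3) :
    localBilin g p₀ z ξ ζ = g (bundlePoint p₀ z) (bundleFrame p₀ (bundlePoint p₀ z) ξ)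
      (bundleFrame p₀ (bundlePoint p₀ z) ζ) := by
  rw [localBilin, frameBilin_apply, show z = (z.1, z.2) from rfl, bundle_extChartAt_symm p₀ hz]
  rfl

theorem bundlePoint_chart {p₀ : ASDBundle R} {z : E4 × E3}
    (hz : z.1 ∈ (extChartAt (𝓡 4) p₀.1).target) :
    extChartAt (𝓡 4) p₀.1 (bundlePoint p₀ z).1 = z.1 := (extChartAt (𝓡 4) p₀.1).right_inv hz

theorem bundlePoint_coords {p₀ : ASDBundle R} {z : E4 × E3}
    (hz : z.1 ∈ (extChartAt (𝓡 4) p₀.1).target) :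
    asdCoords p₀.1 (bundlePoint p₀ z).2 = z.2 := asdCoords_ofCoords (base_mem_source hz) _

theorem bundlePoint_mem {p₀ : ASDBundle R} {z : E4 × E3}
    (hz : z.1 ∈ (extChartAt (𝓡 4) p₀.1).target) :
    (bundlePoint p₀ z).1 ∈ (chartAt E4 p₀.1).source := base_mem_source hz

namespace NormalCharts
variable {κ : ℝ} (hR : NormalCharts R κ)
include hR

theorem localBilin_eq_transition {x₀ x : X} (hx : x ∈ (chartAt E4 x₀).source) (v w : E4) :
    localBilin R.metric x₀ (extChartAt (𝓡 4) x₀ x) v w =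
      inner ℝ (baseFrame x₀ x v) (baseFrame x₀ x w) := by
  rw [localBilin, chart_left_inv hx, frameBilin_apply]
  exact hR.metric_center _ _ _

theorem represents_asdCoords {p₀ q : ASDBundle R} (hq : q.1 ∈ (chartAt E4 p₀.1).source) :
    Represents R p₀.1 (extChartAt (𝓡 4) p₀.1 q.1) (volSign R q.1) (baseFrame p₀.1 q.1)
      (asdCoords q.1 q.2) (asdCoords p₀.1 q.2) := by
  intro v w
  rw [locASD, localBilin, localForm, chart_left_inv hq, ← form_coordFrame hq]
  exact (hR.form_center q.2 _ _).symm

variable {p₀ : ASDBundle R} {z : E4 × E3} (hz : z.1 ∈ (extChartAt (𝓡 4) p₀.1).target)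
include hz

theorem bundleFrame_fst (ξ : E4 × E3) : (bundleFrame p₀ (bundlePoint p₀ z) ξ).1 =
    baseFrame p₀.1 (bundlePoint p₀ z).1 ξ.1 :=
  (hR.bundle_transition (bundlePoint_mem hz) ξ.1 ξ.2).1

theorem represents_bundleFrame (ξ : E4 × E3) : Represents R p₀.1 z.1
    (volSign R (bundlePoint p₀ z).1) (baseFrame p₀.1 (bundlePoint p₀ z).1)
    (bundleFrame p₀ (bundlePoint p₀ z) ξ).2 (locTau R p₀.1 z ξ) := by
  have h := (hR.bundle_transition (bundlePoint_mem hz) ξ.1 ξ.2).2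
  rw [bundlePoint_chart hz, bundlePoint_coords hz] at h
  exact h

theorem inner_bundleFrame_snd (ξ ζ : E4 × E3) :
    inner ℝ (bundleFrame p₀ (bundlePoint p₀ z) ξ).2 (bundleFrame p₀ (bundlePoint p₀ z) ζ).2 =
      locInner R p₀.1 (locTau R p₀.1 z ξ) (locTau R p₀.1 z ζ) z.1 :=
  Represents.inner_eq hz (hR.volSign_mul_self _) (fun v => by
      have h := localForm_eq_transition (R := R) (bundlePoint_mem hz) v
      rwa [bundlePoint_chart hz] at h)
    (hR.represents_bundleFrame hz ξ) (hR.represents_bundleFrame hz ζ)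

theorem inner_bundleFrame_fst (ξ ζ : E4 × E3) :
    inner ℝ (bundleFrame p₀ (bundlePoint p₀ z) ξ).1 (bundleFrame p₀ (bundlePoint p₀ z) ζ).1 =
      localBilin R.metric p₀.1 z.1 ξ.1 ζ.1 := by
  have h := hR.localBilin_eq_transition (bundlePoint_mem hz) ξ.1 ζ.1
  rw [bundlePoint_chart hz] at h
  rw [hR.bundleFrame_fst hz, hR.bundleFrame_fst hz, h]

/-- The radius is the norm of the point of the fibre, whose coordinates in the two charts represent
the same form. -/
theorem coefBase_bundlePoint (b c : ℝ) :
    coefBase R κ b c (bundlePoint p₀ z) = locBase R κ b c p₀.1 z := by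
  have h := hR.represents_asdCoords (bundlePoint_mem hz)
  rw [bundlePoint_chart hz, bundlePoint_coords hz] at h
  rw [coefBase, locBase, hR.radiusSq_eq, Represents.inner_eq hz (hR.volSign_mul_self _) (fun v => by
      have h := localForm_eq_transition (R := R) (bundlePoint_mem hz) v
      rwa [bundlePoint_chart hz] at h) h h]

theorem stdVol_bundleFrame_snd (ξ₀ ξ₁ ξ₂ : E4 × E3) :
    volSign R (bundlePoint p₀ z).1 * stdVol 3 ![(bundleFrame p₀ (bundlePoint p₀ z) ξ₀).2,
      (bundleFrame p₀ (bundlePoint p₀ z) ξ₁).2, (bundleFrame p₀ (bundlePoint p₀ z) ξ₂).2] =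
      locScale R p₀.1 z.1 * stdVol 3 ![locTau R p₀.1 z ξ₀, locTau R p₀.1 z ξ₁, locTau R p₀.1 z ξ₂] :=
  Represents.stdVol_eq hz (hR.volSign_mul_self _) (fun v w => by
      have h := hR.localBilin_eq_transition (bundlePoint_mem hz) v w
      rwa [bundlePoint_chart hz] at h) (fun v => by
      have h := localForm_eq_transition (R := R) (bundlePoint_mem hz) v
      rwa [bundlePoint_chart hz] at h)
    (hR.represents_bundleFrame hz ξ₀) (hR.represents_bundleFrame hz ξ₁)
    (hR.represents_bundleFrame hz ξ₂)

theorem stdVol_flatTriple_bundleFrame (ξ₀ ξ₁ ξ₂ ξ₃ : E4 × E3) :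
    volSign R (bundlePoint p₀ z).1 * stdVol 3 ![(bundleFrame p₀ (bundlePoint p₀ z) ξ₀).2,
      (bundleFrame p₀ (bundlePoint p₀ z) ξ₁).2, flatTriple (volSign R (bundlePoint p₀ z).1)
        (bundleFrame p₀ (bundlePoint p₀ z) ξ₂).1 (bundleFrame p₀ (bundlePoint p₀ z) ξ₃).1] =
      locScale R p₀.1 z.1 * stdVol 3 ![locTau R p₀.1 z ξ₀, locTau R p₀.1 z ξ₁,
        locStar R p₀.1 ξ₂.1 ξ₃.1 z.1] := by
  have hG : ∀ v w, localBilin R.metric p₀.1 z.1 v w = inner ℝ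
      (baseFrame p₀.1 (bundlePoint p₀ z).1 v) (baseFrame p₀.1 (bundlePoint p₀ z).1 w) :=
    fun v w => by
      have h := hR.localBilin_eq_transition (bundlePoint_mem hz) v w
      rwa [bundlePoint_chart hz] at h
  have hV : ∀ v : Fin 4 → E4, localForm R.vol p₀.1 z.1 v = volSign R (bundlePoint p₀ z).1 *
      stdVol 4 fun i => baseFrame p₀.1 (bundlePoint p₀ z).1 (v i) := fun v => by
      have h := localForm_eq_transition (R := R) (bundlePoint_mem hz) v
      rwa [bundlePoint_chart hz] at h
  have h := represents_flatTriple hz (hR.volSign_mul_self _) hG hV ξ₂.1 ξ₃.1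
  rw [← hR.bundleFrame_fst hz, ← hR.bundleFrame_fst hz] at h
  exact Represents.stdVol_eq hz (hR.volSign_mul_self _) hG hV (hR.represents_bundleFrame hz ξ₀)
    (hR.represents_bundleFrame hz ξ₁) h

theorem flatASD_bundleFrame (ξ₀ ξ₁ ξ₂ : E4 × E3) :
    flatASD (volSign R (bundlePoint p₀ z).1) (bundleFrame p₀ (bundlePoint p₀ z) ξ₀).2
      (bundleFrame p₀ (bundlePoint p₀ z) ξ₁).1 (bundleFrame p₀ (bundlePoint p₀ z) ξ₂).1 =
      locASD R p₀.1 (locTau R p₀.1 z ξ₀) z.1 ![ξ₁.1, ξ₂.1] := by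
  rw [hR.bundleFrame_fst hz, hR.bundleFrame_fst hz]
  exact hR.represents_bundleFrame hz ξ₀ _ _

theorem stdVol_bundleFrame_fst (ξ : Fin 4 → E4 × E3) :
    volSign R (bundlePoint p₀ z).1 * stdVol 4 (fun i => (bundleFrame p₀ (bundlePoint p₀ z) (ξ i)).1) =
      localForm R.vol p₀.1 z.1 fun i => (ξ i).1 := by
  have h := localForm_eq_transition (R := R) (bundlePoint_mem hz) fun i => (ξ i).1
  rw [bundlePoint_chart hz] at h
  rw [h]
  simp only [hR.bundleFrame_fst hz]

end NormalCharts
end Local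

/-! ### Smoothness of the local expressions -/

theorem e3_contDiffAt {z : E4 × E3} {f : Fin 3 → E4 × E3 → ℝ} (h : ∀ j, ContDiffAt ℝ ∞ (f j) z) :
    ContDiffAt ℝ ∞ (fun z => (WithLp.toLp 2 fun j => f j z : E3)) z := by
  exact contDiffAt_piLp _ |>.mpr h

theorem stdVol_three_contDiffAt {z : E4 × E3} {a b c : E4 × E3 → E3} (ha : ContDiffAt ℝ ∞ a z)
    (hb : ContDiffAt ℝ ∞ b z) (hc : ContDiffAt ℝ ∞ c z) :
    ContDiffAt ℝ ∞ (fun z => stdVol 3 ![a z, b z, c z]) z := by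
  refine (ContinuousMultilinearMap.contDiff
    (stdVol 3).toContinuousMultilinearMap).contDiffAt.comp z (contDiffAt_pi.mpr fun i => ?_)
  fin_cases i
  · exact ha
  · exact hb
  · exact hc

section Smoothness
variable {X : Type*} [TopologicalSpace X] [ChartedSpace E4 X] [IsManifold (𝓡 4) ∞ X]
  {R : OrientedMetric (𝓡 4) X 4} {x₀ : X} {z : E4 × E3}
  (hz : z.1 ∈ (extChartAt (𝓡 4) x₀).target)
include hz

theorem localBilin_fst_contDiffAt :
    ContDiffAt ℝ ∞ (fun z : E4 × E3 => localBilin R.metric x₀ z.1) z :=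
  ContDiffAt.comp z (g := localBilin R.metric x₀) (f := fun z : E4 × E3 => z.1)
    (localBilin_contDiffAt hz) contDiffAt_fst

theorem localForm_fst_contDiffAt :
    ContDiffAt ℝ ∞ (fun z : E4 × E3 => localForm R.vol x₀ z.1) z :=
  ContDiffAt.comp z (g := localForm R.vol x₀) (f := fun z : E4 × E3 => z.1)
    (localForm_contDiffAt hz) contDiffAt_fst

theorem locASD_apply_contDiffAt {a : E4 × E3 → E3} {v w : E4 × E3 → E4}
    (ha : ContDiffAt ℝ ∞ a z) (hv : ContDiffAt ℝ ∞ v z) (hw : ContDiffAt ℝ ∞ w z) :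
    ContDiffAt ℝ ∞ (fun z => locASD R x₀ (a z) z.1 ![v z, w z]) z :=
  localASD_apply_contDiffAt (localBilin_fst_contDiffAt hz) (localForm_fst_contDiffAt hz) ha hv hw
    (inner_invertible (loc_isOriented hz)) ((loc_isOriented hz).pos _ (stdVec_ne_zero 0)).ne'

theorem locGamma_contDiffAt (u v : E4) :
    ContDiffAt ℝ ∞ (fun z : E4 × E3 => locGamma R x₀ z.1 u v) z := by
  have hD : ContDiffAt ℝ ∞ (fun z : E4 × E3 => fderiv ℝ (localBilin R.metric x₀) z.1) z :=
    ContDiffAt.comp z (g := fderiv ℝ (localBilin R.metric x₀)) (f := fun z : E4 × E3 => z.1)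
      ((localBilin_contDiffAt hz).fderiv_right (m := ∞) (by norm_cast)) contDiffAt_fst
  refine ContDiffAt.clm_apply (inverse_contDiffAt (localBilin_fst_contDiffAt hz)
    (inner_invertible (loc_isOriented hz))) (ContDiffAt.const_smul _ (clm_contDiffAt fun w => ?_))
  have hc : ∀ v : E4, ContDiffAt ℝ ∞ (fun _ : E4 × E3 => v) z := fun v => contDiffAt_const
  exact ((((hD.clm_apply (hc u)).clm_apply (hc v)).clm_apply (hc w)).add
    (((hD.clm_apply (hc v)).clm_apply (hc u)).clm_apply (hc w))).sub
    (((hD.clm_apply (hc w)).clm_apply (hc u)).clm_apply (hc v))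

theorem locTau_contDiffAt (ξ : E4 × E3) : ContDiffAt ℝ ∞ (fun z => locTau R x₀ z ξ) z := by
  refine contDiffAt_const.sub (e3_contDiffAt fun j => ?_)
  exact (locASD_apply_contDiffAt hz contDiffAt_snd (locGamma_contDiffAt hz _ _)
    contDiffAt_const).add (locASD_apply_contDiffAt hz contDiffAt_snd contDiffAt_const
      (locGamma_contDiffAt hz _ _))

theorem localVol_contDiffAt (u : Fin 4 → E4) :
    ContDiffAt ℝ ∞ (fun z : E4 × E3 => localForm R.vol x₀ z.1 u) z :=
  form_apply_contDiffAt (localForm_fst_contDiffAt hz) u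

theorem localMetric_contDiffAt (u v : E4) :
    ContDiffAt ℝ ∞ (fun z : E4 × E3 => localBilin R.metric x₀ z.1 u v) z :=
  ((localBilin_fst_contDiffAt hz).clm_apply contDiffAt_const).clm_apply contDiffAt_const

theorem locScale_contDiffAt : ContDiffAt ℝ ∞ (fun z : E4 × E3 => locScale R x₀ z.1) z :=
  ((localMetric_contDiffAt hz _ _).mul (localVol_contDiffAt hz _)).inv
    (mul_ne_zero ((loc_isOriented hz).pos _ (stdVec_ne_zero 0)).ne'
      (vol_stdVec_ne_zero (loc_isOriented hz)))

theorem locInner_contDiffAt {a b : E4 × E3 → E3} (ha : ContDiffAt ℝ ∞ a z)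
    (hb : ContDiffAt ℝ ∞ b z) : ContDiffAt ℝ ∞ (fun z => locInner R x₀ (a z) (b z) z.1) z := by
  have h : ∀ {a : E4 × E3 → E3}, ContDiffAt ℝ ∞ a z → ∀ i j : Fin 4,
      ContDiffAt ℝ ∞ (fun z => locASD R x₀ (a z) z.1 ![stdVec i, stdVec j]) z := fun ha i j =>
    locASD_apply_contDiffAt hz ha contDiffAt_const contDiffAt_const
  refine ContDiffAt.mul (ContDiffAt.neg ?_) ((contDiffAt_const.mul (localVol_contDiffAt hz _)).inv
    (mul_ne_zero two_ne_zero (vol_stdVec_ne_zero (loc_isOriented hz))))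
  exact ((((((h ha 0 1).mul (h hb 2 3)).add ((h ha 2 3).mul (h hb 0 1))).sub
    ((h ha 0 2).mul (h hb 1 3))).sub ((h ha 1 3).mul (h hb 0 2))).add
    ((h ha 0 3).mul (h hb 1 2))).add ((h ha 1 2).mul (h hb 0 3))

theorem locStar_contDiffAt (n s : E4) :
    ContDiffAt ℝ ∞ (fun z : E4 × E3 => locStar R x₀ n s z.1) z :=
  e3_contDiffAt fun _ => (((localMetric_contDiffAt hz _ _).mul (localMetric_contDiffAt hz _ _)).sub
    ((localMetric_contDiffAt hz _ _).mul (localMetric_contDiffAt hz _ _))).sub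
    (localVol_contDiffAt hz _)

theorem locBase_contDiffAt (κ b c : ℝ) : ContDiffAt ℝ ∞ (locBase R κ b c x₀) z :=
  contDiffAt_const.add (contDiffAt_const.mul (locInner_contDiffAt hz contDiffAt_snd contDiffAt_snd))

end Smoothness

/-! ### The dual four-form and the chart formulas for all tensors -/

theorem form_eq_mul_det {n : ℕ} {E : Type*} [NormedAddCommGroup E] [NormedSpace ℝ E]
    (α : E [⋀^Fin n]→L[ℝ] ℝ) (e : Module.Basis (Fin n) ℝ E) (ξ : Fin n → E) :
    α ξ = α e * e.det ξ :=
  congrArg (fun β => β ξ) (α.toAlternatingMap.eq_smul_basis_det e)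

/-- A top-degree form is controlled by its value on one basis. On a basis that begins with vertical
vectors the wedge product in `bsVol` is a plain product, which makes smoothness visible. -/
theorem exists_basis_vertical_first : ∃ e : Module.Basis (Fin (3 + 4)) ℝ (E4 × E3),
    ∀ i : Fin 3, (e (Fin.castAdd 4 i)).1 = 0 := by
  let L : (E4 × E3) ≃ₗ[ℝ] (Fin 7 → ℝ) :=
    modelIso (σ := 1) (w := 1) (v := 1) (by norm_num) one_ne_zero one_ne_zero
  refine ⟨Module.Basis.ofEquivFun L, fun i => ?_⟩
  have h : Module.Basis.ofEquivFun L (Fin.castAdd 4 i) =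
      L.symm (Pi.single (Fin.castAdd 4 i) 1) := by simp
  have h2 := modelIso_symm_apply (σ := 1) (w := 1) (v := 1) (by norm_num) one_ne_zero
    one_ne_zero (Pi.single (Fin.castAdd 4 i) 1)
  rw [h, h2]
  ext j
  fin_cases i <;> fin_cases j <;> simp

/-- The Hodge dual of the standard three-form, as an alternating form. -/
def stdPsiForm : (Fin 7 → ℝ) [⋀^Fin 4]→L[ℝ] ℝ :=
  let m (i j k l : Fin 7) : (Fin 7 → ℝ) [⋀^Fin 4]→L[ℝ] ℝ :=
    (stdVol 4).compContinuousLinearMap (LinearMap.toContinuousLinearMap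
      { toFun := fun x => WithLp.toLp 2 fun r => x (![i, j, k, l] r)
        map_add' := fun _ _ => rfl
        map_smul' := fun _ _ => rfl })
  m 3 4 5 6 + (m 1 2 5 6 - m 1 2 3 4) + (m 0 2 4 6 + m 0 2 3 5) + (m 0 1 4 5 - m 0 1 3 6)

theorem stdPsiForm_apply (v : Fin 4 → Fin 7 → ℝ) : stdPsiForm v = stdPsi v := by
  have h : ∀ i j k l : Fin 7, minor4 v i j k l =
      stdVol 4 fun s => WithLp.toLp 2 fun r => v s (![i, j, k, l] r) := fun i j k l =>
    (stdVol_apply fun s => (WithLp.toLp 2 fun r => v s (![i, j, k, l] r) : E4)).symm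
  simp only [stdPsi, h]
  rfl

section LocalExpressions
variable {X : Type*} [TopologicalSpace X] [ChartedSpace E4 X] [IsManifold (𝓡 4) ∞ X]
  {R : OrientedMetric (𝓡 4) X 4} {κ b c : ℝ}

namespace NormalCharts
variable (hR : NormalCharts R κ) (hκ : 0 ≤ κ) (hb : 0 < b) (hc : 0 < c)

/-- The Hodge dual of the Bryant-Salamon form. -/
def bsPsi : DiffForm I7 (ASDBundle R) 4 := fun q =>
  stdPsiForm.compContinuousLinearMap (LinearMap.toContinuousLinearMap
    (hR.iso hκ hb hc q : TangentSpace I7 q →ₗ[ℝ] (Fin 7 → ℝ)))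

theorem bsPsi_apply (q : ASDBundle R) (ξ : Fin 4 → TangentSpace I7 q) :
    hR.bsPsi hκ hb hc q ξ = stdPsi fun i => hR.iso hκ hb hc q (ξ i) := by
  rw [← stdPsiForm_apply]; rfl

theorem bsPsi_isHodgeDual : IsHodgeDual (bsMetric R κ b c) (bsVol R κ b c) (bsForm R κ b c)
    (hR.bsPsi hκ hb hc) := fun q e he hv =>
  (hR.bsPsi_apply hκ hb hc q _).trans (hR.stdPsi_dual hκ hb hc q e he hv)

theorem bsPsi_eq (q : ASDBundle R) (ξ₀ ξ₁ ξ₂ ξ₃ : E4 × E3) :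
    hR.bsPsi hκ hb hc q ![ξ₀, ξ₁, ξ₂, ξ₃] = coefW R κ b c q ^ 4 *
      (volSign R q.1 * stdVol 4 ![ξ₀.1, ξ₁.1, ξ₂.1, ξ₃.1]) -
      coefW R κ b c q ^ 2 * coefV R κ b c q ^ 2 * volSign R q.1 *
        (stdVol 3 ![ξ₀.2, ξ₁.2, flatTriple (volSign R q.1) ξ₂.1 ξ₃.1] -
          stdVol 3 ![ξ₀.2, ξ₂.2, flatTriple (volSign R q.1) ξ₁.1 ξ₃.1] +
          stdVol 3 ![ξ₀.2, ξ₃.2, flatTriple (volSign R q.1) ξ₁.1 ξ₂.1] +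
          stdVol 3 ![ξ₁.2, ξ₂.2, flatTriple (volSign R q.1) ξ₀.1 ξ₃.1] -
          stdVol 3 ![ξ₁.2, ξ₃.2, flatTriple (volSign R q.1) ξ₀.1 ξ₂.1] +
          stdVol 3 ![ξ₂.2, ξ₃.2, flatTriple (volSign R q.1) ξ₀.1 ξ₁.1]) := by
  rw [← stdPsi_modelIso (hR.volSign_mul_self q.1) (hR.coefW_pos hκ hb hc q).ne'
    (hR.coefV_pos hκ hb hc q).ne' ξ₀ ξ₁ ξ₂ ξ₃]
  refine (hR.bsPsi_apply hκ hb hc q ![ξ₀, ξ₁, ξ₂, ξ₃]).trans (congrArg stdPsi (funext fun i => ?_))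
  fin_cases i <;> rfl

include hR hκ hc in
theorem coefW_pow (q : ASDBundle R) : coefW R κ b c q ^ 4 = coefBase R κ b c q ∧
    coefW R κ b c q ^ 2 = coefBase R κ b c q ^ (1 / 2 : ℝ) := by
  have h := (hR.coefBase_pos hκ hc (b := b) q).le
  have e : coefW R κ b c q = coefBase R κ b c q ^ (1 / 4 : ℝ) := rfl
  rw [e, ← Real.rpow_natCast, ← Real.rpow_natCast, ← Real.rpow_mul h, ← Real.rpow_mul h]
  norm_num

include hR hκ hc in
-- The exponents are those for which both forms close up. With `F = c + 2κb²r²`, the derivative of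
-- the coefficient `bF^{1/4}` of `dθ` is `κ/2 · d(r²)` times the coefficient `b³F^{-3/4}` of
-- `vol_V`, and the coefficient `w²v²` in the dual form is constant.
theorem coefV_pow (q : ASDBundle R) :
    coefV R κ b c q ^ 2 = b ^ 2 * coefBase R κ b c q ^ (-1 / 2 : ℝ) ∧
    coefV R κ b c q ^ 3 = b ^ 3 * coefBase R κ b c q ^ (-3 / 4 : ℝ) ∧
    coefW R κ b c q ^ 2 * coefV R κ b c q = b * coefBase R κ b c q ^ (1 / 4 : ℝ) ∧
    coefW R κ b c q ^ 2 * coefV R κ b c q ^ 2 = b ^ 2 ∧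
    coefV R κ b c q ^ 3 * coefW R κ b c q ^ 4 = b ^ 3 * coefBase R κ b c q ^ (1 / 4 : ℝ) := by
  have h := hR.coefBase_pos hκ hc (b := b) q
  have e : coefW R κ b c q = coefBase R κ b c q ^ (1 / 4 : ℝ) := rfl
  have e' : coefV R κ b c q = b * coefBase R κ b c q ^ (-(1 / 4) : ℝ) := rfl
  have hp : ∀ (s : ℝ) (n : ℕ), (coefBase R κ b c q ^ s) ^ n = coefBase R κ b c q ^ (s * n) :=
    fun s n => by rw [← Real.rpow_natCast, ← Real.rpow_mul h.le]
  rw [e, e']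
  refine ⟨?_, ?_, ?_, ?_, ?_⟩
  · rw [mul_pow, hp]; norm_num
  · rw [mul_pow, hp]; norm_num
  · rw [hp, mul_left_comm, ← Real.rpow_add h]; norm_num
  · rw [mul_pow, hp, hp, mul_left_comm, ← Real.rpow_add h]; norm_num
  · rw [mul_pow, hp, hp, mul_assoc, ← Real.rpow_add h]; norm_num

section
variable {p₀ : ASDBundle R} {z : E4 × E3} (hz : z.1 ∈ (extChartAt (𝓡 4) p₀.1).target)

include hR hκ hc hz in
theorem locBase_pos : 0 < locBase R κ b c p₀.1 z := by
  rw [← hR.coefBase_bundlePoint hz]; exact hR.coefBase_pos hκ hc _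

include hR hκ hc hz in
theorem localBilin_bsMetric (ξ ζ : E4 × E3) : localBilin (bsMetric R κ b c) p₀ z ξ ζ =
    locBase R κ b c p₀.1 z ^ (1 / 2 : ℝ) * localBilin R.metric p₀.1 z.1 ξ.1 ζ.1 +
      b ^ 2 * locBase R κ b c p₀.1 z ^ (-1 / 2 : ℝ) *
        locInner R p₀.1 (locTau R p₀.1 z ξ) (locTau R p₀.1 z ζ) z.1 := by
  have h1 := hR.coefW_pow hκ hc (b := b) (bundlePoint p₀ z)
  have h2 := hR.coefV_pow hκ hc (b := b) (bundlePoint p₀ z)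
  rw [localBilin_bundle _ p₀ hz]
  refine (hR.bsMetric_eq _ _ _).trans ?_
  rw [h1.2, h2.1, hR.coefBase_bundlePoint hz, hR.inner_bundleFrame_fst hz,
    hR.inner_bundleFrame_snd hz]

include hR hκ hc hz in
theorem localForm_bsForm (ξ₀ ξ₁ ξ₂ : E4 × E3) :
    localForm (bsForm R κ b c) p₀ z ![ξ₀, ξ₁, ξ₂] =
      b ^ 3 * locBase R κ b c p₀.1 z ^ (-3 / 4 : ℝ) * (locScale R p₀.1 z.1 *
        stdVol 3 ![locTau R p₀.1 z ξ₀, locTau R p₀.1 z ξ₁, locTau R p₀.1 z ξ₂]) +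
      b * locBase R κ b c p₀.1 z ^ (1 / 4 : ℝ) *
        (locASD R p₀.1 (locTau R p₀.1 z ξ₀) z.1 ![ξ₁.1, ξ₂.1] -
          locASD R p₀.1 (locTau R p₀.1 z ξ₁) z.1 ![ξ₀.1, ξ₂.1] +
          locASD R p₀.1 (locTau R p₀.1 z ξ₂) z.1 ![ξ₀.1, ξ₁.1]) := by
  have h2 := hR.coefV_pow hκ hc (b := b) (bundlePoint p₀ z)
  rw [localForm_bundle _ p₀ hz]
  have e : (fun i => bundleFrame p₀ (bundlePoint p₀ z) (![ξ₀, ξ₁, ξ₂] i)) =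
      ![bundleFrame p₀ (bundlePoint p₀ z) ξ₀, bundleFrame p₀ (bundlePoint p₀ z) ξ₁,
        bundleFrame p₀ (bundlePoint p₀ z) ξ₂] := by
    ext i : 1; fin_cases i <;> rfl
  refine (congrArg (bsForm R κ b c (bundlePoint p₀ z)) e).trans ((hR.bsForm_eq _ _ _ _).trans ?_)
  rw [h2.2.1, h2.2.2.1, hR.coefBase_bundlePoint hz, hR.stdVol_bundleFrame_snd hz,
    hR.flatASD_bundleFrame hz, hR.flatASD_bundleFrame hz, hR.flatASD_bundleFrame hz]

include hz in
-- Fractional powers disappear, since `w⁴ = F` and `w²v² = b²`; of the two coefficients only the one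
-- in front of the base volume varies with `r`.
theorem localForm_bsPsi (ξ₀ ξ₁ ξ₂ ξ₃ : E4 × E3) :
    localForm (hR.bsPsi hκ hb hc) p₀ z ![ξ₀, ξ₁, ξ₂, ξ₃] =
      locBase R κ b c p₀.1 z * localForm R.vol p₀.1 z.1 ![ξ₀.1, ξ₁.1, ξ₂.1, ξ₃.1] -
      b ^ 2 * (locScale R p₀.1 z.1 *
        (stdVol 3 ![locTau R p₀.1 z ξ₀, locTau R p₀.1 z ξ₁, locStar R p₀.1 ξ₂.1 ξ₃.1 z.1] -
          stdVol 3 ![locTau R p₀.1 z ξ₀, locTau R p₀.1 z ξ₂, locStar R p₀.1 ξ₁.1 ξ₃.1 z.1] +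
          stdVol 3 ![locTau R p₀.1 z ξ₀, locTau R p₀.1 z ξ₃, locStar R p₀.1 ξ₁.1 ξ₂.1 z.1] +
          stdVol 3 ![locTau R p₀.1 z ξ₁, locTau R p₀.1 z ξ₂, locStar R p₀.1 ξ₀.1 ξ₃.1 z.1] -
          stdVol 3 ![locTau R p₀.1 z ξ₁, locTau R p₀.1 z ξ₃, locStar R p₀.1 ξ₀.1 ξ₂.1 z.1] +
          stdVol 3 ![locTau R p₀.1 z ξ₂, locTau R p₀.1 z ξ₃, locStar R p₀.1 ξ₀.1 ξ₁.1 z.1])) := by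
  have h1 := hR.coefW_pow hκ hc (b := b) (bundlePoint p₀ z)
  have h2 := hR.coefV_pow hκ hc (b := b) (bundlePoint p₀ z)
  rw [localForm_bundle _ p₀ hz]
  set T := bundleFrame p₀ (bundlePoint p₀ z) with hT
  have e : (fun i => T (![ξ₀, ξ₁, ξ₂, ξ₃] i)) = ![T ξ₀, T ξ₁, T ξ₂, T ξ₃] := by
    ext i : 1; fin_cases i <;> rfl
  have e' : localForm R.vol p₀.1 z.1 ![ξ₀.1, ξ₁.1, ξ₂.1, ξ₃.1] =
      volSign R (bundlePoint p₀ z).1 * stdVol 4 ![(T ξ₀).1, (T ξ₁).1, (T ξ₂).1, (T ξ₃).1] := by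
    have h := hR.stdVol_bundleFrame_fst hz ![ξ₀, ξ₁, ξ₂, ξ₃]
    have e1 : (fun i => ((![ξ₀, ξ₁, ξ₂, ξ₃] : Fin 4 → E4 × E3) i).1) =
        ![ξ₀.1, ξ₁.1, ξ₂.1, ξ₃.1] := by ext i : 1; fin_cases i <;> rfl
    have e2 : (fun i => (T ((![ξ₀, ξ₁, ξ₂, ξ₃] : Fin 4 → E4 × E3) i)).1) =
        ![(T ξ₀).1, (T ξ₁).1, (T ξ₂).1, (T ξ₃).1] := by ext i : 1; fin_cases i <;> rfl
    rw [e1, e2] at h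
    exact h.symm
  refine (congrArg (hR.bsPsi hκ hb hc (bundlePoint p₀ z)) e).trans
    ((hR.bsPsi_eq hκ hb hc _ _ _ _ _).trans ?_)
  have hs := hR.stdVol_flatTriple_bundleFrame hz
  rw [h1.1, h2.2.2.2.1, hR.coefBase_bundlePoint hz, e']
  linear_combination (-b ^ 2) * (hs ξ₀ ξ₁ ξ₂ ξ₃ - hs ξ₀ ξ₂ ξ₁ ξ₃ + hs ξ₀ ξ₃ ξ₁ ξ₂ +
    hs ξ₁ ξ₂ ξ₀ ξ₃ - hs ξ₁ ξ₃ ξ₀ ξ₂ + hs ξ₂ ξ₃ ξ₀ ξ₁)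

include hR in
theorem bsVol_eq (q : ASDBundle R) (ξ : Fin (3 + 4) → E4 × E3)
    (hξ : ∀ i : Fin 3, (ξ (Fin.castAdd 4 i)).1 = 0) :
    bsVol R κ b c q ξ = coefV R κ b c q ^ 3 * coefW R κ b c q ^ 4 *
      ((volSign R q.1 * stdVol 3 fun i => (ξ (Fin.castAdd 4 i)).2) *
        (volSign R q.1 * stdVol 4 fun i => (ξ (Fin.natAdd 3 i)).1)) := by
  refine (bsVol_apply q ξ).trans ?_
  exact congrArg _ ((wedge_pullbackVol q _ ξ hξ).trans
    (congrArg₂ (· * ·) (hR.vertVol_eq q _) (pullbackVol_eq q _)))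

include hR hκ hc hz in
-- Changes of bundle charts preserve vertical vectors, so the product formula remains valid after
-- passing to the normal chart.
theorem localForm_bsVol (ξ : Fin (3 + 4) → E4 × E3)
    (hξ : ∀ i : Fin 3, (ξ (Fin.castAdd 4 i)).1 = 0) :
    localForm (bsVol R κ b c) p₀ z ξ = b ^ 3 * locBase R κ b c p₀.1 z ^ (1 / 4 : ℝ) *
      (locScale R p₀.1 z.1 * stdVol 3 ![locTau R p₀.1 z (ξ (Fin.castAdd 4 0)),
        locTau R p₀.1 z (ξ (Fin.castAdd 4 1)), locTau R p₀.1 z (ξ (Fin.castAdd 4 2))] *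
        localForm R.vol p₀.1 z.1 fun i => (ξ (Fin.natAdd 3 i)).1) := by
  have h2 := hR.coefV_pow hκ hc (b := b) (bundlePoint p₀ z)
  rw [localForm_bundle _ p₀ hz]
  rw [hR.bsVol_eq _ _ fun i => by rw [hR.bundleFrame_fst hz, hξ]; exact map_zero _, h2.2.2.2.2,
    hR.coefBase_bundlePoint hz, hR.stdVol_bundleFrame_fst hz fun i => ξ (Fin.natAdd 3 i),
    ← hR.stdVol_bundleFrame_snd hz]
  congr 4
  ext i : 1
  fin_cases i <;> rfl

end

variable (p₀ : ASDBundle R)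

theorem contDiffOn_bundle {G : Type*} [NormedAddCommGroup G] [NormedSpace ℝ G] {f : E4 × E3 → G}
    (h : ∀ z : E4 × E3, z.1 ∈ (extChartAt (𝓡 4) p₀.1).target → ContDiffAt ℝ ∞ f z) :
    ContDiffOn ℝ ∞ f (extChartAt I7 p₀).target := fun z hz => by
  rw [bundle_extChartAt_target] at hz
  exact (h z hz.1).contDiffWithinAt

theorem eventually_target {z : E4 × E3} (hz : z.1 ∈ (extChartAt (𝓡 4) p₀.1).target) :
    ∀ᶠ z' : E4 × E3 in 𝓝 z, z'.1 ∈ (extChartAt (𝓡 4) p₀.1).target :=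
  (continuous_fst.tendsto z).eventually ((isOpen_extChartAt_target p₀.1).mem_nhds hz)

include hR hκ hc in
theorem bsMetric_smooth : IsSmoothBilin (bsMetric R κ b c) := fun p₀ =>
  contDiffOn_bundle p₀ fun z hz => bilin_contDiffAt fun ξ ζ => by
    have hf := locBase_contDiffAt (R := R) hz κ b c
    have hp := (hR.locBase_pos hκ hc (b := b) hz).ne'
    refine ContDiffAt.congr_of_eventuallyEq ?_ ((eventually_target p₀ hz).mono fun z' hz' =>
      hR.localBilin_bsMetric hκ hc hz' ξ ζ)
    exact ((hf.rpow_const_of_ne hp).mul (localMetric_contDiffAt hz ξ.1 ζ.1)).add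
      ((contDiffAt_const.mul (hf.rpow_const_of_ne hp)).mul (locInner_contDiffAt hz
        (locTau_contDiffAt hz ξ) (locTau_contDiffAt hz ζ)))

include hR hκ hc in
theorem bsForm_smooth : IsSmoothForm (bsForm R κ b c) := fun p₀ =>
  contDiffOn_bundle p₀ fun z hz => form_contDiffAt fun ξ => by
    have hf := locBase_contDiffAt (R := R) hz κ b c
    have hp := (hR.locBase_pos hκ hc (b := b) hz).ne'
    have hτ := fun ξ => locTau_contDiffAt (R := R) hz ξ
    have hN : ∀ ξ ζ η : E4 × E3, ContDiffAt ℝ ∞ (fun z => locASD R p₀.1 (locTau R p₀.1 z ξ) z.1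
        ![ζ.1, η.1]) z := fun ξ ζ η =>
      locASD_apply_contDiffAt hz (hτ ξ) contDiffAt_const contDiffAt_const
    obtain ⟨ξ₀, ξ₁, ξ₂, rfl⟩ : ∃ x y z, ξ = ![x, y, z] :=
      ⟨ξ 0, ξ 1, ξ 2, by ext i : 1; fin_cases i <;> rfl⟩
    refine ContDiffAt.congr_of_eventuallyEq ?_ ((eventually_target p₀ hz).mono fun z' hz' =>
      hR.localForm_bsForm hκ hc hz' ξ₀ ξ₁ ξ₂)
    exact ((contDiffAt_const.mul (hf.rpow_const_of_ne hp)).mul ((locScale_contDiffAt hz).mul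
      (stdVol_three_contDiffAt (hτ ξ₀) (hτ ξ₁) (hτ ξ₂)))).add
      ((contDiffAt_const.mul (hf.rpow_const_of_ne hp)).mul
      (((hN ξ₀ ξ₁ ξ₂).sub (hN ξ₁ ξ₀ ξ₂)).add (hN ξ₂ ξ₀ ξ₁)))

theorem bsPsi_smooth : IsSmoothForm (hR.bsPsi hκ hb hc) := fun p₀ =>
  contDiffOn_bundle p₀ fun z hz => form_contDiffAt fun ξ => by
    have hf := locBase_contDiffAt (R := R) hz κ b c
    have hs : ∀ ξ ζ η θ : E4 × E3, ContDiffAt ℝ ∞ (fun z => stdVol 3 ![locTau R p₀.1 z ξ,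
        locTau R p₀.1 z ζ, locStar R p₀.1 η.1 θ.1 z.1]) z := fun ξ ζ η θ =>
      stdVol_three_contDiffAt (locTau_contDiffAt hz ξ) (locTau_contDiffAt hz ζ)
        (locStar_contDiffAt hz _ _)
    obtain ⟨ξ₀, ξ₁, ξ₂, ξ₃, rfl⟩ : ∃ x y z w, ξ = ![x, y, z, w] :=
      ⟨ξ 0, ξ 1, ξ 2, ξ 3, by ext i : 1; fin_cases i <;> rfl⟩
    refine ContDiffAt.congr_of_eventuallyEq ?_ ((eventually_target p₀ hz).mono fun z' hz' =>
      hR.localForm_bsPsi hκ hb hc hz' ξ₀ ξ₁ ξ₂ ξ₃)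
    exact (hf.mul (localVol_contDiffAt hz _)).sub (contDiffAt_const.mul
      ((locScale_contDiffAt hz).mul ((((((hs ξ₀ ξ₁ ξ₂ ξ₃).sub (hs ξ₀ ξ₂ ξ₁ ξ₃)).add
        (hs ξ₀ ξ₃ ξ₁ ξ₂)).add (hs ξ₁ ξ₂ ξ₀ ξ₃)).sub (hs ξ₁ ξ₃ ξ₀ ξ₂)).add
        (hs ξ₂ ξ₃ ξ₀ ξ₁))))

include hR hκ hc in
theorem bsVol_smooth : IsSmoothForm (bsVol R κ b c) := fun p₀ =>
  contDiffOn_bundle p₀ fun z hz => form_contDiffAt fun ξ => by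
    have hf := locBase_contDiffAt (R := R) hz κ b c
    have hp := (hR.locBase_pos hκ hc (b := b) hz).ne'
    obtain ⟨e, he⟩ := exists_basis_vertical_first
    have h : ContDiffAt ℝ ∞ (fun z => localForm (bsVol R κ b c) p₀ z e) z := by
      refine ContDiffAt.congr_of_eventuallyEq ?_ ((eventually_target p₀ hz).mono fun z' hz' =>
        hR.localForm_bsVol hκ hc hz' e he)
      exact (contDiffAt_const.mul (hf.rpow_const_of_ne hp)).mul (((locScale_contDiffAt hz).mul
        (stdVol_three_contDiffAt (locTau_contDiffAt hz _) (locTau_contDiffAt hz _)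
          (locTau_contDiffAt hz _))).mul (localVol_contDiffAt hz _))
    have h' : ∀ z', localForm (bsVol R κ b c) p₀ z' ξ =
        localForm (bsVol R κ b c) p₀ z' e * e.det ξ := fun z' => by
      generalize localForm (bsVol R κ b c) p₀ z' = α
      exact form_eq_mul_det (n := 3 + 4) α e ξ
    simp only [h']
    exact h.mul contDiffAt_const

include hR hκ hb hc in
theorem bs_isOrientedRiemannian : IsOrientedRiemannian (bsMetric R κ b c) (bsVol R κ b c) where
  inner := hR.bs_isOrientedInner hκ hb hc
  smooth_metric := hR.bsMetric_smooth hκ hc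
  smooth_vol := hR.bsVol_smooth hκ hc

include hR hκ hb hc in
theorem bs_isG2Structure :
    IsG2Structure (bsForm R κ b c) (bsMetric R κ b c) (bsVol R κ b c) :=
  ⟨hR.bsForm_smooth hκ hc, fun q => ⟨hR.frame hκ hb hc q, hR.frame_orthonormal hκ hb hc q,
    hR.bsVol_frame hκ hb hc q, hR.bsForm_frame hκ hb hc q⟩⟩

include hR hκ hb hc in
theorem bs_isSmithSubmersion : IsSmithSubmersion (J := 𝓡 4) (k := 4) (l := 3) (bsMetric R κ b c)
    (bsVol R κ b c) R.metric R.vol (bsForm R κ b c) (proj R) where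
  smooth_form := hR.bsForm_smooth hκ hc
  calibration := hR.bs_isCalibration hκ hb hc
  smooth := proj_contMDiff
  surjective := proj_surjective
  wedge_eq := hR.bs_wedge_eq hκ hb hc
  conformal q v w hv _ := hR.bs_conformal hκ hb hc q v w hv

end NormalCharts
end LocalExpressions

/-! ### Vector identities behind the closedness -/

section Algebra

theorem stdVol_stdVec : stdVol 4 stdVec = 1 := by
  have e : (stdVec : Fin 4 → E4) = ![stdVec 0, stdVec 1, stdVec 2, stdVec 3] := by
    ext i : 1; fin_cases i <;> rfl
  rw [e, stdVol_four]
  simp [stdVec]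

/-- Lagrange's identity for `(a × w) · (s × t)`. It turns a curvature term inside a determinant into
products of inner products. -/
theorem stdVol_cross (a w s t : E3) : stdVol 3 ![cross a w, s, t] =
    inner ℝ a s * inner ℝ w t - inner ℝ a t * inner ℝ w s := by
  simp only [stdVol_three, e3_inner, cross]
  simp
  ring

theorem stdVol_three_swap (x y z : E3) : stdVol 3 ![x, y, z] = -stdVol 3 ![y, x, z] := by
  simp only [stdVol_three]
  ring

theorem stdVol_three_rotate (x y z : E3) : stdVol 3 ![x, y, z] = stdVol 3 ![z, x, y] := by
  simp only [stdVol_three]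
  ring

theorem inner_cross_swap (a w w' : E3) :
    (inner ℝ (cross a w) w' : ℝ) = -inner ℝ (cross a w') w := by
  simp only [e3_inner, cross]
  simp
  ring

/-- The linear relation between four vectors of `ℝ³`, paired with `a`. It expresses that `d(r²) ∧
vol_V` vanishes on fibres of dimension three. -/
theorem inner_mul_stdVol_three (a s₀ s₁ s₂ s₃ : E3) :
    inner ℝ a s₀ * stdVol 3 ![s₁, s₂, s₃] - inner ℝ a s₁ * stdVol 3 ![s₀, s₂, s₃] +
      inner ℝ a s₂ * stdVol 3 ![s₀, s₁, s₃] - inner ℝ a s₃ * stdVol 3 ![s₀, s₁, s₂] = 0 := by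
  simp only [stdVol_three, e3_inner]
  ring

theorem stdVol_three_add (x x' y z : E3) :
    stdVol 3 ![x + x', y, z] = stdVol 3 ![x, y, z] + stdVol 3 ![x', y, z] := by
  simp only [stdVol_three, PiLp.add_apply]
  ring

theorem stdVol_three_neg (x y z : E3) : stdVol 3 ![-x, y, z] = -stdVol 3 ![x, y, z] := by
  simp only [stdVol_three, PiLp.neg_apply]
  ring

theorem stdVol_three_smul (r : ℝ) (x y z : E3) :
    stdVol 3 ![r • x, y, z] = r * stdVol 3 ![x, y, z] := by
  simp only [stdVol_three, PiLp.smul_apply, smul_eq_mul]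
  ring

/-- Each basic form satisfies `ω ∧ ω = -2σ vol`. The three pairings are half of the six terms of
that wedge product, so each of the three forms contributes `-σ vol`. -/
theorem flatTriple_pairing {σ : ℝ} (hσ : σ * σ = 1) (u : Fin 4 → E4) :
    inner ℝ (flatTriple σ (u 0) (u 1)) (flatTriple σ (u 2) (u 3)) -
      inner ℝ (flatTriple σ (u 0) (u 2)) (flatTriple σ (u 1) (u 3)) +
      inner ℝ (flatTriple σ (u 0) (u 3)) (flatTriple σ (u 1) (u 2)) = -3 * σ * stdVol 4 u := by
  have h := fun j : Fin 3 => wedgePair_flatASD hσ (EuclideanSpace.single j 1)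
    (EuclideanSpace.single j 1) u
  have h0 := h 0
  have h1 := h 1
  have h2 := h 2
  simp only [wedgePair, EuclideanSpace.inner_single_left] at h0 h1 h2
  simp only [e3_inner, flatTriple]
  simp at h0 h1 h2 ⊢
  linarith

theorem flatTriple_inner_pairing {σ : ℝ} (hσ : σ * σ = 1) (a b : E3) (u : Fin 4 → E4) :
    inner ℝ a (flatTriple σ (u 0) (u 1)) * inner ℝ b (flatTriple σ (u 2) (u 3)) +
      inner ℝ a (flatTriple σ (u 2) (u 3)) * inner ℝ b (flatTriple σ (u 0) (u 1)) -
      inner ℝ a (flatTriple σ (u 0) (u 2)) * inner ℝ b (flatTriple σ (u 1) (u 3)) -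
      inner ℝ a (flatTriple σ (u 1) (u 3)) * inner ℝ b (flatTriple σ (u 0) (u 2)) +
      inner ℝ a (flatTriple σ (u 0) (u 3)) * inner ℝ b (flatTriple σ (u 1) (u 2)) +
      inner ℝ a (flatTriple σ (u 1) (u 2)) * inner ℝ b (flatTriple σ (u 0) (u 3)) =
      -2 * σ * inner ℝ a b * stdVol 4 u := by
  rw [← wedgePair_flatASD hσ a b u]
  simp only [wedgePair, flatASD_eq_inner]

end Algebra

/-! ### First derivatives at the centre of a normal chart -/

section Derivatives

/-- Once differentiability is known, one-variable calculus along a line computes the derivative; the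
exterior derivatives below are evaluated in this way. -/
theorem fderiv_eq_of_line {E G : Type*} [NormedAddCommGroup E] [NormedSpace ℝ E]
    [NormedAddCommGroup G] [NormedSpace ℝ G] {f : E → G} {z η : E} {d : G}
    (hf : DifferentiableAt ℝ f z) (hd : HasDerivAt (fun t : ℝ => f (z + t • η)) d 0) :
    fderiv ℝ f z η = d := by
  have hl : HasDerivAt (fun t : ℝ => z + t • η) η 0 := by
    simpa using ((hasDerivAt_id (0 : ℝ)).smul_const η).const_add z
  exact (hf.hasFDerivAt.comp_hasDerivAt_of_eq (0 : ℝ) hl (by simp)).unique hd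

theorem hasDerivAt_line_zero {E G : Type*} [NormedAddCommGroup E] [NormedSpace ℝ E]
    [NormedAddCommGroup G] [NormedSpace ℝ G] {f : E → G} {z : E} {f' : E →L[ℝ] G}
    (hf : HasFDerivAt f f' z) (hf' : f' = 0) (η : E) :
    HasDerivAt (fun t : ℝ => f (z + t • η)) 0 0 := by
  have hl : HasDerivAt (fun t : ℝ => z + t • η) η 0 := by
    simpa using ((hasDerivAt_id (0 : ℝ)).smul_const η).const_add z
  have h := hf.comp_hasDerivAt_of_eq (0 : ℝ) hl (by simp)
  rwa [hf', zero_apply] at h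

theorem exists_hasDerivAt_line {E G : Type*} [NormedAddCommGroup E] [NormedSpace ℝ E]
    [NormedAddCommGroup G] [NormedSpace ℝ G] {f : E → G} {z : E}
    (hf : DifferentiableAt ℝ f z) (η : E) :
    ∃ d, HasDerivAt (fun t : ℝ => f (z + t • η)) d 0 := by
  have hl : HasDerivAt (fun t : ℝ => z + t • η) η 0 := by
    simpa using ((hasDerivAt_id (0 : ℝ)).smul_const η).const_add z
  exact ⟨_, hf.hasFDerivAt.comp_hasDerivAt_of_eq (0 : ℝ) hl (by simp)⟩

theorem differentiableAt_of_fst {f : E4 → E4} {y : E4} {a : E3}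
    (h : DifferentiableAt ℝ (fun z : E4 × E3 => f z.1) (y, a)) : DifferentiableAt ℝ f y :=
  DifferentiableAt.comp y (g := fun z : E4 × E3 => f z.1) (f := fun y => (y, a)) h
    (differentiableAt_id.prodMk (differentiableAt_const a))

theorem hasDerivAt_stdVol_three {x y z : ℝ → E3} {x' y' z' : E3} {t : ℝ} (hx : HasDerivAt x x' t)
    (hy : HasDerivAt y y' t) (hz : HasDerivAt z z' t) :
    HasDerivAt (fun t => stdVol 3 ![x t, y t, z t]) (stdVol 3 ![x', y t, z t] +
      stdVol 3 ![x t, y', z t] + stdVol 3 ![x t, y t, z']) t := by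
  have hk : ∀ {x : ℝ → E3} {x' : E3} (i : Fin 3), HasDerivAt x x' t →
      HasDerivAt (fun t => x t i) (x' i) t := fun i h =>
    (EuclideanSpace.proj i : E3 →L[ℝ] ℝ).hasFDerivAt.comp_hasDerivAt t h
  simp only [stdVol_three]
  refine ((((hk 0 hx).mul (((hk 1 hy).mul (hk 2 hz)).sub ((hk 2 hy).mul (hk 1 hz)))).sub
    ((hk 1 hx).mul (((hk 0 hy).mul (hk 2 hz)).sub ((hk 2 hy).mul (hk 0 hz))))).add
    ((hk 2 hx).mul (((hk 0 hy).mul (hk 1 hz)).sub ((hk 1 hy).mul (hk 0 hz))))).congr_deriv ?_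
  simp only [Pi.mul_apply, Pi.sub_apply]
  ring

theorem hasDerivAt_e3 {f : Fin 3 → ℝ → ℝ} {f' : Fin 3 → ℝ} {t : ℝ}
    (h : ∀ j, HasDerivAt (f j) (f' j) t) :
    HasDerivAt (fun t => (WithLp.toLp 2 fun j => f j t : E3)) (WithLp.toLp 2 f') t :=
  (PiLp.hasFDerivAt_toLp 2 _).comp_hasDerivAt t (hasDerivAt_pi.mpr h)

variable {X : Type*} [TopologicalSpace X] [ChartedSpace E4 X] [IsManifold (𝓡 4) ∞ X]
  {R : OrientedMetric (𝓡 4) X 4} {κ b c : ℝ}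

namespace NormalCharts
variable (hR : NormalCharts R κ) (x : X) (u : E4)
include hR

theorem hasDerivAt_metric (v w : E4) : HasDerivAt (fun t : ℝ =>
    localBilin R.metric x (extChartAt (𝓡 4) x x + t • u) v w) 0 0 := by
  refine hasDerivAt_line_zero (f := fun y => localBilin R.metric x y v w)
    (((hR.hasFDerivAt_metric x).clm_apply (hasFDerivAt_const v _)).clm_apply
      (hasFDerivAt_const w _)) ?_ u
  ext; simp

theorem hasDerivAt_vol (v : Fin 4 → E4) : HasDerivAt (fun t : ℝ =>
    localForm R.vol x (extChartAt (𝓡 4) x x + t • u) v) 0 0 :=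
  hasDerivAt_line_zero (f := fun y => localForm R.vol x y v)
    ((ContinuousAlternatingMap.apply ℝ E4 ℝ v).hasFDerivAt.comp _ (hR.hasFDerivAt_vol x))
      (ContinuousLinearMap.comp_zero _) u

theorem hasDerivAt_locStar (n s : E4) : HasDerivAt (fun t : ℝ =>
    locStar R x n s (extChartAt (𝓡 4) x x + t • u)) 0 0 := by
  have hg := hR.hasDerivAt_metric x u
  refine (hasDerivAt_e3 fun j => (((hg n (stdVec 0)).mul (hg s (stdVec j.succ))).sub
    ((hg n (stdVec j.succ)).mul (hg s (stdVec 0)))).sub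
    (hR.hasDerivAt_vol x u ![n, s, stdVec 0, stdVec j.succ])).congr_deriv ?_
  ext j
  simp

theorem hasDerivAt_locScale : HasDerivAt (fun t : ℝ =>
    locScale R x (extChartAt (𝓡 4) x x + t • u)) 0 0 := by
  have ho := loc_isOriented (R := R) (mem_extChartAt_target x)
  refine (((hR.hasDerivAt_metric x u (stdVec 0) (stdVec 0)).mul
    (hR.hasDerivAt_vol x u stdVec)).inv ?_).congr_deriv (by simp)
  simpa using ⟨(ho.pos _ (stdVec_ne_zero 0)).ne', vol_stdVec_ne_zero ho⟩

/-- The coefficient forms are stationary at the centre, so only the fibre coordinates and the two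
arguments contribute, each with the flat form as coefficient. -/
theorem hasDerivAt_locASD {α : ℝ → E3} {p q : ℝ → E4} {α' : E3} {p' q' : E4}
    (hα : HasDerivAt α α' 0) (hp : HasDerivAt p p' 0) (hq : HasDerivAt q q' 0) :
    HasDerivAt (fun t : ℝ => locASD R x (α t) (extChartAt (𝓡 4) x x + t • u) ![p t, q t])
      (flatASD (volSign R x) α' (p 0) (q 0) + flatASD (volSign R x) (α 0) p' (q 0) +
        flatASD (volSign R x) (α 0) (p 0) q') 0 := by
  have hB : ∀ k : Fin 3, HasFDerivAt (fun t : ℝ => toBil (locASD R x (EuclideanSpace.single k 1)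
      (extChartAt (𝓡 4) x x + t • u))) (0 : ℝ →L[ℝ] E4 →L[ℝ] E4 →L[ℝ] ℝ) 0 := fun k => by
    have h := (toBil.hasFDerivAt.comp_hasDerivAt (0 : ℝ) (hasDerivAt_line_zero
      (hR.hasFDerivAt_locASD x (EuclideanSpace.single k 1)) rfl u)).hasFDerivAt
    refine h.congr_fderiv ?_
    ext; simp
  obtain ⟨A, hA, hA'⟩ := hasFDerivAt_sum_bil hB hα.hasFDerivAt hp.hasFDerivAt hq.hasFDerivAt
  have he : ∀ (a : E3) (y v w : E4), locASD R x a y ![v, w] =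
      ∑ k, a k * toBil (locASD R x (EuclideanSpace.single k 1) y) v w := fun a y v w => by
    rw [locASD_sum]
    simp [toBil_apply]
  have hf : ∀ (a : E3) (v w : E4), flatASD (volSign R x) a v w = ∑ k, a k *
      toBil (locASD R x (EuclideanSpace.single k 1) (extChartAt (𝓡 4) x x + (0 : ℝ) • u)) v w :=
    fun a v w => by rw [← he, zero_smul, add_zero, hR.locASD_center]
  have h := hA.hasDerivAt
  rw [hA'] at h
  simp only [he, hf]
  refine h.congr_deriv ?_
  simp

theorem locScale_center : locScale R x (extChartAt (𝓡 4) x x) = volSign R x := by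
  rw [locScale, localBilin_center, localForm_center, hR.metric_center]
  rw [show inner ℝ (stdVec 0) (stdVec 0) = (1 : ℝ) by simp [stdVec], one_mul]
  exact hR.volSign_inv x

theorem locStar_center (n s : E4) : locStar R x n s (extChartAt (𝓡 4) x x) =
    flatTriple (volSign R x) n s := by
  ext j
  simp only [locStar, localBilin_center, localForm_center, hR.metric_center]
  have h := flatASD_flatTriple (hR.volSign_mul_self x) n s (stdVec 0) (stdVec j.succ)
  have h2 : (R.vol x : E4 [⋀^Fin 4]→L[ℝ] ℝ) ![n, s, stdVec 0, stdVec j.succ] =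
      volSign R x * stdVol 4 ![n, s, stdVec 0, stdVec j.succ] := by
    rw [form4_eq (R.vol x : E4 [⋀^Fin 4]→L[ℝ] ℝ)]; rfl
  refine (congrArg _ h2).trans (h.symm.trans ?_)
  fin_cases j <;> simp [flatASD, stdVec]

theorem locInner_center (a b : E3) :
    locInner R x a b (extChartAt (𝓡 4) x x) = inner ℝ a b := by
  have hs := hR.volSign_mul_self x
  have w := wedgePair_flatASD hs a b stdVec
  have hV : localForm R.vol x (extChartAt (𝓡 4) x x) stdVec = volSign R x := localForm_center x _
  have hne : volSign R x ≠ 0 := left_ne_zero_of_mul (hs.trans_ne one_ne_zero)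
  simp only [locInner, hR.locASD_center, hV]
  have e : (fun v w => flatASD (volSign R x) a v w) = flatASD (volSign R x) a := rfl
  rw [stdVol_stdVec] at w
  rw [e, show (fun v w => flatASD (volSign R x) b v w) = flatASD (volSign R x) b from rfl, w]
  field_simp

theorem hasDerivAt_locInner {α β : ℝ → E3} {α' β' : E3} (hα : HasDerivAt α α' 0)
    (hβ : HasDerivAt β β' 0) :
    HasDerivAt (fun t : ℝ => locInner R x (α t) (β t) (extChartAt (𝓡 4) x x + t • u))
      (inner ℝ α' (β 0) + inner ℝ (α 0) β') 0 := by
  have ho := loc_isOriented (R := R) (mem_extChartAt_target x)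
  have h : ∀ {α : ℝ → E3} {α' : E3}, HasDerivAt α α' 0 → ∀ i j : Fin 4,
      HasDerivAt (fun t : ℝ => locASD R x (α t)
        (extChartAt (𝓡 4) x x + t • u) ![stdVec i, stdVec j])
        (flatASD (volSign R x) α' (stdVec i) (stdVec j)) 0 := fun hα i j => by
    refine (hR.hasDerivAt_locASD x u hα (hasDerivAt_const 0 (stdVec i))
      (hasDerivAt_const 0 (stdVec j))).congr_deriv ?_
    simp [flatASD]
  have hv := hR.hasDerivAt_vol x u stdVec
  have hs := hR.volSign_mul_self x
  refine ((((((((h hα 0 1).mul (h hβ 2 3)).add ((h hα 2 3).mul (h hβ 0 1))).sub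
    ((h hα 0 2).mul (h hβ 1 3))).sub ((h hα 1 3).mul (h hβ 0 2))).add
    ((h hα 0 3).mul (h hβ 1 2))).add ((h hα 1 2).mul (h hβ 0 3))).neg.mul
    ((hv.const_mul 2).inv ?_)).congr_deriv ?_
  · simpa using vol_stdVec_ne_zero ho
  have w1 := wedgePair_flatASD hs α' (β 0) stdVec
  have w2 := wedgePair_flatASD hs (α 0) β' stdVec
  have hV : localForm R.vol x (extChartAt (𝓡 4) x x) stdVec = volSign R x := localForm_center x _
  simp only [zero_smul, add_zero, hR.locASD_center, hV, Pi.mul_apply, Pi.add_apply, Pi.sub_apply,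
    Pi.neg_apply, Pi.inv_apply]
  simp only [wedgePair, stdVol_stdVec] at w1 w2
  have hne : volSign R x ≠ 0 := left_ne_zero_of_mul (hs.trans_ne one_ne_zero)
  field_simp
  linear_combination -volSign R x * (w1 + w2)

/-- Rather than the inverse metric, the Koszul identity for `g(Γ(v, w), ∂ₖ)` is differentiated. At
the centre `g` is Euclidean and stationary, so the left side has derivative `⟨Γ', ∂ₖ⟩`, and the
right side involves only `D`. -/
theorem hasDerivAt_locGamma {D : E4 → E4 → E4 → ℝ} (hD : ∀ v w w' : E4, HasDerivAt (fun t : ℝ =>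
      fderiv ℝ (localBilin R.metric x) (extChartAt (𝓡 4) x x + t • u) v w w') (D v w w') 0)
    (v w : E4) : HasDerivAt (fun t : ℝ => locGamma R x (extChartAt (𝓡 4) x x + t • u) v w)
      (koszulVec D v w) 0 := by
  have hc := mem_extChartAt_target (I := 𝓡 4) x
  have hl : HasDerivAt (fun t : ℝ => extChartAt (𝓡 4) x x + t • u) u 0 := by
    simpa using ((hasDerivAt_id (0 : ℝ)).smul_const u).const_add (extChartAt (𝓡 4) x x)
  have h1 : DifferentiableAt ℝ (fun y : E4 => locGamma R x y v w) (extChartAt (𝓡 4) x x) := by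
    have h := (locGamma_contDiffAt (R := R) (x₀ := x) (z := (extChartAt (𝓡 4) x x, 0)) hc
      v w).differentiableAt (by simp)
    exact differentiableAt_of_fst (f := fun y => locGamma R x y v w) h
  obtain ⟨Γ', h⟩ := exists_hasDerivAt_line h1 u
  have hG : HasDerivAt (fun t : ℝ => localBilin R.metric x (extChartAt (𝓡 4) x x + t • u)) 0 0 :=
    hasDerivAt_line_zero (hR.hasFDerivAt_metric x) rfl u
  suffices Γ' = koszulVec D v w by rwa [this] at h
  ext k
  have h1 : HasDerivAt (fun t : ℝ => localBilin R.metric x (extChartAt (𝓡 4) x x + t • u)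
      (locGamma R x (extChartAt (𝓡 4) x x + t • u) v w) (stdVec k))
      (inner ℝ Γ' (stdVec k)) 0 := by
    refine ((hG.clm_apply h).clm_apply (hasDerivAt_const 0 (stdVec k))).congr_deriv ?_
    simp only [zero_smul, add_zero, map_zero, zero_apply, zero_add]
    exact (localBilin_center x _ _).trans (hR.metric_center x _ _)
  have h2 : HasDerivAt (fun t : ℝ => localBilin R.metric x (extChartAt (𝓡 4) x x + t • u)
      (locGamma R x (extChartAt (𝓡 4) x x + t • u) v w) (stdVec k))
      (1 / 2 * (D v w (stdVec k) + D w v (stdVec k) - D (stdVec k) v w)) 0 := by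
    refine ((((hD v w (stdVec k)).add (hD w v (stdVec k))).sub
      (hD (stdVec k) v w)).const_mul (1 / 2)).congr_of_eventuallyEq ?_
    have ht : ∀ᶠ t : ℝ in 𝓝 0, extChartAt (𝓡 4) x x + t • u ∈ (extChartAt (𝓡 4) x).target :=
      hl.continuousAt.eventually (by
        simpa using (isOpen_extChartAt_target x).mem_nhds hc)
    filter_upwards [ht] with t ht
    rw [locGamma, leviCivita]
    rw [(inner_invertible (loc_isOriented (R := R) ht)).self_apply_inverse]
    rfl
  have h3 := h1.unique h2
  rw [EuclideanSpace.inner_eq_star_dotProduct] at h3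
  simpa [stdVec, koszulVec] using h3

/-- The Christoffel symbols vanish at the centre, so in the rate of parallel transport only their
own derivative survives. The skew part of the outcome in the two base directions is the curvature of
the bundle. -/
theorem hasDerivAt_locTau {D : E4 → E4 → E4 → ℝ} (a : E3) (η ξ : E4 × E3)
    (hD : ∀ v w w' : E4, HasDerivAt (fun t : ℝ =>
      fderiv ℝ (localBilin R.metric x) (extChartAt (𝓡 4) x x + t • η.1) v w w') (D v w w') 0) :
    HasDerivAt (fun t : ℝ => locTau R x ((extChartAt (𝓡 4) x x, a) + t • η) ξ)
      (-WithLp.toLp 2 (curvRate (volSign R x) D a ξ.1)) 0 := by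
  have hα : HasDerivAt (fun t : ℝ => a + t • η.2) η.2 0 := by
    simpa using ((hasDerivAt_id (0 : ℝ)).smul_const η.2).const_add a
  have hΓ := hR.hasDerivAt_locGamma x η.1 hD
  have hz : ∀ v : E4, flatASD (volSign R x) η.2 0 v = 0 ∧ flatASD (volSign R x) η.2 v 0 = 0 :=
    fun v => by simp [flatASD]
  refine (HasDerivAt.const_sub ξ.2 (hasDerivAt_e3 fun j => (hR.hasDerivAt_locASD x η.1 hα
    (hΓ ξ.1 (stdVec 0)) (hasDerivAt_const 0 (stdVec j.succ))).add
    (hR.hasDerivAt_locASD x η.1 hα (hasDerivAt_const 0 (stdVec 0))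
      (hΓ ξ.1 (stdVec j.succ))))).congr_deriv ?_
  congr 1
  ext j
  simp only [zero_smul, add_zero, hR.locGamma_center]
  simp [flatASD, curvRate]

theorem locTau_center (a : E3) (ξ : E4 × E3) : locTau R x (extChartAt (𝓡 4) x x, a) ξ = ξ.2 := by
  have : locRate R x a (extChartAt (𝓡 4) x x) ξ.1 = 0 := by
    ext j
    simp only [locRate, transportRate, hR.locGamma_center, hR.locASD_center]
    simp [flatASD]
  rw [locTau, this, sub_zero]

/-- The fibre metric is stationary in base directions, so `r²` has derivative `2⟨a, ·⟩` and is
unchanged to first order along horizontal vectors. -/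
theorem hasDerivAt_locBase (a : E3) (η : E4 × E3) :
    HasDerivAt (fun t : ℝ => locBase R κ b c x ((extChartAt (𝓡 4) x x, a) + t • η))
      (4 * κ * b ^ 2 * inner ℝ a η.2) 0 := by
  have hα : HasDerivAt (fun t : ℝ => a + t • η.2) η.2 0 := by
    simpa using ((hasDerivAt_id (0 : ℝ)).smul_const η.2).const_add a
  refine (((hR.hasDerivAt_locInner x η.1 hα hα).const_mul (2 * κ * b ^ 2)).const_add c).congr_deriv ?_
  rw [zero_smul, add_zero, real_inner_comm a η.2]
  ring

end NormalCharts
end Derivatives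

/-! ### Closedness of the three-form and of its dual -/

section Closed

theorem eventually_line {E : Type*} [NormedAddCommGroup E] [NormedSpace ℝ E] {z : E} {p : E → Prop}
    (h : ∀ᶠ y in 𝓝 z, p y) (η : E) : ∀ᶠ t : ℝ in 𝓝 0, p (z + t • η) := by
  have hl : Filter.Tendsto (fun t : ℝ => z + t • η) (𝓝 0) (𝓝 z) := by
    have : Continuous fun t : ℝ => z + t • η := by fun_prop
    simpa using this.tendsto 0
  exact hl.eventually h

variable {X : Type*} [TopologicalSpace X] [ChartedSpace E4 X] [IsManifold (𝓡 4) ∞ X]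
  {R : OrientedMetric (𝓡 4) X 4} {κ b c : ℝ}

theorem center_mem (q : ASDBundle R) :
    ((extChartAt (𝓡 4) q.1 q.1, asdCoords q.1 q.2) : E4 × E3).1 ∈ (extChartAt (𝓡 4) q.1).target :=
  mem_extChartAt_target q.1

theorem localForm_differentiableAt {k : ℕ} {α : DiffForm I7 (ASDBundle R) k} (hα : IsSmoothForm α)
    (q : ASDBundle R) :
    DifferentiableAt ℝ (localForm α q) (extChartAt (𝓡 4) q.1 q.1, asdCoords q.1 q.2) := by
  have h := ((hα q).contDiffAt ((isOpen_extChartAt_target q).mem_nhds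
    (mem_extChartAt_target q))).differentiableAt (by simp)
  rwa [bundle_extChartAt] at h

/-- The frame of the preferred chart is the identity at its centre, so the exterior derivative is
the alternating sum of directional derivatives on constant vectors. -/
theorem extD_apply_center {k : ℕ} {α : DiffForm I7 (ASDBundle R) k} (hα : IsSmoothForm α)
    (q : ASDBundle R) (ξ : Fin (k + 1) → E4 × E3) :
    extD α q ξ = ∑ i : Fin (k + 1), (-1 : ℝ) ^ (i : ℕ) * fderiv ℝ (fun z => localForm α q z (i.removeNth ξ))
      (extChartAt (𝓡 4) q.1 q.1, asdCoords q.1 q.2) (ξ i) := by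
  have hz : extChartAt I7 q q = (extChartAt (𝓡 4) q.1 q.1, asdCoords q.1 q.2) :=
    bundle_extChartAt q q
  have hE : extD α q ξ = extDeriv (localForm α q)
      (extChartAt (𝓡 4) q.1 q.1, asdCoords q.1 q.2) ξ := by
    rw [← hz]
    exact congrArg (extDeriv (localForm α q) (extChartAt I7 q q))
      (funext fun i => coordFrameInv_self (I := I7) q _)
  rw [hE, extDeriv_apply (localForm_differentiableAt hα q)]
  simp

theorem form_eq_zero {n : ℕ} {q : ASDBundle R} (α : TangentSpace I7 q [⋀^Fin n]→L[ℝ] ℝ)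
    (h : ∀ ξ : Fin n → E4 × E3, α ξ = 0) : α = 0 :=
  ContinuousAlternatingMap.ext h

namespace NormalCharts
variable (hR : NormalCharts R κ) (hκ : 0 ≤ κ) (hb : 0 < b) (hc : 0 < c) (q : ASDBundle R)

include hR hκ hc in
-- Product rule in which only `F` and the vertical components vary. The terms with `⟨a, η⟩` come
-- from `F`: their coefficients are `b³ · (-3/4) · 4κb²` and `b · (1/4) · 4κb²`. The terms with `Q`
-- come from the vertical components.
theorem fderiv_bsForm {D : E4 → E4 → E4 → E4 → ℝ} (hD : ∀ u' u v w : E4, HasDerivAt (fun t : ℝ =>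
      fderiv ℝ (localBilin R.metric q.1) (extChartAt (𝓡 4) q.1 q.1 + t • u') u v w) (D u' u v w) 0)
    (η ξ₀ ξ₁ ξ₂ : E4 × E3) :
    let Q := fun u' u : E4 =>
      (WithLp.toLp 2 (curvRate (volSign R q.1) (D u') (asdCoords q.1 q.2) u) : E3)
    let N := flatASD (volSign R q.1)
    let F := locBase R κ b c q.1 (extChartAt (𝓡 4) q.1 q.1, asdCoords q.1 q.2)
    fderiv ℝ (fun z => localForm (bsForm R κ b c) q z ![ξ₀, ξ₁, ξ₂])
      (extChartAt (𝓡 4) q.1 q.1, asdCoords q.1 q.2) η =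
    -3 * κ * b ^ 5 * F ^ (-7 / 4 : ℝ) * volSign R q.1 *
        inner ℝ (asdCoords q.1 q.2) η.2 * stdVol 3 ![ξ₀.2, ξ₁.2, ξ₂.2] -
      b ^ 3 * F ^ (-3 / 4 : ℝ) * volSign R q.1 *
        (stdVol 3 ![Q η.1 ξ₀.1, ξ₁.2, ξ₂.2] - stdVol 3 ![Q η.1 ξ₁.1, ξ₀.2, ξ₂.2] +
          stdVol 3 ![Q η.1 ξ₂.1, ξ₀.2, ξ₁.2]) +
      b ^ 3 * F ^ (-3 / 4 : ℝ) * κ * inner ℝ (asdCoords q.1 q.2) η.2 *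
        (N ξ₀.2 ξ₁.1 ξ₂.1 - N ξ₁.2 ξ₀.1 ξ₂.1 + N ξ₂.2 ξ₀.1 ξ₁.1) -
      b * F ^ (1 / 4 : ℝ) *
        (N (Q η.1 ξ₀.1) ξ₁.1 ξ₂.1 - N (Q η.1 ξ₁.1) ξ₀.1 ξ₂.1 + N (Q η.1 ξ₂.1) ξ₀.1 ξ₁.1) := by
  intro Q N F
  set a := asdCoords q.1 q.2 with ha
  set z₀ : E4 × E3 := (extChartAt (𝓡 4) q.1 q.1, a) with hz₀
  have hz : z₀.1 ∈ (extChartAt (𝓡 4) q.1).target := center_mem q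
  have hd : DifferentiableAt ℝ (fun z => localForm (bsForm R κ b c) q z ![ξ₀, ξ₁, ξ₂]) z₀ :=
    (ContinuousAlternatingMap.apply ℝ (E4 × E3) ℝ ![ξ₀, ξ₁, ξ₂]).differentiableAt.comp z₀
      (localForm_differentiableAt (hR.bsForm_smooth hκ hc) q)
  refine fderiv_eq_of_line hd ?_
  have ht := eventually_line (eventually_target q hz) η
  have hB : HasDerivAt (fun t : ℝ => locBase R κ b c q.1 (z₀ + t • η)) _ 0 :=
    hR.hasDerivAt_locBase q.1 a η
  have hτ : ∀ ξ, HasDerivAt (fun t : ℝ => locTau R q.1 (z₀ + t • η) ξ) (-Q η.1 ξ.1) 0 :=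
    fun ξ => hR.hasDerivAt_locTau q.1 a η ξ (hD η.1)
  have hN : ∀ ξ ζ θ : E4 × E3, HasDerivAt (fun t : ℝ => locASD R q.1
      (locTau R q.1 (z₀ + t • η) ξ) (z₀ + t • η).1 ![ζ.1, θ.1]) (-N (Q η.1 ξ.1) ζ.1 θ.1) 0 :=
    fun ξ ζ θ => by
      refine (hR.hasDerivAt_locASD q.1 η.1 (hτ ξ) (hasDerivAt_const 0 ζ.1)
        (hasDerivAt_const 0 θ.1)).congr_deriv ?_
      simp [flatASD, N, Q]
      ring
  have hS : HasDerivAt (fun t : ℝ => locScale R q.1 (z₀ + t • η).1) 0 0 :=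
    hR.hasDerivAt_locScale q.1 η.1
  have e0 : z₀ + (0 : ℝ) • η = z₀ := by rw [zero_smul, add_zero]
  have hne : locBase R κ b c q.1 (z₀ + (0 : ℝ) • η) ≠ 0 := by rw [e0]; exact (hR.locBase_pos hκ hc hz).ne'
  refine HasDerivAt.congr_of_eventuallyEq ?_ (ht.mono fun t ht =>
    hR.localForm_bsForm hκ hc ht ξ₀ ξ₁ ξ₂)
  refine ((((hB.rpow_const (Or.inl hne)).const_mul (b ^ 3)).mul
    (hS.mul (hasDerivAt_stdVol_three (hτ ξ₀) (hτ ξ₁) (hτ ξ₂)))).add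
    (((hB.rpow_const (Or.inl hne)).const_mul b).mul
    (((hN ξ₀ ξ₁ ξ₂).sub (hN ξ₁ ξ₀ ξ₂)).add (hN ξ₂ ξ₀ ξ₁)))).congr_deriv ?_
  have hτ0' : ∀ ξ : E4 × E3, locTau R q.1 z₀ ξ = ξ.2 := fun ξ =>
    hR.locTau_center q.1 a ξ
  have hN0 : ∀ (s : E3) (v w : E4), locASD R q.1 s z₀.1 ![v, w] = N s v w := fun s v w =>
    hR.locASD_center q.1 s v w
  have hS0 : locScale R q.1 z₀.1 = volSign R q.1 := hR.locScale_center q.1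
  have hF : locBase R κ b c q.1 z₀ = F := rfl
  have p1 : (-3 / 4 - 1 : ℝ) = -7 / 4 := by norm_num
  have p2 : (1 / 4 - 1 : ℝ) = -3 / 4 := by norm_num
  -- The differentiated vector is moved to the first slot of each determinant, so that the later
  -- cancellations see terms of a single shape.
  have d1 : ∀ x y z : E3, stdVol 3 ![y, -x, z] = stdVol 3 ![x, y, z] := fun x y z => by
    rw [stdVol_three_swap, stdVol_three_neg, neg_neg]
  have d2 : ∀ x y z : E3, stdVol 3 ![y, z, -x] = -stdVol 3 ![x, y, z] := fun x y z => by
    rw [stdVol_three_rotate, stdVol_three_neg]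
  simp only [e0, hτ0', hN0, hS0, hF, p1, p2, d1, d2, stdVol_three_neg, Pi.add_apply, Pi.sub_apply,
    Pi.mul_apply]
  ring

/-- As `b²` is constant, `F` is differentiated only in front of the base volume. In the other part
the vertical components vary, while the scale and the anti-self-dual triple are stationary. -/
theorem fderiv_bsPsi {D : E4 → E4 → E4 → E4 → ℝ} (hD : ∀ u' u v w : E4, HasDerivAt (fun t : ℝ =>
      fderiv ℝ (localBilin R.metric q.1) (extChartAt (𝓡 4) q.1 q.1 + t • u') u v w) (D u' u v w) 0)
    (η ξ₀ ξ₁ ξ₂ ξ₃ : E4 × E3) :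
    let Q := fun u' u : E4 =>
      (WithLp.toLp 2 (curvRate (volSign R q.1) (D u') (asdCoords q.1 q.2) u) : E3)
    let W := flatTriple (volSign R q.1)
    fderiv ℝ (fun z => localForm (hR.bsPsi hκ hb hc) q z ![ξ₀, ξ₁, ξ₂, ξ₃])
      (extChartAt (𝓡 4) q.1 q.1, asdCoords q.1 q.2) η =
    4 * κ * b ^ 2 * volSign R q.1 * inner ℝ (asdCoords q.1 q.2) η.2 *
        stdVol 4 ![ξ₀.1, ξ₁.1, ξ₂.1, ξ₃.1] +
      b ^ 2 * volSign R q.1 *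
        ((stdVol 3 ![Q η.1 ξ₀.1, ξ₁.2, W ξ₂.1 ξ₃.1] - stdVol 3 ![Q η.1 ξ₁.1, ξ₀.2, W ξ₂.1 ξ₃.1]) -
         (stdVol 3 ![Q η.1 ξ₀.1, ξ₂.2, W ξ₁.1 ξ₃.1] - stdVol 3 ![Q η.1 ξ₂.1, ξ₀.2, W ξ₁.1 ξ₃.1]) +
         (stdVol 3 ![Q η.1 ξ₀.1, ξ₃.2, W ξ₁.1 ξ₂.1] - stdVol 3 ![Q η.1 ξ₃.1, ξ₀.2, W ξ₁.1 ξ₂.1]) +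
         (stdVol 3 ![Q η.1 ξ₁.1, ξ₂.2, W ξ₀.1 ξ₃.1] - stdVol 3 ![Q η.1 ξ₂.1, ξ₁.2, W ξ₀.1 ξ₃.1]) -
         (stdVol 3 ![Q η.1 ξ₁.1, ξ₃.2, W ξ₀.1 ξ₂.1] - stdVol 3 ![Q η.1 ξ₃.1, ξ₁.2, W ξ₀.1 ξ₂.1]) +
         (stdVol 3 ![Q η.1 ξ₂.1, ξ₃.2, W ξ₀.1 ξ₁.1] -
           stdVol 3 ![Q η.1 ξ₃.1, ξ₂.2, W ξ₀.1 ξ₁.1])) := by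
  intro Q W
  set a := asdCoords q.1 q.2 with ha
  set z₀ : E4 × E3 := (extChartAt (𝓡 4) q.1 q.1, a) with hz₀
  have hz : z₀.1 ∈ (extChartAt (𝓡 4) q.1).target := center_mem q
  have hd : DifferentiableAt ℝ
      (fun z => localForm (hR.bsPsi hκ hb hc) q z ![ξ₀, ξ₁, ξ₂, ξ₃]) z₀ :=
    (ContinuousAlternatingMap.apply ℝ (E4 × E3) ℝ ![ξ₀, ξ₁, ξ₂, ξ₃]).differentiableAt.comp z₀
      (localForm_differentiableAt (hR.bsPsi_smooth hκ hb hc) q)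
  refine fderiv_eq_of_line hd ?_
  have ht := eventually_line (eventually_target q hz) η
  have hB : HasDerivAt (fun t : ℝ => locBase R κ b c q.1 (z₀ + t • η)) _ 0 :=
    hR.hasDerivAt_locBase q.1 a η
  have hτ := fun ξ => hR.hasDerivAt_locTau q.1 a η ξ (hD η.1)
  have hS : HasDerivAt (fun t : ℝ => locScale R q.1 (z₀ + t • η).1) 0 0 :=
    hR.hasDerivAt_locScale q.1 η.1
  have hV : ∀ v, HasDerivAt (fun t : ℝ => localForm R.vol q.1 (z₀ + t • η).1 v) 0 0 :=
    hR.hasDerivAt_vol q.1 η.1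
  have e0 : z₀ + (0 : ℝ) • η = z₀ := by rw [zero_smul, add_zero]
  have hW0 : ∀ v w : E4, locStar R q.1 v w z₀.1 = W v w := hR.locStar_center q.1
  have hτ0' : ∀ ξ : E4 × E3, locTau R q.1 (extChartAt (𝓡 4) q.1 q.1, a) ξ = ξ.2 := fun ξ =>
    hR.locTau_center q.1 a ξ
  have d0 : ∀ x y : E3, stdVol 3 ![x, y, 0] = 0 := fun x y => by simp [stdVol_three]
  have d1 : ∀ x y z : E3, stdVol 3 ![y, -x, z] = stdVol 3 ![x, y, z] := fun x y z => by
    rw [stdVol_three_swap, stdVol_three_neg, neg_neg]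
  have hs : ∀ ξ ζ η' θ : E4 × E3, HasDerivAt (fun t : ℝ => stdVol 3 ![locTau R q.1 (z₀ + t • η) ξ,
      locTau R q.1 (z₀ + t • η) ζ, locStar R q.1 η'.1 θ.1 (z₀ + t • η).1])
      (-(stdVol 3 ![Q η.1 ξ.1, ζ.2, W η'.1 θ.1] - stdVol 3 ![Q η.1 ζ.1, ξ.2, W η'.1 θ.1])) 0 :=
    fun ξ ζ η' θ => by
      refine (hasDerivAt_stdVol_three (hτ ξ) (hτ ζ)
        (hR.hasDerivAt_locStar q.1 η.1 η'.1 θ.1)).congr_deriv ?_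
      have e1 : extChartAt (𝓡 4) q.1 q.1 + (0 : ℝ) • η.1 = z₀.1 := by rw [zero_smul, add_zero]
      rw [e0, hτ0', hτ0', e1, hW0, d0, d1, stdVol_three_neg]
      ring
  refine HasDerivAt.congr_of_eventuallyEq ?_ (ht.mono fun t ht =>
    hR.localForm_bsPsi hκ hb hc ht ξ₀ ξ₁ ξ₂ ξ₃)
  refine ((hB.mul (hV ![ξ₀.1, ξ₁.1, ξ₂.1, ξ₃.1])).sub ((hS.mul ((((((hs ξ₀ ξ₁ ξ₂ ξ₃).sub
    (hs ξ₀ ξ₂ ξ₁ ξ₃)).add (hs ξ₀ ξ₃ ξ₁ ξ₂)).add (hs ξ₁ ξ₂ ξ₀ ξ₃)).sub (hs ξ₁ ξ₃ ξ₀ ξ₂)).add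
    (hs ξ₂ ξ₃ ξ₀ ξ₁))).const_mul (b ^ 2))).congr_deriv ?_
  have hS0 : locScale R q.1 z₀.1 = volSign R q.1 := hR.locScale_center q.1
  have hV0 : localForm R.vol q.1 z₀.1 ![ξ₀.1, ξ₁.1, ξ₂.1, ξ₃.1] =
      volSign R q.1 * stdVol 4 ![ξ₀.1, ξ₁.1, ξ₂.1, ξ₃.1] := by
    refine (localForm_center q.1 _).trans ?_
    rw [form4_eq (R.vol q.1 : E4 [⋀^Fin 4]→L[ℝ] ℝ)]
    rfl
  simp only [e0, hS0, hV0]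
  ring

include hR hκ hc in
-- The terms cancel by vertical degree. In degree four, `⟨a, ·⟩ ∧ vol_V` vanishes for reasons of
-- dimension. In degree two, the curvature terms of `vol_V` become, by the curvature hypothesis and
-- Lagrange's identity, the negative of the derivative of `w²v` times `dθ`. In degree zero, the
-- curvature terms of `dθ` are triple products `⟨a × W, W'⟩`, skew in `W` and `W'`, and cancel in
-- pairs.
theorem bsForm_closed : extD (bsForm R κ b c) q = 0 := by
  refine form_eq_zero _ fun ξ => ?_
  obtain ⟨D, hD, hK⟩ := hR.curvature q.1
  rw [extD_apply_center (hR.bsForm_smooth hκ hc) q ξ, Fin.sum_univ_four]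
  have r0 : (0 : Fin 4).removeNth ξ = ![ξ 1, ξ 2, ξ 3] := by
    ext i : 1; fin_cases i <;> rfl
  have r1 : (1 : Fin 4).removeNth ξ = ![ξ 0, ξ 2, ξ 3] := by
    ext i : 1; fin_cases i <;> rfl
  have r2 : (2 : Fin 4).removeNth ξ = ![ξ 0, ξ 1, ξ 3] := by
    ext i : 1; fin_cases i <;> rfl
  have r3 : (3 : Fin 4).removeNth ξ = ![ξ 0, ξ 1, ξ 2] := by
    ext i : 1; fin_cases i <;> rfl
  have hd := hR.fderiv_bsForm hκ hc (b := b) q hD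
  simp only at hd
  rw [r0, r1, r2, r3, hd, hd, hd, hd]
  simp only [flatASD_eq_inner]
  have hσ := hR.volSign_mul_self q.1
  set σ := volSign R q.1
  set a := asdCoords q.1 q.2
  set F := locBase R κ b c q.1 (extChartAt (𝓡 4) q.1 q.1, a)
  obtain ⟨W, hW⟩ : ∃ W : Fin 4 → Fin 4 → E3, ∀ i j, flatTriple σ (ξ i).1 (ξ j).1 = W i j :=
    ⟨_, fun _ _ => rfl⟩
  obtain ⟨Q, hQ'⟩ : ∃ Q : E4 → E4 → E3, ∀ u' u, WithLp.toLp 2 (curvRate σ (D u') a u) = Q u' u :=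
    ⟨_, fun _ _ => rfl⟩
  -- Exchanging the two base directions in `Q` costs exactly the curvature; the hypothesis on `κ` is
  -- used here and nowhere else in the cancellation.
  have hQ : ∀ i j, Q (ξ i).1 (ξ j).1 = Q (ξ j).1 (ξ i).1 + (σ * κ) • cross a (W i j) :=
    fun i j => by
      rw [← hQ', ← hQ', ← hW]
      ext k
      exact (sub_eq_iff_eq_add'.mp (hK a (ξ i).1 (ξ j).1 k))
  simp only [hQ', hW]
  have hdet : ∀ i j : Fin 4, ∀ s t : E3, σ * stdVol 3 ![Q (ξ i).1 (ξ j).1, s, t] -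
      σ * stdVol 3 ![Q (ξ j).1 (ξ i).1, s, t] =
        κ * (inner ℝ a s * inner ℝ t (W i j) - inner ℝ a t * inner ℝ s (W i j)) := by
    intro i j s t
    have h := stdVol_cross a (W i j) s t
    rw [hQ i j, stdVol_three_add, stdVol_three_smul, h, real_inner_comm t (W i j), real_inner_comm s (W i j)]
    linear_combination κ * (inner ℝ a s * inner ℝ t (W i j) - inner ℝ a t * inner ℝ s (W i j)) * hσ
  have hin : ∀ i j : Fin 4, ∀ w : E3, inner ℝ (Q (ξ i).1 (ξ j).1) w -
      inner ℝ (Q (ξ j).1 (ξ i).1) w = σ * κ * inner ℝ (cross a (W i j)) w := by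
    intro i j w
    rw [hQ i j, inner_add_left, real_inner_smul_left, add_sub_cancel_left]
  have hsw : ∀ i j k l : Fin 4, inner ℝ (cross a (W i j)) (W k l) +
      inner ℝ (cross a (W k l)) (W i j) = (0 : ℝ) := fun i j k l => by
    rw [inner_cross_swap, neg_add_cancel]
  have hp := inner_mul_stdVol_three a (ξ 0).2 (ξ 1).2 (ξ 2).2 (ξ 3).2
  simp only [Fin.val_zero, Fin.val_one, Fin.val_two, show ((3 : Fin 4) : ℕ) = 3 from rfl]
  linear_combination (-3 * κ * b ^ 5 * F ^ (-7 / 4 : ℝ) * σ) * hp +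
    (-b ^ 3 * F ^ (-3 / 4 : ℝ)) * (hdet 0 1 (ξ 2).2 (ξ 3).2 - hdet 0 2 (ξ 1).2 (ξ 3).2 + hdet 0 3 (ξ 1).2 (ξ 2).2 + hdet 1 2 (ξ 0).2 (ξ 3).2 - hdet 1 3 (ξ 0).2 (ξ 2).2 + hdet 2 3 (ξ 0).2 (ξ 1).2) +
    (-b * F ^ (1 / 4 : ℝ)) * (hin 0 1 (W 2 3) - hin 0 2 (W 1 3) + hin 0 3 (W 1 2) + hin 1 2 (W 0 3) - hin 1 3 (W 0 2) + hin 2 3 (W 0 1)) +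
    (-b * F ^ (1 / 4 : ℝ)) * σ * κ * (hsw 0 1 2 3 - hsw 0 2 1 3 + hsw 0 3 1 2)

/-- All terms have vertical degree one. For a vertical vector `s`, the derivative of `F` contributes
`4σ⟨a, s⟩` times the base volume of the remaining arguments, in units of `κb²`. Lagrange's identity
turns the curvature terms into twice the sum in `flatTriple_pairing`, which gives `-6σ`, minus the
sum in `flatTriple_inner_pairing`, which gives `+2σ`; the total is zero. -/
theorem bsPsi_closed : extD (hR.bsPsi hκ hb hc) q = 0 := by
  refine form_eq_zero _ fun ξ => ?_
  obtain ⟨D, hD, hK⟩ := hR.curvature q.1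
  rw [extD_apply_center (hR.bsPsi_smooth hκ hb hc) q ξ, Fin.sum_univ_five]
  have r0 : (0 : Fin 5).removeNth ξ = ![ξ 1, ξ 2, ξ 3, ξ 4] := by
    ext i : 1; fin_cases i <;> rfl
  have r1 : (1 : Fin 5).removeNth ξ = ![ξ 0, ξ 2, ξ 3, ξ 4] := by
    ext i : 1; fin_cases i <;> rfl
  have r2 : (2 : Fin 5).removeNth ξ = ![ξ 0, ξ 1, ξ 3, ξ 4] := by
    ext i : 1; fin_cases i <;> rfl
  have r3 : (3 : Fin 5).removeNth ξ = ![ξ 0, ξ 1, ξ 2, ξ 4] := by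
    ext i : 1; fin_cases i <;> rfl
  have r4 : (4 : Fin 5).removeNth ξ = ![ξ 0, ξ 1, ξ 2, ξ 3] := by
    ext i : 1; fin_cases i <;> rfl
  have hd := hR.fderiv_bsPsi hκ hb hc q hD
  simp only at hd
  rw [r0, r1, r2, r3, r4, hd, hd, hd, hd, hd]
  have hσ := hR.volSign_mul_self q.1
  set σ := volSign R q.1
  set a := asdCoords q.1 q.2
  obtain ⟨W, hW⟩ : ∃ W : Fin 5 → Fin 5 → E3, ∀ i j, flatTriple σ (ξ i).1 (ξ j).1 = W i j :=
    ⟨_, fun _ _ => rfl⟩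
  obtain ⟨Q, hQ'⟩ : ∃ Q : E4 → E4 → E3, ∀ u' u, WithLp.toLp 2 (curvRate σ (D u') a u) = Q u' u :=
    ⟨_, fun _ _ => rfl⟩
  have hQ : ∀ i j, Q (ξ i).1 (ξ j).1 = Q (ξ j).1 (ξ i).1 + (σ * κ) • cross a (W i j) :=
    fun i j => by
      rw [← hQ', ← hQ', ← hW]
      ext k
      exact (sub_eq_iff_eq_add'.mp (hK a (ξ i).1 (ξ j).1 k))
  simp only [hQ', hW]
  have hdet' : ∀ i j : Fin 5, ∀ s : E3, ∀ k l : Fin 5,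
      σ * stdVol 3 ![Q (ξ i).1 (ξ j).1, s, W k l] - σ * stdVol 3 ![Q (ξ j).1 (ξ i).1, s, W k l] =
        κ * (inner ℝ a s * inner ℝ (W k l) (W i j) - inner ℝ a (W k l) * inner ℝ s (W i j)) := by
    intro i j s k l
    have h := stdVol_cross a (W i j) s (W k l)
    rw [hQ i j, stdVol_three_add, stdVol_three_smul, h, real_inner_comm (W k l) (W i j), real_inner_comm s (W i j)]
    linear_combination κ * (inner ℝ a s * inner ℝ (W k l) (W i j) -
      inner ℝ a (W k l) * inner ℝ s (W i j)) * hσ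
  -- The same identity with the factors of one inner product exchanged. Each of the thirty curvature
  -- terms uses the version whose products occur in `hP`.
  have hdet : ∀ i j : Fin 5, ∀ s : E3, ∀ k l : Fin 5,
      σ * stdVol 3 ![Q (ξ i).1 (ξ j).1, s, W k l] - σ * stdVol 3 ![Q (ξ j).1 (ξ i).1, s, W k l] =
        κ * (inner ℝ a s * inner ℝ (W i j) (W k l) - inner ℝ a (W k l) * inner ℝ s (W i j)) :=
    fun i j s k l => by rw [hdet', real_inner_comm (W i j)]
  have hP : ∀ i j k l : Fin 5, inner ℝ (W i j) (W k l) - inner ℝ (W i k) (W j l) +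
      inner ℝ (W i l) (W j k) = -3 * σ * stdVol 4 ![(ξ i).1, (ξ j).1, (ξ k).1, (ξ l).1] :=
    fun i j k l => by
      simp only [← hW]
      exact flatTriple_pairing hσ ![(ξ i).1, (ξ j).1, (ξ k).1, (ξ l).1]
  have hS : ∀ (s : E3) (i j k l : Fin 5),
      inner ℝ a (W i j) * inner ℝ s (W k l) + inner ℝ a (W k l) * inner ℝ s (W i j) -
        inner ℝ a (W i k) * inner ℝ s (W j l) - inner ℝ a (W j l) * inner ℝ s (W i k) +
        inner ℝ a (W i l) * inner ℝ s (W j k) + inner ℝ a (W j k) * inner ℝ s (W i l) =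
      -2 * σ * inner ℝ a s * stdVol 4 ![(ξ i).1, (ξ j).1, (ξ k).1, (ξ l).1] :=
    fun s i j k l => by
      simp only [← hW]
      exact flatTriple_inner_pairing hσ a s ![(ξ i).1, (ξ j).1, (ξ k).1, (ξ l).1]
  simp only [Fin.val_zero, Fin.val_one, Fin.val_two, show ((3 : Fin 5) : ℕ) = 3 from rfl,
    show ((4 : Fin 5) : ℕ) = 4 from rfl]
  linear_combination b ^ 2 * (
      hdet 0 1 (ξ 2).2 3 4 - hdet 0 1 (ξ 3).2 2 4 + hdet 0 1 (ξ 4).2 2 3 - hdet 0 2 (ξ 1).2 3 4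
      + hdet 0 2 (ξ 3).2 1 4 - hdet 0 2 (ξ 4).2 1 3 + hdet 0 3 (ξ 1).2 2 4 - hdet 0 3 (ξ 2).2 1 4
      + hdet 0 3 (ξ 4).2 1 2 - hdet 0 4 (ξ 1).2 2 3 + hdet 0 4 (ξ 2).2 1 3 - hdet 0 4 (ξ 3).2 1 2
      + hdet 1 2 (ξ 0).2 3 4 - hdet' 1 2 (ξ 3).2 0 4 + hdet' 1 2 (ξ 4).2 0 3
      - hdet 1 3 (ξ 0).2 2 4 + hdet' 1 3 (ξ 2).2 0 4 - hdet' 1 3 (ξ 4).2 0 2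
      + hdet 1 4 (ξ 0).2 2 3 - hdet' 1 4 (ξ 2).2 0 3 + hdet' 1 4 (ξ 3).2 0 2
      + hdet' 2 3 (ξ 0).2 1 4 - hdet' 2 3 (ξ 1).2 0 4 + hdet' 2 3 (ξ 4).2 0 1
      - hdet' 2 4 (ξ 0).2 1 3 + hdet' 2 4 (ξ 1).2 0 3 - hdet' 2 4 (ξ 3).2 0 1
      + hdet' 3 4 (ξ 0).2 1 2 - hdet' 3 4 (ξ 1).2 0 2 + hdet' 3 4 (ξ 2).2 0 1) +
    κ * b ^ 2 * (2 * inner ℝ a (ξ 0).2 * hP 1 2 3 4 - hS (ξ 0).2 1 2 3 4 -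
      2 * inner ℝ a (ξ 1).2 * hP 0 2 3 4 + hS (ξ 1).2 0 2 3 4 +
      2 * inner ℝ a (ξ 2).2 * hP 0 1 3 4 - hS (ξ 2).2 0 1 3 4 -
      2 * inner ℝ a (ξ 3).2 * hP 0 1 2 4 + hS (ξ 3).2 0 1 2 4 +
      2 * inner ℝ a (ξ 4).2 * hP 0 1 2 3 - hS (ξ 4).2 0 1 2 3)

include hR hκ hb hc in
theorem bs_isTorsionFree :
    IsTorsionFree (bsMetric R κ b c) (bsVol R κ b c) (bsForm R κ b c) :=
  ⟨hR.bsForm_closed hκ hc, hR.bsPsi hκ hb hc, hR.bsPsi_smooth hκ hb hc,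
    hR.bsPsi_isHodgeDual hκ hb hc, hR.bsPsi_closed hκ hb hc⟩

end NormalCharts
end Closed

/-! ### Christoffel symbols and 4-harmonicity -/

theorem isInvertible_of_pos {E : Type*} [NormedAddCommGroup E] [NormedSpace ℝ E]
    [FiniteDimensional ℝ E] {g : E →L[ℝ] E →L[ℝ] ℝ} (hg : ∀ v, v ≠ 0 → 0 < g v v) :
    g.IsInvertible := by
  have hinj : Function.Injective (g : E →ₗ[ℝ] E →L[ℝ] ℝ) := by
    rw [← LinearMap.ker_eq_bot, LinearMap.ker_eq_bot']
    intro v hv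
    by_contra hne
    have h1 := hg v hne
    have h2 : g v = 0 := hv
    rw [h2] at h1
    simp at h1
  have hdim : Module.finrank ℝ E = Module.finrank ℝ (E →L[ℝ] ℝ) := by
    rw [← LinearEquiv.finrank_eq (LinearMap.toContinuousLinearMap (𝕜 := ℝ) (E := E) (F' := ℝ)),
      Module.finrank_linearMap]
    simp
  exact ⟨(LinearEquiv.ofInjectiveOfFinrankEq (g : E →ₗ[ℝ] E →L[ℝ] ℝ) hinj
    hdim).toContinuousLinearEquiv, ContinuousLinearMap.ext fun _ => rfl⟩

section General
variable {E H : Type*} [NormedAddCommGroup E] [NormedSpace ℝ E] [TopologicalSpace H]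
  {I : ModelWithCorners ℝ E H} {M : Type*} [TopologicalSpace M] [ChartedSpace H M]
  [IsManifold I 1 M]

theorem christoffel_isLinear_right (g : BilinField I M) (x : M) (v : E) :
    IsLinearMap ℝ (fun w => christoffel g x v w) where
  map_add w w' := by
    rw [christoffel, christoffel, christoffel, ← map_add]
    generalize fderiv ℝ (localBilin g x) (extChartAt I x x) = D
    refine congrArg _ (ContinuousLinearMap.ext fun z => ?_)
    change (1 / 2 : ℝ) * (D v (w + w') z + D (w + w') v z - D z v (w + w')) =
      (1 / 2 : ℝ) * (D v w z + D w v z - D z v w) +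
        (1 / 2 : ℝ) * (D v w' z + D w' v z - D z v w')
    rw [D.map_add, (D v).map_add, (D z v).map_add, add_apply, add_apply, add_apply]
    ring
  map_smul c w := by
    rw [christoffel, christoffel, ← map_smul]
    generalize fderiv ℝ (localBilin g x) (extChartAt I x x) = D
    refine congrArg _ (ContinuousLinearMap.ext fun z => ?_)
    change (1 / 2 : ℝ) * (D v (c • w) z + D (c • w) v z - D z v (c • w)) =
      c * ((1 / 2 : ℝ) * (D v w z + D w v z - D z v w))
    rw [D.map_smul, (D v).map_smul, (D z v).map_smul, smul_apply, smul_apply, smul_apply]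
    simp only [smul_eq_mul]
    ring

/-- The Christoffel symbol as a bilinear map. -/
def christoffelBilin (g : BilinField I M) (x : M) : E →ₗ[ℝ] E →ₗ[ℝ] E :=
  LinearMap.mk₂ ℝ (christoffel g x) (fun v v' w => (christoffel_isLinear g x w).map_add v v')
    (fun c v w => (christoffel_isLinear g x w).map_smul c v)
    (fun v w w' => (christoffel_isLinear_right g x v).map_add w w')
    (fun c v w => (christoffel_isLinear_right g x v).map_smul c w)

theorem christoffel_spec {g : BilinField I M} {x : M}
    (hg : (localBilin g x (extChartAt I x x)).IsInvertible) (v w z : E) :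
    localBilin g x (extChartAt I x x) (christoffel g x v w) z =
      1 / 2 * (fderiv ℝ (localBilin g x) (extChartAt I x x) v w z +
        fderiv ℝ (localBilin g x) (extChartAt I x x) w v z -
        fderiv ℝ (localBilin g x) (extChartAt I x x) z v w) := by
  rw [christoffel, hg.self_apply_inverse]
  rfl

end General

section Harmonic
variable {X : Type*} [TopologicalSpace X] [ChartedSpace E4 X] [IsManifold (𝓡 4) ∞ X]
  {R : OrientedMetric (𝓡 4) X 4} {κ b c : ℝ}

theorem hasDerivAt_bilin_line {E : Type*} [NormedAddCommGroup E] [NormedSpace ℝ E]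
    {B : E → E →L[ℝ] E →L[ℝ] ℝ} {z : E} (hB : DifferentiableAt ℝ B z) (η v w : E) :
    HasDerivAt (fun t : ℝ => B (z + t • η) v w) (fderiv ℝ B z η v w) 0 := by
  have hl : HasDerivAt (fun t : ℝ => z + t • η) η 0 := by
    simpa using ((hasDerivAt_id (0 : ℝ)).smul_const η).const_add z
  have h := hB.hasFDerivAt.comp_hasDerivAt_of_eq (0 : ℝ) hl (by simp)
  refine ((h.clm_apply (hasDerivAt_const 0 v)).clm_apply (hasDerivAt_const 0 w)).congr_deriv ?_
  simp

theorem koszulVec_zero_right {D : E4 → E4 → E4 → ℝ} (hD : ∀ u v, D u 0 v = 0 ∧ D 0 u v = 0)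
    (v : E4) : koszulVec D 0 v = 0 := by
  ext k
  simp [koszulVec, (hD _ _).1, (hD _ _).2]

theorem koszulVec_zero (u v : E4) : koszulVec (fun _ _ _ => 0) u v = 0 := by
  ext k
  simp [koszulVec]

namespace NormalCharts
variable (hR : NormalCharts R κ) (hκ : 0 ≤ κ) (hb : 0 < b) (hc : 0 < c) (q : ASDBundle R)

include hR in
theorem christoffel_base (x : X) (v w : E4) : christoffel R.metric x v w = 0 :=
  hR.locGamma_center x v w

theorem localBilin_bsMetric_center (ξ ζ : E4 × E3) :
    localBilin (bsMetric R κ b c) q (extChartAt I7 q q) ξ ζ = bsMetric R κ b c q ξ ζ := by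
  rw [localBilin, extChartAt_to_inv, frameBilin_apply, coordFrame_self, coordFrame_self]

include hR hκ hc in
-- The coefficients are left unspecified: below it matters only which terms occur and that they
-- vanish on suitable purely horizontal or purely vertical arguments.
theorem fderiv_bsMetric {D : E4 → E4 → E4 → E4 → ℝ} (hD : ∀ u' u v w : E4, HasDerivAt (fun t : ℝ =>
      fderiv ℝ (localBilin R.metric q.1) (extChartAt (𝓡 4) q.1 q.1 + t • u') u v w) (D u' u v w) 0)
    (η ξ ζ : E4 × E3) :
    ∃ F₁ F₂ F₃ : ℝ, fderiv ℝ (localBilin (bsMetric R κ b c) q) (extChartAt I7 q q) η ξ ζ =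
      F₁ * inner ℝ (asdCoords q.1 q.2) η.2 * inner ℝ ξ.1 ζ.1 +
      F₂ * inner ℝ (asdCoords q.1 q.2) η.2 * inner ℝ ξ.2 ζ.2 +
      F₃ * (inner ℝ (WithLp.toLp 2 (curvRate (volSign R q.1) (D η.1) (asdCoords q.1 q.2) ξ.1) : E3)
          ζ.2 +
        inner ℝ ξ.2 (WithLp.toLp 2 (curvRate (volSign R q.1) (D η.1) (asdCoords q.1 q.2) ζ.1) :
          E3)) := by
  set a := asdCoords q.1 q.2 with ha
  set z₀ : E4 × E3 := (extChartAt (𝓡 4) q.1 q.1, a) with hz₀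
  have hz : z₀.1 ∈ (extChartAt (𝓡 4) q.1).target := center_mem q
  have hq : extChartAt I7 q q = z₀ := bundle_extChartAt q q
  rw [hq]
  have hd : DifferentiableAt ℝ (localBilin (bsMetric R κ b c) q) z₀ := by
    have h := ((hR.bsMetric_smooth hκ hc (b := b) q).contDiffAt
      ((isOpen_extChartAt_target q).mem_nhds (mem_extChartAt_target q))).differentiableAt (by simp)
    rwa [hq] at h
  have ht := eventually_line (eventually_target q hz) η
  have hB : HasDerivAt (fun t : ℝ => locBase R κ b c q.1 (z₀ + t • η)) _ 0 :=
    hR.hasDerivAt_locBase q.1 a η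
  have hτ : ∀ ξ, HasDerivAt (fun t : ℝ => locTau R q.1 (z₀ + t • η) ξ)
      (-WithLp.toLp 2 (curvRate (volSign R q.1) (D η.1) a ξ.1)) 0 :=
    fun ξ => hR.hasDerivAt_locTau q.1 a η ξ (hD η.1)
  have hI : HasDerivAt (fun t : ℝ => locInner R q.1 (locTau R q.1 (z₀ + t • η) ξ)
      (locTau R q.1 (z₀ + t • η) ζ) (z₀ + t • η).1) _ 0 :=
    hR.hasDerivAt_locInner q.1 η.1 (hτ ξ) (hτ ζ)
  have hG : HasDerivAt (fun t : ℝ => localBilin R.metric q.1 (z₀ + t • η).1 ξ.1 ζ.1) 0 0 :=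
    hR.hasDerivAt_metric q.1 η.1 ξ.1 ζ.1
  have e0 : z₀ + (0 : ℝ) • η = z₀ := by rw [zero_smul, add_zero]
  have hne : locBase R κ b c q.1 (z₀ + (0 : ℝ) • η) ≠ 0 := by
    rw [e0]; exact (hR.locBase_pos hκ hc hz).ne'
  have hτ0 : ∀ ξ : E4 × E3, locTau R q.1 z₀ ξ = ξ.2 := fun ξ => hR.locTau_center q.1 a ξ
  have hG0 : localBilin R.metric q.1 z₀.1 ξ.1 ζ.1 = inner ℝ ξ.1 ζ.1 :=
    (localBilin_center q.1 _ _).trans (hR.metric_center _ _ _)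
  have hI0 : locInner R q.1 ξ.2 ζ.2 z₀.1 = inner ℝ ξ.2 ζ.2 := hR.locInner_center q.1 _ _
  have h := (((hB.rpow_const (p := (1 / 2 : ℝ)) (Or.inl hne)).mul hG).add
    (((hB.rpow_const (p := (-1 / 2 : ℝ)) (Or.inl hne)).const_mul (b ^ 2)).mul hI)).congr_of_eventuallyEq
    (ht.mono fun t ht => hR.localBilin_bsMetric hκ hc ht ξ ζ)
  rw [(hasDerivAt_bilin_line hd η ξ ζ).unique h]
  simp only [e0, hτ0, hG0, hI0]
  refine ⟨4 * κ * b ^ 2 * (1 / 2) * locBase R κ b c q.1 z₀ ^ (1 / 2 - 1 : ℝ),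
    b ^ 2 * (4 * κ * b ^ 2 * (-1 / 2) * locBase R κ b c q.1 z₀ ^ (-1 / 2 - 1 : ℝ)),
    -b ^ 2 * locBase R κ b c q.1 z₀ ^ (-1 / 2 : ℝ), ?_⟩
  rw [inner_neg_left, inner_neg_right]
  ring

include hR hκ hb hc in
-- The Koszul formula is tested against horizontal vectors. For vertical `e` the vanishing expresses
-- that the fibres are totally geodesic; for horizontal `e` it holds because `w` is constant to
-- first order in horizontal directions and the base metric is stationary.
theorem christoffel_bsMetric_fst (e : E4 × E3) (he : e.1 = 0 ∨ e.2 = 0) :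
    (christoffel (bsMetric R κ b c) q e e).1 = 0 := by
  obtain ⟨D, hD, -⟩ := hR.curvature q.1
  have hinv : (localBilin (bsMetric R κ b c) q (extChartAt I7 q q)).IsInvertible :=
    isInvertible_of_pos fun v hv => by
      rw [localBilin_bsMetric_center]
      exact (hR.bs_isOrientedInner hκ hb hc q).pos v hv
  -- `D` is known only through derivatives along lines, without any linearity. That it vanishes when
  -- an argument is zero follows from uniqueness of derivatives.
  have h0 : ∀ u v w : E4, D 0 u v w = 0 ∧ D u 0 v w = 0 ∧ D u v 0 w = 0 :=
    fun u v w => ⟨(hD 0 u v w).unique (by simpa using hasDerivAt_const (0 : ℝ) _),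
      (hD u 0 v w).unique (by simpa using hasDerivAt_const (0 : ℝ) (0 : ℝ)),
      (hD u v 0 w).unique (by simpa using hasDerivAt_const (0 : ℝ) (0 : ℝ))⟩
  have hc1 : ∀ (a : E3) (u : E4), (WithLp.toLp 2 (curvRate (volSign R q.1) (D 0) a u) : E3) = 0 := by
    intro a u
    have hD0 : D 0 = fun _ _ _ => 0 := by
      funext u v w; exact (h0 u v w).1
    ext j
    simp [curvRate, hD0, koszulVec_zero, flatASD]
  have hc2 : ∀ (a : E3) (u : E4), (WithLp.toLp 2 (curvRate (volSign R q.1) (D u) a 0) : E3) = 0 := by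
    intro a u
    have hk := koszulVec_zero_right (D := D u) fun v w =>
      ⟨(h0 u v w).2.2, (h0 u v w).2.1⟩
    ext j
    simp [curvRate, hk, flatASD]
  have key : ∀ u : E4, inner ℝ (christoffel (bsMetric R κ b c) q e e).1 u = (0 : ℝ) := by
    intro u
    have h := christoffel_spec hinv e e ((u, 0) : E4 × E3)
    obtain ⟨A₁, A₂, A₃, hA⟩ := hR.fderiv_bsMetric hκ hc (b := b) q hD e e (u, 0)
    obtain ⟨B₁, B₂, B₃, hB⟩ := hR.fderiv_bsMetric hκ hc (b := b) q hD (u, 0) e e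
    rw [localBilin_bsMetric_center, hA, hB] at h
    have h' := (hR.bsMetric_eq q (christoffel (bsMetric R κ b c) q e e) (u, 0)).symm.trans h
    have hw := hR.coefW_pos hκ hb hc q
    rcases he with he | he
    · simp only [he, hc1, hc2, inner_zero_left, inner_zero_right, mul_zero, add_zero] at h'
      simpa [hw.ne'] using h'
    · simp only [he, inner_zero_left, inner_zero_right, mul_zero, zero_mul, add_zero,
        sub_zero] at h'
      simpa [hw.ne'] using h'
  exact inner_self_eq_zero.mp (key _)

/-- The adapted frame splits into purely vertical and purely horizontal vectors, the two cases in
which the Christoffel symbol is controlled. -/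
theorem frame_fst_or_snd (i : Fin 7) :
    (hR.frame hκ hb hc q i).1 = 0 ∨ (hR.frame hκ hb hc q i).2 = 0 := by
  have h : hR.frame hκ hb hc q i = _ := modelIso_symm_apply
    (hR.volSign_mul_self q.1) (hR.coefW_pos hκ hb hc q).ne' (hR.coefV_pos hκ hb hc q).ne' _
  rw [h]
  by_cases hi : i.val < 3
  · left
    ext j
    fin_cases i <;> fin_cases j <;> simp at hi ⊢
  · right
    ext j
    fin_cases i <;> fin_cases j <;> simp at hi ⊢

include hR hκ hb hc in
-- In a bundle chart `|du|² du` is `4F^{-1/2}` times the projection to `E4`, and the Christoffel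
-- symbol of the base vanishes at the centre. In the trace over the adapted frame, a horizontal
-- vector does not change `F`, a vertical one is killed by the projection, and the Christoffel term
-- has no base component.
theorem bs_isPHarmonic : IsPHarmonic 4 (bsMetric R κ b c) R.metric (proj R) := by
  intro q
  set z₀ : E4 × E3 := (extChartAt (𝓡 4) q.1 q.1, asdCoords q.1 q.2) with hz₀
  have hz : z₀.1 ∈ (extChartAt (𝓡 4) q.1).target := center_mem q
  have hq : extChartAt I7 q q = z₀ := bundle_extChartAt q q
  let F : E4 × E3 → E4 × E3 →L[ℝ] E4 := fun z =>
    Real.sqrt (diffNormSq (bsMetric R κ b c) R.metric (proj R) ((extChartAt I7 q).symm z)) ^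
      ((4 : ℝ) - 2) • fderiv ℝ (writtenInExtChartAt I7 (𝓡 4) q (proj R)) z
  have hu : ∀ z ∈ (extChartAt I7 q).target,
      fderiv ℝ (writtenInExtChartAt I7 (𝓡 4) q (proj R)) z = ContinuousLinearMap.fst ℝ E4 E3 :=
    fun z hz => by
      refine HasFDerivAt.fderiv ((hasFDerivAt_fst (𝕜 := ℝ) (E := E4)
        (F := E3)).congr_of_eventuallyEq ?_)
      filter_upwards [(isOpen_extChartAt_target q).mem_nhds hz] with z hz
      exact writtenInExtChartAt_proj q hz
  set g : E4 × E3 → ℝ := fun z => 4 * locBase R κ b c q.1 z ^ (-1 / 2 : ℝ) with hg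
  have hF : ∀ z ∈ (extChartAt I7 q).target, F z = g z • ContinuousLinearMap.fst ℝ E4 E3 := by
    intro z hz
    have hz' := hz
    rw [bundle_extChartAt_target] at hz'
    have hp : (extChartAt I7 q).symm z = bundlePoint q z := bundle_extChartAt_symm q hz'.1 z.2
    have hw := (hR.coefW_pos hκ hb hc (bundlePoint q z)).le
    have h2 : (4 : ℝ) - 2 = 2 := by norm_num
    have hr : (-1 / 2 : ℝ) = -(1 / 2) := by norm_num
    simp only [F, g]
    rw [hu z hz, hp, hR.diffNormSq_eq hκ hb hc, h2, Real.rpow_two, Real.sq_sqrt (by positivity),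
      (hR.coefW_pow hκ hc _).2, hR.coefBase_bundlePoint hz'.1, hr,
      Real.rpow_neg (hR.locBase_pos hκ hc hz'.1).le, div_eq_mul_inv]
  have hgd : DifferentiableAt ℝ g z₀ :=
    (contDiffAt_const.mul ((locBase_contDiffAt (R := R) hz κ b c).rpow_const_of_ne
      (hR.locBase_pos hκ hc hz).ne')).differentiableAt (n := ∞) (by simp)
  have hg0 : ∀ v : E4 × E3, v.2 = 0 → fderiv ℝ g z₀ v = 0 := fun v hv => by
    have hB : HasDerivAt (fun t : ℝ => locBase R κ b c q.1 (z₀ + t • v)) _ 0 :=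
      hR.hasDerivAt_locBase q.1 _ v
    refine fderiv_eq_of_line hgd (((hB.rpow_const (Or.inl ?_)).const_mul 4).congr_deriv ?_)
    · rw [zero_smul, add_zero]; exact (hR.locBase_pos hκ hc hz).ne'
    · rw [hv, inner_zero_right]; ring
  have hFd : ∀ v w : E4 × E3, fderiv ℝ F z₀ v w = fderiv ℝ g z₀ v • w.1 := fun v w => by
    have h : HasFDerivAt F ((fderiv ℝ g z₀).smulRight (ContinuousLinearMap.fst ℝ E4 E3)) z₀ := by
      refine (hgd.hasFDerivAt.smul_const _).congr_of_eventuallyEq ?_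
      rw [← hq]
      filter_upwards [(isOpen_extChartAt_target q).mem_nhds (mem_extChartAt_target q)] with z hz
      exact hF z hz
    rw [h.fderiv]
    rfl
  have hF0 : ∀ w : E4 × E3, F z₀ w = g z₀ • w.1 := fun w => by
    rw [hF z₀ (hq ▸ mem_extChartAt_target q)]
    rfl
  let e : Module.Basis (Fin 7) ℝ (E4 × E3) := Module.Basis.ofEquivFun (hR.iso hκ hb hc q)
  have he : ∀ i, e i = hR.frame hκ hb hc q i := fun i => congrFun (Module.Basis.coe_ofEquivFun _) i
  have hB : ∀ v w : E4 × E3, fderiv ℝ F (extChartAt I7 q q) v w -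
      F (extChartAt I7 q q) (christoffel (bsMetric R κ b c) q v w) +
      christoffel R.metric (proj R q)
        (fderiv ℝ (writtenInExtChartAt I7 (𝓡 4) q (proj R)) (extChartAt I7 q q) v)
        (F (extChartAt I7 q q) w) =
      ((ContinuousLinearMap.coeLM ℝ ∘ₗ (fderiv ℝ F z₀).toLinearMap : E4 × E3 →ₗ[ℝ] E4 × E3 →ₗ[ℝ] E4) -
        (christoffelBilin (bsMetric R κ b c) q).compr₂ (F z₀).toLinearMap) v w := fun v w => by
    rw [hR.christoffel_base, hq, add_zero]
    rfl
  have h := metricTrace_eq_sum (T := E4 × E3)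
    (fun v w => localBilin (bsMetric R κ b c) q (extChartAt I7 q q) v w) _
    (ContinuousLinearMap.coeLM ℝ ∘ₗ
      (localBilin (bsMetric R κ b c) q (extChartAt I7 q q)).toLinearMap)
    _ (fun _ _ => rfl) hB e fun i j => by
      rw [he, he, localBilin_bsMetric_center]; exact hR.frame_orthonormal hκ hb hc q i j
  refine h.trans (Finset.sum_eq_zero fun i _ => ?_)
  have h1 : fderiv ℝ F z₀ (e i) (e i) - F z₀ (christoffel (bsMetric R κ b c) q (e i) (e i)) = 0 := by
    have hi := hR.frame_fst_or_snd hκ hb hc q i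
    rw [← he] at hi
    rw [hFd, hF0, hR.christoffel_bsMetric_fst hκ hb hc q _ hi, smul_zero, sub_zero]
    rcases hi with hi | hi
    · rw [hi, smul_zero]
    · rw [hg0 _ hi, zero_smul]
  exact (hB _ _).trans h1

end NormalCharts
end Harmonic

/-! ### Normal charts from an explicit formula for the metric -/

section Formula
variable {X : Type*} [TopologicalSpace X] [ChartedSpace E4 X] [IsManifold (𝓡 4) ∞ X]
  {R : OrientedMetric (𝓡 4) X 4}

/-- The preferred charts are normal if the metric is given in all of them by the same formula `G`,
with first derivative `G'` and second derivative `D` at the origin. -/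
theorem normalCharts_of_formula {κ : ℝ} {G : E4 → E4 → E4 → ℝ} {G' D : E4 → E4 → E4 → E4 → ℝ}
    (h0 : ∀ x : X, extChartAt (𝓡 4) x x = 0)
    (ht : ∀ x : X, (extChartAt (𝓡 4) x).target = Set.univ)
    (hG : ∀ (x : X) (y v w : E4), localBilin R.metric x y v w = G y v w)
    (hG0 : ∀ v w : E4, G 0 v w = inner ℝ v w)
    (hG' : ∀ y u v w : E4, HasDerivAt (fun s : ℝ => G (y + s • u) v w) (G' y u v w) 0)
    (hG'0 : ∀ u v w : E4, G' 0 u v w = 0)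
    (hD : ∀ u' u v w : E4, HasDerivAt (fun t : ℝ => G' (t • u') u v w) (D u' u v w) 0)
    (hcurv : ∀ x : X, volSign R x = 1 ∨ volSign R x = -1 →
      ∀ (a : E3) (u' u : E4) (j : Fin 3),
        curvRate (volSign R x) (D u') a u j - curvRate (volSign R x) (D u) a u' j =
          volSign R x * κ * cross a (flatTriple (volSign R x) u' u) j) :
    NormalCharts R κ := by
  have hm : ∀ (x : X) (v w : E4), R.metric x v w = inner ℝ v w := fun x v w => by
    rw [← localBilin_center x v w, h0, hG, hG0]
  have hf : ∀ (x : X) (y u v w : E4), fderiv ℝ (localBilin R.metric x) y u v w = G' y u v w :=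
    fun x y u v w => by
      have hd : DifferentiableAt ℝ (localBilin R.metric x) y :=
        (localBilin_contDiffAt (R := R) (by rw [ht]; trivial)).differentiableAt (by simp)
      have h := hasDerivAt_bilin_line hd u v w
      simp only [hG] at h
      exact h.unique (hG' y u v w)
  refine ⟨hm, fun x => ?_, fun x => ⟨D, fun u' u v w => ?_, hcurv x ?_⟩⟩
  · ext u v w
    rw [h0, hf, hG'0]
    rfl
  · simp only [h0, zero_add, hf]
    exact hD u' u v w
  · refine (R.isOriented.inner x).unit stdVec fun i j => ?_
    rw [hm]
    simp [stdVec, PiLp.inner_apply, eq_comm]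

end Formula

/-! ### The round four-sphere -/

section Sphere

/-- The preferred chart at `x` is stereographic projection from `-x`, which sends `x` to the origin.
-/
theorem sphere_extChartAt_self (x : S4) : extChartAt (𝓡 4) x x = 0 := by
  have h : extChartAt (𝓡 4) x x = stereographic' 4 (-x) x := rfl
  have h2 : stereographic (norm_eq_of_mem_sphere (-x)) x = 0 := stereographic_neg_apply x
  rw [h]
  exact (congrArg (OrthonormalBasis.fromOrthogonalSpanSingleton 4
    (ne_zero_of_mem_unit_sphere (-x))).repr h2).trans (map_zero _)

theorem sphere_extChartAt_target (x : S4) : (extChartAt (𝓡 4) x).target = Set.univ := by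
  have h : (chartAt E4 x).target = Set.univ := stereographic'_target (n := 4) (-x)
  rw [extChartAt_target, h]
  simp

/-- The inverse of stereographic projection from `-p`, composed with a linear isometry `A`. -/
def stereoLift (A : E4 →L[ℝ] E5) (p : E5) (y : E4) : E5 :=
  (4 * (‖y‖ ^ 2 + 4)⁻¹) • A y + ((‖y‖ ^ 2 - 4) * (‖y‖ ^ 2 + 4)⁻¹) • p

theorem sphere_lift_eq (x : S4) : ∃ (A : E4 →L[ℝ] E5) (p : E5),
    (∀ v w, inner ℝ (A v) (A w) = (inner ℝ v w : ℝ)) ∧ (∀ v, inner ℝ (A v) p = (0 : ℝ)) ∧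
    inner ℝ p p = (1 : ℝ) ∧
    (fun y => (((extChartAt (𝓡 4) x).symm y : S4) : E5)) = stereoLift A p := by
  let U : (ℝ ∙ ((-x : S4) : E5))ᗮ ≃ₗᵢ[ℝ] E4 :=
    (OrthonormalBasis.fromOrthogonalSpanSingleton 4 (ne_zero_of_mem_unit_sphere (-x))).repr
  refine ⟨(ℝ ∙ ((-x : S4) : E5))ᗮ.subtypeL ∘L U.symm.toContinuousLinearEquiv, ((-x : S4) : E5),
    fun v w => U.symm.inner_map_map v w, fun v => ?_, ?_, ?_⟩
  · rw [real_inner_comm]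
    exact Submodule.mem_orthogonal_singleton_iff_inner_right.mp (U.symm v).2
  · rw [real_inner_self_eq_norm_sq, norm_eq_of_mem_sphere, one_pow]
  · funext y
    have h : (((extChartAt (𝓡 4) x).symm y : S4) : E5) = _ := stereographic'_symm_apply (n := 4) (-x) y
    have hn : ‖((U.symm y : (ℝ ∙ ((-x : S4) : E5))ᗮ) : E5)‖ = ‖y‖ :=
      (Submodule.coe_norm _).symm.trans (U.symm.norm_map y)
    refine h.trans ?_
    change (‖((U.symm y : (ℝ ∙ ((-x : S4) : E5))ᗮ) : E5)‖ ^ 2 + 4)⁻¹ • (4 : ℝ) • ((U.symm y : (ℝ ∙ ((-x : S4) : E5))ᗮ) : E5) +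
      (‖((U.symm y : (ℝ ∙ ((-x : S4) : E5))ᗮ) : E5)‖ ^ 2 + 4)⁻¹ • (‖((U.symm y : (ℝ ∙ ((-x : S4) : E5))ᗮ) : E5)‖ ^ 2 - 4) • ((-x : S4) : E5) =
      (4 * (‖y‖ ^ 2 + 4)⁻¹) • ((U.symm y : (ℝ ∙ ((-x : S4) : E5))ᗮ) : E5) + ((‖y‖ ^ 2 - 4) * (‖y‖ ^ 2 + 4)⁻¹) • ((-x : S4) : E5)
    rw [hn, smul_smul, smul_smul, mul_comm _ (4 : ℝ), mul_comm _ (‖y‖ ^ 2 - 4)]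

theorem hasDerivAt_affine (a b : ℝ) : HasDerivAt (fun s : ℝ => a + s * b) b 0 := by
  simpa using ((hasDerivAt_id (0 : ℝ)).mul_const b).const_add a

theorem norm_sq_line (y u : E4) (s : ℝ) :
    ‖y + s • u‖ ^ 2 = ‖y‖ ^ 2 + 2 * s * inner ℝ y u + s ^ 2 * ‖u‖ ^ 2 := by
  rw [norm_add_sq_real, inner_smul_right, norm_smul, mul_pow, Real.norm_eq_abs, sq_abs]
  ring

theorem hasDerivAt_norm_sq_line (y u : E4) (k : ℝ) :
    HasDerivAt (fun s : ℝ => ‖y + s • u‖ ^ 2 + k) (2 * inner ℝ y u) 0 := by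
  have h := ((hasDerivAt_affine (‖y‖ ^ 2) (2 * inner ℝ y u)).add
    (((hasDerivAt_id (0 : ℝ)).pow 2).mul_const (‖u‖ ^ 2))).add_const k
  refine (h.congr_of_eventuallyEq (Filter.Eventually.of_forall fun s => ?_)).congr_deriv (by simp)
  simp only [norm_sq_line, Pi.add_apply, id, Pi.pow_apply]
  ring

theorem hasDerivAt_stereoLift (A : E4 →L[ℝ] E5) (p : E5) (y v : E4) :
    HasDerivAt (fun s : ℝ => stereoLift A p (y + s • v))
      ((4 * (‖y‖ ^ 2 + 4)⁻¹) • A v + (-(8 * inner ℝ y v) * ((‖y‖ ^ 2 + 4) ^ 2)⁻¹) • A y +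
        (16 * inner ℝ y v * ((‖y‖ ^ 2 + 4) ^ 2)⁻¹) • p) 0 := by
  have hρ : ‖y‖ ^ 2 + 4 ≠ 0 := by positivity
  have h1 := hasDerivAt_norm_sq_line y v 4
  have h2 := hasDerivAt_norm_sq_line y v (-4)
  have h3 := h1.inv (by simpa using hρ)
  have hA : HasDerivAt (fun s : ℝ => A (y + s • v)) (A v) 0 := by
    have := ((hasDerivAt_id (0 : ℝ)).smul_const (A v)).const_add (A y)
    simpa using this
  have h := ((h3.const_mul 4).smul hA).add ((h2.mul h3).smul_const p)
  refine h.congr_deriv ?_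
  simp only [Pi.inv_apply, zero_smul, add_zero]
  rw [add_assoc, add_assoc]
  congr 2
  · congr 1
    field_simp
    ring
  · congr 1
    field_simp
    ring

/-- The inverse chart is built from an isometry and a unit vector orthogonal to its image. On
pairing two of its derivatives the terms along `A y` and along `p` cancel, leaving the conformal
factor. -/
theorem localBilin_round (x : S4) (y v w : E4) :
    localBilin roundS4.metric x y v w = 16 * ((‖y‖ ^ 2 + 4) ^ 2)⁻¹ * inner ℝ v w := by
  have hy : y ∈ (extChartAt (𝓡 4) x).target := by rw [sphere_extChartAt_target]; trivial
  have h1 : localBilin roundS4.metric x y v w = inner ℝ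
      (fderiv ℝ (fun y => (((extChartAt (𝓡 4) x).symm y : S4) : E5)) y v)
      (fderiv ℝ (fun y => (((extChartAt (𝓡 4) x).symm y : S4) : E5)) y w) := by
    rw [← sphereIncl_frame x hy]
    rfl
  have hd : DifferentiableAt ℝ (fun y => (((extChartAt (𝓡 4) x).symm y : S4) : E5)) y :=
    ((sphere_lift_smooth x).contDiffAt ((isOpen_extChartAt_target x).mem_nhds hy)).differentiableAt
      (by simp)
  obtain ⟨A, p, hA, hAp, hp, hF⟩ := sphere_lift_eq x
  rw [h1]
  rw [hF] at hd ⊢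
  have hρ : ‖y‖ ^ 2 + 4 ≠ 0 := by positivity
  rw [fderiv_eq_of_line hd (hasDerivAt_stereoLift A p y v),
    fderiv_eq_of_line hd (hasDerivAt_stereoLift A p y w)]
  have hpA : ∀ v, inner ℝ p (A v) = (0 : ℝ) := fun v => (real_inner_comm _ _).trans (hAp v)
  simp only [inner_add_left, inner_add_right, real_inner_smul_left, real_inner_smul_right, hA, hAp,
    hpA, hp, real_inner_self_eq_norm_sq]
  rw [real_inner_comm y v]
  field_simp
  ring

/-- Near the origin the conformal factor is `1 - |y|²/2` to second order, which gives `D`. The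
curvature identity holds with both orientation signs, so the sign of the charts need not be
determined. -/
theorem normalCharts_sphere : NormalCharts roundS4 1 := by
  refine normalCharts_of_formula
    (G := fun y v w => 16 * ((‖y‖ ^ 2 + 4) ^ 2)⁻¹ * inner ℝ v w)
    (G' := fun y u v w => -(64 * inner ℝ y u) * ((‖y‖ ^ 2 + 4) ^ 3)⁻¹ * inner ℝ v w)
    (D := fun u' u v w => -(inner ℝ u' u * inner ℝ v w))
    sphere_extChartAt_self sphere_extChartAt_target localBilin_round (fun v w => ?_)
    (fun y u v w => ?_) (fun u v w => ?_) (fun u' u v w => ?_) fun x hσ a u' u j => ?_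
  · norm_num
  · have hρ : ‖y‖ ^ 2 + 4 ≠ 0 := by positivity
    have h := ((((hasDerivAt_norm_sq_line y u 4).pow 2).inv
      (by simpa using hρ)).const_mul 16).mul_const (inner ℝ v w)
    refine h.congr_deriv ?_
    simp only [Pi.pow_apply, zero_smul, add_zero]
    field_simp
    norm_num
    ring
  · simp
  · have h1 := hasDerivAt_norm_sq_line 0 u' 4
    have h := (((((hasDerivAt_id (0 : ℝ)).mul_const (inner ℝ u' u : ℝ)).const_mul 64).neg).mul
      ((h1.pow 3).inv (by simp))).mul_const (inner ℝ v w)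
    refine (h.congr_of_eventuallyEq (Filter.Eventually.of_forall fun t => ?_)).congr_deriv ?_
    · simp [real_inner_smul_left]
    · simp only [id, Pi.inv_apply, Pi.pow_apply, Pi.neg_apply, zero_mul, mul_zero, zero_smul,
        add_zero, norm_zero, neg_zero, inner_zero_left, zero_div]
      ring
  · generalize volSign roundS4 x = σ at hσ
    simp only [curvRate, flatASD, koszulVec, cross, flatTriple, e4_inner]
    rcases hσ with rfl | rfl <;> fin_cases j <;> simp [stdVec] <;> ring

end Sphere

/-! ### The complex projective plane -/

section ProjectivePlane

theorem cp2_extChartAt_self (L : CP2) : extChartAt (𝓡 4) L L = 0 := (centeredFrame_spec L).2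

theorem cp2_extChartAt_target (L : CP2) : (extChartAt (𝓡 4) L).target = Set.univ := by
  have h : (chartAt E4 L).target = Set.univ := rfl
  rw [extChartAt_target, h]
  simp

theorem herm_act (U : U3) (z w : C3) : herm (U3.act U z) (U3.act U w) = herm z w := by
  have h : ∀ z w : C3, herm z w = star z ⬝ᵥ w := fun _ _ => rfl
  have hU : star U.1 * U.1 = 1 := Matrix.mem_unitaryGroup_iff'.mp U.2
  rw [h, h]
  change star (U.1.mulVec z) ⬝ᵥ (U.1.mulVec w) = _
  rw [Matrix.star_mulVec, Matrix.dotProduct_mulVec, Matrix.vecMul_vecMul, ← Matrix.star_eq_conjTranspose,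
    hU, Matrix.vecMul_one]

/-- The standard symplectic form of `ℝ⁴ = ℂ²`. -/
def symp (v w : E4) : ℝ := v 0 * w 1 - v 1 * w 0 + (v 2 * w 3 - v 3 * w 2)

theorem symp_add_right (v y u : E4) (s : ℝ) : symp v (y + s • u) = symp v y + s * symp v u := by
  simp [symp]; ring

theorem symp_add_left (v y u : E4) (s : ℝ) : symp (y + s • u) v = symp y v + s * symp u v := by
  simp [symp]; ring

theorem symp_neg (v w : E4) : symp w v = -symp v w := by
  simp [symp]; ring

theorem herm_affineLin (v w : E4) :
    herm (affineLin v) (affineLin w) = ⟨inner ℝ v w, symp v w⟩ := by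
  apply Complex.ext
  · simp [herm, affineLin_apply, Fin.sum_univ_succ, e4_inner]; ring
  · simp [herm, affineLin_apply, Fin.sum_univ_succ, symp]; ring

theorem herm_affineLin_affinePoint (v y : E4) :
    herm (affineLin v) (affinePoint y) = ⟨inner ℝ v y, symp v y⟩ := by
  rw [← herm_affineLin, affinePoint, herm_add_right]
  simp [herm, affineLin_apply, Fin.sum_univ_succ]

theorem herm_affinePoint (y : E4) :
    herm (affinePoint y) (affinePoint y) = ((1 + ‖y‖ ^ 2 : ℝ) : ℂ) := by
  rw [← real_inner_self_eq_norm_sq, e4_inner]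
  apply Complex.ext
  · simp [herm, affinePoint, affineLin_apply, Fin.sum_univ_succ]; ring
  · simp [herm, affinePoint, affineLin_apply, Fin.sum_univ_succ]; ring

/-- Horizontal vectors are orthogonal to `z`, so only one of the two projections has to be expanded.
-/
theorem herm_horizontal_horizontal {z : C3} (hz : z ≠ 0) (a b : C3) :
    herm (horizontal z a) (horizontal z b) = herm a b - herm a z * herm z b / herm z z := by
  have h1 : herm (horizontal z a) z = 0 := by
    rw [← herm_conj, herm_horizontal hz, star_zero]
  rw [horizontal_apply z b, sub_eq_add_neg, ← neg_smul, herm_add_right, herm_smul_right, h1,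
    mul_zero, add_zero, ← herm_conj, horizontal_apply, sub_eq_add_neg, ← neg_smul, herm_add_right,
    herm_smul_right, star_add, star_mul', herm_conj, star_neg, star_div₀, herm_conj, herm_conj,
    herm_conj]
  ring

/-- The unitary matrix drops out by invariance of the Hermitian product. What remains is the real
part of the Fubini–Study formula in affine coordinates, the same in every preferred chart; `symp` is
the imaginary part of the Hermitian product. -/
theorem hopfInner_apply (U : U3) (y v w : E4) :
    hopfInner (affineLift U y) (affineLiftDeriv U) v w =
      ((1 + ‖y‖ ^ 2) * inner ℝ v w - (inner ℝ v y * inner ℝ y w - symp v y * symp y w)) *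
        ((1 + ‖y‖ ^ 2) ^ 2)⁻¹ := by
  have hz := affineLift_ne_zero U y
  have hρ : 1 + ‖y‖ ^ 2 ≠ 0 := by positivity
  have hzz : herm (affineLift U y) (affineLift U y) = ((1 + ‖y‖ ^ 2 : ℝ) : ℂ) :=
    (herm_act _ _ _).trans (herm_affinePoint y)
  have hn : ‖realify (affineLift U y)‖ ^ 2 = 1 + ‖y‖ ^ 2 := by
    have := (herm_self (affineLift U y)).symm.trans hzz
    exact_mod_cast this
  have hvw : herm (affineLiftDeriv U v) (affineLiftDeriv U w) = ⟨inner ℝ v w, symp v w⟩ :=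
    (herm_act _ _ _).trans (herm_affineLin v w)
  have hvz : ∀ v, herm (affineLiftDeriv U v) (affineLift U y) = ⟨inner ℝ v y, symp v y⟩ := fun v =>
    (herm_act _ _ _).trans (herm_affineLin_affinePoint v y)
  have hzw : herm (affineLift U y) (affineLiftDeriv U w) = ⟨inner ℝ y w, symp y w⟩ := by
    rw [← herm_conj, hvz, symp_neg y w, real_inner_comm]
    apply Complex.ext <;> simp
  rw [hopfInner, pullInner_apply, ContinuousLinearMap.comp_apply, ContinuousLinearMap.comp_apply,
    hopfDiff_apply, hopfDiff_apply, map_smul, map_smul, real_inner_smul_left, real_inner_smul_right,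
    inner_realify, herm_horizontal_horizontal hz, hvw, hvz, hzw, hzz, ← mul_assoc, ← mul_inv,
    ← pow_two, hn, Complex.sub_re, Complex.div_ofReal_re, Complex.mul_re]
  field_simp

theorem localBilin_fubiniStudy (L : CP2) (y v w : E4) :
    localBilin fubiniStudyCP2.metric L y v w =
      ((1 + ‖y‖ ^ 2) * inner ℝ v w - (inner ℝ v y * inner ℝ y w - symp v y * symp y w)) *
        ((1 + ‖y‖ ^ 2) ^ 2)⁻¹ := by
  rw [← hopfInner_apply (centeredFrame L)]
  exact congrArg (fun B : E4 →L[ℝ] E4 →L[ℝ] ℝ => B v w)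
    (localBilin_fs L (by rw [cp2_extChartAt_target]; trivial))

/-- The identification of `ℂ³` with `ℝ⁶`, as an equivalence. -/
def realifyEquiv : C3 ≃ₗ[ℝ] E6 :=
  LinearEquiv.ofBijective (realify : C3 →ₗ[ℝ] E6) ⟨realify_injective, realify_surjective⟩

/-- The real determinant of a complex-linear map is the squared modulus of its complex determinant.
-/
theorem det_realify_nonneg (f : C3 →ₗ[ℂ] C3) :
    0 ≤ LinearMap.det ((realifyEquiv : C3 →ₗ[ℝ] E6) ∘ₗ f.restrictScalars ℝ ∘ₗ
      (realifyEquiv.symm : E6 →ₗ[ℝ] C3)) := by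
  rw [LinearMap.det_conj, LinearMap.det_restrictScalars, Algebra.norm_complex_apply]
  exact Complex.normSq_nonneg _

/-- At the origin of the chart the six vectors in the determinant are the images of the standard
real basis of `ℂ³` under a complex-linear map. This shows that the affine charts are positively
oriented. -/
theorem volSign_fubiniStudy_nonneg (L : CP2) : 0 ≤ volSign fubiniStudyCP2 L := by
  set U := centeredFrame L
  have h0 : affineLift U 0 = U3.act U⁻¹ (Pi.single 0 1) := by simp [affineLift, affinePoint]
  have hn : ‖realify (affineLift U 0)‖ = 1 := by
    have h1 := (herm_self (affineLift U 0)).symm.trans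
      ((herm_act _ _ _).trans (herm_affinePoint 0))
    have h2 : ‖realify (affineLift U 0)‖ ^ 2 = 1 := by
      have : ‖realify (affineLift U 0)‖ ^ 2 = 1 + ‖(0 : E4)‖ ^ 2 := by exact_mod_cast h1
      simpa using this
    nlinarith [norm_nonneg (realify (affineLift U 0))]
  have hh : ∀ v, horizontal (affineLift U 0) (affineLiftDeriv U v) = affineLiftDeriv U v := fun v => by
    have : herm (affineLift U 0) (affineLiftDeriv U v) = 0 := by
      rw [← herm_conj]
      refine (congrArg star ((herm_act _ _ _).trans (herm_affineLin_affinePoint v 0))).trans ?_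
      apply Complex.ext <;> simp [symp]
    rw [horizontal_apply, this, zero_div, zero_smul, sub_zero]
  have h1 : volSign fubiniStudyCP2 L = hopfVol (affineLift U 0) (affineLiftDeriv U) stdVec := by
    refine (localForm_center (R := fubiniStudyCP2) L stdVec).symm.trans ?_
    rw [cp2_extChartAt_self]
    exact congrArg (fun α : E4 [⋀^Fin 4]→L[ℝ] ℝ => α stdVec)
      (localForm_fs L (by rw [cp2_extChartAt_target]; trivial))
  let e : Fin 6 → C3 := Fin.cons (Pi.single 0 1)
    (Fin.cons (Complex.I • Pi.single 0 1) fun i => affineLin (stdVec i))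
  have he : ∀ i, realifyEquiv (e i) = EuclideanSpace.basisFun (Fin 6) ℝ i := fun i => by
    ext j
    refine Fin.cases ?_ (fun i => Fin.cases ?_ (fun i => ?_) i) i
    · change realify (Pi.single 0 1) j = _
      fin_cases j <;> simp [realify_apply]
    · change realify (Complex.I • Pi.single 0 1) j = _
      fin_cases j <;> simp [realify_apply]
    · change realify (affineLin (stdVec i)) j = _
      fin_cases i <;> fin_cases j <;> simp [realify_apply, affineLin_apply, stdVec]
  have h2 := stdVol_comp ((realifyEquiv : C3 →ₗ[ℝ] E6) ∘ₗ
    (U3.act U⁻¹ : C3 →ₗ[ℂ] C3).restrictScalars ℝ ∘ₗ (realifyEquiv.symm : E6 →ₗ[ℝ] C3))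
    (fun i => realifyEquiv (e i))
  have h3 : stdVol 6 (fun i => realifyEquiv (e i)) = 1 := by
    simp only [he]
    have := (EuclideanSpace.basisFun (Fin 6) ℝ).toBasis.det_self
    rw [OrthonormalBasis.coe_toBasis] at this
    exact this
  rw [h3, mul_one] at h2
  rw [h1, hopfVol_apply, hn, inv_one, one_smul, one_smul]
  refine (det_realify_nonneg (U3.act U⁻¹ : C3 →ₗ[ℂ] C3)).trans_eq (h2.symm.trans ?_)
  congr 1
  ext i : 1
  change realify (U3.act U⁻¹ (realifyEquiv.symm (realifyEquiv (e i)))) = _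
  rw [LinearEquiv.symm_apply_apply]
  refine Fin.cases ?_ (fun i => Fin.cases ?_ (fun i => ?_) i) i
  · rw [h0]; rfl
  · rw [h0, ← map_smul]; rfl
  · simp only [Fin.cons_succ]
    rw [hopfDiff_apply, hh, hn, inv_one, one_smul]
    rfl

/-- `D` is the second derivative at the origin of the affine formula. Its symplectic terms are those
that distinguish the two orientations. -/
theorem normalCharts_projectivePlane : NormalCharts fubiniStudyCP2 2 := by
  refine normalCharts_of_formula
    (G := fun y v w =>
      ((1 + ‖y‖ ^ 2) * inner ℝ v w - (inner ℝ v y * inner ℝ y w - symp v y * symp y w)) *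
        ((1 + ‖y‖ ^ 2) ^ 2)⁻¹)
    (G' := fun y u v w =>
      (2 * inner ℝ y u * inner ℝ v w - (inner ℝ v u * inner ℝ y w + inner ℝ v y * inner ℝ u w) +
        (symp v u * symp y w + symp v y * symp u w)) * ((1 + ‖y‖ ^ 2) ^ 2)⁻¹ -
      4 * inner ℝ y u * ((1 + ‖y‖ ^ 2) * inner ℝ v w -
        (inner ℝ v y * inner ℝ y w - symp v y * symp y w)) * ((1 + ‖y‖ ^ 2) ^ 3)⁻¹)
    (D := fun u' u v w => -(2 * inner ℝ u' u * inner ℝ v w) -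
      (inner ℝ v u * inner ℝ u' w + inner ℝ v u' * inner ℝ u w) +
        (symp v u * symp u' w + symp v u' * symp u w))
    cp2_extChartAt_self cp2_extChartAt_target localBilin_fubiniStudy (fun v w => ?_)
    (fun y u v w => ?_) (fun u v w => ?_) (fun u' u v w => ?_) fun L hσ a u' u j => ?_
  · simp [symp]
  · have hρ : 1 + ‖y‖ ^ 2 ≠ 0 := by positivity
    have h0 : HasDerivAt (fun s : ℝ => 1 + ‖y + s • u‖ ^ 2) (2 * inner ℝ y u) 0 := by
      simpa only [add_comm] using hasDerivAt_norm_sq_line y u 1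
    have h := ((h0.mul_const (inner ℝ v w)).sub
      (((hasDerivAt_affine (inner ℝ v y) (inner ℝ v u)).mul
        (hasDerivAt_affine (inner ℝ y w) (inner ℝ u w))).sub
      ((hasDerivAt_affine (symp v y) (symp v u)).mul
        (hasDerivAt_affine (symp y w) (symp u w))))).mul
      ((h0.pow 2).inv (by simpa using hρ))
    refine (h.congr_of_eventuallyEq (Filter.Eventually.of_forall fun s => ?_)).congr_deriv ?_
    · simp only [inner_add_right, inner_add_left, real_inner_smul_left, real_inner_smul_right,
        symp_add_left, symp_add_right]
      rfl
    · simp only [Pi.pow_apply, Pi.inv_apply, Pi.sub_apply, Pi.mul_apply, zero_smul, zero_mul,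
        add_zero, Nat.cast_ofNat]
      field_simp
      norm_num
      ring
  · simp [symp]
  · have h0 : HasDerivAt (fun t : ℝ => 1 + t ^ 2 * ‖u'‖ ^ 2) 0 0 := by
      simpa using (((hasDerivAt_id (0 : ℝ)).pow 2).mul_const (‖u'‖ ^ 2)).const_add 1
    -- On the line through `u'` both parts of the first derivative carry a factor `t`. `K` and `N`
    -- collect coefficients independent of `t`, and the derivative at zero is `K - 4⟨u', u⟩⟨v, w⟩`.
    set K := 2 * inner ℝ u' u * inner ℝ v w -
      (inner ℝ v u * inner ℝ u' w + inner ℝ v u' * inner ℝ u w) +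
        (symp v u * symp u' w + symp v u' * symp u w) with hK
    set N := inner ℝ v u' * inner ℝ u' w - symp v u' * symp u' w with hN
    have h := (((hasDerivAt_id (0 : ℝ)).mul_const K).mul ((h0.pow 2).inv (by simp))).sub
      ((((hasDerivAt_id (0 : ℝ)).mul_const (4 * inner ℝ u' u)).mul
        ((h0.mul_const (inner ℝ v w)).sub (((hasDerivAt_id (0 : ℝ)).pow 2).mul_const N))).mul
        ((h0.pow 3).inv (by simp)))
    have hs : ∀ (x : E4) (t : ℝ), symp x (t • u') = t * symp x u' := fun x t => by
      simp [symp]; ring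
    have hs' : ∀ (x : E4) (t : ℝ), symp (t • u') x = t * symp u' x := fun x t => by
      simp [symp]; ring
    refine (h.congr_of_eventuallyEq (Filter.Eventually.of_forall fun t => ?_)).congr_deriv ?_
    · simp only [real_inner_smul_left, real_inner_smul_right, hs, hs', norm_smul, mul_pow,
        Real.norm_eq_abs, sq_abs, Pi.pow_apply, Pi.inv_apply, Pi.sub_apply, Pi.mul_apply, id, hK, hN]
      ring
    · simp only [Pi.pow_apply, Pi.inv_apply, Pi.sub_apply, Pi.mul_apply, id]
      rw [hK]
      norm_num
      ring
  · have h1 : volSign fubiniStudyCP2 L = 1 := by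
      rcases hσ with h | h
      · exact h
      · have := volSign_fubiniStudy_nonneg L
        rw [h] at this
        norm_num at this
    rw [h1]
    simp only [curvRate, flatASD, koszulVec, cross, flatTriple, e4_inner, symp]
    fin_cases j <;> simp [stdVec] <;> ring

end ProjectivePlane

end BryantSalamon

end

/-! ### The two examples -/

open BryantSalamon in
theorem mainTheorem11 (b c : ℝ) (hb : 0 < b) (hc : 0 < c) :
    (IsOrientedRiemannian (bsMetric roundS4 1 b c) (bsVol roundS4 1 b c) ∧
      IsG2Structure (bsForm roundS4 1 b c) (bsMetric roundS4 1 b c) (bsVol roundS4 1 b c) ∧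
      IsTorsionFree (bsMetric roundS4 1 b c) (bsVol roundS4 1 b c) (bsForm roundS4 1 b c) ∧
      IsSmithSubmersion (J := 𝓡 4) (k := 4) (l := 3) (bsMetric roundS4 1 b c) (bsVol roundS4 1 b c)
        roundS4.metric roundS4.vol (bsForm roundS4 1 b c) (proj roundS4) ∧
      (∀ p : ASDBundle roundS4, Function.Surjective (mfderiv I7 (𝓡 4) (proj roundS4) p)) ∧
      (∀ p : ASDBundle roundS4, 0 < coefW roundS4 1 b c p ∧
        Real.sqrt (diffNormSq (bsMetric roundS4 1 b c) roundS4.metric (proj roundS4) p) / Real.sqrt 4 =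
          1 / coefW roundS4 1 b c p) ∧
      IsPHarmonic 4 (bsMetric roundS4 1 b c) roundS4.metric (proj roundS4) ∧
      FibresCalibrated (J := 𝓡 4) (k := 4) (l := 3) (bsMetric roundS4 1 b c) (bsVol roundS4 1 b c) roundS4.vol
        (bsForm roundS4 1 b c) (proj roundS4)) ∧
    (IsOrientedRiemannian (bsMetric fubiniStudyCP2 2 b c) (bsVol fubiniStudyCP2 2 b c) ∧
      IsG2Structure (bsForm fubiniStudyCP2 2 b c) (bsMetric fubiniStudyCP2 2 b c) (bsVol fubiniStudyCP2 2 b c) ∧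
      IsTorsionFree (bsMetric fubiniStudyCP2 2 b c) (bsVol fubiniStudyCP2 2 b c) (bsForm fubiniStudyCP2 2 b c) ∧
      IsSmithSubmersion (J := 𝓡 4) (k := 4) (l := 3) (bsMetric fubiniStudyCP2 2 b c) (bsVol fubiniStudyCP2 2 b c)
        fubiniStudyCP2.metric fubiniStudyCP2.vol (bsForm fubiniStudyCP2 2 b c) (proj fubiniStudyCP2) ∧
      (∀ p : ASDBundle fubiniStudyCP2, Function.Surjective (mfderiv I7 (𝓡 4) (proj fubiniStudyCP2) p)) ∧
      (∀ p : ASDBundle fubiniStudyCP2, 0 < coefW fubiniStudyCP2 2 b c p ∧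
        Real.sqrt (diffNormSq (bsMetric fubiniStudyCP2 2 b c) fubiniStudyCP2.metric (proj fubiniStudyCP2) p) / Real.sqrt 4 =
          1 / coefW fubiniStudyCP2 2 b c p) ∧
      IsPHarmonic 4 (bsMetric fubiniStudyCP2 2 b c) fubiniStudyCP2.metric (proj fubiniStudyCP2) ∧
      FibresCalibrated (J := 𝓡 4) (k := 4) (l := 3) (bsMetric fubiniStudyCP2 2 b c) (bsVol fubiniStudyCP2 2 b c) fubiniStudyCP2.vol
        (bsForm fubiniStudyCP2 2 b c) (proj fubiniStudyCP2)) := by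
  have hS := normalCharts_sphere
  have hP := normalCharts_projectivePlane
  have h1 : (0 : ℝ) ≤ 1 := zero_le_one
  have h2 : (0 : ℝ) ≤ 2 := zero_le_two
  exact ⟨⟨hS.bs_isOrientedRiemannian h1 hb hc, hS.bs_isG2Structure h1 hb hc,
      hS.bs_isTorsionFree h1 hb hc, hS.bs_isSmithSubmersion h1 hb hc,
      NormalCharts.mfderiv_proj_surjective,
      fun p => ⟨hS.coefW_pos h1 hb hc p, hS.dilation h1 hb hc p⟩,
      hS.bs_isPHarmonic h1 hb hc, hS.bs_fibresCalibrated h1 hb hc⟩,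
    hP.bs_isOrientedRiemannian h2 hb hc, hP.bs_isG2Structure h2 hb hc,
    hP.bs_isTorsionFree h2 hb hc, hP.bs_isSmithSubmersion h2 hb hc,
    NormalCharts.mfderiv_proj_surjective,
    fun p => ⟨hP.coefW_pos h2 hb hc p, hP.dilation h2 hb hc p⟩,
    hP.bs_isPHarmonic h2 hb hc, hP.bs_fibresCalibrated h2 hb hc⟩
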